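/- Fix integers $n\ge 1$ and $1=k_0<k_1<\dots<k_m=n+1$, put $J=\{0,k_0,\dots,k_m\}$, and fix $0\le i<m$; write $b=k_i$, $a=k_{i+1}-k_i$. *Regenerations.* A regeneration consists of a function $\eta:\{0,\dots,n+1\}\to\mathbb Z$ defining the triangulation of $[0,n+1]$ with vertex set $J$ (the slopes $\eta'_l=\frac{\eta(k_{l+1})-\eta(k_l)}{k_{l+1}-k_l}$ are integers, $\eta(1)-\eta(0)<\eta'_0<\eta'_1<\dots<\eta'_{m-1}$, and $\eta$ lies strictly above the corresponding piecewise linear function at the points outside $J$), together with $\mathbf c\in\mathbb C^{n+2}$ such that $c_j=1$ for $j\in J$. Put $\psi(\mathbf c,s,t)(z)=\sum_{j=1}^{n+1}c_js^{\eta(j)}z^j+s^{\eta(0)}t$ and $\tilde\psi_i(s,t)=\psi(\mathbf c,s,s^{\eta(k_{i+1})-\eta(0)-k_{i+1}\eta'_i}t)$. In the coordinate $u$ with $z=s^{-\eta'_i}u$, the polynomial $\tilde\psi_i(s,t)$, suitably scaled, converges to the circuit polynomial $u^{a+b}+u^b+t$ as $s\to0$. The fibers consist of the $u$-roots. For $|t|$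 small, $F_{i,i+1}(t)$ is the set of roots near the $b$ roots of $u^b=-t$, and $F_{i,i+2}(t)$ is the set of roots near the $a$ roots of $u^a=-1$; for $|t|$ large, $F_{i+1,i+2}(t)$ is the set of roots near the $a+b$ roots of $u^{a+b}=-t$ (all for $s$ small relative to $t$; "$u$ is near the roots of $u^d=-v$" means $|u^d/v+1|<\frac12$). $F_{i,i+1}$ and $F_{i+1,i+2}$ are cyclically ordered counterclockwise, by argument. *Radar screens.* Suppose that $\tilde\psi_i(s,\cdot)$ has $n$ critical values in $\mathbb C^*$, of pairwise distinct norms. A radar screen is a choice of logarithms $w_1,\dots,w_n$ of them, with $\operatorname{Re}w_1<\dots<\operatorname{Re}w_n$. In the logarithmic plane the path $p_j$ starts at $w_j$ and, for $l=j+1,j+2,\dots$ successively, goes horizontally to real part $\operatorname{Re}w_l-\varepsilon$ and vertically to height $\operatorname{Im}w_l-\varepsilon$, with $\varepsilon>0$ small (so that it passes $w_l$ on the clockwise side). The block of the circuit consists of $w_b,\dots,w_{a+b-1}$. For $r$ small and $R$ large, let $\gamma_i$ be the path that starts at the point with real part $\log r$ and imaginary part that of $w_{\max(1,b-1)}$,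 passes $w_b,\dots,w_{a+b-1}$ in the same manner, continues horizontally to real part $\log R$, and there moves vertically to the endpoint $\log R+\sqrt{-1}\,\operatorname{Im}w_{a+b-1}$. The block paths $p_b,\dots,p_{a+b-1}$ are cut off at this same endpoint in the same way. Let $q=\exp$(start of $\gamma_i$), $q'=\exp$(end of $\gamma_i$). The monodromy map is parallel transport $\tau_{i,i+2}:F_{i,i+1}(q)\sqcup F_{i,i+2}(q)\to F_{i+1,i+2}(q')$ of the roots along $\exp\gamma_i$. The vanishing graph is the graph on $F_{i+1,i+2}(q')$ which for each $l=0,\dots,a-1$ has an edge labelled $l$ that joins the two points which come together at the critical point over $e^{w_{b+l}}$ along $p_{b+l}$. *Insertions.* Let $S_1,S_2,S_3$ be finite sets, with cyclic orders on $S_1$ and $S_3$. A bijection $\sigma:S_1\sqcup S_2\to S_3$ is a cyclic $|S_2|$-insertion if $\sigma|_{S_1}$ preserves the cyclic order. Given a total order $<$ on $S_2$, extended by putting $S_1$ below $S_2$, let $m_\sigma(s)$, for $s\in S_2$, be the unique element less than $s$ such that all elements of the open cyclic interval from $\sigma(m_\sigma(s))$ to $\sigma(s)$ are images of elements greater than $s$.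 The incidence graph $I_{\sigma,<}$ has the edges $\{\sigma(s),\sigma(m_\sigma(s))\}$, $s\in S_2$, where the edge of $s$ is labelled by the number of elements of $S_2$ below $s$. **Theorem.** There are $r_0,R_0>0$, depending only on $n$, $J$ and $i$, such that the following hold. (1) For every regeneration, all $0<r<r_0$ and $R>R_0$, there is $s_0>0$ such that for every $s\in\mathbb C$ with $0<|s|<s_0$, every radar screen, and all sufficiently small $\varepsilon>0$: $|F_{i,i+1}(q)|=b$; $\tau_{i,i+2}$ is a well-defined bijection and a cyclic $(k_{i+1}-k_i)$-insertion; and there is a unique total order $<$ on $F_{i,i+2}(q)$ for which the labelled vanishing graph of $p_{k_i},\dots,p_{k_{i+1}-1}$ equals the labelled graph $I_{\tau_{i,i+2},<}$. (2) Let $\mu_d$ be the set of $d$-th roots of unity with the counterclockwise cyclic order, and $\mu'_a$ the set of solutions of $\zeta^a=-1$. For every cyclic $a$-insertion $\sigma:\mu_b\sqcup\mu'_a\to\mu_{a+b}$ and every total order $<$ on $\mu'_a$ there is a regeneration with $c_j\ne0$ for $1\le j\le n+1$ such that for all $0<r<r_0$ and $R>R_0$ and all sufficiently small real $s>0$ there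 is a radar screen for which, for all sufficiently small $\varepsilon>0$, $\tau_{i,i+2}$ is $\sigma$ and the total order in (1) is $<$, under the following identifications: a point $u$ of $F_{i,i+2}(q)$ corresponds to the element of $\mu'_a$ nearest to $u$, and a point $u$ of $F_{i,i+1}(q)$ (respectively $F_{i+1,i+2}(q')$) corresponds to the element of $\mu_d$, $d=b$ (respectively $d=a+b$), nearest to $u\,e^{-(z+\pi\sqrt{-1})/d}$, where $z$ is the starting point (respectively endpoint) of $\gamma_i$. -/

import Mathlib

open Filter Topology Polynomial

/-! ## Cyclic insertions and incidence graphs -/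

section Combinatorics

variable {S₁ S₂ S₃ : Type*}

/-- Given ternary relations `C₁`, `C₃` (the strict cyclic orders) on finite sets `S₁`, `S₃`, a
bijection `σ : S₁ ⊔ S₂ → S₃` is a cyclic `a`-insertion, `a = |S₂|`, if it preserves the cyclic order
on `S₁`. -/
def IsCyclicInsertion (C₁ : S₁ → S₁ → S₁ → Prop) (C₃ : S₃ → S₃ → S₃ → Prop) (a : ℕ)
    (σ : S₁ ⊕ S₂ ≃ S₃) : Prop :=
  Finite S₁ ∧ Finite S₂ ∧ Nat.card S₂ = a ∧
    ∀ x y z : S₁, C₁ x y z → C₃ (σ (Sum.inl x)) (σ (Sum.inl y)) (σ (Sum.inl z))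

/-- `p < s` for `p ∈ S₁ ⊔ S₂` and `s ∈ S₂`, where the order `lt` of `S₂` is extended by putting all
elements of `S₁` below all elements of `S₂`. -/
def LiesBelow (lt : S₂ → S₂ → Prop) (p : S₁ ⊕ S₂) (s : S₂) : Prop :=
  Sum.elim (fun _ => True) (fun s' => lt s' s) p

/-- `s < p` for `s ∈ S₂` and `p ∈ S₁ ⊔ S₂`, for the same extended partial order. -/
def LiesAbove (lt : S₂ → S₂ → Prop) (p : S₁ ⊕ S₂) (s : S₂) : Prop :=
  Sum.elim (fun _ => False) (fun s' => lt s s') p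

/-- `p = m_σ(s)`: `p` is less than `s`, and every element of the open cyclic interval from `σ(p)`
to `σ(s)` comes from an element greater than `s`. -/
def IsAttachingPoint (C₃ : S₃ → S₃ → S₃ → Prop) (σ : S₁ ⊕ S₂ ≃ S₃) (lt : S₂ → S₂ → Prop)
    (s : S₂) (p : S₁ ⊕ S₂) : Prop :=
  LiesBelow lt p s ∧ ∀ x : S₃, C₃ (σ p) x (σ (Sum.inr s)) → LiesAbove lt (σ.symm x) s

/-- The edge-labelled incidence graph `I_{σ,<}` on `S₃`: its edges are the pairs
`{σ(s), σ(m_σ(s))}`, and the edge of `s` has as label `l` the rank of `s` in `S₂`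
(the number of elements of `S₂` below `s`). -/
def IncidenceEdge (C₃ : S₃ → S₃ → S₃ → Prop) (σ : S₁ ⊕ S₂ ≃ S₃) (lt : S₂ → S₂ → Prop)
    (l : ℕ) (x y : S₃) : Prop :=
  ∃ (s : S₂) (p : S₁ ⊕ S₂), Nat.card {s' : S₂ // lt s' s} = l ∧ IsAttachingPoint C₃ σ lt s p ∧
    ((x = σ (Sum.inr s) ∧ y = σ p) ∨ (x = σ p ∧ y = σ (Sum.inr s)))

end Combinatorics

/-- The strict counterclockwise cyclic order by argument of three complex numbers. -/
def CCW (x y z : ℂ) : Prop :=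
  sbtw (x.arg : Real.Angle) (y.arg : Real.Angle) (z.arg : Real.Angle)

/-- `CCW` on the elements of a set of complex numbers. -/
def CCWOn (S : Set ℂ) (x y z : S) : Prop := CCW x y z

/-! ## The degenerating family of polynomials -/

/-- The values `k 0, …, k m` encode `J = {0, 1 = k 0 < k 1 < ⋯ < k m = n + 1}`. -/
def IsMonotonePath (n m : ℕ) (k : ℕ → ℕ) : Prop :=
  k 0 = 1 ∧ k m = n + 1 ∧ ∀ i < m, k i < k (i + 1)

/-- The choices that determine the family `ψ(c, s, t)`: an integral height function `η` on
`{0, …, n+1}` that defines the triangulation of `[0, n+1]` with vertex set `J`, with integral slopes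
over the intervals `[k i, k (i+1)]`, and coefficients `c` with `c_j = 1` for `j ∈ J`. -/
structure Regeneration (n m : ℕ) (k : ℕ → ℕ) where
  η : ℕ → ℤ
  slope : ℕ → ℤ
  c : ℕ → ℂ
  slope_eq : ∀ i < m, η (k (i + 1)) - η (k i) = slope i * ((k (i + 1) : ℤ) - (k i : ℤ))
  slope_zero_lt : ∀ i < m, η 1 - η 0 < slope i
  slope_lt : ∀ i, i + 1 < m → slope i < slope (i + 1)
  above : ∀ i < m, ∀ j, k i < j → j < k (i + 1) →
    η (k i) + slope i * ((j : ℤ) - (k i : ℤ)) < η j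
  c_zero : c 0 = 1
  c_vertex : ∀ i ≤ m, c (k i) = 1

namespace Regeneration

variable {n m : ℕ} {k : ℕ → ℕ} (D : Regeneration n m k)

/-- `ψ(c, s, t)(z) = (∑_{j=1}^{n+1} c_j s^{η(j)} z^j) + s^{η(0)} t`. -/
noncomputable def psi (s t : ℂ) : ℂ[X] :=
  (∑ j ∈ Finset.Icc 1 (n + 1), C (D.c j * s ^ D.η j) * X ^ j) + C (s ^ D.η 0 * t)

/-- The regeneration of the `i`-th circuit `{0, k i, k (i+1)}`:
`ψ̃_i(s, t) = ψ(c, s, s^{η(k_{i+1}) - η(0) - k_{i+1} η'_i} t)` with `η'_i` the `i`-th slope. -/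
noncomputable def psiTilde (i : ℕ) (s t : ℂ) : ℂ[X] :=
  D.psi s (s ^ (D.η (k (i + 1)) - D.η 0 - (k (i + 1) : ℤ) * D.slope i) * t)

/-- `u` is a point of the fiber over `ψ̃_i(s, t)`, in the coordinate `z = s^{-η'_i} u` in which the
circuit polynomial `u^{k_{i+1}} + u^{k_i} + t` is the limit as `s → 0`. -/
def FiberPoint (i : ℕ) (s t u : ℂ) : Prop :=
  (D.psiTilde i s t).eval (s ^ (-D.slope i) * u) = 0

/-- `u` is a multiple root of `ψ̃_i(s, t)` (in the same coordinate). -/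
def SingularPoint (i : ℕ) (s t u : ℂ) : Prop :=
  D.FiberPoint i s t u ∧ (D.psiTilde i s t).derivative.eval (s ^ (-D.slope i) * u) = 0

/-- The critical values in `ℂ*` of the Landau–Ginzburg model `ψ̃_i(s, ·)`. -/
def criticalValues (i : ℕ) (s : ℂ) : Set ℂ :=
  {t | t ≠ 0 ∧ ∃ u, D.SingularPoint i s t u}

/-- `F_{i,i+1}(q)`, `q = ψ̃_i(s, e^z)` near `0`: the fiber points near the `k_i` roots of
`u^{k_i} = -e^z`. -/
def innerFiber (i : ℕ) (s z : ℂ) : Set ℂ :=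
  {u | D.FiberPoint i s (Complex.exp z) u ∧ ‖u ^ k i / Complex.exp z + 1‖ < 1 / 2}

/-- `F_{i,i+2}(q)`, `q = ψ̃_i(s, e^z)` near `0`: the fiber points near the `k_{i+1} - k_i` roots of
`u^{k_{i+1} - k_i} = -1`. -/
def middleFiber (i : ℕ) (s z : ℂ) : Set ℂ :=
  {u | D.FiberPoint i s (Complex.exp z) u ∧ ‖u ^ (k (i + 1) - k i) + 1‖ < 1 / 2}

/-- `F_{i+1,i+2}(q')`, `q' = ψ̃_i(s, e^z)` near `∞`: the fiber points near the `k_{i+1}` roots of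
`u^{k_{i+1}} = -e^z`. -/
def outerFiber (i : ℕ) (s z : ℂ) : Set ℂ :=
  {u | D.FiberPoint i s (Complex.exp z) u ∧ ‖u ^ k (i + 1) / Complex.exp z + 1‖ < 1 / 2}

/-- `w 1, …, w n` are logarithms of the critical values of `ψ̃_i(s, ·)`, which are `n` in number
and have distinct norms, enumerated by increasing norm. Such a choice is the datum that determines
a radar screen distinguished basis. -/
def IsRadarScreen (i : ℕ) (s : ℂ) (w : ℕ → ℂ) : Prop :=
  StrictMonoOn (fun j => (w j).re) (Set.Icc 1 n) ∧
    (fun j => Complex.exp (w j)) '' Set.Icc 1 n = D.criticalValues i s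

end Regeneration

/-! ## Radar paths, as polygonal paths in the logarithmic plane

The unperturbed radar paths overlap. The representatives below are their pushed-off versions, up to
homotopy in the complement of the critical values, all of which pass the earlier end points on the
clockwise side, so that by decreasing norm of the end points the paths leave the base point
in counterclockwise order. Transport depends only on these homotopy classes. -/

/-- The rest of a radar path that has reached height `h` (imaginary part) and still has to pass the
points `w l` for `l` in the given list, in order of increasing norm: it goes horizontally up to
just before the real part of `w l`, then vertically to just below the height of `w l`, thus passing
`w l` on its clockwise side, and so on; it ends at the point `e`, reached horizontally up to
the real part of `e` and then vertically. -/
noncomputable def radarRest (w : ℕ → ℂ) (ε : ℝ) (e : ℂ) : ℝ → List ℕ → List ℂ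
  | h, [] => [⟨e.re, h⟩, e]
  | h, l :: ls => ⟨(w l).re - ε, h⟩ :: ⟨(w l).re - ε, (w l).im - ε⟩ ::
      radarRest w ε e ((w l).im - ε) ls

/-- The radar path from `z` to `e` that passes the points `w l`, `l` in the list. -/
noncomputable def radarPath (w : ℕ → ℂ) (ε : ℝ) (z e : ℂ) (ls : List ℕ) : List ℂ :=
  z :: radarRest w ε e z.im ls

/-- The base point near `∞`, in the logarithmic plane: the points `w l` of the `i`-th block are those
with `k i ≤ l ≤ k (i+1) - 1`; the base point is on the horizontal ray of the last one. -/
noncomputable def endPoint (k : ℕ → ℕ) (i : ℕ) (w : ℕ → ℂ) (R : ℝ) : ℂ :=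
  ⟨Real.log R, (w (k (i + 1) - 1)).im⟩

/-- The starting point near `0` of the path `γ_i`: it is on the horizontal ray of the first point
inside the block, or, if there is none (`k i = 1`), on the line extending that of `w 1`. -/
noncomputable def startPoint (k : ℕ → ℕ) (i : ℕ) (w : ℕ → ℂ) (r : ℝ) : ℂ :=
  ⟨Real.log r, (w (max 1 (k i - 1))).im⟩

/-- The path `γ_i`: the part between the circles of radius `r` and `R` of the first radar path that
does not end in the block. -/
noncomputable def gammaPath (k : ℕ → ℕ) (i : ℕ) (w : ℕ → ℂ) (ε r R : ℝ) : List ℂ :=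
  radarPath w ε (startPoint k i w r) (endPoint k i w R) (List.range' (k i) (k (i + 1) - k i))

/-- The radar path `p_j` from `w j`, for `j` in the block, up to the circle of radius `R`. -/
noncomputable def blockPath (k : ℕ → ℕ) (i : ℕ) (w : ℕ → ℂ) (ε R : ℝ) (j : ℕ) : List ℂ :=
  radarPath w ε (w j) (endPoint k i w R) (List.range' (j + 1) (k (i + 1) - 1 - j))

/-! ## Parallel transport and the vanishing graph -/

/-- `u` is moved to `u'` by following continuously a point of the fiber `{u | F t u}` while `t` moves
along the polygonal path with the given vertices in the logarithmic plane. -/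
def Transport (F : ℂ → ℂ → Prop) : List ℂ → ℂ → ℂ → Prop
  | [], u, u' => u = u'
  | [_], u, u' => u = u'
  | z :: z' :: zs, u, u' => ∃ v : ℂ,
      (∃ f : ℝ → ℂ, ContinuousOn f (Set.Icc 0 1) ∧ f 0 = u ∧ f 1 = v ∧
        ∀ x ∈ Set.Icc (0 : ℝ) 1, F (Complex.exp (z + x * (z' - z))) (f x)) ∧
      Transport F (z' :: zs) v u'

namespace Regeneration

variable {n m : ℕ} {k : ℕ → ℕ} (D : Regeneration n m k)

/-- `τ = τ_{i,i+2}` is the monodromy map along `γ_i`: from each point of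
`F_{i,i+1}(q) ⊔ F_{i,i+2}(q)` transport along `γ_i` is possible, and leads to the point given by `τ`
and to no other point. -/
def IsMonodromyMap (i : ℕ) (s : ℂ) (w : ℕ → ℂ) (ε r R : ℝ)
    (τ : D.innerFiber i s (startPoint k i w r) ⊕ D.middleFiber i s (startPoint k i w r) ≃
      D.outerFiber i s (endPoint k i w R)) : Prop :=
  ∀ p, ∀ u' : ℂ, Transport (D.FiberPoint i s) (gammaPath k i w ε r R)
    (Sum.elim Subtype.val Subtype.val p) u' ↔ u' = τ p

/-- The edge of the vanishing graph defined by the path `p_j`: it joins the endpoints in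
`F_{i+1,i+2}(q')` of the vanishing thimble, that is, the two points that come together at the
critical point over `e^{w j}` along `p_j`. -/
def VanishingEdge (i : ℕ) (s : ℂ) (w : ℕ → ℂ) (ε R : ℝ) (j : ℕ)
    (x y : D.outerFiber i s (endPoint k i w R)) : Prop :=
  x ≠ y ∧ ∃ u : ℂ, D.SingularPoint i s (Complex.exp (w j)) u ∧
    Transport (D.FiberPoint i s) (blockPath k i w ε R j) u x ∧
    Transport (D.FiberPoint i s) (blockPath k i w ε R j) u y

/-- The edge-labelled vanishing graph of the paths `p_{k_i}, …, p_{k_{i+1}-1}` is `I_{τ,<}`; the path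
`p_{k_i + l}` corresponds to the element of rank `l`. -/
def VanishingGraphEq (i : ℕ) (s : ℂ) (w : ℕ → ℂ) (ε r R : ℝ)
    (τ : D.innerFiber i s (startPoint k i w r) ⊕ D.middleFiber i s (startPoint k i w r) ≃
      D.outerFiber i s (endPoint k i w R))
    (lt : D.middleFiber i s (startPoint k i w r) → D.middleFiber i s (startPoint k i w r) → Prop) :
    Prop :=
  ∀ l < k (i + 1) - k i, ∀ x y, D.VanishingEdge i s w ε R (k i + l) x y ↔
    IncidenceEdge (CCWOn _) τ lt l x y

end Regeneration

/-! ## Identification of the fibers with roots of unity -/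

/-- The `d`-th roots of `a`. -/
def powRoots (d : ℕ) (a : ℂ) : Set ℂ := {ζ | ζ ^ d = a}

/-- `ζ` is the element of `S` nearest to `x`. -/
def IsNearest (S : Set ℂ) (x ζ : ℂ) : Prop := ζ ∈ S ∧ ∀ ζ' ∈ S, ζ' ≠ ζ → ‖x - ζ‖ < ‖x - ζ'‖

/-- The `d`-th root of `-e^z` singled out by the logarithm `z`. -/
noncomputable def phaseRoot (d : ℕ) (z : ℂ) : ℂ := Complex.exp ((z + Real.pi * Complex.I) / d)

/-! Write `b = k i`, `a = k (i+1) - k i`, and let `w` be a logarithm of `t`. In the coordinate of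
the circuit the fibre is `P(u) = -e^w`, where `P` is a small perturbation of `u^(a+b) + u^b`. The
strip `log r - 1 < Re w < log R + 1` contains only logarithms of the `a` critical values that belong
to the critical points `U ω` near `critRadius a b * ω`, `ω^a = -1`; the critical values of the other
circuits are of another order of magnitude in `s` (`energy_strict`, `IsIsolated`).

Cut the strip along the vertical lines through the chosen logarithms `c 0, …, c (a-1)`, leaving open
a gap of length `2π` below each. The result is simply connected (`isSimplyConnected_cutStrip`) and
contains the radar paths, apart from the starting points of the block paths. So the bounded roots
become continuous functions `ρ x` of `w`, with labels `x` in `μ_b ⊔ μ'_a`, named by their positions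
over `Re w = log r`. Between consecutive cuts, translation by `2πi` permutes the labels, by `π 0, …,
π a`. The first of these rotates `μ_b` and fixes `μ'_a`; transport to `Re w = log R` conjugates the
last to the rotation of `μ_(a+b)`. Across `c l` the permutation is multiplied by the transposition
of the two labels that collide there (`CrossingData.exists_swap`).

One of the two is the label `ξ l` of the critical point itself. The petal of `ω` consists of the
bounded points outside the circle through `U ω` that are nearer to `ω` than to the other roots of
`-1`. On its frontier, `‖P‖` is at least `‖P (U ω)‖` (except on the circle of radius `M`, which
roots never meet), so a root cannot cross it before the critical value is reached; and of two roots
about to collide at `U ω`, one is outside the circle and one inside (`exists_norm_lt_of_collision`).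
The other label `y l` is an inner one or has collided before, since `U ω` is not in the closure of
another petal. Thus the `π l` arise by inserting `ξ 0, ξ 1, …` successively, `ξ l` right after `y l`
(`PetalData.exists_isInsertionChain`).

The rest of the first part is combinatorial. `π l` is the first return map of `π a` to the elements
inserted before step `l` (`IsInsertionChain.isFirstReturn`). Hence the cyclic order of `μ_b`
survives, and what finally lies between `y l` and `ξ l` was inserted later, which is to say that `y
l` is the attaching point of `ξ l`. The vanishing edge of label `l` joins the same two labels. As `y
l` is older than `ξ l`, the order can be recovered from the labelled graph by induction
(`order_unique`).

For the realization, every insertion comes from a chain, obtained by deleting elements in the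
reverse order (`exists_isInsertionChain`). Adding `2πiκ` to `c L` moves `y L` by a power of `π L`,
which is transitive on the elements already inserted, so the `y L` can be adjusted one after the
other; the remaining rotation of the outer roots is corrected with the last logarithm, in multiples
of the period of `π (a-1)` (`exists_isCircuitLabelling_eq`). The order of the norms of the critical
values is prescribed to first order in `s`: interior coefficients proportional to `s` vary the
logarithms of these norms by the real part of a polynomial in `ω`, to be chosen by interpolation
(`exists_coeff_norm_lt`). -/

/-! ## Cyclic permutations and first return maps -/

section FirstReturn

/-- `f` is the successor permutation, of order `d`, of the strict cyclic order `C`. -/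
structure IsCyclicSucc {S : Type*} (C : S → S → S → Prop) (f : Equiv.Perm S) (d : ℕ) : Prop where
  exists_pow : ∀ x y, ∃ j < d, (f ^ j) x = y
  pow_ne : ∀ x j, 0 < j → j < d → (f ^ j) x ≠ x
  pow_eq : ∀ x, (f ^ d) x = x
  iff_pow : ∀ x y z, C x y z ↔ ∃ j k, 0 < j ∧ j < k ∧ k < d ∧ (f ^ j) x = y ∧ (f ^ k) x = z

/-- On `T`, the map `f` is the map of first return of `τ` to `T`. -/
def IsFirstReturn {S : Type*} (τ : Equiv.Perm S) (T : Set S) (f : S → S) : Prop :=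
  ∀ z ∈ T, ∃ k, 0 < k ∧ (τ ^ k) z = f z ∧ ∀ k', 0 < k' → k' < k → (τ ^ k') z ∉ T

variable {S : Type*}

theorem IsCyclicSucc.pow_inj {C : S → S → S → Prop} {f : Equiv.Perm S} {d : ℕ}
    (h : IsCyclicSucc C f d) {x : S} {j k : ℕ} (hj : j < d) (hk : k < d)
    (hjk : (f ^ j) x = (f ^ k) x) : j = k := by
  wlog hlt : j ≤ k generalizing j k
  · exact (this hk hj hjk.symm (le_of_not_ge hlt)).symm
  by_contra hne
  obtain ⟨e, rfl⟩ := Nat.exists_eq_add_of_le hlt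
  rw [pow_add, Equiv.Perm.mul_apply] at hjk
  exact h.pow_ne x e (by omega) (by omega) ((f ^ j).injective hjk).symm

theorem isFirstReturn_univ (τ : Equiv.Perm S) : IsFirstReturn τ Set.univ τ :=
  fun z _ => ⟨1, one_pos, by simp, fun k' h1 h2 => by omega⟩

/-- The product with the transposition cuts `x` out of its cycle: `y`, which was sent to `x`, is now
sent to `f x`, and its return time is the sum of those of `y` and of `x`. -/
theorem IsFirstReturn.mul_swap [DecidableEq S] {τ : Equiv.Perm S} {T : Set S} {f : Equiv.Perm S}
    {x y : S} (h : IsFirstReturn τ (insert x T) f) (hx : x ∉ T) (hy : f y = x) :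
    IsFirstReturn τ T (f * Equiv.swap x y : Equiv.Perm S) := by
  intro z hz
  have hzx : z ≠ x := fun h => hx (h ▸ hz)
  obtain ⟨k, hk, hkz, hk'⟩ := h z (Set.mem_insert_of_mem x hz)
  have hnot : ∀ w, w ∉ insert x T → w ∉ T := fun w h1 h2 => h1 (Set.mem_insert_of_mem x h2)
  by_cases hzy : z = y
  · obtain ⟨k₂, hk₂, hk₂x, hk₂'⟩ := h x (Set.mem_insert x T)
    rw [hzy, hy] at hkz
    refine ⟨k + k₂, by omega, ?_, fun k' h1 h2 => ?_⟩
    · rw [add_comm, pow_add, Equiv.Perm.mul_apply, hzy, hkz, hk₂x, Equiv.Perm.mul_apply,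
        Equiv.swap_apply_right]
    · rcases lt_trichotomy k' k with h3 | h3 | h3
      · exact hnot _ (hk' k' h1 h3)
      · rw [h3, hzy, hkz]
        exact hx
      · obtain ⟨e, rfl⟩ := Nat.exists_eq_add_of_lt h3
        rw [show k + e + 1 = (e + 1) + k by ring, pow_add, Equiv.Perm.mul_apply, hzy, hkz]
        exact hnot _ (hk₂' _ (by omega) (by omega))
  · refine ⟨k, hk, ?_, fun k' h1 h2 => hnot _ (hk' k' h1 h2)⟩
    rw [hkz, Equiv.Perm.mul_apply, Equiv.swap_apply_of_ne_of_ne hzx hzy]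

/-- The iterates of a first return map have increasing return times. -/
theorem IsFirstReturn.exists_times {τ f : Equiv.Perm S} {T : Set S} (h : IsFirstReturn τ T f)
    (hf : ∀ z ∈ T, f z ∈ T) {x : S} (hx : x ∈ T) :
    ∃ t : ℕ → ℕ, StrictMono t ∧ t 0 = 0 ∧ (∀ j, (τ ^ t j) x = (f ^ j) x) ∧
      ∀ k t', t' ≤ t k → (τ ^ t') x ∈ T → ∃ j ≤ k, t' = t j := by
  have hfx : ∀ j, (f ^ j) x ∈ T := by
    intro j
    induction j with
    | zero => simpa using hx
    | succ j ih => rw [pow_succ', Equiv.Perm.mul_apply]; exact hf _ ih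
  choose k hk0 hk hk' using fun j => h _ (hfx j)
  have hpow : ∀ j, (τ ^ (∑ i ∈ Finset.range j, k i)) x = (f ^ j) x := by
    intro j
    induction j with
    | zero => simp
    | succ j ih =>
      rw [Finset.sum_range_succ, add_comm, pow_add, Equiv.Perm.mul_apply, ih, hk, pow_succ',
        Equiv.Perm.mul_apply]
  refine ⟨fun j => ∑ i ∈ Finset.range j, k i, strictMono_nat_of_lt_succ fun j => ?_, by simp,
    hpow, fun j => ?_⟩
  · simp only [Finset.sum_range_succ]
    have := hk0 j
    omega
  · induction j with
    | zero =>
      intro t' ht' _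
      exact ⟨0, le_rfl, by simpa using ht'⟩
    | succ j ih =>
      intro t' ht' hT
      by_cases h1 : t' ≤ ∑ i ∈ Finset.range j, k i
      · obtain ⟨j', hj', e⟩ := ih t' h1 hT
        exact ⟨j', by omega, e⟩
      · refine ⟨j + 1, le_rfl, ?_⟩
        by_contra hne
        simp only [Finset.sum_range_succ] at ht' hne
        obtain ⟨e, he⟩ := Nat.exists_eq_add_of_lt (not_le.1 h1)
        rw [he, show ∑ i ∈ Finset.range j, k i + e + 1 = (e + 1) + ∑ i ∈ Finset.range j, k i by ring,
          pow_add, Equiv.Perm.mul_apply, hpow] at hT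
        exact hk' j (e + 1) (by omega) (by omega) hT

end FirstReturn

/-! ## Chains of insertions -/

section InsertionChain

variable {S₁ S₂ S₃ : Type*}

/-- The elements that are not among the `inr (ξ l')` with `l ≤ l' < a`. -/
def insertedBefore (S₁ : Type*) {S₂ : Type*} (a : ℕ) (ξ : ℕ → S₂) (l : ℕ) : Set (S₁ ⊕ S₂) :=
  {z | ∀ l', l ≤ l' → l' < a → z ≠ Sum.inr (ξ l')}

/-- Starting from a permutation of `S₁`, the elements `ξ 0, ξ 1, …` of `S₂` are inserted successively;
`ξ l` comes immediately after `y l`. -/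
structure IsInsertionChain [DecidableEq (S₁ ⊕ S₂)] (a : ℕ) (f : Equiv.Perm S₁) (ξ : ℕ → S₂)
    (y : ℕ → S₁ ⊕ S₂) (π : ℕ → Equiv.Perm (S₁ ⊕ S₂)) : Prop where
  injOn : Set.InjOn ξ (Set.Iio a)
  surj : ∀ s, ∃ l < a, ξ l = s
  zero_inl : ∀ x, π 0 (Sum.inl x) = Sum.inl (f x)
  zero_inr : ∀ s, π 0 (Sum.inr s) = Sum.inr s
  mem : ∀ l < a, y l ∈ insertedBefore S₁ a ξ l
  succ : ∀ l < a, π (l + 1) = π l * Equiv.swap (Sum.inr (ξ l)) (y l)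

theorem insertedBefore_succ {a : ℕ} {ξ : ℕ → S₂} (hξ : Set.InjOn ξ (Set.Iio a)) {l : ℕ}
    (hl : l < a) : insertedBefore S₁ a ξ (l + 1) =
      insert (Sum.inr (ξ l)) (insertedBefore S₁ a ξ l) := by
  ext z
  constructor
  · intro hz
    by_cases h : z = Sum.inr (ξ l)
    · exact Or.inl h
    · refine Or.inr fun l' h1 h2 => ?_
      rcases h1.eq_or_lt with rfl | h1
      · exact h
      · exact hz l' h1 h2
  · rintro (rfl | hz) l' h1 h2
    · intro he
      have : l = l' := hξ hl h2 (Sum.inr.inj he)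
      omega
    · exact hz l' (by omega) h2

theorem insertedBefore_top {a : ℕ} {ξ : ℕ → S₂} : insertedBefore S₁ a ξ a = Set.univ :=
  Set.eq_univ_of_forall fun _ _ h1 h2 => absurd h1 (not_le.2 h2)

theorem notMem_insertedBefore {a : ℕ} {ξ : ℕ → S₂} {l : ℕ} (hl : l < a) :
    (Sum.inr (ξ l) : S₁ ⊕ S₂) ∉ insertedBefore S₁ a ξ l := fun h => h l le_rfl hl rfl

theorem inl_mem_insertedBefore (a : ℕ) (ξ : ℕ → S₂) (l : ℕ) (x : S₁) :
    (Sum.inl x : S₁ ⊕ S₂) ∈ insertedBefore S₁ a ξ l := fun _ _ _ => Sum.inl_ne_inr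

theorem card_lt_of_enumeration {a : ℕ} {ξ : ℕ → S₂} (hinj : Set.InjOn ξ (Set.Iio a))
    (hsurj : ∀ s, ∃ l < a, ξ l = s) {lt : S₂ → S₂ → Prop}
    (hlt : ∀ i < a, ∀ j < a, lt (ξ i) (ξ j) ↔ i < j) {l : ℕ} (hl : l < a) :
    Nat.card {s' : S₂ // lt s' (ξ l)} = l := by
  have e : {s' : S₂ | lt s' (ξ l)} = ξ '' Set.Iio l := by
    ext s
    constructor
    · intro hs
      obtain ⟨l', hl', rfl⟩ := hsurj s
      exact ⟨l', (hlt l' hl' l hl).1 hs, rfl⟩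
    · rintro ⟨l', hl', rfl⟩
      exact (hlt l' (lt_trans hl' hl) l hl).2 hl'
  have h1 : Nat.card {s' : S₂ // lt s' (ξ l)} = Set.ncard {s' : S₂ | lt s' (ξ l)} :=
    Nat.card_coe_set_eq _
  rw [h1, e, (hinj.mono (Set.Iio_subset_Iio hl.le)).ncard_image]
  simp [← Nat.card_coe_set_eq]

variable [DecidableEq (S₁ ⊕ S₂)] {a : ℕ} {f : Equiv.Perm S₁} {ξ : ℕ → S₂} {y : ℕ → S₁ ⊕ S₂}
  {π : ℕ → Equiv.Perm (S₁ ⊕ S₂)}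

namespace IsInsertionChain

variable (h : IsInsertionChain a f ξ y π)

include h

theorem perm_inr {l : ℕ} (hla : l ≤ a) {l' : ℕ} (h1 : l ≤ l') (h2 : l' < a) :
    π l (Sum.inr (ξ l')) = Sum.inr (ξ l') := by
  induction l with
  | zero => exact h.zero_inr _
  | succ l ih =>
    rw [h.succ l (by omega), Equiv.Perm.mul_apply, Equiv.swap_apply_of_ne_of_ne,
      ih (by omega) (by omega)]
    · intro he
      have : l' = l := h.injOn h2 (show l < a by omega) (Sum.inr.inj he)
      omega
    · exact (h.mem l (by omega) l' (by omega) h2).symm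

theorem perm_mem {l : ℕ} (hl : l ≤ a) {z : S₁ ⊕ S₂} (hz : z ∈ insertedBefore S₁ a ξ l) :
    π l z ∈ insertedBefore S₁ a ξ l := by
  intro l' h1 h2 he
  rw [← h.perm_inr hl h1 h2] at he
  exact hz l' h1 h2 ((π l).injective he)

/-- Induction on the number of insertions still to come: undoing the insertion of `ξ l` cuts it out
of the cycle, which by `IsFirstReturn.mul_swap` is the passage to the first return map on the
smaller set. -/
theorem isFirstReturn {l : ℕ} (hl : l ≤ a) :
    IsFirstReturn (π a) (insertedBefore S₁ a ξ l) (π l) := by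
  obtain ⟨j, rfl⟩ := Nat.exists_eq_add_of_le hl
  induction j generalizing l with
  | zero =>
    rw [add_zero, insertedBefore_top]
    exact isFirstReturn_univ _
  | succ j ih =>
    have hla : l < l + (j + 1) := by omega
    have e : l + 1 + j = l + (j + 1) := by ring
    have ih' := ih (l := l + 1) (by rw [e]; exact h) (by omega)
    rw [e, insertedBefore_succ h.injOn hla] at ih'
    have := ih'.mul_swap (notMem_insertedBefore hla) (by
      rw [h.succ l hla, Equiv.Perm.mul_apply, Equiv.swap_apply_right,
        h.perm_inr hla.le le_rfl hla])
    rwa [h.succ l hla, mul_assoc, Equiv.swap_mul_self, mul_one] at this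

theorem zero_pow_inl (j : ℕ) (x : S₁) : (π 0 ^ j) (Sum.inl x) = Sum.inl ((f ^ j) x) := by
  induction j with
  | zero => simp
  | succ j ih =>
    rw [pow_succ', Equiv.Perm.mul_apply, ih, h.zero_inl, pow_succ', Equiv.Perm.mul_apply]

theorem mem_cases {l : ℕ} {z : S₁ ⊕ S₂} (hz : z ∈ insertedBefore S₁ a ξ l) :
    (∃ x, z = Sum.inl x) ∨ ∃ l' < l, l' < a ∧ z = Sum.inr (ξ l') := by
  rcases z with x | s
  · exact Or.inl ⟨x, rfl⟩
  · obtain ⟨l', hl', rfl⟩ := h.surj s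
    refine Or.inr ⟨l', ?_, hl', rfl⟩
    by_contra hcon
    exact hz l' (not_lt.1 hcon) hl' rfl

omit [DecidableEq (S₁ ⊕ S₂)] h in
theorem _root_.notMem_insertedBefore_cases {l : ℕ} {z : S₁ ⊕ S₂} (hz : z ∉ insertedBefore S₁ a ξ l) :
    ∃ l', l ≤ l' ∧ l' < a ∧ z = Sum.inr (ξ l') := by
  rw [insertedBefore, Set.mem_ofPred_eq] at hz
  push Not at hz
  exact hz

variable {C₁ : S₁ → S₁ → S₁ → Prop} {C₃ : S₃ → S₃ → S₃ → Prop} {b N : ℕ} {R : Equiv.Perm S₃}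
  {σ : S₁ ⊕ S₂ ≃ S₃} (hf : IsCyclicSucc C₁ f b) (hR : IsCyclicSucc C₃ R N)
  (hσ : ∀ z, σ (π a z) = R (σ z))

include hσ in
omit [DecidableEq (S₁ ⊕ S₂)] h in
theorem _root_.equiv_pow_apply (j : ℕ) (z : S₁ ⊕ S₂) : σ ((π a ^ j) z) = (R ^ j) (σ z) := by
  induction j with
  | zero => simp
  | succ j ih => rw [pow_succ', Equiv.Perm.mul_apply, hσ, ih, pow_succ', Equiv.Perm.mul_apply]

include hf hR hσ

/-- On `S₁` the first return map of `π a` is `f`, so the `f`-orbit of `x` is met in the same order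
along the `R`-orbit of `σ x`, at increasing times. -/
theorem cyclic_preserved {x y z : S₁} (hxyz : C₁ x y z) :
    C₃ (σ (Sum.inl x)) (σ (Sum.inl y)) (σ (Sum.inl z)) := by
  obtain ⟨j, k, hj, hjk, hkb, rfl, rfl⟩ := (hf.iff_pow x y z).1 hxyz
  obtain ⟨t, htm, ht0, htp, htT⟩ := (h.isFirstReturn (Nat.zero_le a)).exists_times
    (fun z hz => h.perm_mem (Nat.zero_le a) hz) (inl_mem_insertedBefore a ξ 0 x)
  refine (hR.iff_pow _ _ _).2 ⟨t j, t k, ?_, htm hjk, ?_, ?_, ?_⟩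
  · have := htm hj
    omega
  -- If the last point were met only after a full turn `N`, then `N` itself would be a return time
  -- of `x`, belonging to fewer than `b` steps of `f`.
  · by_contra hN
    have hper : (π a ^ N) (Sum.inl x) = Sum.inl x :=
      σ.injective (by rw [equiv_pow_apply hσ, hR.pow_eq])
    obtain ⟨j', hj', e⟩ := htT k N (not_lt.1 hN) (by
      rw [hper]
      exact inl_mem_insertedBefore a ξ 0 x)
    rw [e, htp, h.zero_pow_inl] at hper
    have hj0 : j' ≠ 0 := by
      rintro rfl
      obtain ⟨i, hi, -⟩ := hR.exists_pow (σ (Sum.inl x)) (σ (Sum.inl x))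
      omega
    exact hf.pow_ne x j' (by omega) (by omega) (Sum.inl.inj hper)
  · rw [← equiv_pow_apply hσ, htp, h.zero_pow_inl]
  · rw [← equiv_pow_apply hσ, htp, h.zero_pow_inl]

variable {lt : S₂ → S₂ → Prop} (hlt : ∀ i < a, ∀ j < a, lt (ξ i) (ξ j) ↔ i < j)

omit hf
include hlt

/-- `π (l+1)` is a first return map and sends `y l` to `ξ l`, so everything strictly between the two
was inserted after `ξ l`. Of two attaching points, one would lie strictly between the other and `ξ
l`, and so would have been inserted after `ξ l`. -/
theorem isAttachingPoint_iff {l : ℕ} (hl : l < a) (p : S₁ ⊕ S₂) :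
    IsAttachingPoint C₃ σ lt (ξ l) p ↔ p = y l := by
  have hbelow : ∀ p, LiesBelow lt p (ξ l) → p ∈ insertedBefore S₁ a ξ l := by
    intro p hp l' h1 h2 he
    rw [he] at hp
    have hp' : lt (ξ l') (ξ l) := hp
    have := (hlt l' h2 l hl).1 hp'
    omega
  have habove : ∀ p, LiesAbove lt p (ξ l) → p ∉ insertedBefore S₁ a ξ l := by
    intro p hp hmem
    rcases h.mem_cases hmem with ⟨x, rfl⟩ | ⟨l', h1, h2, rfl⟩
    · exact hp
    · have hp' : lt (ξ l) (ξ l') := hp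
      have := (hlt l hl l' h2).1 hp'
      omega
  have hy : IsAttachingPoint C₃ σ lt (ξ l) (y l) := by
    constructor
    · rcases h.mem_cases (h.mem l hl) with ⟨x, hx⟩ | ⟨l', h1, h2, hx⟩
      · rw [hx]
        trivial
      · rw [hx]
        exact (hlt l' h2 l hl).2 h1
    · intro X hX
      obtain ⟨j, k, hj, hjk, hkN, hjX, hkX⟩ := (hR.iff_pow _ _ _).1 hX
      have hyl : y l ∈ insertedBefore S₁ a ξ (l + 1) := by
        rw [insertedBefore_succ h.injOn hl]
        exact Or.inr (h.mem l hl)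
      obtain ⟨K, hK, hKy, hK'⟩ := h.isFirstReturn (l := l + 1) hl (y l) hyl
      have hyx : π (l + 1) (y l) = Sum.inr (ξ l) := by
        rw [h.succ l hl, Equiv.Perm.mul_apply, Equiv.swap_apply_right,
          h.perm_inr hl.le le_rfl hl]
      rw [hyx] at hKy
      have hky : (π a ^ k) (y l) = Sum.inr (ξ l) := σ.injective (by rw [equiv_pow_apply hσ, hkX])
      have hkK : K ≤ k := by
        by_contra hcon
        refine hK' k (by omega) (by omega) ?_
        rw [hky, insertedBefore_succ h.injOn hl]
        exact Set.mem_insert _ _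
      -- The first return time of `y l` is the number of steps from `y l` to `ξ l` in the final
      -- cyclic order, so the intermediate points are not among the elements inserted so far.
      have hKk : K = k := hR.pow_inj (x := σ (y l)) (by omega) hkN (by
        rw [← equiv_pow_apply hσ, ← equiv_pow_apply hσ, hKy, hky])
      have hXy : σ.symm X = (π a ^ j) (y l) := by
        rw [← hjX, ← equiv_pow_apply hσ, Equiv.symm_apply_apply]
      obtain ⟨l', h1, h2, h3⟩ := notMem_insertedBefore_cases (hK' j hj (by omega))
      rw [hXy, h3]
      exact (hlt l hl l' h2).2 h1
  refine ⟨fun hp => ?_, fun hp => hp ▸ hy⟩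
  by_contra hne
  have hpm := hbelow p hp.1
  have hym := h.mem l hl
  have hne' : ∀ q, q ∈ insertedBefore S₁ a ξ l → σ q ≠ σ (Sum.inr (ξ l)) := fun q hq he =>
    hq l le_rfl hl (σ.injective he)
  obtain ⟨j, hjN, hj⟩ := hR.exists_pow (σ (y l)) (σ p)
  obtain ⟨k, hkN, hk⟩ := hR.exists_pow (σ (y l)) (σ (Sum.inr (ξ l)))
  have hj0 : j ≠ 0 := by
    rintro rfl
    exact hne (σ.injective (by simpa using hj.symm))
  have hk0 : k ≠ 0 := by
    rintro rfl
    exact hne' _ hym (by simpa using hk)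
  have hjk : j ≠ k := by
    rintro rfl
    exact hne' _ hpm (hj.symm.trans hk)
  rcases lt_or_gt_of_ne hjk with hlt' | hlt'
  · have hC : C₃ (σ (y l)) (σ p) (σ (Sum.inr (ξ l))) :=
      (hR.iff_pow _ _ _).2 ⟨j, k, by omega, hlt', hkN, hj, hk⟩
    have := hy.2 _ hC
    rw [Equiv.symm_apply_apply] at this
    exact habove _ this hpm
  · have hC : C₃ (σ p) (σ (y l)) (σ (Sum.inr (ξ l))) := by
      -- Positions are now counted from `p`, which lies `j` steps after `y l`: from there `y l`
      -- comes after `N - j` steps and `ξ l` after `N - j + k`.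
      refine (hR.iff_pow _ _ _).2 ⟨N - j, N - j + k, by omega, by omega, by omega, ?_, ?_⟩
      · rw [← hj, ← Equiv.Perm.mul_apply, ← pow_add, Nat.sub_add_cancel hjN.le, hR.pow_eq]
      · rw [← hj, ← Equiv.Perm.mul_apply, ← pow_add, show N - j + k + j = k + N by omega, pow_add,
          Equiv.Perm.mul_apply, hR.pow_eq, hk]
    have := hp.2 _ hC
    rw [Equiv.symm_apply_apply] at this
    exact habove _ this hym

omit hR hσ in
theorem card_lt {l : ℕ} (hl : l < a) : Nat.card {s' : S₂ // lt s' (ξ l)} = l :=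
  card_lt_of_enumeration h.injOn h.surj hlt hl

theorem incidenceEdge_iff {l : ℕ} (hl : l < a) (X Y : S₃) :
    IncidenceEdge C₃ σ lt l X Y ↔ (X = σ (Sum.inr (ξ l)) ∧ Y = σ (y l)) ∨
      (X = σ (y l) ∧ Y = σ (Sum.inr (ξ l))) := by
  constructor
  · rintro ⟨s, p, hs, hp, hXY⟩
    obtain ⟨l', hl', rfl⟩ := h.surj s
    rw [h.card_lt hlt hl'] at hs
    subst hs
    rw [h.isAttachingPoint_iff hR hσ hlt hl] at hp
    rwa [hp] at hXY
  · intro hXY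
    exact ⟨ξ l, y l, h.card_lt hlt hl, (h.isAttachingPoint_iff hR hσ hlt hl _).2 rfl, hXY⟩

omit hR hσ in
theorem isStrictTotalOrder : IsStrictTotalOrder S₂ lt where
  trichotomous s s' h1 h2 := by
    obtain ⟨i, hi, rfl⟩ := h.surj s
    obtain ⟨j, hj, rfl⟩ := h.surj s'
    rw [hlt i hi j hj] at h1
    rw [hlt j hj i hi] at h2
    rw [show i = j by omega]
  irrefl s hs := by
    obtain ⟨i, hi, rfl⟩ := h.surj s
    exact lt_irrefl _ ((hlt i hi i hi).1 hs)
  trans s s' s'' h1 h2 := by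
    obtain ⟨i, hi, rfl⟩ := h.surj s
    obtain ⟨j, hj, rfl⟩ := h.surj s'
    obtain ⟨k, hk, rfl⟩ := h.surj s''
    exact (hlt i hi k hk).2 (lt_trans ((hlt i hi j hj).1 h1) ((hlt j hj k hk).1 h2))

end IsInsertionChain

theorem exists_enumeration [Finite S₂] (a : ℕ) (ha : Nat.card S₂ = a) (ha0 : 0 < a)
    (lt : S₂ → S₂ → Prop) (hlt : IsStrictTotalOrder S₂ lt) :
    ∃ ξ : ℕ → S₂, Set.InjOn ξ (Set.Iio a) ∧ (∀ s, ∃ l < a, ξ l = s) ∧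
      ∀ i < a, ∀ j < a, lt (ξ i) (ξ j) ↔ i < j := by
  classical
  have := Fintype.ofFinite S₂
  let := linearOrderOfSTO lt
  let e : Fin a ≃o S₂ := Fintype.orderIsoFinOfCardEq S₂ (by rw [← ha, Nat.card_eq_fintype_card])
  refine ⟨fun l => if hl : l < a then e ⟨l, hl⟩ else e ⟨0, ha0⟩, ?_, ?_, ?_⟩
  · intro i hi j hj hij
    have hi' : i < a := hi
    have hj' : j < a := hj
    simpa [hi', hj'] using hij
  · intro s
    refine ⟨e.symm s, (e.symm s).2, ?_⟩
    simp
  · intro i hi j hj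
    simp only [hi, hj, dif_pos]
    exact (e.lt_iff_lt (x := ⟨i, hi⟩) (y := ⟨j, hj⟩)).trans (by simp)

namespace IsInsertionChain

/-- The order of insertion can be read off from the labelled incidence graph. -/
theorem order_unique [Finite S₂] (h : IsInsertionChain a f ξ y π) (ha : Nat.card S₂ = a)
    {C₃ : S₃ → S₃ → S₃ → Prop} {N : ℕ} {R : Equiv.Perm S₃} {σ : S₁ ⊕ S₂ ≃ S₃}
    (hR : IsCyclicSucc C₃ R N) (hσ : ∀ z, σ (π a z) = R (σ z)) {lt : S₂ → S₂ → Prop}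
    (hlt : ∀ i < a, ∀ j < a, lt (ξ i) (ξ j) ↔ i < j) (lt' : S₂ → S₂ → Prop)
    (hlt' : IsStrictTotalOrder S₂ lt')
    (he : ∀ l < a, ∀ X Y, IncidenceEdge C₃ σ lt l X Y → IncidenceEdge C₃ σ lt' l X Y) :
    lt' = lt := by
  rcases Nat.eq_zero_or_pos a with ha0 | ha0
  · ext s
    obtain ⟨l, hl, -⟩ := h.surj s
    omega
  obtain ⟨ξ', hinj', hsurj', hlt''⟩ := exists_enumeration a ha ha0 lt' hlt'
  have hcard : ∀ l < a, ∀ s, Nat.card {s' : S₂ // lt' s' s} = l → s = ξ' l := by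
    intro l hl s hs
    obtain ⟨j, hj, rfl⟩ := hsurj' s
    rw [card_lt_of_enumeration hinj' hsurj' hlt'' hj] at hs
    rw [hs]
  have key : ∀ l < a, ξ l = ξ' l := by
    intro l
    induction l using Nat.strong_induction_on with
    | _ l ih =>
      intro hl
      obtain ⟨s, p, hs, hp, hXY⟩ := he l hl _ _
        ((h.incidenceEdge_iff hR hσ hlt hl _ _).2 (Or.inl ⟨rfl, rfl⟩))
      have hs' := hcard l hl s hs
      -- The edge of label `l` is `{ξ l, y l}`. In the graph of `lt'` its inserted end is `ξ' l`. If
      -- this were `y l`, it would be an earlier `ξ j = ξ' j`, which has another rank.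
      rcases hXY with ⟨h1, -⟩ | ⟨-, h2⟩
      · rw [← hs']
        exact Sum.inr.inj (σ.injective h1)
      · have h3 : y l = Sum.inr s := σ.injective h2
        have hmem := h.mem l hl
        rcases h.mem_cases hmem with ⟨x, hx⟩ | ⟨j, hj, hja, hx⟩
        · rw [hx] at h3
          exact absurd h3 Sum.inl_ne_inr
        · rw [hx] at h3
          have h4 : ξ' j = ξ' l := by
            rw [← ih j hj hja, ← hs']
            exact Sum.inr.inj h3
          have := hinj' hja hl h4
          omega
  ext s s'
  obtain ⟨i, hi, rfl⟩ := h.surj s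
  obtain ⟨j, hj, rfl⟩ := h.surj s'
  rw [hlt i hi j hj, key i hi, key j hj, hlt'' i hi j hj]

end IsInsertionChain

/-- Every cyclic insertion arises from a chain of insertions, in any prescribed order. -/
theorem exists_isInsertionChain {C₁ : S₁ → S₁ → S₁ → Prop} {C₃ : S₃ → S₃ → S₃ → Prop} {b N : ℕ}
    {R : Equiv.Perm S₃} (σ : S₁ ⊕ S₂ ≃ S₃) (x₀ : S₁) (hf : IsCyclicSucc C₁ f b)
    (hR : IsCyclicSucc C₃ R N)
    (hins : ∀ x y z, C₁ x y z → C₃ (σ (Sum.inl x)) (σ (Sum.inl y)) (σ (Sum.inl z)))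
    (hinj : Set.InjOn ξ (Set.Iio a)) (hsurj : ∀ s, ∃ l < a, ξ l = s) :
    ∃ y π, IsInsertionChain a f ξ y π ∧ ∀ z, σ (π a z) = R (σ z) := by
  classical
  let τ : Equiv.Perm (S₁ ⊕ S₂) := (σ.trans R).trans σ.symm
  have hτ : ∀ z, σ (τ z) = R (σ z) := fun z => by simp [τ]
  have hτp : ∀ j z, σ ((τ ^ j) z) = (R ^ j) (σ z) := by
    intro j z
    induction j with
    | zero => simp
    | succ j ih => rw [pow_succ', Equiv.Perm.mul_apply, hτ, ih, pow_succ', Equiv.Perm.mul_apply]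
  -- Starting from the successor permutation of `S₃`, the elements `ξ (a-1), ξ (a-2), …` are cut
  -- out; `κ j` is what remains after `j` deletions, and `y l` is the predecessor of `ξ l` at the
  -- moment of its deletion.
  let κ : ℕ → Equiv.Perm (S₁ ⊕ S₂) := fun j => Nat.rec τ
    (fun j κ => κ * Equiv.swap (Sum.inr (ξ (a - 1 - j))) (κ.symm (Sum.inr (ξ (a - 1 - j))))) j
  let π : ℕ → Equiv.Perm (S₁ ⊕ S₂) := fun l => κ (a - l)
  let y : ℕ → S₁ ⊕ S₂ := fun l => (π (l + 1)).symm (Sum.inr (ξ l))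
  have hπa : π a = τ := by simp [π, κ]
  have hstep : ∀ l < a, π l = π (l + 1) * Equiv.swap (Sum.inr (ξ l)) (y l) := by
    intro l hl
    have e1 : a - l = (a - (l + 1)) + 1 := by omega
    have e2 : a - 1 - (a - (l + 1)) = l := by omega
    show κ (a - l) = _
    rw [e1]
    show κ (a - (l + 1)) * Equiv.swap (Sum.inr (ξ (a - 1 - (a - (l + 1)))))
      ((κ (a - (l + 1))).symm (Sum.inr (ξ (a - 1 - (a - (l + 1)))))) = _
    rw [e2]
  have hstep' : ∀ l < a, π (l + 1) = π l * Equiv.swap (Sum.inr (ξ l)) (y l) := by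
    intro l hl
    rw [hstep l hl, mul_assoc, Equiv.swap_mul_self, mul_one]
  have hyl : ∀ l, π (l + 1) (y l) = Sum.inr (ξ l) := fun l => by simp [y]
  have main : ∀ j l, l + j = a → (∀ l', l ≤ l' → l' < a → π l (Sum.inr (ξ l')) = Sum.inr (ξ l')) ∧
      IsFirstReturn τ (insertedBefore S₁ a ξ l) (π l) ∧
      ∀ l', l ≤ l' → l' < a → y l' ∈ insertedBefore S₁ a ξ l' := by
    intro j
    induction j with
    | zero =>
      intro l hl
      obtain rfl : l = a := by omega
      refine ⟨fun l' h1 h2 => by omega, ?_, fun l' h1 h2 => by omega⟩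
      rw [hπa, insertedBefore_top]
      exact isFirstReturn_univ _
    | succ j ih =>
      intro l hl
      have hla : l < a := by omega
      obtain ⟨h1, h2, h3⟩ := ih (l + 1) (by omega)
      -- If `ξ l` were its own predecessor, its first return would need a full turn; but the element
      -- `x₀` of `S₁`, which is never deleted, is met before.
      have hne : y l ≠ Sum.inr (ξ l) := by
        intro he
        have hfix : π (l + 1) (Sum.inr (ξ l)) = Sum.inr (ξ l) := by
          have := hyl l
          rwa [he] at this
        have hmem : (Sum.inr (ξ l) : S₁ ⊕ S₂) ∈ insertedBefore S₁ a ξ (l + 1) := by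
          rw [insertedBefore_succ hinj hla]
          exact Set.mem_insert _ _
        obtain ⟨k, hk, hkz, hk'⟩ := h2 _ hmem
        rw [hfix] at hkz
        obtain ⟨t, htN, ht⟩ := hR.exists_pow (σ (Sum.inr (ξ l))) (σ (Sum.inl x₀))
        rw [← hτp] at ht
        have ht := σ.injective ht
        have ht0 : t ≠ 0 := by
          rintro rfl
          exact Sum.inl_ne_inr ht.symm
        have hkN : N ≤ k := by
          by_contra hcon
          exact hR.pow_ne (σ (Sum.inr (ξ l))) k hk (not_le.1 hcon) (by rw [← hτp, hkz])
        exact hk' t (by omega) (by omega) (ht ▸ inl_mem_insertedBefore a ξ (l + 1) x₀)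
      have hy : y l ∈ insertedBefore S₁ a ξ l := by
        intro l' hl' hl'a he
        rcases hl'.eq_or_lt with rfl | hlt
        · exact hne he
        · have := hyl l
          rw [he, h1 l' hlt hl'a] at this
          have := hinj hl'a hla (Sum.inr.inj this)
          omega
      refine ⟨fun l' hl' hl'a => ?_, ?_, fun l' hl' hl'a => ?_⟩
      · rw [hstep l hla, Equiv.Perm.mul_apply]
        rcases hl'.eq_or_lt with rfl | hlt
        · rw [Equiv.swap_apply_left, hyl]
        · rw [Equiv.swap_apply_of_ne_of_ne, h1 l' hlt hl'a]
          · intro he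
            have := hinj hl'a hla (Sum.inr.inj he)
            omega
          · exact (hy l' hlt.le hl'a).symm
      · rw [hstep l hla]
        rw [insertedBefore_succ hinj hla] at h2
        exact h2.mul_swap (notMem_insertedBefore hla) (hyl l)
      · rcases hl'.eq_or_lt with rfl | hlt
        · exact hy
        · exact h3 l' hlt hl'a
  obtain ⟨m1, m2, m3⟩ := main a 0 (by omega)
  have hzero : ∀ s, π 0 (Sum.inr s) = Sum.inr s := by
    intro s
    obtain ⟨l, hl, rfl⟩ := hsurj s
    exact m1 l (Nat.zero_le l) hl
  refine ⟨y, π, ⟨hinj, hsurj, fun x => ?_, hzero, fun l hl => m3 l (Nat.zero_le l) hl, hstep'⟩,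
    fun z => by rw [hπa, hτ]⟩
  obtain ⟨k, hk, hkx, hk'⟩ := m2 _ (inl_mem_insertedBefore a ξ 0 x)
  rcases hx' : π 0 (Sum.inl x) with x' | s
  swap
  · rw [← hzero s] at hx'
    exact absurd ((π 0).injective hx') Sum.inl_ne_inr
  rw [hx'] at hkx
  congr 1
  -- It remains to see that the first return map to `S₁` is `f`. If it sent `x` to some `x' ≠ f x`,
  -- then `x'` would precede `f x` after `x` in `S₃`, whereas `x, f x, x'` are in cyclic order in
  -- `S₁`.
  by_contra hne
  obtain ⟨j, hjb, hj⟩ := hf.exists_pow x x'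
  have hb : 1 < b := by
    by_contra hcon
    obtain ⟨i, hi, hi'⟩ := hf.exists_pow x (f x)
    obtain rfl : i = 0 := by omega
    obtain rfl : j = 0 := by omega
    exact hne (hj.symm.trans hi')
  obtain ⟨t, htN, ht⟩ := hR.exists_pow (σ (Sum.inl x)) (σ (Sum.inl (f x)))
  have ht' := ht
  rw [← hτp] at ht'
  have ht' := σ.injective ht'
  have hfx : f x ≠ x := by simpa using hf.pow_ne x 1 one_pos hb
  have ht0 : t ≠ 0 := by
    rintro rfl
    exact hfx (Sum.inl.inj ht'.symm)
  have htk : k < t := by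
    by_contra hcon
    rcases (not_lt.1 hcon).eq_or_lt with rfl | hlt
    · exact hne (Sum.inl.inj (hkx.symm.trans ht'))
    · exact hk' t (by omega) hlt (ht' ▸ inl_mem_insertedBefore a ξ 0 (f x))
  have hj0 : j ≠ 0 := by
    rintro rfl
    have hxx : x = x' := by simpa using hj
    subst hxx
    exact hR.pow_ne (σ (Sum.inl x)) k hk (by omega) (by rw [← hτp, hkx])
  have hj1 : j ≠ 1 := by
    rintro rfl
    exact hne (by simpa using hj.symm)
  obtain ⟨p, q, hp, hpq, hqN, hpx, hqx⟩ := (hR.iff_pow _ _ _).1 (hins x (f x) x'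
    ((hf.iff_pow _ _ _).2 ⟨1, j, one_pos, by omega, hjb, by simp, hj⟩))
  have e1 : p = t := hR.pow_inj (x := σ (Sum.inl x)) (by omega) htN (hpx.trans ht.symm)
  have e2 : q = k := hR.pow_inj (x := σ (Sum.inl x)) hqN (by omega)
    (hqx.trans (by rw [← hτp, hkx]))
  omega

/-- Both bijections carry `τ` to the transitive permutation `R`, so each is determined by its value
at one point. -/
theorem exists_pow_of_conj {T : Type*} {C₃ : S₃ → S₃ → S₃ → Prop} {N : ℕ} {R : Equiv.Perm S₃}
    (hR : IsCyclicSucc C₃ R N) (σ σ' : T ≃ S₃) (τ : Equiv.Perm T) (h : ∀ z, σ (τ z) = R (σ z))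
    (h' : ∀ z, σ' (τ z) = R (σ' z)) (z₀ : T) : ∃ K < N, ∀ z, σ' z = (R ^ K) (σ z) := by
  have hp : ∀ (σ : T ≃ S₃), (∀ z, σ (τ z) = R (σ z)) → ∀ j z, σ ((τ ^ j) z) = (R ^ j) (σ z) := by
    intro σ h j z
    induction j with
    | zero => simp
    | succ j ih => rw [pow_succ', Equiv.Perm.mul_apply, h, ih, pow_succ', Equiv.Perm.mul_apply]
  obtain ⟨K, hKN, hK⟩ := hR.exists_pow (σ z₀) (σ' z₀)
  refine ⟨K, hKN, fun z => ?_⟩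
  obtain ⟨j, -, hj⟩ := hR.exists_pow (σ z₀) (σ z)
  have hz : (τ ^ j) z₀ = z := σ.injective (by rw [hp σ h, hj])
  rw [← hj, ← hz, hp σ' h', ← hK, ← Equiv.Perm.mul_apply, ← Equiv.Perm.mul_apply, ← pow_add,
    ← pow_add, add_comm]

end InsertionChain

/-! ## Cyclic orders by argument -/

section CCW

theorem sbtw_coe_of_lt {p q r : ℝ} (h1 : p < q) (h2 : q < r) (h3 : r < p + 2 * Real.pi) :
    sbtw (p : Real.Angle) (q : Real.Angle) (r : Real.Angle) := by
  have hpi : Fact (0 < 2 * Real.pi) := ⟨by positivity⟩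
  rw [sbtw_iff_not_btw]
  change ¬ btw (((r : ℝ) : ℝ ⧸ AddSubgroup.zmultiples (2 * Real.pi)))
    ((q : ℝ) : ℝ ⧸ AddSubgroup.zmultiples (2 * Real.pi))
    ((p : ℝ) : ℝ ⧸ AddSubgroup.zmultiples (2 * Real.pi))
  rw [QuotientAddGroup.btw_coe_iff]
  have e1 : toIcoMod hpi.out r q = q + 2 * Real.pi :=
    (toIcoMod_eq_iff hpi.out).2 ⟨⟨by linarith, by linarith⟩, -1, by simp⟩
  have e2 : toIocMod hpi.out r p = p + 2 * Real.pi :=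
    (toIocMod_eq_iff hpi.out).2 ⟨⟨by linarith, by linarith⟩, -1, by simp⟩
  rw [e1, e2]
  linarith

theorem coe_arg_exp_mul_I (θ : ℝ) : ((Complex.exp (θ * Complex.I)).arg : Real.Angle) = θ := by
  rw [Complex.exp_mul_I]
  rw [← Complex.ofReal_cos, ← Complex.ofReal_sin]
  exact Complex.arg_cos_add_sin_mul_I_coe_angle (θ : Real.Angle)

/-- The primitive `d`-th root of unity with the smallest positive argument. -/
noncomputable def unitRoot (d : ℕ) : ℂ := Complex.exp (2 * Real.pi * Complex.I / d)

theorem isPrimitiveRoot_unitRoot {d : ℕ} (hd : 0 < d) : IsPrimitiveRoot (unitRoot d) d :=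
  Complex.isPrimitiveRoot_exp d hd.ne'

theorem unitRoot_ne_zero (d : ℕ) : unitRoot d ≠ 0 := Complex.exp_ne_zero _

theorem ne_zero_of_mem_powRoots {d : ℕ} {c ζ : ℂ} (hd : 0 < d) (hc : c ≠ 0)
    (h : ζ ∈ powRoots d c) : ζ ≠ 0 := by
  rintro rfl
  have h' : (0 : ℂ) ^ d = c := h
  rw [zero_pow hd.ne'] at h'
  exact hc h'.symm

/-- Counterclockwise rotation of the `d`-th roots of unity. -/
noncomputable def rotatePerm (d : ℕ) (hd : 0 < d) : Equiv.Perm (powRoots d 1) where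
  toFun ζ := ⟨unitRoot d * ζ, by
    have : (ζ : ℂ) ^ d = 1 := ζ.2
    show (unitRoot d * (ζ : ℂ)) ^ d = 1
    rw [mul_pow, this, (isPrimitiveRoot_unitRoot hd).pow_eq_one, one_mul]⟩
  invFun ζ := ⟨(unitRoot d)⁻¹ * ζ, by
    have : (ζ : ℂ) ^ d = 1 := ζ.2
    show ((unitRoot d)⁻¹ * (ζ : ℂ)) ^ d = 1
    rw [mul_pow, this, inv_pow, (isPrimitiveRoot_unitRoot hd).pow_eq_one, inv_one, one_mul]⟩
  left_inv ζ := Subtype.ext (by simp [unitRoot_ne_zero])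
  right_inv ζ := Subtype.ext (by simp [unitRoot_ne_zero])

theorem coe_rotatePerm {d : ℕ} (hd : 0 < d) (ζ : powRoots d 1) :
    (rotatePerm d hd ζ : ℂ) = unitRoot d * ζ := rfl

theorem coe_rotatePerm_pow {d : ℕ} (hd : 0 < d) (j : ℕ) (ζ : powRoots d 1) :
    ((rotatePerm d hd ^ j) ζ : ℂ) = unitRoot d ^ j * ζ := by
  induction j with
  | zero => simp
  | succ j ih => rw [pow_succ', Equiv.Perm.mul_apply, coe_rotatePerm, ih, pow_succ', mul_assoc]

theorem exists_rotatePerm_pow {d : ℕ} (hd : 0 < d) (ζ ζ' : powRoots d 1) :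
    ∃ j < d, (rotatePerm d hd ^ j) ζ = ζ' := by
  have h0 : (ζ : ℂ) ≠ 0 := ne_zero_of_mem_powRoots hd one_ne_zero ζ.2
  have h1 : (ζ : ℂ) ^ d = 1 := ζ.2
  have h2 : (ζ' : ℂ) ^ d = 1 := ζ'.2
  have := NeZero.of_pos hd
  obtain ⟨j, hj, e⟩ := (isPrimitiveRoot_unitRoot hd).eq_pow_of_pow_eq_one
    (ξ := (ζ' : ℂ) / ζ) (by rw [div_pow, h1, h2, div_one])
  refine ⟨j, hj, Subtype.ext ?_⟩
  rw [coe_rotatePerm_pow, e, div_mul_cancel₀ _ h0]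

theorem rotatePerm_pow_ne {d : ℕ} (hd : 0 < d) (ζ : powRoots d 1) {j : ℕ} (hj : 0 < j)
    (hjd : j < d) : (rotatePerm d hd ^ j) ζ ≠ ζ := by
  intro h
  have h0 : (ζ : ℂ) ≠ 0 := ne_zero_of_mem_powRoots hd one_ne_zero ζ.2
  have h1 := congrArg Subtype.val h
  rw [coe_rotatePerm_pow] at h1
  exact (isPrimitiveRoot_unitRoot hd).pow_ne_one_of_pos_of_lt hj.ne' hjd (mul_right_cancel₀ h0 (h1.trans (one_mul _).symm))

theorem rotatePerm_pow_eq {d : ℕ} (hd : 0 < d) (ζ : powRoots d 1) :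
    (rotatePerm d hd ^ d) ζ = ζ := by
  apply Subtype.ext
  rw [coe_rotatePerm_pow, (isPrimitiveRoot_unitRoot hd).pow_eq_one, one_mul]

/-- Neighbouring roots of unity differ in argument by `2π / d`, so displacements of the arguments by
less than `π / d` do not change the cyclic order. The proof lifts the arguments along an orbit to an
increasing sequence within one turn. -/
theorem isCyclicSucc_of_arg_lt {d : ℕ} (hd : 0 < d) {S : Set ℂ} (e : powRoots d 1 ≃ S) {Φ : ℂ}
    (hΦ : Φ ≠ 0) (he0 : ∀ ζ, (e ζ : ℂ) ≠ 0)
    (he : ∀ ζ : powRoots d 1, |((e ζ : ℂ) / Φ / ζ).arg| < Real.pi / d) :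
    IsCyclicSucc (CCWOn S) ((e.symm.trans (rotatePerm d hd)).trans e) d := by
  set f : Equiv.Perm S := (e.symm.trans (rotatePerm d hd)).trans e with hf
  have hpow : ∀ j x, (f ^ j) x = e ((rotatePerm d hd ^ j) (e.symm x)) := by
    intro j x
    induction j with
    | zero => simp
    | succ j ih => rw [pow_succ', Equiv.Perm.mul_apply, ih, pow_succ', Equiv.Perm.mul_apply]; simp [hf]
  have hex : ∀ x y, ∃ j < d, (f ^ j) x = y := by
    intro x y
    obtain ⟨j, hj, h⟩ := exists_rotatePerm_pow hd (e.symm x) (e.symm y)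
    exact ⟨j, hj, by rw [hpow, h, Equiv.apply_symm_apply]⟩
  have hd' : (0 : ℝ) < d := by exact_mod_cast hd
  have hpi := Real.pi_pos
  -- a lift of the arguments along an orbit
  have hang : ∀ (x : S) (j : ℕ), ∃ δ : ℝ, |δ| < Real.pi / d ∧ ((((f ^ j) x : S) : ℂ).arg : Real.Angle) =
      ((Φ.arg + ((e.symm x : powRoots d 1) : ℂ).arg + 2 * Real.pi / d * j + δ : ℝ) : Real.Angle) := by
    intro x j
    set ζ := (rotatePerm d hd ^ j) (e.symm x) with hζ
    refine ⟨((e ζ : ℂ) / Φ / ζ).arg, he ζ, ?_⟩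
    have hζ0 : (ζ : ℂ) ≠ 0 := ne_zero_of_mem_powRoots hd one_ne_zero ζ.2
    have hx0 : ((e.symm x : powRoots d 1) : ℂ) ≠ 0 :=
      ne_zero_of_mem_powRoots hd one_ne_zero (e.symm x).2
    have hv0 : (e ζ : ℂ) / Φ / ζ ≠ 0 := div_ne_zero (div_ne_zero (he0 ζ) hΦ) hζ0
    have hu : unitRoot d ^ j = Complex.exp ((2 * Real.pi / d * j : ℝ) * Complex.I) := by
      rw [unitRoot, ← Complex.exp_nat_mul]
      congr 1
      push_cast
      ring
    have h1 : (((f ^ j) x : S) : ℂ) = Φ * (((e.symm x : powRoots d 1) : ℂ) *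
        (unitRoot d ^ j * ((e ζ : ℂ) / Φ / ζ))) := by
      rw [hpow, ← hζ]
      have h2 : (ζ : ℂ) = unitRoot d ^ j * ((e.symm x : powRoots d 1) : ℂ) :=
        coe_rotatePerm_pow hd j _
      have h3 : ((e.symm x : powRoots d 1) : ℂ) * (unitRoot d ^ j * ((e ζ : ℂ) / Φ / ζ)) =
          (ζ : ℂ) * ((e ζ : ℂ) / Φ / ζ) := by
        rw [← mul_assoc, mul_comm ((e.symm x : powRoots d 1) : ℂ), ← h2]
      rw [h3]
      field_simp
    rw [h1, Complex.arg_mul_coe_angle hΦ (mul_ne_zero hx0 (mul_ne_zero (pow_ne_zero _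
      (unitRoot_ne_zero d)) hv0)), Complex.arg_mul_coe_angle hx0 (mul_ne_zero (pow_ne_zero _
      (unitRoot_ne_zero d)) hv0), Complex.arg_mul_coe_angle (pow_ne_zero _ (unitRoot_ne_zero d)) hv0,
      hu, coe_arg_exp_mul_I, Real.Angle.coe_add, Real.Angle.coe_add, Real.Angle.coe_add]
    abel
  have hccw : ∀ (x : S) (j k : ℕ), 0 < j → j < k → k < d → CCWOn S x ((f ^ j) x) ((f ^ k) x) := by
    intro x j k hj hjk hkd
    obtain ⟨δ₀, hδ₀, e₀⟩ := hang x 0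
    obtain ⟨δ₁, hδ₁, e₁⟩ := hang x j
    obtain ⟨δ₂, hδ₂, e₂⟩ := hang x k
    rw [abs_lt] at hδ₀ hδ₁ hδ₂
    rw [pow_zero, Equiv.Perm.one_apply] at e₀
    have hstep : ∀ i i' : ℕ, i < i' → 2 * Real.pi / d * i + 2 * (Real.pi / d) ≤ 2 * Real.pi / d * i' := by
      intro i i' hii
      have : (i : ℝ) + 1 ≤ i' := by exact_mod_cast hii
      calc 2 * Real.pi / d * i + 2 * (Real.pi / d) = 2 * Real.pi / d * (i + 1) := by ring
        _ ≤ _ := by gcongr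
    have s1 := hstep 0 j hj
    have s2 := hstep j k hjk
    have s3 := hstep k d hkd
    have s4 : 2 * Real.pi / d * (d : ℝ) = 2 * Real.pi := by field_simp
    rw [Nat.cast_zero, mul_zero] at s1
    show sbtw _ _ _
    rw [e₀, e₁, e₂]
    apply sbtw_coe_of_lt
    · rw [Nat.cast_zero, mul_zero]
      linarith
    · linarith
    · rw [Nat.cast_zero, mul_zero]
      linarith
  refine ⟨hex, fun x j h1 h2 h3 => ?_, fun x => ?_, fun x y z => ⟨fun h => ?_, ?_⟩⟩
  · rw [hpow] at h3
    exact rotatePerm_pow_ne hd _ h1 h2 (e.injective (h3.trans (e.apply_symm_apply x).symm))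
  · rw [hpow, rotatePerm_pow_eq, Equiv.apply_symm_apply]
  · have h' : sbtw _ _ _ := h
    obtain ⟨j, hj, rfl⟩ := hex x y
    obtain ⟨k, hk, rfl⟩ := hex x z
    have hj0 : j ≠ 0 := by
      rintro rfl
      exact sbtw_irrefl_left h'
    have hk0 : k ≠ 0 := by
      rintro rfl
      exact sbtw_irrefl_left_right h'
    have hjk : j ≠ k := by
      rintro rfl
      exact sbtw_irrefl_right h'
    rcases lt_or_gt_of_ne hjk with hlt | hlt
    · exact ⟨j, k, by omega, hlt, hk, rfl, rfl⟩
    · have h2 : sbtw _ _ _ := hccw x k j (by omega) hlt hj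
      exact absurd (sbtw_cyclic_left h2) (sbtw_asymm h')
  · rintro ⟨j, k, h1, h2, h3, rfl, rfl⟩
    exact hccw x j k h1 h2 h3

end CCW

/-! ## Continuous families of roots -/

section Lifting

/-- The mechanism by which roots are confined in what follows: to a disc around a given position, to
a petal, to the ball of radius `M`. -/
theorem IsPreconnected.mem_of_notMem_frontier {X Y : Type*} [TopologicalSpace X]
    [TopologicalSpace Y] {S : Set X} (hS : IsPreconnected S) {f : X → Y} (hf : ContinuousOn f S)
    {U : Set Y} (hU : IsOpen U) (hfr : ∀ x ∈ S, f x ∉ frontier U) {x₀ : X} (hx₀ : x₀ ∈ S)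
    (h₀ : f x₀ ∈ U) : ∀ x ∈ S, f x ∈ U := by
  have hI := hS.image f hf
  intro x hx
  by_contra hxU
  have hcov : f '' S ⊆ U ∪ (closure U)ᶜ := by
    rintro _ ⟨y, hy, rfl⟩
    by_cases h : f y ∈ U
    · exact Or.inl h
    · refine Or.inr fun h' => hfr y hy ?_
      rw [hU.frontier_eq]
      exact ⟨h', h⟩
  obtain ⟨y, -, hyU, hyc⟩ := hI U (closure U)ᶜ hU isClosed_closure.isOpen_compl hcov
    ⟨f x₀, ⟨x₀, hx₀, rfl⟩, h₀⟩
    ⟨f x, ⟨x, hx, rfl⟩, (hcov ⟨x, hx, rfl⟩).resolve_left hxU⟩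
  exact hyc (subset_closure hyU)

theorem Polynomial.exists_nhds_injOn_eval (P : ℂ[X]) {u : ℂ} (hu : P.derivative.eval u ≠ 0) :
    ∃ V ∈ 𝓝 u, Set.InjOn P.eval V := by
  have h := (P.hasStrictDerivAt u).hasStrictFDerivAt_equiv hu
  refine ⟨_, (h.toOpenPartialHomeomorph _).open_source.mem_nhds
    h.mem_toOpenPartialHomeomorph_source, ?_⟩
  simpa using (h.toOpenPartialHomeomorph _).injOn

/-- Uniqueness of continuous families of simple roots. -/
theorem Polynomial.eqOn_of_eval_eq (P : ℂ[X]) {X : Type*} [TopologicalSpace X] {S : Set X}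
    (hS : IsPreconnected S) {f g : X → ℂ} (hf : ContinuousOn f S) (hg : ContinuousOn g S)
    (hfg : ∀ x ∈ S, P.eval (f x) = P.eval (g x)) (hP : ∀ x ∈ S, P.derivative.eval (g x) ≠ 0)
    {x₀ : X} (hx₀ : x₀ ∈ S) (h₀ : f x₀ = g x₀) : Set.EqOn f g S := by
  have hSs : PreconnectedSpace S := isPreconnected_iff_preconnectedSpace.1 hS
  have hclo : IsClopen {x : S | f x = g x} := by
    constructor
    · exact isClosed_eq (continuousOn_iff_continuous_domRestrict.1 hf)
        (continuousOn_iff_continuous_domRestrict.1 hg)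
    · rw [isOpen_iff_mem_nhds]
      intro x hx
      obtain ⟨V, hV, hinj⟩ := P.exists_nhds_injOn_eval (hP x x.2)
      have h1 : ∀ᶠ y : S in 𝓝 x, f y ∈ V :=
        (continuousOn_iff_continuous_domRestrict.1 hf).continuousAt (x := x)
          (by simpa [Set.domRestrict_apply, show f x = g x from hx] using hV)
      have h2 : ∀ᶠ y : S in 𝓝 x, g y ∈ V :=
        (continuousOn_iff_continuous_domRestrict.1 hg).continuousAt (x := x) hV
      filter_upwards [h1, h2] with y hy1 hy2
      exact hinj hy1 hy2 (hfg y y.2)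
  have := hclo.eq_univ ⟨⟨x₀, hx₀⟩, h₀⟩
  intro x hx
  have hx' : (⟨x, hx⟩ : S) ∈ {x : S | f x = g x} := this ▸ Set.mem_univ _
  exact hx'

/-- A polynomial is a covering map away from its critical points and values, so `w ↦ -exp w` lifts
through it on a simply connected set. -/
theorem Polynomial.exists_lift_exp (P : ℂ[X]) {U : Set ℂ} (hUc : IsSimplyConnected U)
    (hUo : IsOpen U)
    (hreg : ∀ w ∈ U, ∀ u, P.eval u = -Complex.exp w → P.derivative.eval u ≠ 0)
    {w₀ u₀ : ℂ} (hw₀ : w₀ ∈ U) (hu₀ : P.eval u₀ = -Complex.exp w₀) :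
    ∃ f : ℂ → ℂ, ContinuousOn f U ∧ f w₀ = u₀ ∧ ∀ w ∈ U, P.eval (f w) = -Complex.exp w := by
  classical
  have := hUc.simplyConnectedSpace
  have := hUo.locallyPathConnectedSpace
  obtain ⟨F, ⟨hF0, hF⟩, -⟩ := P.isCoveringMapOn_eval.existsUnique_continuousMap_lifts
    (A := U) (⟨fun w => -Complex.exp w, by fun_prop⟩ : C(U, ℂ)) (a₀ := ⟨w₀, hw₀⟩) (e₀ := u₀) hu₀
    (by
      rintro ⟨w, hw⟩ ⟨u, hu, huw⟩
      exact hreg w hw u huw hu)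
  obtain ⟨f, hf⟩ : ∃ f : ℂ → ℂ, ∀ z : U, f z = F z :=
    ⟨fun z ↦ if hz : z ∈ U then F ⟨z, hz⟩ else 0, by simp⟩
  refine ⟨f, ?_, ?_, ?_⟩
  · rw [continuousOn_iff_continuous_domRestrict]
    convert map_continuous F
    ext z
    exact hf z
  · exact (hf ⟨w₀, hw₀⟩).trans hF0
  · intro w hw
    rw [hf ⟨w, hw⟩]
    exact congrFun hF ⟨w, hw⟩

end Lifting

/-! ## Cut strips -/

section CutStrip

/-- The strip `A < Re w < B`, cut along the vertical lines through the points `c l`, except for the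
gaps of length `2π` below these points. -/
def cutStrip (A B : ℝ) (a : ℕ) (c : ℕ → ℂ) : Set ℂ :=
  {w | A < w.re ∧ w.re < B ∧
    ∀ l < a, w.re = (c l).re → (c l).im - 2 * Real.pi < w.im ∧ w.im < (c l).im}

variable {A B : ℝ} {a : ℕ} {c : ℕ → ℂ}

theorem isOpen_cutStrip : IsOpen (cutStrip A B a c) := by
  have : cutStrip A B a c = {w : ℂ | A < w.re} ∩ {w : ℂ | w.re < B} ∩
      ⋂ l ∈ Finset.range a, {w : ℂ | w.re ≠ (c l).re ∨
        ((c l).im - 2 * Real.pi < w.im ∧ w.im < (c l).im)} := by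
    ext w
    simp only [cutStrip, Set.mem_ofPred_eq, Set.mem_inter_iff, Set.mem_iInter, Finset.mem_range,
      and_assoc, imp_iff_not_or, ne_eq]
  rw [this]
  have hre := Complex.continuous_re
  have him := Complex.continuous_im
  refine ((isOpen_lt continuous_const hre).inter
    (isOpen_lt hre continuous_const)).inter (isOpen_biInter_finset fun l _ => ?_)
  exact (isOpen_ne_fun hre continuous_const).union
    ((isOpen_lt continuous_const him).inter (isOpen_lt him continuous_const))

/-- Each vertical line meets the region in an interval, either the whole line or a gap. The region
is therefore contracted vertically to the graph of a function that passes through the middle of all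
gaps, and then along this graph. -/
theorem isSimplyConnected_cutStrip (hAB : A < B)
    (hc : Set.InjOn (fun l => (c l).re) (Set.Iio a)) :
    IsSimplyConnected (cutStrip A B a c) := by
  -- a continuous function whose graph passes through all gaps
  obtain ⟨h, hhc, hh⟩ : ∃ h : ℝ → ℝ, Continuous h ∧
      ∀ l < a, h (c l).re = (c l).im - Real.pi := by
    refine ⟨fun x => (Lagrange.interpolate (Finset.range a) (fun l => (c l).re)
      (fun l => (c l).im - Real.pi)).eval x, by fun_prop, fun l hl => ?_⟩
    refine Lagrange.eval_interpolate_at_node (v := fun l => (c l).re)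
      (fun l => (c l).im - Real.pi) ?_ (Finset.mem_range.2 hl)
    intro x hx y hy hxy
    exact hc (by simpa using hx) (by simpa using hy) hxy
  set W := cutStrip A B a c with hW
  have hpi := Real.pi_pos
  have hgraph : ∀ x : ℝ, A < x → x < B → (⟨x, h x⟩ : ℂ) ∈ W := by
    intro x h1 h2
    refine ⟨h1, h2, fun l hl hx => ?_⟩
    have hx' : x = (c l).re := hx
    have := hh l hl
    rw [← hx'] at this
    constructor
    · show (c l).im - 2 * Real.pi < h x
      linarith
    · show h x < (c l).im
      linarith
  have hvert : ∀ w ∈ W, ∀ t : ℝ, 0 ≤ t → t ≤ 1 →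
      (⟨w.re, (1 - t) * w.im + t * h w.re⟩ : ℂ) ∈ W := by
    intro w hw t h0 h1
    refine ⟨hw.1, hw.2.1, fun l hl hx => ?_⟩
    have hx' : w.re = (c l).re := hx
    have h3 := hw.2.2 l hl hx'
    have h4 := (hgraph w.re hw.1 hw.2.1).2.2 l hl hx'
    simp only at h4
    constructor
    · show _ < (1 - t) * w.im + t * h w.re
      rcases h0.eq_or_lt with rfl | h0
      · linarith
      · nlinarith
    · show (1 - t) * w.im + t * h w.re < _
      rcases h0.eq_or_lt with rfl | h0
      · linarith
      · nlinarith
  have hmid : ∀ x : ℝ, A < x → x < B → ∀ t : ℝ, 0 ≤ t → t ≤ 1 →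
      A < (1 - t) * x + t * ((A + B) / 2) ∧ (1 - t) * x + t * ((A + B) / 2) < B := by
    intro x h1 h2 t h3 h4
    rcases h3.eq_or_lt with rfl | h3
    · constructor <;> linarith
    · constructor <;> nlinarith
  have hm : A < (A + B) / 2 ∧ (A + B) / 2 < B := by constructor <;> linarith
  have hcontr : ContractibleSpace W := by
    rw [contractible_iff_id_nullhomotopic]
    have h1 : ContinuousMap.Homotopic (ContinuousMap.id W)
        (⟨fun w : W => ⟨⟨w.1.re, h w.1.re⟩, hgraph _ w.2.1 w.2.2.1⟩, by
          refine Continuous.subtype_mk ?_ _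
          have : Continuous fun w : W => ((w.1.re : ℝ) : ℂ) + ((h w.1.re : ℝ) : ℂ) * Complex.I := by
            fun_prop
          convert this using 2
          rw [Complex.mk_eq_add_mul_I]⟩ : C(W, W)) := by
      refine ⟨⟨⟨fun p => ⟨⟨p.2.1.re, (1 - (p.1 : ℝ)) * p.2.1.im + (p.1 : ℝ) * h p.2.1.re⟩,
        hvert _ p.2.2 _ p.1.2.1 p.1.2.2⟩, ?_⟩, ?_, ?_⟩⟩
      · refine Continuous.subtype_mk ?_ _
        have : Continuous fun p : unitInterval × W => ((p.2.1.re : ℝ) : ℂ) +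
            (((1 - (p.1 : ℝ)) * p.2.1.im + (p.1 : ℝ) * h p.2.1.re : ℝ) : ℂ) * Complex.I := by
          fun_prop
        convert this using 2
        rw [Complex.mk_eq_add_mul_I]
      · intro w
        apply Subtype.ext
        apply Complex.ext <;> simp
      · intro w
        apply Subtype.ext
        apply Complex.ext <;> simp
    refine ⟨⟨⟨(A + B) / 2, h ((A + B) / 2)⟩, hgraph _ hm.1 hm.2⟩, h1.trans ?_⟩
    refine ⟨⟨⟨fun p => ⟨⟨(1 - (p.1 : ℝ)) * p.2.1.re + (p.1 : ℝ) * ((A + B) / 2),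
        h ((1 - (p.1 : ℝ)) * p.2.1.re + (p.1 : ℝ) * ((A + B) / 2))⟩,
        hgraph _ (hmid _ p.2.2.1 p.2.2.2.1 _ p.1.2.1 p.1.2.2).1
          (hmid _ p.2.2.1 p.2.2.2.1 _ p.1.2.1 p.1.2.2).2⟩, ?_⟩, ?_, ?_⟩⟩
    · refine Continuous.subtype_mk ?_ _
      have : Continuous fun p : unitInterval × W =>
          (((1 - (p.1 : ℝ)) * p.2.1.re + (p.1 : ℝ) * ((A + B) / 2) : ℝ) : ℂ) +
          ((h ((1 - (p.1 : ℝ)) * p.2.1.re + (p.1 : ℝ) * ((A + B) / 2)) : ℝ) : ℂ) * Complex.I := by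
        fun_prop
      convert this using 2
      rw [Complex.mk_eq_add_mul_I]
    · intro w
      apply Subtype.ext
      apply Complex.ext <;> simp
    · intro w
      apply Subtype.ext
      apply Complex.ext <;> simp
  have : SimplyConnectedSpace W := inferInstance
  exact this

end CutStrip

/-! ## Labellings of the bounded roots -/

section Labelling

/-- `ρ` parametrizes the roots of `P + exp w` of norm less than `M`, continuously for `w ∈ W`. -/
structure IsLabelling (P : ℂ[X]) (M : ℝ) (W : Set ℂ) {ι : Type*} (ρ : ι → ℂ → ℂ) : Prop where
  continuousOn : ∀ x, ContinuousOn (ρ x) W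
  eval_eq : ∀ x, ∀ w ∈ W, P.eval (ρ x w) = -Complex.exp w
  norm_lt : ∀ x, ∀ w ∈ W, ‖ρ x w‖ < M
  injective : ∀ w ∈ W, Function.Injective fun x => ρ x w
  exists_eq : ∀ w ∈ W, ∀ u, P.eval u = -Complex.exp w → ‖u‖ < M → ∃ x, ρ x w = u

/-- All roots of `P + exp w` are simple for `w ∈ W`. -/
def RegularOn (P : ℂ[X]) (W : Set ℂ) : Prop :=
  ∀ w ∈ W, ∀ u, P.eval u = -Complex.exp w → P.derivative.eval u ≠ 0

/-- No root of `P + exp w` has norm `M`, for `w ∈ W`. -/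
def NoRootOn (P : ℂ[X]) (M : ℝ) (W : Set ℂ) : Prop :=
  ∀ w ∈ W, ∀ u, P.eval u = -Complex.exp w → ‖u‖ ≠ M

variable {P : ℂ[X]} {M : ℝ} {W : Set ℂ} {ι : Type*} {ρ : ι → ℂ → ℂ}

theorem norm_lt_of_lift {X : Type*} [TopologicalSpace X] {S : Set X} (hS : IsPreconnected S)
    {γ : X → ℂ} {f : X → ℂ} (hf : ContinuousOn f S)
    (hroot : ∀ x ∈ S, P.eval (f x) = -Complex.exp (γ x)) (hγ : ∀ x ∈ S, γ x ∈ W)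
    (hM : NoRootOn P M W) {x₀ : X} (hx₀ : x₀ ∈ S) (h₀ : ‖f x₀‖ < M) : ∀ x ∈ S, ‖f x‖ < M := by
  have := hS.mem_of_notMem_frontier hf (U := Metric.ball 0 M) Metric.isOpen_ball
    (fun x hx hfr => hM (γ x) (hγ x hx) (f x) (hroot x hx)
      (by simpa using Metric.frontier_ball_subset_sphere hfr)) hx₀ (by simpa using h₀)
  simpa using this

/-- The roots over `w₀` are lifted over `W`. No lift crosses the circle of radius `M`, lifts that
meet agree, and every bounded root over another point is found by lifting it back to `w₀`. -/
theorem exists_isLabelling (hWc : IsSimplyConnected W) (hWo : IsOpen W) (hreg : RegularOn P W)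
    (hM : NoRootOn P M W) {w₀ : ℂ} (hw₀ : w₀ ∈ W) (u : ι → ℂ) (hu : Function.Injective u)
    (hur : ∀ x, P.eval (u x) = -Complex.exp w₀) (huM : ∀ x, ‖u x‖ < M)
    (hus : ∀ v, P.eval v = -Complex.exp w₀ → ‖v‖ < M → ∃ x, u x = v) :
    ∃ ρ : ι → ℂ → ℂ, IsLabelling P M W ρ ∧ ∀ x, ρ x w₀ = u x := by
  choose ρ hρc hρ0 hρr using fun x => P.exists_lift_exp hWc hWo hreg hw₀ (hur x)
  have hpre : IsPreconnected W := hWc.isPathConnected.isConnected.isPreconnected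
  refine ⟨ρ, ⟨hρc, hρr, fun x => ?_, fun w hw x y hxy => ?_, fun w hw v hv hvM => ?_⟩, hρ0⟩
  · exact norm_lt_of_lift hpre (hρc x) (γ := id) (hρr x) (fun w hw => hw) hM hw₀
      (by rw [hρ0]; exact huM x)
  · have := P.eqOn_of_eval_eq hpre (hρc x) (hρc y)
      (fun w hw => (hρr x w hw).trans (hρr y w hw).symm)
      (fun w hw => hreg w hw _ (hρr y w hw)) hw hxy hw₀
    rw [hρ0, hρ0] at this
    exact hu this
  · obtain ⟨f, hfc, hf0, hfr⟩ := P.exists_lift_exp hWc hWo hreg hw hv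
    obtain ⟨x, hx⟩ := hus (f w₀) (hfr w₀ hw₀)
      (norm_lt_of_lift hpre hfc (γ := id) hfr (fun w hw => hw) hM hw (by rw [hf0]; exact hvM) w₀ hw₀)
    refine ⟨x, ?_⟩
    have := P.eqOn_of_eval_eq hpre (hρc x) hfc
      (fun w hw => (hρr x w hw).trans (hfr w hw).symm)
      (fun w hw => hreg w hw _ (hfr w hw)) hw₀ (by rw [hρ0, hx]) hw
    rw [this, hf0]

theorem IsLabelling.eqOn_lift (h : IsLabelling P M W ρ) (hreg : RegularOn P W)
    {X : Type*} [TopologicalSpace X] {S : Set X} (hS : IsPreconnected S)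
    {γ : X → ℂ} (hγc : ContinuousOn γ S) (hγ : ∀ x ∈ S, γ x ∈ W) {f : X → ℂ}
    (hf : ContinuousOn f S) (hroot : ∀ x ∈ S, P.eval (f x) = -Complex.exp (γ x)) {x : ι} {s₀ : X}
    (hs₀ : s₀ ∈ S) (h₀ : f s₀ = ρ x (γ s₀)) : ∀ s ∈ S, f s = ρ x (γ s) :=
  P.eqOn_of_eval_eq hS hf ((h.continuousOn x).comp hγc hγ)
    (fun s hs => (hroot s hs).trans (h.eval_eq x _ (hγ s hs)).symm)
    (fun s hs => hreg _ (hγ s hs) _ (h.eval_eq x _ (hγ s hs))) hs₀ h₀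

/-- The monodromy permutation of the translation `w ↦ w + 2πi`. -/
theorem IsLabelling.exists_perm [Finite ι] (h : IsLabelling P M W ρ) (hreg : RegularOn P W)
    {V : Set ℂ} (hV : IsConnected V) (hVW : V ⊆ W)
    (hVt : ∀ w ∈ V, w + 2 * Real.pi * Complex.I ∈ V) :
    ∃ π : Equiv.Perm ι, ∀ x, ∀ w ∈ V, ρ x (w + 2 * Real.pi * Complex.I) = ρ (π x) w := by
  obtain ⟨w₀, hw₀⟩ := hV.nonempty
  have hex : ∀ x, ∃ y, ∀ w ∈ V, ρ x (w + 2 * Real.pi * Complex.I) = ρ y w := by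
    intro x
    have hw₁ := hVW (hVt w₀ hw₀)
    obtain ⟨y, hy⟩ := h.exists_eq w₀ (hVW hw₀) (ρ x (w₀ + 2 * Real.pi * Complex.I))
      (by rw [h.eval_eq x _ hw₁, Complex.exp_periodic]) (h.norm_lt x _ hw₁)
    refine ⟨y, h.eqOn_lift hreg hV.isPreconnected (γ := id) continuousOn_id (fun w hw => hVW hw)
      (f := fun w => ρ x (w + 2 * Real.pi * Complex.I)) ?_ ?_ hw₀ hy.symm⟩
    · exact (h.continuousOn x).comp (by fun_prop) fun w hw => hVW (hVt w hw)
    · intro w hw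
      simp only [id]
      rw [h.eval_eq x _ (hVW (hVt w hw)), Complex.exp_periodic]
  choose π hπ using hex
  have hinj : Function.Injective π := by
    intro x y hxy
    have h1 := hπ x w₀ hw₀
    rw [hxy, ← hπ y w₀ hw₀] at h1
    exact h.injective _ (hVW (hVt w₀ hw₀)) h1
  exact ⟨Equiv.ofBijective π (Finite.injective_iff_bijective.1 hinj), hπ⟩

theorem NoRootOn.mono (h : NoRootOn P M W) {W' : Set ℂ} (hW : W' ⊆ W) : NoRootOn P M W' :=
  fun w hw => h w (hW hw)

end Labelling

/-! ## Crossing a critical value -/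

section Crossing

theorem Set.Finite.exists_pos_forall_le_dist {X : Type*} [MetricSpace X] {S : Set X}
    (hS : S.Finite) : ∃ ε > 0, ∀ s ∈ S, ∀ s' ∈ S, s ≠ s' → ε ≤ dist s s' := by
  by_cases h : S.Nontrivial
  · exact ⟨S.infsep, hS.infsep_pos_iff_nontrivial.2 h,
      fun s hs s' hs' hne => Set.infsep_le_dist_of_mem hs hs' hne⟩
  · exact ⟨1, one_pos, fun s hs s' hs' hne =>
      absurd (Set.not_nontrivial_iff.1 h hs hs') hne⟩

theorem Polynomial.finite_setOf_eval_eq (P : ℂ[X]) (hP : 0 < P.natDegree) (t : ℂ) :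
    {u | P.eval u = t}.Finite := by
  have hne : P - C t ≠ 0 := by
    intro h
    rw [sub_eq_zero.1 h, natDegree_C] at hP
    exact lt_irrefl _ hP
  refine (P - C t).roots.toFinset.finite_toSet.subset fun u hu => ?_
  have hu' : P.eval u = t := hu
  simp [hne, hu', IsRoot]

/-- On the compact ball without the small discs around the roots over `c`, the function `P + exp c`
has no zero, and this persists for nearby `w`. -/
theorem Polynomial.eventually_root_near (P : ℂ[X]) (M : ℝ) (c : ℂ) {ε : ℝ} (hε : 0 < ε) :
    ∀ᶠ w in 𝓝 c, ∀ u, ‖u‖ ≤ M → P.eval u = -Complex.exp w →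
      ∃ s, P.eval s = -Complex.exp c ∧ dist u s < ε := by
  set K : Set ℂ := Metric.closedBall 0 M \ ⋃ s ∈ {s | P.eval s = -Complex.exp c}, Metric.ball s ε
  have hK : IsCompact K := (isCompact_closedBall 0 M).diff
    (isOpen_biUnion fun s _ => Metric.isOpen_ball)
  have h := hK.eventually_forall_of_forall_eventually (x₀ := c)
    (P := fun w u => P.eval u ≠ -Complex.exp w) (fun u hu => by
      have hne : P.eval u ≠ -Complex.exp c := by
        intro h
        exact hu.2 (Set.mem_biUnion (x := u) h (Metric.mem_ball_self hε))
      have h1 : Tendsto (fun z : ℂ × ℂ => P.eval z.2 + Complex.exp z.1) (𝓝 (c, u))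
          (𝓝 (P.eval u + Complex.exp c)) :=
        (Continuous.tendsto (by fun_prop) (c, u) : _)
      have h2 := h1.eventually_ne (b₂ := 0) (fun h => hne (eq_neg_of_add_eq_zero_left h))
      filter_upwards [h2] with z hz h
      exact hz (by rw [h]; ring))
  filter_upwards [h] with w hw u huM hu
  by_contra hcon
  push Not at hcon
  refine hw u ⟨by simpa using huM, ?_⟩ hu
  simp only [Set.mem_iUnion, not_exists]
  intro s hs hus
  exact absurd hus (not_lt.2 (hcon s hs))

/-- A continuous family of roots of `P + exp w`, defined for `w` near `c` in a locally connected set,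
converges as `w → c`. -/
theorem Polynomial.exists_tendsto_root (P : ℂ[X]) (hP : 0 < P.natDegree) {T : Set ℂ} {c : ℂ}
    {δ₀ : ℝ} (hδ₀ : 0 < δ₀)
    (hT : ∀ δ, 0 < δ → δ ≤ δ₀ → IsConnected (T ∩ Metric.ball c δ)) {f : ℂ → ℂ} {M : ℝ}
    (hf : ContinuousOn f (T ∩ Metric.ball c δ₀))
    (hroot : ∀ w ∈ T ∩ Metric.ball c δ₀, P.eval (f w) = -Complex.exp w)
    (hM : ∀ w ∈ T ∩ Metric.ball c δ₀, ‖f w‖ ≤ M) :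
    ∃ s, P.eval s = -Complex.exp c ∧ Tendsto f (𝓝[T] c) (𝓝 s) := by
  obtain ⟨ε₀, hε₀, hsep⟩ := (P.finite_setOf_eval_eq hP (-Complex.exp c)).exists_pos_forall_le_dist
  have hsmall : ∀ ε > 0, ∃ δ, 0 < δ ∧ δ ≤ δ₀ ∧ ∀ w ∈ T ∩ Metric.ball c δ,
      ∃ s, P.eval s = -Complex.exp c ∧ dist (f w) s < ε := by
    intro ε hε
    obtain ⟨δ, hδ, h⟩ := Metric.eventually_nhds_iff_ball.1 (P.eventually_root_near M c hε)
    refine ⟨min δ δ₀, lt_min hδ hδ₀, min_le_right _ _, fun w hw => ?_⟩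
    have hw' : w ∈ T ∩ Metric.ball c δ₀ :=
      ⟨hw.1, Metric.ball_subset_ball (min_le_right _ _) hw.2⟩
    exact h w (Metric.ball_subset_ball (min_le_left _ _) hw.2) _ (hM w hw') (hroot w hw')
  obtain ⟨δ₁, hδ₁, hδ₁', h₁⟩ := hsmall (ε₀ / 4) (by positivity)
  obtain ⟨w₁, hw₁⟩ := (hT δ₁ hδ₁ hδ₁').nonempty
  obtain ⟨s, hs, hs₁⟩ := h₁ w₁ hw₁
  -- Distinct roots over `c` are at least `ε₀` apart and `f w` is always within `ε₀ / 4` of one of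
  -- them, so it cannot cross the circle of radius `ε₀ / 2` around `s`: the nearest root remains the
  -- same.
  have hstay := (hT δ₁ hδ₁ hδ₁').isPreconnected.mem_of_notMem_frontier
    (hf.mono (Set.inter_subset_inter_right _ (Metric.ball_subset_ball hδ₁')))
    (U := Metric.ball s (ε₀ / 2)) Metric.isOpen_ball (by
      intro w hw hfr
      have h2 : dist (f w) s = ε₀ / 2 := Metric.frontier_ball_subset_sphere hfr
      obtain ⟨s', hs', hs''⟩ := h₁ w hw
      have hne : s ≠ s' := by
        rintro rfl
        linarith
      have := hsep s hs s' hs' hne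
      have := dist_triangle_left s s' (f w)
      linarith) hw₁ (Metric.mem_ball.2 (by linarith))
  refine ⟨s, hs, Metric.tendsto_nhds.2 fun ε hε => ?_⟩
  obtain ⟨δ₂, hδ₂, hδ₂', h₂⟩ := hsmall (min ε (ε₀ / 4)) (by positivity)
  rw [eventually_nhdsWithin_iff]
  filter_upwards [Metric.ball_mem_nhds c (lt_min hδ₁ hδ₂)] with w hw hwT
  obtain ⟨s', hs', hs''⟩ := h₂ w ⟨hwT, Metric.ball_subset_ball (min_le_right _ _) hw⟩
  have h3 := hstay w ⟨hwT, Metric.ball_subset_ball (min_le_left _ _) hw⟩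
  rw [Metric.mem_ball] at h3
  have h4 := lt_min_iff.1 hs''
  have : s = s' := by
    by_contra hne
    have := hsep s hs s' hs' hne
    have := dist_triangle_left s s' (f w)
    linarith
  rw [this]
  exact h4.1

/-- The complement of the vertical half-line that goes up from `c`. -/
def slitUp (c : ℂ) : Set ℂ := {w | w.re = c.re → w.im < c.im}

/-- The complement of the vertical half-line that goes down from `c`. -/
def slitDown (c : ℂ) : Set ℂ := {w | w.re = c.re → c.im < w.im}

theorem isConnected_slitUp_inter_ball (c : ℂ) {δ : ℝ} (hδ : 0 < δ) :
    IsConnected (slitUp c ∩ Metric.ball c δ) := by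
  -- The slit disc is star-shaped with respect to a point right below its centre.
  set p : ℂ := c - (δ / 2 : ℝ) * Complex.I with hp
  have hpb : p ∈ Metric.ball c δ := by
    rw [Metric.mem_ball, Complex.dist_eq, hp, sub_sub_cancel_left, norm_neg, norm_mul,
      Complex.norm_I, mul_one, Complex.norm_real, Real.norm_of_nonneg (by positivity)]
    linarith
  have hps : p ∈ slitUp c := by
    intro _
    simp [hp, hδ]
  have hstar : StarConvex ℝ p (slitUp c ∩ Metric.ball c δ) := by
    intro w hw α β hα hβ hαβ
    refine ⟨?_, convex_ball c δ hpb hw.2 hα hβ hαβ⟩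
    intro hre
    have hα' : α = 1 - β := by linarith
    have hre' : α * c.re + β * w.re = c.re := by simpa [hp] using hre
    have him : (α • p + β • w).im = α * (c.im - δ / 2) + β * w.im := by simp [hp]
    rw [him]
    rcases hβ.eq_or_lt with rfl | hβ
    · have : α = 1 := by linarith
      subst this
      linarith
    · have h1 : w.re = c.re := by
        rw [hα'] at hre'
        have : β * (w.re - c.re) = 0 := by linarith
        rcases mul_eq_zero.1 this with h | h <;> linarith
      have h2 := hw.1 h1
      rw [hα'] at hα ⊢
      nlinarith [mul_nonneg hα hδ.le, mul_pos hβ (sub_pos.2 h2)]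
  exact (hstar.isPathConnected ⟨hps, hpb⟩).isConnected

theorem isConnected_slitDown_inter_ball (c : ℂ) {δ : ℝ} (hδ : 0 < δ) :
    IsConnected (slitDown c ∩ Metric.ball c δ) := by
  have h := (isConnected_slitUp_inter_ball (-c) hδ).image (fun w => -w) (by fun_prop)
  convert h using 1
  ext w
  constructor
  · rintro ⟨h1, h2⟩
    refine ⟨-w, ⟨fun h => ?_, ?_⟩, by simp⟩
    · have := h1 (by simpa using h)
      simpa using this
    · simpa [dist_neg_neg] using h2
  · rintro ⟨v, ⟨h1, h2⟩, rfl⟩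
    refine ⟨fun h => ?_, ?_⟩
    · have := h1 (by simp at h; simp; linarith)
      simp at this ⊢
      linarith
    · simpa [dist_neg_neg, ← dist_neg_neg v] using h2

theorem Polynomial.exists_eval_sub_eq_sq_mul (P : ℂ[X]) {u : ℂ} (h1 : P.derivative.eval u = 0) :
    ∃ H : ℂ[X], (∀ v, P.eval v - P.eval u = (v - u) ^ 2 * H.eval v) ∧
      2 * H.eval u = P.derivative.derivative.eval u := by
  obtain ⟨Q, hQ⟩ := (dvd_iff_isRoot (p := P - C (P.eval u)) (a := u)).2 (by simp [IsRoot])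
  have hQ1 : Q.eval u = 0 := by
    have := congrArg (fun R => R.derivative.eval u) hQ
    simpa [h1] using this.symm
  obtain ⟨H, rfl⟩ := (dvd_iff_isRoot (p := Q) (a := u)).2 hQ1
  refine ⟨H, fun v => ?_, ?_⟩
  · have := congrArg (eval v) hQ
    simp only [eval_sub, eval_C, eval_mul, eval_X] at this
    rw [this]
    ring
  · have := congrArg (fun R => R.derivative.derivative.eval u) hQ
    simp at this
    rw [this]
    ring

/-- Near a nondegenerate critical point two points of a fibre have opposite displacements to first
order. This excludes triple collisions, and later places colliding roots on different sides of a
circle. -/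
theorem Polynomial.exists_norm_add_le_of_double_root (P : ℂ[X]) {u : ℂ}
    (h1 : P.derivative.eval u = 0) (h2 : P.derivative.derivative.eval u ≠ 0) {κ : ℝ}
    (hκ : 0 < κ) :
    ∃ ε > 0, ∀ u₁ u₂, dist u₁ u < ε → dist u₂ u < ε → u₁ ≠ u₂ → P.eval u₁ = P.eval u₂ →
      ‖(u₁ - u) + (u₂ - u)‖ ≤ κ * ‖u₂ - u‖ := by
  obtain ⟨H, hH, hH2⟩ := P.exists_eval_sub_eq_sq_mul h1
  have hHu : H.eval u ≠ 0 := fun h => h2 (by rw [← hH2, h, mul_zero])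
  obtain ⟨K, V, hV, hK⟩ := (H.hasStrictDerivAt u).hasStrictFDerivAt.exists_lipschitzOnWith
  have hm : 0 < ‖H.eval u‖ / 2 := by positivity
  have hev : ∀ᶠ v in 𝓝 u, ‖H.eval u‖ / 2 < ‖H.eval v‖ :=
    (H.continuous.norm.tendsto u).eventually (lt_mem_nhds (half_lt_self (norm_pos_iff.2 hHu)))
  obtain ⟨ε, hε, hball⟩ := Metric.eventually_nhds_iff_ball.1 ((eventually_mem_set.2 hV).and hev)
  -- With `P v - P u = (v - u)² H v`, division of `P u₁ = P u₂` by `u₁ - u₂` bounds the sum of the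
  -- displacements by `K ‖u₂ - u‖² / ‖H u₁‖`, where `K` is a Lipschitz constant of `H` and `‖H u₁‖ >
  -- ‖H u‖ / 2`. The `+ 1` guards against `K = 0`.
  refine ⟨min ε (κ * (‖H.eval u‖ / 2) / (K + 1)), by positivity, ?_⟩
  intro u₁ u₂ hu₁ hu₂ hne heq
  obtain ⟨hV1, hm1⟩ := hball u₁ (lt_of_lt_of_le hu₁ (min_le_left _ _))
  obtain ⟨hV2, hm2⟩ := hball u₂ (lt_of_lt_of_le hu₂ (min_le_left _ _))
  have hkey : (u₁ - u₂) * (((u₁ - u) + (u₂ - u)) * H.eval u₁) =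
      (u₂ - u) ^ 2 * (H.eval u₂ - H.eval u₁) := by
    have e1 := hH u₁
    have e2 := hH u₂
    rw [heq] at e1
    linear_combination e2 - e1
  have hlip : ‖H.eval u₂ - H.eval u₁‖ ≤ K * ‖u₁ - u₂‖ := by
    have := hK.dist_le_mul _ hV1 _ hV2
    rwa [dist_comm, dist_eq_norm, dist_eq_norm] at this
  have hd2 : ‖u₂ - u‖ < κ * (‖H.eval u‖ / 2) / (K + 1) := by
    rw [← dist_eq_norm]
    exact lt_of_lt_of_le hu₂ (min_le_right _ _)
  have hpos : 0 < ‖u₁ - u₂‖ := norm_pos_iff.2 (sub_ne_zero.2 hne)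
  have hn := congrArg norm hkey
  rw [norm_mul, norm_mul, norm_mul, norm_pow] at hn
  have h3 : ‖u₁ - u₂‖ * (‖u₁ - u + (u₂ - u)‖ * ‖H.eval u₁‖) ≤
      ‖u₁ - u₂‖ * (‖u₂ - u‖ ^ 2 * K) := by
    rw [hn]
    nlinarith [sq_nonneg ‖u₂ - u‖]
  have h4 := le_of_mul_le_mul_left h3 hpos
  have h5 : ‖u₂ - u‖ * K ≤ κ * (‖H.eval u‖ / 2) := by
    rw [lt_div_iff₀ (by positivity)] at hd2
    nlinarith [norm_nonneg (u₂ - u)]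
  have h6 : ‖u₁ - u + (u₂ - u)‖ * (‖H.eval u‖ / 2) ≤ (κ * ‖u₂ - u‖) * (‖H.eval u‖ / 2) := by
    calc _ ≤ ‖u₁ - u + (u₂ - u)‖ * ‖H.eval u₁‖ := by gcongr
      _ ≤ ‖u₂ - u‖ * (‖u₂ - u‖ * K) := by linarith [h4]
      _ ≤ ‖u₂ - u‖ * (κ * (‖H.eval u‖ / 2)) := by gcongr
      _ = _ := by ring
  exact le_of_mul_le_mul_right h6 hm

theorem Polynomial.exists_branch (P : ℂ[X]) {c s : ℂ} (hs : P.eval s = -Complex.exp c)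
    (hs' : P.derivative.eval s ≠ 0) :
    ∃ f : ℂ → ℂ, f c = s ∧ DifferentiableAt ℂ f c ∧ ∃ δ > 0, ContinuousOn f (Metric.ball c δ) ∧
      ∀ w ∈ Metric.ball c δ, P.eval (f w) = -Complex.exp w ∧ P.derivative.eval (f w) ≠ 0 := by
  have h := (P.hasStrictDerivAt s).hasStrictFDerivAt_equiv hs'
  set e := h.toOpenPartialHomeomorph _ with he
  have hee : (e : ℂ → ℂ) = P.eval := rfl
  have hse : s ∈ e.source := h.mem_toOpenPartialHomeomorph_source
  have htgt : -Complex.exp c ∈ e.target := by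
    rw [← hs]
    exact e.map_source hse
  have hsymm : e.symm (-Complex.exp c) = s := by
    rw [← hs]
    exact e.left_inv hse
  have hexp : ContinuousAt (fun w => -Complex.exp w) c := by fun_prop
  have hcont : ContinuousAt (fun w => e.symm (-Complex.exp w)) c :=
    (e.continuousAt_symm htgt).comp (f := fun w => -Complex.exp w) hexp
  have ev1 : ∀ᶠ w in 𝓝 c, -Complex.exp w ∈ e.target :=
    hexp.eventually (e.open_target.mem_nhds htgt)
  have ev2 : ∀ᶠ w in 𝓝 c, P.derivative.eval (e.symm (-Complex.exp w)) ≠ 0 := by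
    refine Tendsto.eventually_ne (b₁ := P.derivative.eval s) ?_ hs'
    have : Tendsto (fun w => e.symm (-Complex.exp w)) (𝓝 c) (𝓝 s) := by
      simpa [ContinuousAt, hsymm] using hcont
    exact (P.derivative.continuous.tendsto s).comp this
  obtain ⟨δ, hδ, hball⟩ := Metric.eventually_nhds_iff_ball.1 (ev1.and ev2)
  refine ⟨fun w => e.symm (-Complex.exp w), hsymm, ?_, δ, hδ, ?_, fun w hw => ⟨?_, (hball w hw).2⟩⟩
  · have hd : HasDerivAt e (P.derivative.eval s) (e.symm (-Complex.exp c)) := by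
      rw [hsymm]
      exact P.hasDerivAt s
    exact (e.hasDerivAt_symm htgt hs' hd).differentiableAt.comp c (by fun_prop)
  · exact e.continuousOn_symm.comp (by fun_prop) fun w hw => (hball w hw).1
  · exact e.right_inv (hball w hw).1

theorem Polynomial.differentiableAt_root (P : ℂ[X]) {f : ℂ → ℂ} {c : ℂ} (hf : ContinuousAt f c)
    (hroot : ∀ᶠ w in 𝓝 c, P.eval (f w) = -Complex.exp w) (hs : P.derivative.eval (f c) ≠ 0) :
    DifferentiableAt ℂ f c := by
  obtain ⟨g, hgc, hgd, δ, hδ, hgcont, hg⟩ := P.exists_branch hroot.self_of_nhds hs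
  obtain ⟨V, hV, hinj⟩ := P.exists_nhds_injOn_eval hs
  refine hgd.congr_of_eventuallyEq ?_
  have h2 : ContinuousAt g c := hgcont.continuousAt (Metric.ball_mem_nhds c hδ)
  filter_upwards [hroot, hf.eventually (eventually_mem_set.2 hV),
    h2.eventually (eventually_mem_set.2 (by rwa [hgc])),
    Metric.ball_mem_nhds c hδ] with w h3 h4 h5 h6
  exact hinj h4 h5 (h3.trans (hg w h6).1.symm)

theorem isOpen_slitUp (c : ℂ) : IsOpen (slitUp c) := by
  have : slitUp c = {w : ℂ | w.re ≠ c.re} ∪ {w : ℂ | w.im < c.im} := by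
    ext w
    simp [slitUp, imp_iff_not_or]
  rw [this]
  exact (isOpen_ne_fun Complex.continuous_re continuous_const).union
    (isOpen_lt Complex.continuous_im continuous_const)

theorem isOpen_slitDown (c : ℂ) : IsOpen (slitDown c) := by
  have : slitDown c = {w : ℂ | w.re ≠ c.re} ∪ {w : ℂ | c.im < w.im} := by
    ext w
    simp [slitDown, imp_iff_not_or]
  rw [this]
  exact (isOpen_ne_fun Complex.continuous_re continuous_const).union
    (isOpen_lt continuous_const Complex.continuous_im)

theorem nhdsNE_le_slitUp_sup_slitDown (c : ℂ) : 𝓝[≠] c ≤ 𝓝[slitUp c] c ⊔ 𝓝[slitDown c] c := by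
  rw [← nhdsWithin_union]
  refine nhdsWithin_mono c fun w hw => ?_
  by_cases h : w.re = c.re
  · rcases lt_trichotomy w.im c.im with h' | h' | h'
    · exact Or.inl fun _ => h'
    · exact absurd (Complex.ext h h') hw
    · exact Or.inr fun _ => h'
  · exact Or.inl fun h' => absurd h' h

theorem tendsto_add_ofReal_nhdsGT (c : ℂ) {T : Set ℂ} (hT : ∀ w : ℂ, w.re ≠ c.re → w ∈ T) :
    Tendsto (fun η : ℝ => c + η) (𝓝[>] 0) (𝓝[T] c) := by
  refine tendsto_nhdsWithin_iff.2 ⟨?_, ?_⟩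
  · have : Tendsto (fun η : ℝ => c + (η : ℂ)) (𝓝 0) (𝓝 (c + ((0 : ℝ) : ℂ))) :=
      (show Continuous fun η : ℝ => c + (η : ℂ) by fun_prop).tendsto 0
    simpa using this.mono_left nhdsWithin_le_nhds
  · filter_upwards [self_mem_nhdsWithin] with η hη
    exact hT _ (by simpa using (show (0 : ℝ) < η from hη).ne')

theorem tendsto_sub_ofReal_nhdsGT (c : ℂ) {T : Set ℂ} (hT : ∀ w : ℂ, w.re ≠ c.re → w ∈ T) :
    Tendsto (fun η : ℝ => c - η) (𝓝[>] 0) (𝓝[T] c) := by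
  refine tendsto_nhdsWithin_iff.2 ⟨?_, ?_⟩
  · have : Tendsto (fun η : ℝ => c - (η : ℂ)) (𝓝 0) (𝓝 (c - ((0 : ℝ) : ℂ))) :=
      (show Continuous fun η : ℝ => c - (η : ℂ) by fun_prop).tendsto 0
    simpa using this.mono_left nhdsWithin_le_nhds
  · filter_upwards [self_mem_nhdsWithin] with η hη
    exact hT _ (by simpa using (show (0 : ℝ) < η from hη).ne')

theorem mem_slitUp_of_ne {c w : ℂ} (h : w.re ≠ c.re) : w ∈ slitUp c := fun h' => absurd h' h

theorem mem_slitDown_of_ne {c w : ℂ} (h : w.re ≠ c.re) : w ∈ slitDown c := fun h' => absurd h' h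

instance slitUp_neBot (c : ℂ) : (𝓝[slitUp c] c).NeBot :=
  (tendsto_add_ofReal_nhdsGT c fun _ => mem_slitUp_of_ne).neBot

/-- A labelling on a set that contains the strip `α < Re w < β` without the vertical line through
`c`, except for the gap of length `2π` below `c`; `πm` and `πp` are the monodromy permutations
to the left and to the right of this line. -/
structure CrossingData (P : ℂ[X]) (M : ℝ) (W : Set ℂ) {ι : Type*} (ρ : ι → ℂ → ℂ) (c : ℂ)
    (α β : ℝ) (πm πp : Equiv.Perm ι) : Prop where
  labelling : IsLabelling P M W ρ
  regular : RegularOn P W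
  left : α < c.re
  right : c.re < β
  isOpen : IsOpen W
  mem : ∀ w : ℂ, α < w.re → w.re < β →
    (w.re = c.re → c.im - 2 * Real.pi < w.im ∧ w.im < c.im) → w ∈ W
  left_perm : ∀ x, ∀ w : ℂ, α < w.re → w.re < c.re →
    ρ x (w + 2 * Real.pi * Complex.I) = ρ (πm x) w
  right_perm : ∀ x, ∀ w : ℂ, c.re < w.re → w.re < β →
    ρ x (w + 2 * Real.pi * Complex.I) = ρ (πp x) w

namespace CrossingData

variable {P : ℂ[X]} {M : ℝ} {W : Set ℂ} {ι : Type*} {ρ : ι → ℂ → ℂ} {c : ℂ} {α β : ℝ}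
  {πm πp : Equiv.Perm ι} (h : CrossingData P M W ρ c α β πm πp)

include h

/-- A disc around `c` is covered by two slit discs and the point `c`. The one below lies in `W`; the
one above does so after a translation by `-2πi`, which moves the half-line above `c` into the gap.
-/
theorem exists_radius : ∃ δ > 0, ∀ w ∈ Metric.ball c δ, α < w.re ∧ w.re < β ∧
    (w ∈ slitUp c → w ∈ W) ∧ (w ∈ slitDown c → w - 2 * Real.pi * Complex.I ∈ W) := by
  have hl := h.left
  have hr := h.right
  have hpi := Real.pi_pos
  refine ⟨min (min (c.re - α) (β - c.re)) (2 * Real.pi),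
    lt_min (lt_min (by linarith) (by linarith)) (by linarith), fun w hw => ?_⟩
  rw [Metric.mem_ball, Complex.dist_eq, lt_min_iff, lt_min_iff] at hw
  have h1 := abs_le.1 ((Complex.abs_re_le_norm (w - c)).trans hw.1.1.le)
  have h1' := abs_lt.1 ((Complex.abs_re_le_norm (w - c)).trans_lt hw.1.1)
  have h2' := abs_lt.1 ((Complex.abs_re_le_norm (w - c)).trans_lt hw.1.2)
  have h3' := abs_lt.1 ((Complex.abs_im_le_norm (w - c)).trans_lt hw.2)
  simp only [Complex.sub_re, Complex.sub_im] at h1' h2' h3'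
  refine ⟨by linarith, by linarith, fun hw' => h.mem w (by linarith) (by linarith)
    fun hre => ⟨by linarith, hw' hre⟩, fun hw' => h.mem _ ?_ ?_ fun hre => ?_⟩
  · simp; linarith
  · simp; linarith
  · have hre' : w.re = c.re := by simpa using hre
    have := hw' hre'
    simp
    constructor <;> linarith

theorem eventually_mem : ∀ᶠ w in 𝓝[slitUp c] c, w ∈ W := by
  obtain ⟨δ, hδ, hball⟩ := h.exists_radius
  rw [eventually_nhdsWithin_iff]
  filter_upwards [Metric.ball_mem_nhds c hδ] with w hw hw'
  exact (hball w hw).2.2.1 hw'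

theorem exists_limit (hP : 0 < P.natDegree) (z : ι) :
    ∃ s, P.eval s = -Complex.exp c ∧ Tendsto (ρ z) (𝓝[slitUp c] c) (𝓝 s) := by
  obtain ⟨δ, hδ, hball⟩ := h.exists_radius
  have hsub : slitUp c ∩ Metric.ball c δ ⊆ W := fun w hw => (hball w hw.2).2.2.1 hw.1
  exact P.exists_tendsto_root hP hδ (fun δ' hδ' _ => isConnected_slitUp_inter_ball c hδ')
    ((h.labelling.continuousOn z).mono hsub)
    (fun w hw => h.labelling.eval_eq z w (hsub hw))
    (M := M) (fun w hw => (h.labelling.norm_lt z w (hsub hw)).le)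

theorem left_perm' (x : ι) {w : ℂ} (h1 : α < w.re) (h2 : w.re < c.re) :
    ρ (πm x) (w - 2 * Real.pi * Complex.I) = ρ x w := by
  have := h.left_perm x (w - 2 * Real.pi * Complex.I) (by simpa using h1) (by simpa using h2)
  rw [← this, sub_add_cancel]

theorem right_perm' (x : ι) {w : ℂ} (h1 : c.re < w.re) (h2 : w.re < β) :
    ρ (πp x) (w - 2 * Real.pi * Complex.I) = ρ x w := by
  have := h.right_perm x (w - 2 * Real.pi * Complex.I) (by simpa using h1) (by simpa using h2)
  rw [← this, sub_add_cancel]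

/-- At a simple root a single branch through `s` describes the label `z` on both sides of `c`.
Followed above `c`, it is the translate of the label `πm z`, by comparison on the left, and of `πp
z`, by comparison on the right. -/
theorem perm_eq_of_regular {z : ι} {s : ℂ} (hz : Tendsto (ρ z) (𝓝[slitUp c] c) (𝓝 s))
    (hs : P.eval s = -Complex.exp c) (hs' : P.derivative.eval s ≠ 0) : πm z = πp z := by
  obtain ⟨δ, hδ, hball⟩ := h.exists_radius
  obtain ⟨f, hfc, -, δ', hδ', hfcont, hf⟩ := P.exists_branch hs hs'
  obtain ⟨V, hV, hinj⟩ := P.exists_nhds_injOn_eval hs'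
  have hfc' : Tendsto f (𝓝[slitUp c] c) (𝓝 s) := by
    have := (hfcont.continuousAt (Metric.ball_mem_nhds c hδ')).tendsto
    rw [hfc] at this
    exact this.mono_left nhdsWithin_le_nhds
  have hev : ∀ᶠ w in 𝓝[slitUp c] c, ρ z w = f w ∧ w ∈ Metric.ball c (min δ δ') := by
    filter_upwards [hz.eventually (eventually_mem_set.2 hV),
      hfc'.eventually (eventually_mem_set.2 hV), h.eventually_mem,
      nhdsWithin_le_nhds (Metric.ball_mem_nhds c (lt_min hδ hδ'))] with w h1 h2 h3 h4
    exact ⟨hinj h1 h2 ((h.labelling.eval_eq z w h3).trans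
      (hf w (Metric.ball_subset_ball (min_le_right _ _) h4)).1.symm), h4⟩
  obtain ⟨η₁, ⟨h11, h12⟩, hη₁⟩ := (((tendsto_sub_ofReal_nhdsGT c fun _ =>
    mem_slitUp_of_ne).eventually hev).and self_mem_nhdsWithin).exists
  obtain ⟨η₂, ⟨h21, h22⟩, hη₂⟩ := (((tendsto_add_ofReal_nhdsGT c fun _ =>
    mem_slitUp_of_ne).eventually hev).and self_mem_nhdsWithin).exists
  have hη₁' : 0 < η₁ := hη₁
  have hη₂' : 0 < η₂ := hη₂
  have b1 := hball _ (Metric.ball_subset_ball (min_le_left _ _) h12)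
  have b2 := hball _ (Metric.ball_subset_ball (min_le_left _ _) h22)
  have hsub : ∀ w ∈ slitDown c ∩ Metric.ball c (min δ δ'), w - 2 * Real.pi * Complex.I ∈ W :=
    fun w hw => (hball w (Metric.ball_subset_ball (min_le_left _ _) hw.2)).2.2.2 hw.1
  have heq := P.eqOn_of_eval_eq
    (isConnected_slitDown_inter_ball c (lt_min hδ hδ')).isPreconnected
    (f := fun w => ρ (πm z) (w - 2 * Real.pi * Complex.I)) (g := f)
    ((h.labelling.continuousOn _).comp (by fun_prop) hsub)
    (hfcont.mono (Set.inter_subset_right.trans (Metric.ball_subset_ball (min_le_right _ _))))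
    (fun w hw => by
      rw [h.labelling.eval_eq _ _ (hsub w hw), Complex.exp_periodic.sub_eq,
        (hf w (Metric.ball_subset_ball (min_le_right _ _) hw.2)).1])
    (fun w hw => (hf w (Metric.ball_subset_ball (min_le_right _ _) hw.2)).2)
    (x₀ := c - η₁) ⟨mem_slitDown_of_ne (by simpa using hη₁'.ne'), h12⟩
    (by rw [← h11]; exact h.left_perm' z b1.1 (by simpa using hη₁'))
  have h3 := heq (x := c + η₂) ⟨mem_slitDown_of_ne (by simpa using hη₂'.ne'), h22⟩
  simp only at h3
  rw [← h21, ← h.right_perm' z (by simpa using hη₂') b2.2.1] at h3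
  exact h.labelling.injective _
    (hsub _ ⟨mem_slitDown_of_ne (by simpa using hη₂'.ne'), h22⟩) h3

/-- If both permutations agree on `z`, the label continues to a single-valued function `f` around
`c`, continuous at `c` and hence holomorphic there. Differentiating `P (f w) = -exp w` gives `P' (s)
f' (c) = -exp c ≠ 0`. -/
theorem regular_of_perm_eq (hP : 0 < P.natDegree) {z : ι} {s : ℂ}
    (hz : Tendsto (ρ z) (𝓝[slitUp c] c) (𝓝 s)) (hs : P.eval s = -Complex.exp c)
    (hπ : πm z = πp z) : P.derivative.eval s ≠ 0 := by
  classical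
  obtain ⟨δ, hδ, hball⟩ := h.exists_radius
  set g : ℂ → ℂ := fun w => ρ (πm z) (w - 2 * Real.pi * Complex.I) with hg
  have hsub : ∀ w ∈ slitDown c ∩ Metric.ball c δ, w - 2 * Real.pi * Complex.I ∈ W :=
    fun w hw => (hball w hw.2).2.2.2 hw.1
  have hgcont : ContinuousOn g (slitDown c ∩ Metric.ball c δ) :=
    (h.labelling.continuousOn _).comp (by fun_prop) hsub
  have hgroot : ∀ w ∈ slitDown c ∩ Metric.ball c δ, P.eval (g w) = -Complex.exp w := by
    intro w hw
    rw [hg, h.labelling.eval_eq _ _ (hsub w hw), Complex.exp_periodic.sub_eq]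
  have hagree : ∀ w ∈ Metric.ball c δ, w.re ≠ c.re → g w = ρ z w := by
    intro w hw hne
    rcases lt_or_gt_of_ne hne with h1 | h1
    · exact h.left_perm' z (hball w hw).1 h1
    · rw [hg, hπ]
      exact h.right_perm' z h1 (hball w hw).2.1
  have hgs : Tendsto g (𝓝[slitDown c] c) (𝓝 s) := by
    obtain ⟨s', -, hs'⟩ := P.exists_tendsto_root hP hδ
      (fun δ' hδ' _ => isConnected_slitDown_inter_ball c hδ') hgcont hgroot (M := M)
      (fun w hw => (h.labelling.norm_lt _ _ (hsub w hw)).le)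
    have h1 := hs'.comp (tendsto_add_ofReal_nhdsGT c fun _ => mem_slitDown_of_ne)
    have h2 := hz.comp (tendsto_add_ofReal_nhdsGT c fun _ => mem_slitUp_of_ne)
    have h3 : (g ∘ fun η : ℝ => c + (η : ℂ)) =ᶠ[𝓝[>] 0] (ρ z ∘ fun η : ℝ => c + (η : ℂ)) := by
      have := (tendsto_add_ofReal_nhdsGT c (T := Set.univ) fun _ _ => trivial).eventually
        (nhdsWithin_le_nhds (Metric.ball_mem_nhds c hδ))
      filter_upwards [this, self_mem_nhdsWithin] with η h1 h2
      exact hagree _ h1 (by simpa using (show (0 : ℝ) < η from h2).ne')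
    rwa [tendsto_nhds_unique (h1.congr' h3) h2] at hs'
  set f : ℂ → ℂ := fun w => if w = c then s else if w ∈ slitUp c then ρ z w else g w with hfdef
  have hfc : f c = s := by simp [hfdef]
  have hnc : c ∉ slitUp c := fun h => lt_irrefl _ (h rfl)
  have hnc' : c ∉ slitDown c := fun h => lt_irrefl _ (h rfl)
  have hfU : ∀ w ∈ slitUp c, f w = ρ z w := by
    intro w hw
    have : w ≠ c := fun h => hnc (h ▸ hw)
    simp [hfdef, this, hw]
  have hfD : ∀ w ∈ slitDown c, w ∈ Metric.ball c δ → f w = g w := by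
    intro w hw hwb
    have : w ≠ c := fun h => hnc' (h ▸ hw)
    by_cases hU : w ∈ slitUp c
    · rw [hfU w hU, hagree w hwb]
      intro hre
      exact absurd (hU hre) (not_lt.2 (hw hre).le)
    · simp [hfdef, this, hU]
  have hball_nhds : ∀ w ∈ Metric.ball c δ, ∀ᶠ v in 𝓝 w, v ∈ Metric.ball c δ :=
    fun w hw => Metric.isOpen_ball.mem_nhds hw
  have hcases : ∀ w, w ≠ c → w ∈ slitUp c ∨ w ∈ slitDown c := by
    intro w hw
    by_cases hre : w.re = c.re
    · rcases lt_trichotomy w.im c.im with h' | h' | h'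
      · exact Or.inl fun _ => h'
      · exact absurd (Complex.ext hre h') hw
      · exact Or.inr fun _ => h'
    · exact Or.inl fun h' => absurd h' hre
  have hroot : ∀ w ∈ Metric.ball c δ, P.eval (f w) = -Complex.exp w := by
    intro w hw
    by_cases hwc : w = c
    · rw [hwc, hfc, hs]
    · rcases hcases w hwc with hU | hD
      · rw [hfU w hU, h.labelling.eval_eq _ _ ((hball w hw).2.2.1 hU)]
      · rw [hfD w hD hw, hgroot w ⟨hD, hw⟩]
  have hdiff : ∀ᶠ w in 𝓝[≠] c, DifferentiableAt ℂ f w := by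
    filter_upwards [self_mem_nhdsWithin, nhdsWithin_le_nhds (Metric.ball_mem_nhds c hδ)]
      with w hwc hw
    refine P.differentiableAt_root ?_ ((hball_nhds w hw).mono hroot) ?_
    · rcases hcases w hwc with hU | hD
      · have h1 : ContinuousAt (ρ z) w := (h.labelling.continuousOn z).continuousAt
          (h.isOpen.mem_nhds ((hball w hw).2.2.1 hU))
        exact h1.congr ((eventually_mem_set.2 ((isOpen_slitUp c).mem_nhds hU)).mono
          fun v hv => (hfU v hv).symm)
      · have h1 : ContinuousAt g w := hgcont.continuousAt
          (((isOpen_slitDown c).inter Metric.isOpen_ball).mem_nhds ⟨hD, hw⟩)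
        refine h1.congr ?_
        filter_upwards [(isOpen_slitDown c).mem_nhds hD, hball_nhds w hw] with v h1 h2
        exact (hfD v h1 h2).symm
    · rcases hcases w hwc with hU | hD
      · rw [hfU w hU]
        have := (hball w hw).2.2.1 hU
        exact h.regular w this _ (h.labelling.eval_eq z w this)
      · rw [hfD w hD hw]
        have := hsub w ⟨hD, hw⟩
        exact h.regular _ this _ (h.labelling.eval_eq _ _ this)
  have hfcont : ContinuousAt f c := by
    rw [continuousAt_iff_punctured_nhds, hfc]
    refine Tendsto.mono_left (tendsto_sup.2 ⟨?_, ?_⟩) (nhdsNE_le_slitUp_sup_slitDown c)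
    · exact hz.congr' (eventually_nhdsWithin_of_forall fun w hw => (hfU w hw).symm)
    · refine hgs.congr' ?_
      filter_upwards [self_mem_nhdsWithin, nhdsWithin_le_nhds (Metric.ball_mem_nhds c hδ)]
        with w h1 h2
      exact (hfD w h1 h2).symm
  have hfd : DifferentiableAt ℂ f c :=
    (Complex.analyticAt_of_differentiable_on_punctured_nhds_of_continuousAt hdiff
      hfcont).differentiableAt
  have h1 : HasDerivAt (fun w => P.eval (f w)) (P.derivative.eval (f c) * deriv f c) c :=
    (P.hasDerivAt (f c)).comp c hfd.hasDerivAt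
  have h2 : HasDerivAt (fun w => -Complex.exp w) (-Complex.exp c) c :=
    (Complex.hasDerivAt_exp c).neg
  have h3 := h1.unique (h2.congr_of_eventuallyEq
    ((eventually_mem_set.2 (Metric.ball_mem_nhds c hδ)).mono hroot))
  intro h0
  rw [hfc, h0, zero_mul] at h3
  exact Complex.exp_ne_zero c (neg_eq_zero.1 h3.symm)

/-- `P` is an open map, so every root over `c` is approached by roots over nearby points; each of
these carries one of finitely many labels, whose limits are separated. -/
theorem exists_limit_eq [Finite ι] (hP : 0 < P.natDegree) {u : ℂ} (huM : ‖u‖ < M)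
    (hu : P.eval u = -Complex.exp c) : ∃ z, Tendsto (ρ z) (𝓝[slitUp c] c) (𝓝 u) := by
  choose lim hlim hlimt using h.exists_limit hP
  obtain ⟨ε, hε, hsep⟩ := (P.finite_setOf_eval_eq hP (-Complex.exp c)).exists_pos_forall_le_dist
  have hopen : 𝓝 (P.eval u) ≤ map P.eval (𝓝 u) := by
    have han : AnalyticAt ℂ P.eval u := P.differentiable.analyticAt u
    refine han.eventually_constant_or_nhds_le_map_nhds.resolve_left fun hcon => ?_
    have hfin := P.finite_setOf_eval_eq hP (P.eval u)
    have hinf : {v | P.eval v = P.eval u}.Infinite := infinite_of_mem_nhds u hcon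
    exact hinf hfin
  set B := Metric.ball u (ε / 2) ∩ Metric.ball 0 M
  have hB : B ∈ 𝓝 u := inter_mem (Metric.ball_mem_nhds u (by positivity))
    (Metric.isOpen_ball.mem_nhds (by simpa using huM))
  have h1 : P.eval '' B ∈ 𝓝 (-Complex.exp c) := hu ▸ hopen (image_mem_map hB)
  have h2 : ∀ᶠ w in 𝓝[slitUp c] c, -Complex.exp w ∈ P.eval '' B :=
    nhdsWithin_le_nhds ((show Continuous fun w => -Complex.exp w by fun_prop).continuousAt h1)
  have h3 : ∀ᶠ w in 𝓝[slitUp c] c, ∀ z, dist (ρ z w) (lim z) < ε / 2 :=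
    eventually_all.2 fun z => Metric.tendsto_nhds.1 (hlimt z) _ (by positivity)
  obtain ⟨w, ⟨v, ⟨hv1, hv2⟩, hv⟩, hw3, hwW⟩ := (h2.and (h3.and h.eventually_mem)).exists
  obtain ⟨z, rfl⟩ := h.labelling.exists_eq w hwW v hv (by simpa using hv2)
  refine ⟨z, ?_⟩
  have : lim z = u := by
    by_contra hne
    have h4 := hsep _ (hlim z) u hu hne
    have h5 := dist_triangle_left (lim z) u (ρ z w)
    have h6 := hw3 z
    rw [Metric.mem_ball] at hv1
    linarith
  exact this ▸ hlimt z

/-- Exactly two labels come together at a nondegenerate critical point, and the monodromy changes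
by their transposition. -/
theorem exists_swap [Finite ι] [DecidableEq ι] (hP : 0 < P.natDegree) {u : ℂ} (huM : ‖u‖ < M)
    (hu : P.eval u = -Complex.exp c) (hu' : P.derivative.eval u = 0)
    (hu'' : P.derivative.derivative.eval u ≠ 0)
    (huniq : ∀ v, P.eval v = -Complex.exp c → P.derivative.eval v = 0 → v = u) :
    ∃ x y, x ≠ y ∧ πp = πm * Equiv.swap x y ∧
      ∀ z, Tendsto (ρ z) (𝓝[slitUp c] c) (𝓝 u) ↔ z = x ∨ z = y := by
  set Z : Set ι := {z | Tendsto (ρ z) (𝓝[slitUp c] c) (𝓝 u)} with hZ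
  have hZ1 : ∀ z, z ∉ Z → πm z = πp z := by
    intro z hz
    obtain ⟨s, hs, hst⟩ := h.exists_limit hP z
    refine h.perm_eq_of_regular hst hs fun h0 => hz ?_
    rw [hZ, Set.mem_ofPred_eq, ← huniq s hs h0]
    exact hst
  have hZ2 : ∀ z, z ∈ Z → πm z ≠ πp z := fun z hz he => h.regular_of_perm_eq hP hz hu he hu'
  -- Three colliding labels would have displacements whose pairwise sums are small relative to the
  -- displacements themselves; adding up the inequalities forces all three to vanish.
  have hZ3 : ∀ x y z, x ∈ Z → y ∈ Z → z ∈ Z → x ≠ y → x ≠ z → y ≠ z → False := by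
    intro x y z hx hy hz hxy hxz hyz
    obtain ⟨ε, hε, hloc⟩ := P.exists_norm_add_le_of_double_root hu' hu''
      (κ := 1 / 4) (by norm_num)
    have ev : ∀ t ∈ Z, ∀ᶠ w in 𝓝[slitUp c] c, dist (ρ t w) u < ε :=
      fun t ht => Metric.tendsto_nhds.1 ht ε hε
    obtain ⟨w, h1, h2, h3, hW⟩ := ((ev x hx).and ((ev y hy).and ((ev z hz).and
      h.eventually_mem))).exists
    have hne : ∀ {s t : ι}, s ≠ t → ρ s w ≠ ρ t w := fun hst he =>
      hst (h.labelling.injective w hW he)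
    have heq : ∀ s t : ι, P.eval (ρ s w) = P.eval (ρ t w) := fun s t =>
      (h.labelling.eval_eq s w hW).trans (h.labelling.eval_eq t w hW).symm
    have e1 := hloc _ _ h1 h2 (hne hxy) (heq _ _)
    have e2 := hloc _ _ h2 h3 (hne hyz) (heq _ _)
    have e3 := hloc _ _ h3 h1 (hne hxz.symm) (heq _ _)
    set d1 := ρ x w - u
    set d2 := ρ y w - u
    set d3 := ρ z w - u
    have f1 : 2 * ‖d1‖ ≤ ‖d1 + d2‖ + ‖d3 + d1‖ + ‖d2 + d3‖ := by
      have : (2 : ℂ) * d1 = (d1 + d2) + (d3 + d1) - (d2 + d3) := by ring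
      calc 2 * ‖d1‖ = ‖(2 : ℂ) * d1‖ := by simp
        _ ≤ _ := by
          rw [this]
          exact (norm_sub_le _ _).trans (by gcongr; exact norm_add_le _ _)
    have f2 : 2 * ‖d2‖ ≤ ‖d1 + d2‖ + ‖d2 + d3‖ + ‖d3 + d1‖ := by
      have : (2 : ℂ) * d2 = (d1 + d2) + (d2 + d3) - (d3 + d1) := by ring
      calc 2 * ‖d2‖ = ‖(2 : ℂ) * d2‖ := by simp
        _ ≤ _ := by
          rw [this]
          exact (norm_sub_le _ _).trans (by gcongr; exact norm_add_le _ _)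
    have f3 : 2 * ‖d3‖ ≤ ‖d3 + d1‖ + ‖d2 + d3‖ + ‖d1 + d2‖ := by
      have : (2 : ℂ) * d3 = (d3 + d1) + (d2 + d3) - (d1 + d2) := by ring
      calc 2 * ‖d3‖ = ‖(2 : ℂ) * d3‖ := by simp
        _ ≤ _ := by
          rw [this]
          exact (norm_sub_le _ _).trans (by gcongr; exact norm_add_le _ _)
    have g1 := norm_nonneg d1
    have g2 := norm_nonneg d2
    have g3 := norm_nonneg d3
    have z1 : d1 = 0 := norm_le_zero_iff.1 (by linarith)
    have z2 : d2 = 0 := norm_le_zero_iff.1 (by linarith)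
    exact hne hxy ((sub_eq_zero.1 z1).trans (sub_eq_zero.1 z2).symm)
  -- `πm⁻¹ πp` fixes exactly the labels that do not tend to `u`. So it preserves the set of the
  -- labels that do, without fixed points, and this set has at most two elements.
  have hZ4 : ∀ z ∈ Z, πm.symm (πp z) ∈ Z ∧ πm.symm (πp z) ≠ z := by
    intro z hz
    have hne : πm.symm (πp z) ≠ z := fun he => hZ2 z hz (by rw [← he, Equiv.apply_symm_apply, he])
    refine ⟨?_, hne⟩
    by_contra hcon
    have h1 := hZ1 _ hcon
    rw [Equiv.apply_symm_apply] at h1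
    exact hne (πp.injective h1).symm
  obtain ⟨x, hx⟩ := h.exists_limit_eq hP huM hu
  obtain ⟨hy, hyx⟩ := hZ4 x hx
  set y := πm.symm (πp x) with hydef
  have hZxy : ∀ z, z ∈ Z ↔ z = x ∨ z = y := by
    intro z
    constructor
    · intro hz
      by_contra hcon
      push Not at hcon
      exact hZ3 x y z hx hy hz hyx.symm hcon.1.symm hcon.2.symm
    · rintro (rfl | rfl)
      exacts [hx, hy]
  refine ⟨x, y, hyx.symm, ?_, hZxy⟩
  obtain ⟨h1, h2⟩ := hZ4 y hy
  have h3 : πm.symm (πp y) = x := ((hZxy _).1 h1).resolve_right h2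
  ext z
  rw [Equiv.Perm.mul_apply]
  by_cases hzx : z = x
  · rw [hzx, Equiv.swap_apply_left, hydef, Equiv.apply_symm_apply]
  · by_cases hzy : z = y
    · rw [hzy, Equiv.swap_apply_right, ← h3, Equiv.apply_symm_apply]
    · rw [Equiv.swap_apply_of_ne_of_ne hzx hzy, hZ1 z]
      rw [hZxy]
      tauto

end CrossingData

end Crossing

/-! ## Petals and insertions -/

section Petals

/-- The left end of the `l`-th vertical strip. -/
noncomputable def stripLeft (A : ℝ) (c : ℕ → ℂ) : ℕ → ℝ
  | 0 => A
  | l + 1 => (c l).re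

/-- The right end of the `l`-th vertical strip. -/
noncomputable def stripRight (B : ℝ) (a : ℕ) (c : ℕ → ℂ) (l : ℕ) : ℝ :=
  if l < a then (c l).re else B

/-- A polynomial `P` whose critical values `t = exp w` with `A < Re w < B` are the `exp (c l)`, `l < a`,
with regions `petal s` which roots can leave only through these critical points. -/
structure PetalData (P : ℂ[X]) (M A B : ℝ) (a : ℕ) (c u : ℕ → ℂ) {S₂ : Type*} (ξ : ℕ → S₂)
    (petal : S₂ → Set ℂ) : Prop where
  natDegree_pos : 0 < P.natDegree
  lt : A < B
  strictMono : StrictMonoOn (fun l => (c l).re) (Set.Iio a)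
  mem : ∀ l < a, A < (c l).re ∧ (c l).re < B
  crit : ∀ w : ℂ, A < w.re → w.re < B → ∀ v, P.eval v = -Complex.exp w → P.derivative.eval v = 0 →
    ∃ l < a, v = u l ∧ ∃ k : ℤ, w = c l + k * (2 * Real.pi * Complex.I)
  noRoot : NoRootOn P M {w | A < w.re ∧ w.re < B}
  eval_crit : ∀ l < a, P.eval (u l) = -Complex.exp (c l)
  deriv_crit : ∀ l < a, P.derivative.eval (u l) = 0
  deriv2_crit : ∀ l < a, P.derivative.derivative.eval (u l) ≠ 0
  norm_crit : ∀ l < a, ‖u l‖ < M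
  isOpen : ∀ s, IsOpen (petal s)
  injOn : Set.InjOn ξ (Set.Iio a)
  surj : ∀ s, ∃ l < a, ξ l = s
  frontier : ∀ l < a, ∀ w : ℂ, A < w.re → w.re < (c l).re → ∀ v, P.eval v = -Complex.exp w →
    v ∉ frontier (petal (ξ l))
  closure : ∀ l < a, ∀ l' < a, l ≠ l' → u l ∉ closure (petal (ξ l'))
  collision : ∀ l < a, ∃ ε > 0, ∀ η : ℝ, 0 < η → η < ε → ∀ v₁ v₂, dist v₁ (u l) < ε →
    dist v₂ (u l) < ε → v₁ ≠ v₂ → P.eval v₁ = -Complex.exp (c l - η) →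
    P.eval v₂ = -Complex.exp (c l - η) →
    (v₁ ∈ petal (ξ l) ∧ v₂ ∉ petal (ξ l)) ∨ (v₂ ∈ petal (ξ l) ∧ v₁ ∉ petal (ξ l))

namespace PetalData

variable {P : ℂ[X]} {M A B : ℝ} {a : ℕ} {c u : ℕ → ℂ} {S₁ S₂ : Type*} {ξ : ℕ → S₂}
  {petal : S₂ → Set ℂ} (h : PetalData P M A B a c u ξ petal)

include h

theorem re_lt_re {l l' : ℕ} (hl' : l' < a) (hll : l < l') : (c l).re < (c l').re :=
  h.strictMono (show l < a by omega) hl' hll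

theorem re_le_re {l l' : ℕ} (hl' : l' < a) (hll : l ≤ l') : (c l).re ≤ (c l').re := by
  rcases hll.eq_or_lt with rfl | hlt
  · exact le_rfl
  · exact (h.re_lt_re hl' hlt).le

theorem injOn_re : Set.InjOn (fun l => (c l).re) (Set.Iio a) := h.strictMono.injOn

theorem isSimplyConnected : IsSimplyConnected (cutStrip A B a c) :=
  isSimplyConnected_cutStrip h.lt h.injOn_re

/-- Above a critical value on the line `Re w = Re (c l)`, the logarithms are `c l + 2πik`, and none
of them is in the open gap. -/
theorem regularOn : RegularOn P (cutStrip A B a c) := by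
  intro w hw v hv hv'
  obtain ⟨l, hl, -, k, rfl⟩ := h.crit w hw.1 hw.2.1 v hv hv'
  have h1 := hw.2.2 l hl (by simp)
  have h2 : ((k : ℂ) * (2 * Real.pi * Complex.I)).im = k * (2 * Real.pi) := by simp
  rw [Complex.add_im, h2] at h1
  have hpi := Real.pi_pos
  have h3 : (-1 : ℝ) < k := by nlinarith
  have h4 : (k : ℝ) < 0 := by nlinarith
  have h3' : (-1 : ℤ) < k := by exact_mod_cast h3
  have h4' : k < (0 : ℤ) := by exact_mod_cast h4
  omega

theorem noRootOn : NoRootOn P M (cutStrip A B a c) := h.noRoot.mono fun _ hw => ⟨hw.1, hw.2.1⟩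

theorem stripLeft_le {l l' : ℕ} (hl : l' < l) (hla : l ≤ a) : (c l').re ≤ stripLeft A c l := by
  rcases l with _ | l
  · omega
  · exact h.re_le_re (by omega) (by omega)

theorem le_stripRight {l l' : ℕ} (hl : l ≤ l') (hla : l' < a) : stripRight B a c l ≤ (c l').re := by
  rw [stripRight, if_pos (by omega)]
  exact h.re_le_re hla hl

theorem le_stripLeft {l : ℕ} (hla : l ≤ a) : A ≤ stripLeft A c l := by
  rcases l with _ | l
  · exact le_rfl
  · exact (h.mem l (by omega)).1.le

theorem stripRight_le (l : ℕ) : stripRight B a c l ≤ B := by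
  rw [stripRight]
  split_ifs with hl
  · exact (h.mem l hl).2.le
  · exact le_rfl

theorem stripLeft_lt {l : ℕ} (hla : l ≤ a) : stripLeft A c l < stripRight B a c l := by
  rw [stripRight]
  rcases l with _ | l
  · split_ifs with hl
    · exact (h.mem 0 hl).1
    · exact h.lt
  · split_ifs with hl
    · exact h.re_lt_re hl (Nat.lt_succ_self l)
    · exact (h.mem l (by omega)).2

theorem mem_of_strip {l : ℕ} (hla : l ≤ a) {w : ℂ} (h1 : stripLeft A c l < w.re)
    (h2 : w.re < stripRight B a c l) : w ∈ cutStrip A B a c := by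
  refine ⟨(h.le_stripLeft hla).trans_lt h1, h2.trans_le (h.stripRight_le l), fun l' hl' hre => ?_⟩
  rcases lt_or_ge l' l with hlt | hge
  · exact absurd hre (ne_of_gt ((h.stripLeft_le hlt hla).trans_lt h1))
  · exact absurd hre (ne_of_lt (h2.trans_le (h.le_stripRight hge hl')))

theorem mem_of_gap {l : ℕ} (hla : l < a) {w : ℂ} (h1 : stripLeft A c l < w.re)
    (h2 : w.re < stripRight B a c (l + 1))
    (h3 : w.re = (c l).re → (c l).im - 2 * Real.pi < w.im ∧ w.im < (c l).im) :
    w ∈ cutStrip A B a c := by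
  refine ⟨(h.le_stripLeft hla.le).trans_lt h1, h2.trans_le (h.stripRight_le _),
    fun l' hl' hre => ?_⟩
  rcases lt_trichotomy l' l with hlt | rfl | hgt
  · exact absurd hre (ne_of_gt ((h.stripLeft_le hlt hla.le).trans_lt h1))
  · exact h3 hre
  · exact absurd hre (ne_of_lt (h2.trans_le (h.le_stripRight (l := l + 1) hgt hl')))

omit h in
theorem stripRight_eq {l : ℕ} (hl : l < a) : stripRight B a c l = (c l).re := if_pos hl

theorem isConnected_strip {l : ℕ} (hla : l ≤ a) :
    IsConnected {w : ℂ | stripLeft A c l < w.re ∧ w.re < stripRight B a c l} := by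
  refine ⟨⟨(((stripLeft A c l + stripRight B a c l) / 2 : ℝ) : ℂ), ?_⟩, ?_⟩
  · have := h.stripLeft_lt hla
    constructor <;> rw [Complex.ofReal_re] <;> linarith
  · exact ((convex_halfSpace_re_gt _).inter (convex_halfSpace_re_lt _)).isPreconnected

theorem exists_perm [Finite S₁] [Finite S₂] {ρ : S₁ ⊕ S₂ → ℂ → ℂ}
    (hρ : IsLabelling P M (cutStrip A B a c) ρ) :
    ∃ π : ℕ → Equiv.Perm (S₁ ⊕ S₂), ∀ l ≤ a, ∀ x, ∀ w : ℂ, stripLeft A c l < w.re →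
      w.re < stripRight B a c l → ρ x (w + 2 * Real.pi * Complex.I) = ρ (π l x) w := by
  have : ∀ l, ∃ π : Equiv.Perm (S₁ ⊕ S₂), l ≤ a → ∀ x, ∀ w : ℂ, stripLeft A c l < w.re →
      w.re < stripRight B a c l → ρ x (w + 2 * Real.pi * Complex.I) = ρ (π x) w := by
    intro l
    by_cases hl : l ≤ a
    · obtain ⟨π, hπ⟩ := hρ.exists_perm h.regularOn (h.isConnected_strip hl)
        (fun w hw => h.mem_of_strip hl hw.1 hw.2) (fun w hw => by simpa using hw)
      exact ⟨π, fun _ x w h1 h2 => hπ x w ⟨h1, h2⟩⟩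
    · exact ⟨1, fun h => absurd h hl⟩
  choose π hπ using this
  exact ⟨π, fun l hl => hπ l hl⟩

theorem crossingData [Finite S₁] [Finite S₂] {ρ : S₁ ⊕ S₂ → ℂ → ℂ}
    (hρ : IsLabelling P M (cutStrip A B a c) ρ) {π : ℕ → Equiv.Perm (S₁ ⊕ S₂)}
    (hπ : ∀ l ≤ a, ∀ x, ∀ w : ℂ, stripLeft A c l < w.re →
      w.re < stripRight B a c l → ρ x (w + 2 * Real.pi * Complex.I) = ρ (π l x) w) {l : ℕ}
    (hl : l < a) : CrossingData P M (cutStrip A B a c) ρ (c l) (stripLeft A c l)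
      (stripRight B a c (l + 1)) (π l) (π (l + 1)) where
  labelling := hρ
  regular := h.regularOn
  left := by
    rw [← stripRight_eq hl]
    exact h.stripLeft_lt hl.le
  right := h.stripLeft_lt (l := l + 1) hl
  isOpen := isOpen_cutStrip
  mem w h1 h2 h3 := h.mem_of_gap hl h1 h2 h3
  left_perm x w h1 h2 := hπ l hl.le x w h1 (by rwa [stripRight_eq hl])
  right_perm x w h1 h2 := hπ (l + 1) hl x w h1 h2

/-- Before its collision, a root stays in its petal. -/
theorem mem_petal_iff {ρ : S₁ ⊕ S₂ → ℂ → ℂ} (hρ : IsLabelling P M (cutStrip A B a c) ρ) {z₀ : ℂ}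
    (hz₀ : A < z₀.re ∧ z₀.re < stripRight B a c 0)
    (hpet : ∀ x s, ρ x z₀ ∈ petal s ↔ x = Sum.inr s) {l : ℕ} (hl : l < a) {w : ℂ}
    (hw : w ∈ cutStrip A B a c) (hwl : w.re < (c l).re) (x : S₁ ⊕ S₂) :
    ρ x w ∈ petal (ξ l) ↔ x = Sum.inr (ξ l) := by
  -- The part of the cut strip to the left of `c l` is connected and contains `z₀` and `w`; over it
  -- no root meets the frontier of the petal of `ξ l`.
  have hsub : cutStrip A (c l).re l c ⊆ cutStrip A B a c := by
    intro w hw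
    refine ⟨hw.1, hw.2.1.trans (h.mem l hl).2, fun l' hl' hre => ?_⟩
    rcases lt_or_ge l' l with hlt | hge
    · exact hw.2.2 l' hlt hre
    · exact absurd hre (ne_of_lt (hw.2.1.trans_le (h.re_le_re hl' hge)))
  have hconn : IsPreconnected (cutStrip A (c l).re l c) :=
    (isSimplyConnected_cutStrip (h.mem l hl).1
      (h.injOn_re.mono (Set.Iio_subset_Iio hl.le))).isPathConnected.isConnected.isPreconnected
  have hw' : w ∈ cutStrip A (c l).re l c :=
    ⟨hw.1, hwl, fun l' hl' hre => hw.2.2 l' (by omega) hre⟩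
  have hz₀' : z₀ ∈ cutStrip A (c l).re l c := by
    have h1 : z₀.re < (c 0).re := by
      rw [← stripRight_eq (show 0 < a by omega)]
      exact hz₀.2
    refine ⟨hz₀.1, h1.trans_le (h.re_le_re hl (Nat.zero_le l)), fun l' hl' hre => ?_⟩
    exact absurd hre (ne_of_lt (h1.trans_le (h.re_le_re (by omega) (Nat.zero_le l'))))
  have hfr : ∀ v ∈ cutStrip A (c l).re l c, ρ x v ∉ _root_.frontier (petal (ξ l)) := fun v hv =>
    h.frontier l hl v hv.1 hv.2.1 _ (hρ.eval_eq x v (hsub hv))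
  rw [← hpet x (ξ l)]
  exact ⟨fun hm => hconn.mem_of_notMem_frontier ((hρ.continuousOn x).mono hsub) (h.isOpen _) hfr
    hw' hm _ hz₀', fun hm => hconn.mem_of_notMem_frontier ((hρ.continuousOn x).mono hsub)
    (h.isOpen _) hfr hz₀' hm _ hw'⟩

/-- The monodromy permutations on the successive strips form a chain of insertions. -/
theorem exists_isInsertionChain [Finite S₁] [Finite S₂] [DecidableEq (S₁ ⊕ S₂)]
    {ρ : S₁ ⊕ S₂ → ℂ → ℂ} (hρ : IsLabelling P M (cutStrip A B a c) ρ) {z₀ : ℂ}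
    (hz₀ : A < z₀.re ∧ z₀.re < stripRight B a c 0)
    (hpet : ∀ x s, ρ x z₀ ∈ petal s ↔ x = Sum.inr s) {f : Equiv.Perm S₁}
    (hf : ∀ x, ρ (Sum.inl x) (z₀ + 2 * Real.pi * Complex.I) = ρ (Sum.inl (f x)) z₀)
    {π : ℕ → Equiv.Perm (S₁ ⊕ S₂)}
    (hπ : ∀ l ≤ a, ∀ x, ∀ w : ℂ, stripLeft A c l < w.re →
      w.re < stripRight B a c l → ρ x (w + 2 * Real.pi * Complex.I) = ρ (π l x) w) :
    ∃ y, IsInsertionChain a f ξ y π ∧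
      ∀ l < a, ∀ z, Tendsto (ρ z) (𝓝[slitUp (c l)] (c l)) (𝓝 (u l)) ↔
        z = Sum.inr (ξ l) ∨ z = y l := by
  have hz₀W : z₀ ∈ cutStrip A B a c := h.mem_of_strip (Nat.zero_le a) hz₀.1 hz₀.2
  have hstep : ∀ l, ∃ y, l < a → y ∈ insertedBefore S₁ a ξ l ∧
      π (l + 1) = π l * Equiv.swap (Sum.inr (ξ l)) y ∧
      ∀ z, Tendsto (ρ z) (𝓝[slitUp (c l)] (c l)) (𝓝 (u l)) ↔ z = Sum.inr (ξ l) ∨ z = y := by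
    intro l
    by_cases hl : l < a
    swap
    · exact ⟨Sum.inr (ξ l), fun h => absurd h hl⟩
    have hcd := h.crossingData hρ hπ hl
    obtain ⟨x, y, hxy, hsw, hlim⟩ := hcd.exists_swap h.natDegree_pos (h.norm_crit l hl)
      (h.eval_crit l hl) (h.deriv_crit l hl) (h.deriv2_crit l hl) (fun v hv hv' => by
        obtain ⟨l', hl', hvl', k, hk⟩ := h.crit (c l) (h.mem l hl).1 (h.mem l hl).2 v hv hv'
        have : l = l' := h.injOn_re hl hl' (by simp [hk])
        rw [hvl', this])
    -- one of the two labels is that of the petal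
    have key : x = Sum.inr (ξ l) ∨ y = Sum.inr (ξ l) := by
      obtain ⟨ε, hε, hcol⟩ := h.collision l hl
      have ev : ∀ᶠ w in 𝓝[slitUp (c l)] (c l), dist (ρ x w) (u l) < ε ∧ dist (ρ y w) (u l) < ε ∧
          w ∈ cutStrip A B a c :=
        (Metric.tendsto_nhds.1 ((hlim x).2 (Or.inl rfl)) ε hε).and
          ((Metric.tendsto_nhds.1 ((hlim y).2 (Or.inr rfl)) ε hε).and hcd.eventually_mem)
      obtain ⟨η, ⟨h1, h2, h3⟩, hη0, hηε⟩ :=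
        (((tendsto_sub_ofReal_nhdsGT (c l) fun _ => mem_slitUp_of_ne).eventually ev).and
          (Ioo_mem_nhdsGT hε)).exists
      have hre : (c l - η : ℂ).re < (c l).re := by simpa using hη0
      have hiff := fun x => h.mem_petal_iff hρ hz₀ hpet hl h3 hre x
      rcases hcol η hη0 hηε _ _ h1 h2 (fun he => hxy (hρ.injective _ h3 he))
        (hρ.eval_eq _ _ h3) (hρ.eval_eq _ _ h3) with ⟨h4, -⟩ | ⟨h4, -⟩
      · exact Or.inl ((hiff x).1 h4)
      · exact Or.inr ((hiff y).1 h4)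
    -- A label whose own critical value is still to come has its root in its petal up to `c l`, so
    -- that `u l` would be in the closure of a foreign petal.
    have hother : ∀ y, y ≠ Sum.inr (ξ l) → Tendsto (ρ y) (𝓝[slitUp (c l)] (c l)) (𝓝 (u l)) →
        y ∈ insertedBefore S₁ a ξ l := by
      intro y hy hyt l' hl' hl'a hyl'
      rcases hl'.eq_or_lt with rfl | hlt
      · exact hy hyl'
      · have h1 := (hyt.comp (tendsto_sub_ofReal_nhdsGT (c l) fun _ => mem_slitUp_of_ne))
        refine h.closure l hl l' hl'a hlt.ne (mem_closure_of_tendsto h1 ?_)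
        filter_upwards [(tendsto_sub_ofReal_nhdsGT (c l) fun _ => mem_slitUp_of_ne).eventually
          hcd.eventually_mem, self_mem_nhdsWithin] with η hW hη
        have hη' : (0 : ℝ) < η := hη
        have hre : (c l - η : ℂ).re < (c l').re := by
          have := h.re_lt_re hl'a hlt
          simp
          linarith
        exact (h.mem_petal_iff hρ hz₀ hpet hl'a hW hre y).2 hyl'
    rcases key with rfl | rfl
    · exact ⟨y, fun _ => ⟨hother y hxy.symm ((hlim y).2 (Or.inr rfl)), hsw, hlim⟩⟩
    · refine ⟨x, fun _ => ⟨hother x hxy ((hlim x).2 (Or.inl rfl)), ?_, fun z => ?_⟩⟩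
      · rw [hsw, Equiv.swap_comm]
      · rw [hlim, or_comm]
  choose y hy using hstep
  refine ⟨y, ⟨h.injOn, h.surj, fun x => ?_, fun s => ?_, fun l hl => (hy l hl).1,
    fun l hl => (hy l hl).2.1⟩, fun l hl => (hy l hl).2.2⟩
  · have h1 := hπ 0 (Nat.zero_le a) (Sum.inl x) z₀ hz₀.1 hz₀.2
    rw [hf] at h1
    exact (hρ.injective _ hz₀W h1).symm
  -- In the first strip a petal label is fixed by the monodromy, because its root is still in the
  -- same petal over `z₀ + 2πi`.
  · obtain ⟨l, hl, rfl⟩ := h.surj s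
    have h1 := hπ 0 (Nat.zero_le a) (Sum.inr (ξ l)) z₀ hz₀.1 hz₀.2
    rw [← hpet, ← h1]
    have h2 : stripRight B a c 0 ≤ (c l).re := h.le_stripRight (Nat.zero_le l) hl
    refine (h.mem_petal_iff hρ hz₀ hpet hl (h.mem_of_strip (Nat.zero_le a) ?_ ?_) ?_ _).2 rfl
    all_goals rw [show (z₀ + 2 * Real.pi * Complex.I).re = z₀.re by simp]
    exacts [hz₀.1, hz₀.2, hz₀.2.trans_le h2]

end PetalData

end Petals

/-! ## Transport along radar paths -/

section RadarTransport

/-- All points of the polygonal path with the given vertices are in `W`. -/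
def ChainIn (W : Set ℂ) : List ℂ → Prop
  | z :: z' :: zs => (∀ x ∈ Set.Icc (0 : ℝ) 1, z + x * (z' - z) ∈ W) ∧ ChainIn W (z' :: zs)
  | _ => True

variable {P : ℂ[X]} {M : ℝ} {W : Set ℂ} {ι : Type*} {ρ : ι → ℂ → ℂ} {F : ℂ → ℂ → Prop}

theorem continuous_segment (z z' : ℂ) : Continuous fun x : ℝ => z + x * (z' - z) := by fun_prop

theorem IsLabelling.transport_iff (h : IsLabelling P M W ρ) (hreg : RegularOn P W)
    (hF : ∀ t u, F t u ↔ P.eval u = -t) (x : ι) (u' : ℂ) :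
    ∀ (zs : List ℂ) (z : ℂ), ChainIn W (z :: zs) →
      (Transport F (z :: zs) (ρ x z) u' ↔ u' = ρ x ((z :: zs).getLast (List.cons_ne_nil _ _)))
  | [], z, _ => by simp [Transport, eq_comm]
  | z' :: zs, z, hc => by
    obtain ⟨hseg, hc'⟩ := hc
    have ih := h.transport_iff hreg hF x u' zs z' hc'
    rw [List.getLast_cons_cons, ← ih]
    have e0 : z + ((0 : ℝ) : ℂ) * (z' - z) = z := by simp
    have e1 : z + ((1 : ℝ) : ℂ) * (z' - z) = z' := by simp
    constructor
    · rintro ⟨v, ⟨f, hf, hf0, hf1, hfF⟩, hT⟩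
      have := h.eqOn_lift hreg isPreconnected_Icc (continuous_segment z z').continuousOn hseg hf
        (fun y hy => (hF _ _).1 (hfF y hy)) (x := x) (s₀ := (0 : ℝ)) (by simp)
        (by simpa using hf0) 1 (by simp)
      rw [hf1] at this
      simp only [e1] at this
      rwa [← this]
    · intro hT
      refine ⟨ρ x z', ⟨fun y => ρ x (z + y * (z' - z)), ?_, by simp only [e0], by simp only [e1],
        fun y hy => (hF _ _).2 (h.eval_eq x _ (hseg y hy))⟩, hT⟩
      exact (h.continuousOn x).comp (continuous_segment z z').continuousOn hseg

theorem re_segment (z z' : ℂ) (x : ℝ) : (z + x * (z' - z)).re = (1 - x) * z.re + x * z'.re := by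
  simp; ring

theorem im_segment (z z' : ℂ) (x : ℝ) : (z + x * (z' - z)).im = (1 - x) * z.im + x * z'.im := by
  simp; ring

theorem lt_convexCombination {p q α x : ℝ} (hx : x ∈ Set.Icc (0 : ℝ) 1) (hp : α < p) (hq : α < q) :
    α < (1 - x) * p + x * q := by
  obtain ⟨h0, h1⟩ := hx
  rcases h0.eq_or_lt with rfl | h0
  · simpa
  · nlinarith

theorem convexCombination_lt {p q β x : ℝ} (hx : x ∈ Set.Icc (0 : ℝ) 1) (hp : p < β) (hq : q < β) :
    (1 - x) * p + x * q < β := by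
  obtain ⟨h0, h1⟩ := hx
  rcases h0.eq_or_lt with rfl | h0
  · simpa
  · nlinarith

namespace PetalData

variable {A B : ℝ} {a : ℕ} {c u : ℕ → ℂ} {S₁ S₂ : Type*} {ξ : ℕ → S₂}
  {petal : S₂ → Set ℂ} (h : PetalData P M A B a c u ξ petal)

include h

theorem segment_mem_of_strip {l : ℕ} (hla : l ≤ a) {z z' : ℂ}
    (hz : stripLeft A c l < z.re ∧ z.re < stripRight B a c l)
    (hz' : stripLeft A c l < z'.re ∧ z'.re < stripRight B a c l) {x : ℝ}
    (hx : x ∈ Set.Icc (0 : ℝ) 1) : z + x * (z' - z) ∈ cutStrip A B a c := by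
  refine h.mem_of_strip hla ?_ ?_ <;> rw [re_segment]
  · exact lt_convexCombination hx hz.1 hz'.1
  · exact convexCombination_lt hx hz.2 hz'.2

/-- The abscissa at which a radar path makes its next turn. -/
noncomputable def _root_.turnRe (c : ℕ → ℂ) (a : ℕ) (ε : ℝ) (e : ℂ) (l : ℕ) : ℝ :=
  if l < a then (c l).re - ε else e.re

theorem turnRe_mem {e : ℂ} (he : stripLeft A c a < e.re ∧ e.re < B) {ε : ℝ} (hε : 0 < ε)
    (hεc : ∀ l < a, stripLeft A c l < (c l).re - ε) {l : ℕ} (hla : l ≤ a) :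
    stripLeft A c l < turnRe c a ε e l ∧ turnRe c a ε e l < stripRight B a c l := by
  rw [turnRe, stripRight]
  split_ifs with hl
  · exact ⟨hεc l hl, by linarith⟩
  · obtain rfl : l = a := by omega
    exact he

/-- The path turns at `Re (c l) - ε`, still inside the `l`-th strip, and crosses the line through `c
l` at the height `Im (c l) - ε`, which is in the gap as `0 < ε < 2π`. -/
theorem chainIn_radarRest {w : ℕ → ℂ} {b : ℕ} (hw : ∀ l < a, w (b + l) = c l) {e : ℂ}
    (he : stripLeft A c a < e.re ∧ e.re < B) {ε : ℝ} (hε : 0 < ε) (hε' : ε < 2 * Real.pi)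
    (hεc : ∀ l < a, stripLeft A c l < (c l).re - ε) :
    ∀ (d l : ℕ) (y : ℝ), l + d = a →
      ∃ tl, radarRest w ε e y (List.range' (b + l) d) = ⟨turnRe c a ε e l, y⟩ :: tl ∧
        ChainIn (cutStrip A B a c) (⟨turnRe c a ε e l, y⟩ :: tl) ∧
        ∀ hne, (⟨turnRe c a ε e l, y⟩ :: tl).getLast hne = e
  | 0, l, y, hd => by
    obtain rfl : l = a := by omega
    have ht : turnRe c l ε e l = e.re := by simp [turnRe]
    refine ⟨[e], by simp [radarRest, ht], ⟨fun x hx => ?_, trivial⟩, fun _ => rfl⟩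
    have := h.turnRe_mem he hε hεc (l := l) le_rfl
    exact h.segment_mem_of_strip le_rfl this (by rwa [ht] at this) hx
  | d + 1, l, y, hd => by
    have hl : l < a := by omega
    obtain ⟨tl, h1, h2, h3⟩ := chainIn_radarRest hw he hε hε' hεc d (l + 1) ((c l).im - ε)
      (by omega)
    have ht : turnRe c a ε e l = (c l).re - ε := if_pos hl
    have hm := h.turnRe_mem he hε hεc hl.le
    have hm' := h.turnRe_mem he hε hεc (l := l + 1) hl
    refine ⟨⟨(c l).re - ε, (c l).im - ε⟩ :: ⟨turnRe c a ε e (l + 1), (c l).im - ε⟩ :: tl, ?_,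
      ⟨fun x hx => ?_, fun x hx => ?_, h2⟩, fun _ => ?_⟩
    · rw [List.range'_succ, radarRest, hw l hl, ht, ← h1, add_assoc]
    · exact h.segment_mem_of_strip hl.le hm (by rwa [ht] at hm) hx
    · have hs : stripLeft A c l < stripLeft A c (l + 1) := (h.stripLeft_lt hl.le).trans_eq
        (stripRight_eq hl)
      have hs' : (c l).re < stripRight B a c (l + 1) := h.stripLeft_lt (l := l + 1) hl
      refine h.mem_of_gap hl ?_ ?_ fun _ => ?_
      · rw [re_segment]
        exact lt_convexCombination hx (hεc l hl) (hs.trans hm'.1)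
      · rw [re_segment]
        exact convexCombination_lt hx (by dsimp; linarith) hm'.2
      · rw [im_segment]
        dsimp
        constructor <;> nlinarith
    · rw [List.getLast_cons_cons, List.getLast_cons_cons]
      exact h3 _

theorem chainIn_radarPath {w : ℕ → ℂ} {b : ℕ} (hw : ∀ l < a, w (b + l) = c l) {e : ℂ}
    (he : stripLeft A c a < e.re ∧ e.re < B) {ε : ℝ} (hε : 0 < ε) (hε' : ε < 2 * Real.pi)
    (hεc : ∀ l < a, stripLeft A c l < (c l).re - ε) {z₀ : ℂ}
    (hz₀ : A < z₀.re ∧ z₀.re < stripRight B a c 0) :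
    ∃ tl, radarPath w ε z₀ e (List.range' b a) = z₀ :: tl ∧
      ChainIn (cutStrip A B a c) (z₀ :: tl) ∧ ∀ hne, (z₀ :: tl).getLast hne = e := by
  obtain ⟨tl, h1, h2, h3⟩ := h.chainIn_radarRest hw he hε hε' hεc a 0 z₀.im (Nat.zero_add a)
  refine ⟨⟨turnRe c a ε e 0, z₀.im⟩ :: tl, by rw [radarPath]; exact congrArg _ h1, ⟨fun x hx => ?_, h2⟩, fun _ => ?_⟩
  · exact h.segment_mem_of_strip (Nat.zero_le a) hz₀ (h.turnRe_mem he hε hεc (Nat.zero_le a)) hx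
  · rw [List.getLast_cons_cons]
    exact h3 _

theorem transport_radarPath (hF : ∀ t u, F t u ↔ P.eval u = -t)
    {ρ : S₁ ⊕ S₂ → ℂ → ℂ} (hρ : IsLabelling P M (cutStrip A B a c) ρ)
    {w : ℕ → ℂ} {b : ℕ} (hw : ∀ l < a, w (b + l) = c l) {e : ℂ}
    (he : stripLeft A c a < e.re ∧ e.re < B) {ε : ℝ} (hε : 0 < ε) (hε' : ε < 2 * Real.pi)
    (hεc : ∀ l < a, stripLeft A c l < (c l).re - ε) {z₀ : ℂ}
    (hz₀ : A < z₀.re ∧ z₀.re < stripRight B a c 0) (x : S₁ ⊕ S₂) (u' : ℂ) :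
    Transport F (radarPath w ε z₀ e (List.range' b a)) (ρ x z₀) u' ↔ u' = ρ x e := by
  obtain ⟨tl, h1, h2, h3⟩ := h.chainIn_radarPath hw he hε hε' hεc hz₀
  rw [h1, hρ.transport_iff h.regularOn hF x u' tl z₀ h2, h3]

/-- The path leaves the branch point `c l` horizontally to the right, inside the cut strip. A
continuous family of roots that starts at `u l` is bounded by `M` at first, hence throughout, and so
agrees with one label after the start; that label tends to `u l` at `c l`. Conversely, such a label
is extended by `u l` at the starting point. -/
theorem transport_blockPath [Finite S₁] [Finite S₂] (hF : ∀ t u, F t u ↔ P.eval u = -t)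
    {ρ : S₁ ⊕ S₂ → ℂ → ℂ} (hρ : IsLabelling P M (cutStrip A B a c) ρ)
    {π : ℕ → Equiv.Perm (S₁ ⊕ S₂)}
    (hπ : ∀ l ≤ a, ∀ x, ∀ w : ℂ, stripLeft A c l < w.re →
      w.re < stripRight B a c l → ρ x (w + 2 * Real.pi * Complex.I) = ρ (π l x) w)
    {w : ℕ → ℂ} {b : ℕ} (hw : ∀ l < a, w (b + l) = c l) {e : ℂ}
    (he : stripLeft A c a < e.re ∧ e.re < B) {ε : ℝ} (hε : 0 < ε) (hε' : ε < 2 * Real.pi)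
    (hεc : ∀ l < a, stripLeft A c l < (c l).re - ε) {l : ℕ} (hl : l < a) (u' : ℂ) :
    Transport F (radarPath w ε (c l) e (List.range' (b + l + 1) (a - 1 - l))) (u l) u' ↔
      ∃ z, Tendsto (ρ z) (𝓝[slitUp (c l)] (c l)) (𝓝 (u l)) ∧ u' = ρ z e := by
  have hcd := h.crossingData hρ hπ hl
  obtain ⟨tl, h1, h2, h3⟩ := h.chainIn_radarRest hw he hε hε' hεc (a - 1 - l) (l + 1) (c l).im
    (by omega)
  rw [radarPath, add_assoc, h1, Transport]
  set X : ℂ := ⟨turnRe c a ε e (l + 1), (c l).im⟩ with hX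
  have hXm := h.turnRe_mem he hε hεc (l := l + 1) hl
  have hXre : (c l).re < X.re := hXm.1
  have hXc : X - c l = ((X.re - (c l).re : ℝ) : ℂ) := by
    apply Complex.ext <;> simp [hX]
  have hseg : ∀ x ∈ Set.Ioc (0 : ℝ) 1, c l + x * (X - c l) ∈ cutStrip A B a c := by
    intro x hx
    have hre : (c l + x * (X - c l)).re = (c l).re + x * (X.re - (c l).re) := by
      rw [hXc]; simp
    refine h.mem_of_strip (l := l + 1) hl ?_ ?_ <;> rw [hre]
    · exact lt_add_of_pos_right _ (mul_pos hx.1 (by linarith))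
    · have := hXm.2
      have h5 : X.re = turnRe c a ε e (l + 1) := rfl
      nlinarith [hx.2, hx.1]
  have htend : Tendsto (fun x : ℝ => c l + x * (X - c l)) (𝓝[>] 0) (𝓝[slitUp (c l)] (c l)) := by
    refine tendsto_nhdsWithin_iff.2 ⟨?_, ?_⟩
    · have := (continuous_segment (c l) X).tendsto 0
      simp only [Complex.ofReal_zero, zero_mul, add_zero] at this
      exact this.mono_left nhdsWithin_le_nhds
    · filter_upwards [self_mem_nhdsWithin] with x hx
      refine mem_slitUp_of_ne ?_
      have hre : (c l + x * (X - c l)).re = (c l).re + x * (X.re - (c l).re) := by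
        rw [hXc]; simp
      rw [hre]
      have : 0 < x * (X.re - (c l).re) := mul_pos hx (by linarith)
      linarith
  have e1 : c l + ((1 : ℝ) : ℂ) * (X - c l) = X := by simp
  have hIoc : Set.Ioc (0 : ℝ) 1 ∈ 𝓝[>] (0 : ℝ) := Ioc_mem_nhdsGT one_pos
  constructor
  · rintro ⟨v, ⟨f, hf, hf0, hf1, hfF⟩, hT⟩
    have hft : Tendsto f (𝓝[>] 0) (𝓝 (u l)) := by
      have := (hf 0 (by simp)).mono_left (nhdsWithin_le_iff.2
        (mem_of_superset hIoc Set.Ioc_subset_Icc_self) : 𝓝[>] (0 : ℝ) ≤ 𝓝[Set.Icc 0 1] 0)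
      rwa [hf0] at this
    have hroot : ∀ x ∈ Set.Icc (0 : ℝ) 1, P.eval (f x) = -Complex.exp (c l + x * (X - c l)) :=
      fun x hx => (hF _ _).1 (hfF x hx)
    obtain ⟨x₀, hx₀M, hx₀⟩ := ((hft.norm.eventually (gt_mem_nhds (h.norm_crit l hl))).and
      hIoc).exists
    have hlt := norm_lt_of_lift (P := P) (M := M) (W := cutStrip A B a c) isPreconnected_Ioc
      (hf.mono Set.Ioc_subset_Icc_self) (γ := fun x : ℝ => c l + x * (X - c l))
      (fun x hx => hroot x (Set.Ioc_subset_Icc_self hx)) hseg h.noRootOn hx₀ hx₀M 1 (by simp)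
    obtain ⟨z, hz⟩ := hρ.exists_eq X (by simpa using hseg 1 (by simp)) (f 1)
      (by simpa using hroot 1 (by simp)) hlt
    have heq := hρ.eqOn_lift h.regularOn isPreconnected_Ioc
      (continuous_segment (c l) X).continuousOn hseg (hf.mono Set.Ioc_subset_Icc_self)
      (fun x hx => hroot x (Set.Ioc_subset_Icc_self hx)) (x := z) (s₀ := (1 : ℝ)) (by simp)
      (by simpa using hz.symm)
    obtain ⟨s, -, hs⟩ := hcd.exists_limit h.natDegree_pos z
    have hsu : s = u l := tendsto_nhds_unique (hs.comp htend) (hft.congr' (by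
      filter_upwards [hIoc] with x hx
      exact heq x hx))
    refine ⟨z, hsu ▸ hs, ?_⟩
    rw [← hf1, ← hz, hρ.transport_iff h.regularOn hF z u' tl X h2, h3] at hT
    exact hT
  · rintro ⟨z, hz, rfl⟩
    refine ⟨ρ z X, ⟨fun x => if x = 0 then u l else ρ z (c l + x * (X - c l)), ?_, by simp,
      by simp, fun x hx => ?_⟩, ?_⟩
    · intro x hx
      rcases eq_or_ne x 0 with rfl | hx0
      · have : Tendsto (fun x : ℝ => if x = 0 then u l else ρ z (c l + x * (X - c l)))
            (𝓝[>] 0) (𝓝 (u l)) := (hz.comp htend).congr' (by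
          filter_upwards [self_mem_nhdsWithin] with x hx
          rw [if_neg (ne_of_gt hx), Function.comp])
        rw [ContinuousWithinAt, if_pos rfl]
        have hle : 𝓝[Set.Icc 0 1] (0 : ℝ) ≤ pure 0 ⊔ 𝓝[>] (0 : ℝ) := by
          rw [← nhdsWithin_insert, Set.Ioi_insert]
          exact nhdsWithin_mono _ Set.Icc_subset_Ici_self
        refine Tendsto.mono_left (tendsto_sup.2 ⟨?_, this⟩) hle
        rw [tendsto_pure_left]
        intro s hs
        simpa using mem_of_mem_nhds hs
      · have hx' : 0 < x := lt_of_le_of_ne hx.1 (Ne.symm hx0)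
        have h5 : ContinuousWithinAt (fun x : ℝ => ρ z (c l + x * (X - c l))) (Set.Ioc 0 1) x :=
          ((hρ.continuousOn z).comp (continuous_segment (c l) X).continuousOn hseg) x ⟨hx', hx.2⟩
        have h6 : ContinuousWithinAt (fun x : ℝ => ρ z (c l + x * (X - c l))) (Set.Icc 0 1) x := by
          refine h5.mono_of_mem_nhdsWithin ?_
          filter_upwards [self_mem_nhdsWithin, nhdsWithin_le_nhds (lt_mem_nhds hx')] with y hy hy'
          exact ⟨hy', hy.2⟩
        refine h6.congr_of_eventuallyEq ?_ (by simp [hx0])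
        filter_upwards [nhdsWithin_le_nhds (lt_mem_nhds hx')] with y hy
        rw [if_neg (ne_of_gt hy)]
    · rw [hF]
      dsimp only
      split_ifs with hx0
      · rw [hx0]
        simpa using h.eval_crit l hl
      · exact hρ.eval_eq z _ (hseg x ⟨lt_of_le_of_ne hx.1 (Ne.symm hx0), hx.2⟩)
    · rw [hρ.transport_iff h.regularOn hF z _ tl X h2, h3]

end PetalData

end RadarTransport

/-! ## Roots of polynomials depending on their coefficients -/

section CoeffPoly

/-- The polynomial of degree less than `d` with the given coefficients. -/
noncomputable def coeffPoly (d : ℕ) (g : ℕ → ℂ) : ℂ[X] := ∑ j ∈ Finset.range d, C (g j) * X ^ j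

variable {d : ℕ}

theorem eval_coeffPoly (g : ℕ → ℂ) (u : ℂ) :
    (coeffPoly d g).eval u = ∑ j ∈ Finset.range d, g j * u ^ j := by
  simp [coeffPoly, eval_finsetSum]

theorem continuous_eval_coeffPoly :
    Continuous fun p : (ℕ → ℂ) × ℂ => (coeffPoly d p.1).eval p.2 := by
  simp only [eval_coeffPoly]
  fun_prop

theorem eval_derivative_coeffPoly (g : ℕ → ℂ) (u : ℂ) :
    (coeffPoly d g).derivative.eval u = ∑ j ∈ Finset.range d, g j * (j * u ^ (j - 1)) := by
  simp [coeffPoly, eval_finsetSum, derivative_X_pow]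

theorem eval_derivative2_coeffPoly (g : ℕ → ℂ) (u : ℂ) :
    (coeffPoly d g).derivative.derivative.eval u =
      ∑ j ∈ Finset.range d, g j * (j * ((j - 1 : ℕ) * u ^ (j - 1 - 1))) := by
  simp [coeffPoly, eval_finsetSum, derivative_X_pow]

theorem continuous_eval_derivative2_coeffPoly :
    Continuous fun p : (ℕ → ℂ) × ℂ => (coeffPoly d p.1).derivative.derivative.eval p.2 := by
  simp only [eval_derivative2_coeffPoly]
  fun_prop

theorem derivative_coeffPoly (g : ℕ → ℂ) :
    (coeffPoly (d + 1) g).derivative = coeffPoly d fun j => (j + 1) * g (j + 1) := by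
  simp only [coeffPoly, Finset.sum_range_succ', derivative_add, derivative_sum, derivative_C_mul,
    derivative_X_pow, pow_zero, mul_one, derivative_C, add_zero]
  refine Finset.sum_congr rfl fun j _ => ?_
  simp only [Nat.cast_add, Nat.cast_one, map_add, map_natCast, map_one, map_mul,
    Nat.add_sub_cancel]
  ring

theorem coeffPoly_add_single (hd : 0 < d) (g : ℕ → ℂ) (t u : ℂ) :
    (coeffPoly d (g + Pi.single 0 t)).eval u = (coeffPoly d g).eval u + t := by
  obtain ⟨d, rfl⟩ := Nat.exists_eq_succ_of_ne_zero hd.ne'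
  simp only [eval_coeffPoly, Nat.succ_eq_add_one, Finset.sum_range_succ', Pi.add_apply]
  simp
  ring

theorem eval_coeffPoly_sub (g : ℕ → ℂ) (x y : ℂ) :
    (coeffPoly d g).eval x - (coeffPoly d g).eval y =
      (∑ j ∈ Finset.range d, g j * ∑ i ∈ Finset.range j, x ^ i * y ^ (j - 1 - i)) * (x - y) := by
  rw [eval_coeffPoly, eval_coeffPoly, ← Finset.sum_sub_distrib, Finset.sum_mul]
  refine Finset.sum_congr rfl fun j _ => ?_
  rw [mul_assoc, geom_sum₂_mul, mul_sub]

/-- Near a simple point, the polynomials with coefficients near the given ones are injective. -/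
theorem eventually_injOn_coeffPoly {h₀ : ℕ → ℂ} {ζ : ℂ}
    (hd : (coeffPoly d h₀).derivative.eval ζ ≠ 0) :
    ∃ δ₀ > 0, ∀ᶠ h in 𝓝 h₀, Set.InjOn (fun u => (coeffPoly d h).eval u) (Metric.ball ζ δ₀) := by
  -- The difference quotient is polynomial in the coefficients and in both points. It does not
  -- vanish at the double point `(ζ, ζ)`, where it is the derivative, and so not nearby.
  have hQ : Continuous fun p : (ℕ → ℂ) × (ℂ × ℂ) => ∑ j ∈ Finset.range d,
      p.1 j * ∑ i ∈ Finset.range j, p.2.1 ^ i * p.2.2 ^ (j - 1 - i) := by fun_prop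
  have h0 : (∑ j ∈ Finset.range d,
      h₀ j * ∑ i ∈ Finset.range j, ζ ^ i * ζ ^ (j - 1 - i)) ≠ 0 := by
    simpa only [geom_sum₂_self, eval_derivative_coeffPoly] using hd
  have hev := (hQ.tendsto (h₀, (ζ, ζ))).eventually_ne h0
  rw [nhds_prod_eq, eventually_prod_iff] at hev
  obtain ⟨pa, hpa, pb, hpb, hab⟩ := hev
  rw [nhds_prod_eq] at hpb
  obtain ⟨q, hq, hqq⟩ := eventually_prod_self_iff'.1 hpb
  obtain ⟨δ, hδ, hball⟩ := Metric.eventually_nhds_iff_ball.1 hq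
  refine ⟨δ, hδ, ?_⟩
  filter_upwards [hpa] with h hh x hx y hy hxy
  have h1 := eval_coeffPoly_sub (d := d) h x y
  simp only at hxy
  rw [hxy, sub_self] at h1
  have h2 := hab hh (hqq x (hball x hx) y (hball y hy))
  exact sub_eq_zero.1 ((mul_eq_zero.1 h1.symm).resolve_left h2)

/-- A simple root persists. -/
theorem eventually_exists_root {h₀ : ℕ → ℂ} {ζ : ℂ} (hz : (coeffPoly d h₀).eval ζ = 0)
    (hd : (coeffPoly d h₀).derivative.eval ζ ≠ 0) {δ : ℝ} (hδ : 0 < δ) :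
    ∀ᶠ h in 𝓝 h₀, ∃ y ∈ Metric.ball ζ δ, (coeffPoly d h).eval y = 0 := by
  obtain ⟨δ₀, hδ₀, hinj⟩ := eventually_injOn_coeffPoly hd
  set ρ := min δ δ₀ / 2 with hρ
  have hρ0 : 0 < ρ := by positivity
  have hρδ : ρ < δ := by have := min_le_left δ δ₀; linarith
  have hρδ₀ : ρ < δ₀ := by have := min_le_right δ δ₀; linarith
  have hζ : ζ ∈ Metric.ball ζ δ₀ := Metric.mem_ball_self hδ₀
  have hc0 : Continuous fun u => ‖(coeffPoly d h₀).eval u‖ := by fun_prop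
  obtain ⟨z₀, hz₀, hmin⟩ := (isCompact_sphere ζ ρ).exists_isMinOn
    (NormedSpace.sphere_nonempty.2 hρ0.le) hc0.continuousOn
  have hsub : Metric.sphere ζ ρ ⊆ Metric.ball ζ δ₀ := fun z hz => by
    rw [Metric.mem_sphere] at hz
    rw [Metric.mem_ball, hz]
    exact hρδ₀
  have hm : 0 < ‖(coeffPoly d h₀).eval z₀‖ := by
    rw [norm_pos_iff]
    intro h0
    have h1 := hinj.self_of_nhds (hsub hz₀) hζ (by simp only; rw [h0, hz])
    rw [h1, Metric.mem_sphere, dist_self] at hz₀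
    exact hρ0.ne hz₀
  set μ := ‖(coeffPoly d h₀).eval z₀‖ with hμ
  have hζ' : ∀ᶠ h in 𝓝 h₀, ‖(coeffPoly d h).eval ζ‖ < μ / 4 := by
    have hc : Continuous fun h : ℕ → ℂ => ‖(coeffPoly d h).eval ζ‖ :=
      (continuous_eval_coeffPoly.comp (by fun_prop : Continuous fun h : ℕ → ℂ => (h, ζ))).norm
    refine (hc.tendsto h₀).eventually (gt_mem_nhds ?_)
    rw [hz, norm_zero]
    positivity
  have hsph : ∀ᶠ h in 𝓝 h₀, ∀ z ∈ Metric.sphere ζ ρ,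
      μ / 2 ≤ ‖(coeffPoly d h).eval z - (coeffPoly d h).eval ζ‖ := by
    refine (isCompact_sphere ζ ρ).eventually_forall_of_forall_eventually fun z hz' => ?_
    have hc : Continuous fun p : (ℕ → ℂ) × ℂ =>
        ‖(coeffPoly d p.1).eval p.2 - (coeffPoly d p.1).eval ζ‖ :=
      (continuous_eval_coeffPoly.sub (continuous_eval_coeffPoly.comp
        (by fun_prop : Continuous fun p : (ℕ → ℂ) × ℂ => (p.1, ζ)))).norm
    refine ((hc.tendsto (h₀, z)).eventually (lt_mem_nhds (a := μ / 2) ?_)).mono fun _ => le_of_lt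
    rw [hz, sub_zero]
    have := hmin hz'
    rw [Set.mem_ofPred_eq] at this
    linarith
  filter_upwards [hinj, hζ', hsph] with h h1 h2 h3
  have hfreq : ∃ᶠ z in 𝓝 ζ, (coeffPoly d h).eval z ≠ (coeffPoly d h).eval ζ := by
    have : ∀ᶠ z in 𝓝[≠] ζ, (coeffPoly d h).eval z ≠ (coeffPoly d h).eval ζ := by
      filter_upwards [self_mem_nhdsWithin, nhdsWithin_le_nhds (Metric.ball_mem_nhds ζ hδ₀)]
        with z hz1 hz2 he
      exact hz1 (h1 hz2 hζ he)
    exact this.frequently.filter_mono nhdsWithin_le_nhds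
  -- Quantitative open mapping: on the circle of radius `ρ` the values are at distance at least `μ /
  -- 2` from the value at `ζ`, so the image of the closed disc contains the disc of radius `μ / 4`
  -- around that value, and therefore `0`.
  have := ((coeffPoly d h).differentiable.diffContOnCl (s := Metric.ball ζ ρ))
  obtain ⟨y, hy, hy0⟩ := this.ball_subset_image_closedBall hρ0 h3 hfreq
    (show (0 : ℂ) ∈ Metric.ball ((coeffPoly d h).eval ζ) (μ / 2 / 2) by
      rw [Metric.mem_ball, dist_zero_left]
      linarith)
  exact ⟨y, lt_of_le_of_lt hy hρδ, hy0⟩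

/-- The roots in a compact set stay in the neighborhood of the given ones. -/
theorem eventually_root_mem {X : Type*} [TopologicalSpace X] {x₀ : X} {h : X → ℕ → ℂ}
    (hh : ContinuousAt h x₀) {K U : Set ℂ} (hK : IsCompact K) (hU : IsOpen U)
    (hr : ∀ y ∈ K, (coeffPoly d (h x₀)).eval y = 0 → y ∈ U) :
    ∀ᶠ x in 𝓝 x₀, ∀ y ∈ K, (coeffPoly d (h x)).eval y = 0 → y ∈ U := by
  refine hK.eventually_forall_of_forall_eventually fun y hy => ?_
  by_cases hyU : y ∈ U
  · filter_upwards [continuousAt_snd.eventually (hU.mem_nhds hyU)] with z hz _ using hz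
  · have hc : ContinuousAt (fun z : X × ℂ => (coeffPoly d (h z.1)).eval z.2) (x₀, y) :=
      ContinuousAt.comp (f := fun z : X × ℂ => (h z.1, z.2)) (x := (x₀, y))
        continuous_eval_coeffPoly.continuousAt
        ((ContinuousAt.comp (f := Prod.fst) (x := (x₀, y)) hh continuousAt_fst).prodMk
          continuousAt_snd)
    filter_upwards [hc.eventually_ne fun h0 => hyU (hr y hy h0)] with z hz h0
    exact absurd h0 hz

end CoeffPoly

/-! ## The circuit polynomial `u ^ (a + b) + u ^ b` and its critical points -/

section Circuit

/-- The coefficients of the circuit polynomial `u ^ (a + b) + u ^ b`. -/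
def circuitCoeff (a b : ℕ) (j : ℕ) : ℂ := if j = b ∨ j = a + b then 1 else 0

/-- The common norm of the nonzero critical points of the circuit polynomial. -/
noncomputable def critRadius (a b : ℕ) : ℝ := ((b : ℝ) / (a + b)) ^ (1 / (a : ℝ))

/-- The common norm of the nonzero critical values of the circuit polynomial. -/
noncomputable def critNorm (a b : ℕ) : ℝ := critRadius a b ^ b * (a / (a + b))

variable {a b d : ℕ}

theorem sum_circuitCoeff (ha : 0 < a) (hd : a + b < d) (F : ℕ → ℂ) :
    ∑ j ∈ Finset.range d, circuitCoeff a b j * F j = F b + F (a + b) := by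
  have h : ∀ j, circuitCoeff a b j * F j =
      (if j = b then F b else 0) + (if j = a + b then F (a + b) else 0) := by
    intro j
    unfold circuitCoeff
    by_cases h1 : j = b
    · subst h1
      simp [ha.ne']
    · by_cases h2 : j = a + b
      · subst h2
        simp [ha.ne']
      · simp [h1, h2]
  simp only [h, Finset.sum_add_distrib, Finset.sum_ite_eq', Finset.mem_range]
  rw [if_pos (by omega), if_pos hd]

theorem eval_circuit (ha : 0 < a) (hd : a + b < d) (u : ℂ) :
    (coeffPoly d (circuitCoeff a b)).eval u = u ^ b * (1 + u ^ a) := by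
  rw [eval_coeffPoly, sum_circuitCoeff ha hd]
  ring

theorem eval_derivative_circuit (ha : 0 < a) (hb : 0 < b) (hd : a + b < d) (u : ℂ) :
    (coeffPoly d (circuitCoeff a b)).derivative.eval u = u ^ (b - 1) * (b + (a + b) * u ^ a) := by
  rw [eval_derivative_coeffPoly, sum_circuitCoeff ha hd]
  obtain ⟨b, rfl⟩ := Nat.exists_eq_succ_of_ne_zero hb.ne'
  rw [show a + b.succ - 1 = b + a by omega, Nat.succ_sub_one]
  push_cast
  ring

theorem critRadius_pow (ha : 0 < a) : critRadius a b ^ a = (b : ℝ) / (a + b) := by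
  rw [critRadius, ← Real.rpow_natCast, ← Real.rpow_mul (by positivity)]
  have : (a : ℝ) ≠ 0 := by positivity
  rw [one_div_mul_cancel this, Real.rpow_one]

theorem critRadius_pos (hb : 0 < b) : 0 < critRadius a b := by
  rw [critRadius]
  positivity

theorem critRadius_lt_one (ha : 0 < a) : critRadius a b < 1 := by
  rw [critRadius]
  refine Real.rpow_lt_one (by positivity) ?_ (by positivity)
  rw [div_lt_one (by positivity)]
  have : (0 : ℝ) < a := by positivity
  linarith

theorem critNorm_pos (ha : 0 < a) (hb : 0 < b) : 0 < critNorm a b := by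
  have := critRadius_pos (a := a) hb
  rw [critNorm]
  positivity

theorem norm_eq_one_of_mem_powRoots (ha : 0 < a) {ω : ℂ} (hω : ω ^ a = -1) : ‖ω‖ = 1 := by
  have : ‖ω‖ ^ a = 1 := by rw [← norm_pow, hω]; simp
  exact (pow_eq_one_iff_of_nonneg (norm_nonneg _) ha.ne').1 this

theorem crit_pow (ha : 0 < a) {ω : ℂ} (hω : ω ^ a = -1) :
    ((critRadius a b : ℂ) * ω) ^ a = -((b : ℂ) / (a + b)) := by
  rw [mul_pow, hω, ← Complex.ofReal_pow, critRadius_pow ha]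
  push_cast
  ring

theorem norm_crit (ha : 0 < a) (hb : 0 < b) {ω : ℂ} (hω : ω ^ a = -1) :
    ‖(critRadius a b : ℂ) * ω‖ = critRadius a b := by
  rw [norm_mul, norm_eq_one_of_mem_powRoots ha hω, mul_one, Complex.norm_real,
    Real.norm_of_nonneg (critRadius_pos hb).le]

theorem crit_ne_zero (ha : 0 < a) (hb : 0 < b) {ω : ℂ} (hω : ω ^ a = -1) :
    (critRadius a b : ℂ) * ω ≠ 0 := by
  rw [← norm_pos_iff, norm_crit ha hb hω]
  exact critRadius_pos hb

theorem eval_circuit_crit (ha : 0 < a) (hd : a + b < d) {ω : ℂ} (hω : ω ^ a = -1) :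
    (coeffPoly d (circuitCoeff a b)).eval (critRadius a b * ω) =
      ω ^ b * critNorm a b := by
  have : (a : ℂ) + b ≠ 0 := by exact_mod_cast (by omega : a + b ≠ 0)
  rw [eval_circuit ha hd, crit_pow ha hω, critNorm]
  push_cast
  rw [mul_pow]
  field_simp
  ring

theorem norm_eval_circuit_crit (ha : 0 < a) (hb : 0 < b) (hd : a + b < d) {ω : ℂ}
    (hω : ω ^ a = -1) :
    ‖(coeffPoly d (circuitCoeff a b)).eval (critRadius a b * ω)‖ = critNorm a b := by
  rw [eval_circuit_crit ha hd hω, norm_mul, norm_pow, norm_eq_one_of_mem_powRoots ha hω, one_pow,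
    one_mul, Complex.norm_real, Real.norm_of_nonneg (critNorm_pos ha hb).le]

theorem eval_circuit_crit_ne_zero (ha : 0 < a) (hb : 0 < b) (hd : a + b < d) {ω : ℂ}
    (hω : ω ^ a = -1) : (coeffPoly d (circuitCoeff a b)).eval (critRadius a b * ω) ≠ 0 := by
  rw [← norm_pos_iff, norm_eval_circuit_crit ha hb hd hω]
  exact critNorm_pos ha hb

theorem eval_derivative_circuit_crit (ha : 0 < a) (hb : 0 < b) (hd : a + b < d) {ω : ℂ}
    (hω : ω ^ a = -1) :
    (coeffPoly d (circuitCoeff a b)).derivative.eval (critRadius a b * ω) = 0 := by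
  have : (a : ℂ) + b ≠ 0 := by exact_mod_cast (by omega : a + b ≠ 0)
  rw [eval_derivative_circuit ha hb hd, crit_pow ha hω]
  field_simp
  simp

/-- The normalized second derivative at a critical point of the circuit polynomial. -/
theorem eval_derivative2_circuit_crit (ha : 0 < a) (hb : 0 < b) (hd : a + b < d) {ω : ℂ}
    (hω : ω ^ a = -1) :
    (critRadius a b * ω) ^ 2 *
        (coeffPoly d (circuitCoeff a b)).derivative.derivative.eval (critRadius a b * ω) =
      -(b * (a + b)) * (coeffPoly d (circuitCoeff a b)).eval (critRadius a b * ω) := by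
  set v := (critRadius a b : ℂ) * ω with hv
  have hN : (a : ℂ) + b ≠ 0 := by exact_mod_cast (by omega : a + b ≠ 0)
  have h1 : ∀ j : ℕ, v ^ 2 * (j * ((j - 1 : ℕ) * v ^ (j - 1 - 1))) = j * (j - 1) * v ^ j := by
    intro j
    rcases j with _ | _ | j
    · simp
    · simp
    · simp only [Nat.add_sub_cancel]
      push_cast
      ring
  rw [eval_derivative2_coeffPoly, sum_circuitCoeff ha hd, mul_add, h1, h1, eval_circuit ha hd,
    pow_add, crit_pow ha hω]
  push_cast
  field_simp
  ring

/-- Critical points persist. -/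
theorem eventually_exists_crit (ha : 0 < a) (hb : 0 < b) (hd : a + b < d) {ω : ℂ}
    (hω : ω ^ a = -1) {δ : ℝ} (hδ : 0 < δ) : ∀ᶠ g in 𝓝 (circuitCoeff a b),
      ∃ U ∈ Metric.ball (critRadius a b * ω : ℂ) δ, (coeffPoly d g).derivative.eval U = 0 := by
  obtain ⟨d, rfl⟩ := Nat.exists_eq_succ_of_ne_zero (show d ≠ 0 by omega)
  have hc : Continuous fun (g : ℕ → ℂ) (j : ℕ) => ((j : ℂ) + 1) * g (j + 1) := by fun_prop
  simp only [Nat.succ_eq_add_one, derivative_coeffPoly]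
  refine (hc.tendsto (circuitCoeff a b)).eventually
    (p := fun h => ∃ U ∈ Metric.ball (critRadius a b * ω : ℂ) δ, (coeffPoly d h).eval U = 0)
    (eventually_exists_root ?_ ?_ hδ)
  · rw [← derivative_coeffPoly]
    exact eval_derivative_circuit_crit ha hb hd hω
  · rw [← derivative_coeffPoly]
    intro h0
    have h1 := eval_derivative2_circuit_crit ha hb hd hω
    rw [Nat.succ_eq_add_one, h0, mul_zero] at h1
    have hN : (a : ℂ) + b ≠ 0 := by exact_mod_cast (by omega : a + b ≠ 0)
    have hb' : (b : ℂ) ≠ 0 := by exact_mod_cast hb.ne'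
    exact mul_ne_zero (neg_ne_zero.2 (mul_ne_zero hb' hN))
      (eval_circuit_crit_ne_zero ha hb hd hω) h1.symm

theorem norm_pow_sub_one_le {q : ℂ} (hq : ‖q‖ = 1) (j : ℕ) : ‖q ^ j - 1‖ ≤ j * ‖q - 1‖ := by
  rw [← geom_sum_mul, norm_mul]
  refine mul_le_mul_of_nonneg_right ((norm_sum_le _ _).trans ?_) (norm_nonneg _)
  simp [hq]

theorem norm_pow_sub_one_sub_le {q : ℂ} (hq : ‖q‖ = 1) (j : ℕ) :
    ‖q ^ j - 1 - j * (q - 1)‖ ≤ j ^ 2 * ‖q - 1‖ ^ 2 := by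
  have h1 : q ^ j - 1 - j * (q - 1) = (∑ i ∈ Finset.range j, (q ^ i - 1)) * (q - 1) := by
    rw [← geom_sum_mul, Finset.sum_sub_distrib]
    simp
    ring
  rw [h1, norm_mul]
  have h2 : ‖∑ i ∈ Finset.range j, (q ^ i - 1)‖ ≤ ∑ i ∈ Finset.range j, (j : ℝ) * ‖q - 1‖ := by
    refine norm_sum_le_of_le _ fun i hi => (norm_pow_sub_one_le hq i).trans ?_
    have : (i : ℝ) ≤ j := by exact_mod_cast (Finset.mem_range.1 hi).le
    gcongr
  rw [Finset.sum_const, Finset.card_range, nsmul_eq_mul] at h2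
  calc _ ≤ (j * (j * ‖q - 1‖)) * ‖q - 1‖ := by gcongr
    _ = _ := by ring

/-- On the unit circle the square of the right side is exactly `1 + (l + l²) ‖1 - x‖²`. So the
minimum at `x = 1` is nondegenerate and survives small perturbations of second order. -/
theorem one_add_le_norm_one_add_mul {l : ℝ} (hl : 0 < l) : ∃ κ > 0, ∀ x : ℂ, ‖x‖ = 1 →
    1 + κ * ‖1 - x‖ ^ 2 ≤ ‖1 + l * (1 - x)‖ := by
  -- For `y = ‖1 - x‖² ≤ 4` and `κ ≤ 1` one has `(1 + κ y)² ≤ 1 + 6 κ y`, hence the `6`.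
  refine ⟨min 1 ((l + l ^ 2) / 6), by positivity, fun x hx => ?_⟩
  set κ := min 1 ((l + l ^ 2) / 6)
  have h1 : κ ≤ 1 := min_le_left _ _
  have h2 : κ ≤ (l + l ^ 2) / 6 := min_le_right _ _
  have h0 : 0 < κ := by positivity
  have hx2 : x.re ^ 2 + x.im ^ 2 = 1 := by
    have := Complex.sq_norm x
    rw [hx, Complex.normSq_apply] at this
    linarith
  have hy : ‖1 - x‖ ^ 2 = 2 - 2 * x.re := by
    rw [Complex.sq_norm, Complex.normSq_apply]
    simp
    linarith
  have hre : -1 ≤ x.re := by nlinarith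
  have hre' : x.re ≤ 1 := by nlinarith
  refine le_of_sq_le_sq ?_ (norm_nonneg _) 
  have hn : ‖1 + (l : ℂ) * (1 - x)‖ ^ 2 = 1 + (l + l ^ 2) * (2 - 2 * x.re) := by
    rw [Complex.sq_norm, Complex.normSq_apply]
    simp
    linear_combination l ^ 2 * hx2
  rw [hn, hy]
  set y := 2 - 2 * x.re
  have hy0 : 0 ≤ y := by simp only [y]; linarith
  have hy4 : y ≤ 4 := by simp only [y]; linarith
  nlinarith [mul_nonneg hy0 h0.le, mul_nonneg (mul_nonneg hy0 h0.le) (sub_nonneg.2 hy4),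
    mul_nonneg (mul_nonneg hy0 h0.le) (sub_nonneg.2 h1), mul_nonneg hy0 (sub_nonneg.2 h2)]

end Circuit

/-! ### The norm of a perturbed circuit polynomial on the circle through a critical point. -/

section CircuitPetals

variable {a b d : ℕ}

/-- Normalized at a critical point, the circuit polynomial has on the circle through this point the
norm `‖1 + (b/a) (1 - q^a)‖`, to which `one_add_le_norm_one_add_mul` applies. -/
theorem eval_circuit_mul_crit (ha : 0 < a) (hb : 0 < b) (hd : a + b < d) {ω : ℂ} (hω : ω ^ a = -1)
    (q : ℂ) : ∑ j ∈ Finset.range d, circuitCoeff a b j * (critRadius a b * ω) ^ j /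
        (coeffPoly d (circuitCoeff a b)).eval (critRadius a b * ω) * q ^ j =
      q ^ b * (1 + ((b / a : ℝ) : ℂ) * (1 - q ^ a)) := by
  have hv := crit_ne_zero (b := b) ha hb hω
  have hp := crit_pow (b := b) ha hω
  set v := (critRadius a b : ℂ) * ω
  have hN : (a : ℂ) + b ≠ 0 := by exact_mod_cast (by omega : a + b ≠ 0)
  have ha' : (a : ℂ) ≠ 0 := by exact_mod_cast ha.ne'
  simp only [mul_div_assoc, mul_assoc]
  rw [sum_circuitCoeff ha hd (fun j => v ^ j / (coeffPoly d (circuitCoeff a b)).eval v * q ^ j),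
    eval_circuit ha hd, pow_add, hp]
  push_cast
  have h1 : (1 : ℂ) + -((b : ℂ) / (a + b)) = a / (a + b) := by field_simp; ring
  rw [h1]
  field_simp
  ring

/-- Near a critical point `U`, the norm of a polynomial is minimal at `U` among the points of norm
`‖U‖`. -/
theorem eventually_norm_eval_crit_le (ha : 0 < a) (hb : 0 < b) (hd : a + b < d) {ω : ℂ}
    (hω : ω ^ a = -1) :
    ∀ᶠ p : (ℕ → ℂ) × (ℂ × ℂ) in
      𝓝 (circuitCoeff a b, ((critRadius a b : ℂ) * ω, (critRadius a b : ℂ) * ω)),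
      (coeffPoly d p.1).derivative.eval p.2.1 = 0 → ‖p.2.2‖ = ‖p.2.1‖ →
        ‖(coeffPoly d p.1).eval p.2.1‖ ≤ ‖(coeffPoly d p.1).eval p.2.2‖ := by
  have hv := crit_ne_zero (b := b) ha hb hω
  have hG := eval_circuit_crit_ne_zero (d := d) ha hb hd hω
  have hmain := eval_circuit_mul_crit ha hb hd hω
  set u₀ := (critRadius a b : ℂ) * ω
  obtain ⟨κ, hκ, hmin⟩ := one_add_le_norm_one_add_mul (l := (b : ℝ) / a) (by positivity)
  set α₀ : ℕ → ℂ := fun j => circuitCoeff a b j * u₀ ^ j / (coeffPoly d (circuitCoeff a b)).eval u₀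
  have hcG : Continuous fun p : (ℕ → ℂ) × (ℂ × ℂ) => (coeffPoly d p.1).eval p.2.1 :=
    continuous_eval_coeffPoly.comp (by fun_prop : Continuous fun p : (ℕ → ℂ) × (ℂ × ℂ) =>
      (p.1, p.2.1))
  have hE : ContinuousAt (fun p : (ℕ → ℂ) × (ℂ × ℂ) => ∑ j ∈ Finset.range d,
      ‖p.1 j * p.2.1 ^ j / (coeffPoly d p.1).eval p.2.1 - α₀ j‖ * (j : ℝ) ^ 2)
      (circuitCoeff a b, (u₀, u₀)) := by
    refine tendsto_finsetSum _ fun j _ => ?_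
    refine ContinuousAt.mul (ContinuousAt.norm (ContinuousAt.sub (ContinuousAt.div ?_
      hcG.continuousAt hG) continuousAt_const)) continuousAt_const
    fun_prop
  have hS : ContinuousAt (fun p : (ℕ → ℂ) × (ℂ × ℂ) =>
      ‖∑ i ∈ Finset.range a, (p.2.2 / p.2.1) ^ i‖) (circuitCoeff a b, (u₀, u₀)) := by
    have hq : ContinuousAt (fun p : (ℕ → ℂ) × (ℂ × ℂ) => p.2.2 / p.2.1)
        (circuitCoeff a b, (u₀, u₀)) := ContinuousAt.div (by fun_prop) (by fun_prop) hv
    exact ContinuousAt.norm (tendsto_finsetSum _ fun j _ => hq.pow j)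
  have hE0 : ∑ j ∈ Finset.range d, ‖α₀ j - α₀ j‖ * (j : ℝ) ^ 2 < κ / 4 := by
    simp only [sub_self, norm_zero, zero_mul, Finset.sum_const_zero]
    positivity
  have hE' := hE.eventually (gt_mem_nhds hE0)
  have hS0 : (1 / 2 : ℝ) < ‖∑ i ∈ Finset.range a, (u₀ / u₀) ^ i‖ := by
    simp only [div_self hv, one_pow, Finset.sum_const, Finset.card_range, nsmul_eq_mul, mul_one,
      Complex.norm_natCast]
    have : (1 : ℝ) ≤ a := by exact_mod_cast ha
    linarith
  have hS' := hS.eventually (lt_mem_nhds hS0)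
  have hU : ∀ᶠ p : (ℕ → ℂ) × (ℂ × ℂ) in 𝓝 (circuitCoeff a b, (u₀, u₀)), p.2.1 ≠ 0 :=
    ContinuousAt.eventually_ne (by fun_prop) hv
  filter_upwards [hE', hS', hcG.continuousAt.eventually_ne hG, hU] with ⟨g, U, v⟩ h1 h2 h3 h4 h5 h6
  dsimp only at h1 h2 h3 h4 h5 h6 ⊢
  set q := v / U with hq
  have hvq : v = U * q := by rw [hq]; field_simp
  have hqn : ‖q‖ = 1 := by
    rw [hq, norm_div, h6, div_self (norm_ne_zero_iff.2 h4)]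
  -- `D` is the deviation of the coefficients, normalized at `U`, from those of the circuit
  -- polynomial. Both normalized polynomials have the value `1` and a critical point at `q = 1`, so
  -- `∑ D j = 0` and `∑ j D j = 0`, and the deviation is of second order in `q - 1`, with a small
  -- constant.
  set D : ℕ → ℂ := fun j => g j * U ^ j / (coeffPoly d g).eval U - α₀ j with hD
  have hq1 : (coeffPoly d g).eval v / (coeffPoly d g).eval U =
      ∑ j ∈ Finset.range d, g j * U ^ j / (coeffPoly d g).eval U * q ^ j := by
    rw [eval_coeffPoly g v, Finset.sum_div]
    refine Finset.sum_congr rfl fun j _ => ?_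
    rw [hvq, mul_pow]
    ring
  have hα0 : ∑ j ∈ Finset.range d, α₀ j = 1 := by
    have := hmain 1
    simpa using this
  have hα1 : ∑ j ∈ Finset.range d, α₀ j * j = 0 := by
    have h0 := eval_derivative_circuit_crit ha hb hd hω
    rw [eval_derivative_coeffPoly] at h0
    have : ∀ j : ℕ, α₀ j * j = circuitCoeff a b j * (j * u₀ ^ (j - 1)) *
        (u₀ / (coeffPoly d (circuitCoeff a b)).eval u₀) := by
      intro j
      rcases j with _ | j
      · simp
      · simp only [α₀, Nat.add_sub_cancel]
        ring
    rw [Finset.sum_congr rfl fun j _ => this j, ← Finset.sum_mul, h0, zero_mul]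
  have hD0 : ∑ j ∈ Finset.range d, D j = 0 := by
    rw [hD, Finset.sum_sub_distrib, hα0, ← Finset.sum_div, ← eval_coeffPoly, div_self h3, sub_self]
  have hD1 : ∑ j ∈ Finset.range d, D j * j = 0 := by
    rw [eval_derivative_coeffPoly] at h5
    have : ∀ j : ℕ, D j * j = g j * (j * U ^ (j - 1)) * (U / (coeffPoly d g).eval U) -
        α₀ j * j := by
      intro j
      rcases j with _ | j
      · simp
      · simp only [D, Nat.add_sub_cancel]
        ring
    rw [Finset.sum_congr rfl fun j _ => this j, Finset.sum_sub_distrib, ← Finset.sum_mul, h5,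
      zero_mul, hα1, sub_self]
  have herr : ‖∑ j ∈ Finset.range d, D j * q ^ j‖ ≤ κ / 4 * ‖q - 1‖ ^ 2 := by
    have e1 : ∑ j ∈ Finset.range d, D j * q ^ j =
        ∑ j ∈ Finset.range d, D j * (q ^ j - 1 - j * (q - 1)) := by
      have : ∀ j, D j * (q ^ j - 1 - j * (q - 1)) = D j * q ^ j - D j - D j * j * (q - 1) :=
        fun j => by ring
      rw [Finset.sum_congr rfl fun j _ => this j, Finset.sum_sub_distrib, Finset.sum_sub_distrib,
        ← Finset.sum_mul, hD0, hD1]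
      ring
    rw [e1]
    calc _ ≤ ∑ j ∈ Finset.range d, ‖D j‖ * (j : ℝ) ^ 2 * ‖q - 1‖ ^ 2 := by
          refine norm_sum_le_of_le _ fun j _ => ?_
          rw [norm_mul, mul_assoc]
          exact mul_le_mul_of_nonneg_left (norm_pow_sub_one_sub_le hqn j) (norm_nonneg _)
      _ = (∑ j ∈ Finset.range d, ‖D j‖ * (j : ℝ) ^ 2) * ‖q - 1‖ ^ 2 := by rw [Finset.sum_mul]
      _ ≤ _ := by gcongr
  have hsplit : (coeffPoly d g).eval v / (coeffPoly d g).eval U =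
      q ^ b * (1 + ((b / a : ℝ) : ℂ) * (1 - q ^ a)) + ∑ j ∈ Finset.range d, D j * q ^ j := by
    rw [hq1, ← hmain, ← Finset.sum_add_distrib]
    refine Finset.sum_congr rfl fun j _ => ?_
    simp only [D, α₀]
    ring
  -- The geometric sum has norm at least `1/2` near `q = 1`, so the gain `κ ‖1 - q^a‖²` is at least
  -- `(κ/4) ‖q - 1‖²`, which absorbs the error `herr`.
  have hqa : ‖q - 1‖ ^ 2 / 4 ≤ ‖1 - q ^ a‖ ^ 2 := by
    have e2 : ‖1 - q ^ a‖ = ‖∑ i ∈ Finset.range a, q ^ i‖ * ‖q - 1‖ := by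
      rw [norm_sub_rev, ← geom_sum_mul, norm_mul]
    rw [e2, mul_pow]
    have : (1 / 4 : ℝ) ≤ ‖∑ i ∈ Finset.range a, q ^ i‖ ^ 2 := by nlinarith
    nlinarith [sq_nonneg ‖q - 1‖]
  have hfin : 1 ≤ ‖(coeffPoly d g).eval v / (coeffPoly d g).eval U‖ := by
    have e3 : ‖q ^ b * (1 + ((b / a : ℝ) : ℂ) * (1 - q ^ a))‖ =
        ‖1 + ((b / a : ℝ) : ℂ) * (1 - q ^ a)‖ := by
      rw [norm_mul, norm_pow, hqn, one_pow, one_mul]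
    have e4 := hmin (q ^ a) (by rw [norm_pow, hqn, one_pow])
    have e5 := norm_sub_le_norm_add (q ^ b * (1 + ((b / a : ℝ) : ℂ) * (1 - q ^ a)))
      (∑ j ∈ Finset.range d, D j * q ^ j)
    rw [← hsplit, e3] at e5
    nlinarith
  rw [norm_div, one_le_div (norm_pos_iff.2 h3)] at hfin
  exact hfin

end CircuitPetals

/-! ### The frontier of a petal, and the collision of roots across the critical circle. -/

section CircuitPetals

variable {a b d : ℕ}

theorem finite_powRoots (ha : 0 < a) (c : ℂ) : (powRoots a c).Finite := by
  have h : (X ^ a - C c : ℂ[X]) ≠ 0 := X_pow_sub_C_ne_zero ha c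
  refine ((X ^ a - C c : ℂ[X]).roots.toFinset.finite_toSet).subset fun ζ hζ => ?_
  have hζ' : ζ ^ a = c := hζ
  simp [h, hζ']

theorem re_le_of_norm_sub_le {x y v : ℂ} (hx : ‖x‖ = 1) (hy : ‖y‖ = 1) :
    ‖v - x‖ ≤ ‖v - y‖ ↔ (v * (starRingEnd ℂ) y).re ≤ (v * (starRingEnd ℂ) x).re := by
  rw [← sq_le_sq₀ (norm_nonneg _) (norm_nonneg _), Complex.sq_norm, Complex.sq_norm,
    Complex.normSq_sub, Complex.normSq_sub, ← Complex.sq_norm x, ← Complex.sq_norm y, hx, hy]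
  constructor <;> intro h <;> linarith

/-- A point with two nearest `a`-th roots of `-1` is on a ray through an `a`-th root of unity. -/
theorem pow_eq_norm_pow_of_equidistant (ha : 0 < a) {v ω ω' : ℂ} (hω : ω ∈ powRoots a (-1))
    (hω' : ω' ∈ powRoots a (-1)) (hne : ω' ≠ ω) (heq : ‖v - ω‖ = ‖v - ω'‖)
    (hmin : ∀ ω'' ∈ powRoots a (-1), ‖v - ω‖ ≤ ‖v - ω''‖) : v ^ a = ((‖v‖ ^ a : ℝ) : ℂ) := by
  rcases eq_or_ne v 0 with rfl | hv
  · simp [ha.ne']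
  have h1 : ‖ω‖ = 1 := norm_eq_one_of_mem_powRoots ha hω
  have h1' : ‖ω'‖ = 1 := norm_eq_one_of_mem_powRoots ha hω'
  have hω0 : ω ≠ 0 := by rw [← norm_pos_iff, h1]; exact one_pos
  have hcc : ∀ z : ℂ, ‖z‖ = 1 → z * (starRingEnd ℂ) z = 1 := fun z hz => by
    rw [Complex.mul_conj, ← Complex.sq_norm, hz]; simp
  set x := v * (starRingEnd ℂ) ω with hx
  have hxn : ‖x‖ = ‖v‖ := by rw [hx, norm_mul, RCLike.norm_conj, h1, mul_one]
  have hx0 : x ≠ 0 := by rw [← norm_pos_iff, hxn]; exact norm_pos_iff.2 hv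
  have hvx : v = x * ω := by rw [hx, mul_assoc, mul_comm _ ω, hcc ω h1, mul_one]
  have hmax : ∀ ω'' ∈ powRoots a (-1), (v * (starRingEnd ℂ) ω'').re ≤ x.re := fun ω'' h'' =>
    (re_le_of_norm_sub_le h1 (norm_eq_one_of_mem_powRoots ha h'')).1 (hmin ω'' h'')
  set y := v * (starRingEnd ℂ) ω' with hy
  have hyn : ‖y‖ = ‖v‖ := by rw [hy, norm_mul, RCLike.norm_conj, h1', mul_one]
  have hvy : v = y * ω' := by rw [hy, mul_assoc, mul_comm _ ω', hcc ω' h1', mul_one]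
  -- `x` and `y` are `v` rotated by the inverses of `ω` and `ω'`. Equal distances mean equal real
  -- parts; as the norms agree too, `y` is the conjugate of `x`. Since `x^a = y^a`, the number `x^a
  -- = -v^a` is real.
  have hyx : y.re = x.re := le_antisymm (hmax ω' hω')
    ((re_le_of_norm_sub_le h1' h1).1 heq.ge)
  have hya : y ^ a = x ^ a := by
    have e1 : v ^ a = -x ^ a := by rw [hvx, mul_pow, show ω ^ a = -1 from hω]; ring
    have e2 : v ^ a = -y ^ a := by rw [hvy, mul_pow, show ω' ^ a = -1 from hω']; ring
    rw [e1] at e2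
    exact (neg_injective e2).symm
  have him : y.im = -x.im := by
    have e3 : y.im ^ 2 = x.im ^ 2 := by
      have e4 : ‖y‖ ^ 2 = ‖x‖ ^ 2 := by rw [hyn, hxn]
      rw [Complex.sq_norm, Complex.sq_norm, Complex.normSq_apply, Complex.normSq_apply, hyx] at e4
      nlinarith
    rcases sq_eq_sq_iff_eq_or_eq_neg.1 e3 with h | h
    · exfalso
      have : y = x := Complex.ext hyx h
      rw [this] at hvy
      exact hne (mul_left_cancel₀ hx0 (hvy.symm.trans hvx))
    · exact h
  have hyc : y = (starRingEnd ℂ) x := Complex.ext (by simpa using hyx) (by simpa using him)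
  have hreal : (starRingEnd ℂ) (x ^ a) = x ^ a := by rw [map_pow, ← hyc, hya]
  obtain ⟨t, ht⟩ := Complex.conj_eq_iff_real.1 hreal
  have hva : v ^ a = -t := by rw [hvx, mul_pow, show ω ^ a = -1 from hω, ht]; ring
  have htn : |t| = ‖v‖ ^ a := by
    rw [← norm_pow, hva, norm_neg, Complex.norm_real, Real.norm_eq_abs]
  -- If `t ≥ 0`, then `v` is on the ray of a root of `-1`, which would be its only nearest one. In
  -- the other case `v^a` is the positive number claimed.
  rcases abs_choice t with h | h
  · exfalso
    rw [h] at htn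
    have hn0 : (‖x‖ : ℂ) ≠ 0 := by exact_mod_cast (norm_pos_iff.2 hx0).ne'
    have hζ : v / ‖x‖ ∈ powRoots a (-1) := by
      change (v / ‖x‖) ^ a = -1
      rw [div_pow, hva, htn, ← hxn]
      push_cast
      rw [neg_div, div_self (pow_ne_zero _ hn0)]
    have h2 := hmax _ hζ
    have h3 : v * (starRingEnd ℂ) (v / ‖x‖) = ‖x‖ := by
      rw [map_div₀, Complex.conj_ofReal, ← mul_div_assoc, Complex.mul_conj, ← Complex.sq_norm,
        ← hxn]
      push_cast
      field_simp
    rw [h3, Complex.ofReal_re] at h2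
    have h4 : x.re = ‖x‖ := le_antisymm (Complex.re_le_norm x) h2
    have h5 : x.im = 0 := by
      have := Complex.sq_norm x
      rw [Complex.normSq_apply, ← h4] at this
      nlinarith
    have : y = x := Complex.ext hyx (by rw [him, h5, neg_zero])
    rw [this] at hvy
    exact hne (mul_left_cancel₀ hx0 (hvy.symm.trans hvx))
  · rw [hva, ← htn, h]
    push_cast
    rfl

theorem norm_mul_sub_lt {ω ω' : ℂ} (hω : ‖ω‖ = 1) (hω' : ‖ω'‖ = 1) (hne : ω' ≠ ω) {ρ : ℝ}
    (hρ : 0 < ρ) : ‖ρ * ω - ω‖ < ‖ρ * ω - ω'‖ := by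
  rw [← not_le, re_le_of_norm_sub_le hω' hω, mul_assoc, mul_assoc, Complex.re_ofReal_mul,
    Complex.re_ofReal_mul, mul_le_mul_iff_right₀ hρ, not_le]
  have h1 : ω * (starRingEnd ℂ) ω = 1 := by
    rw [Complex.mul_conj, ← Complex.sq_norm, hω]; simp
  have h2 : ‖ω * (starRingEnd ℂ) ω'‖ = 1 := by rw [norm_mul, RCLike.norm_conj, hω, hω', one_mul]
  rw [h1, Complex.one_re]
  refine lt_of_le_of_ne (h2 ▸ Complex.re_le_norm _) fun h3 => hne ?_
  have h4 : ω * (starRingEnd ℂ) ω' = 1 := by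
    refine Complex.ext h3 ?_
    have := Complex.sq_norm (ω * (starRingEnd ℂ) ω')
    rw [h2, Complex.normSq_apply, h3] at this
    simp only [Complex.one_im]
    nlinarith
  have h5 : (starRingEnd ℂ) ω' * ω' = 1 := by
    rw [mul_comm, Complex.mul_conj, ← Complex.sq_norm, hω']; simp
  calc ω' = ω * (starRingEnd ℂ) ω' * ω' := by rw [h4, one_mul]
    _ = ω := by rw [mul_assoc, h5, mul_one]

/-- The region of the plane that belongs to the root `ω` of `-1`. -/
def circuitPetal (a : ℕ) (M : ℝ) (U ω : ℂ) : Set ℂ :=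
  {u | ‖U‖ < ‖u‖ ∧ ‖u‖ < M ∧ ∀ ω' ∈ powRoots a (-1), ω' ≠ ω → ‖u - ω‖ < ‖u - ω'‖}

theorem isOpen_circuitPetal (ha : 0 < a) (M : ℝ) (U ω : ℂ) : IsOpen (circuitPetal a M U ω) := by
  have h : circuitPetal a M U ω = {u | ‖U‖ < ‖u‖} ∩ ({u | ‖u‖ < M} ∩
      ⋂ ω' ∈ powRoots a (-1), {u | ω' ≠ ω → ‖u - ω‖ < ‖u - ω'‖}) := by
    ext u
    simp only [circuitPetal, Set.mem_inter_iff, Set.mem_ofPred_eq, Set.mem_iInter]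
  rw [h]
  refine (isOpen_lt (by fun_prop) (by fun_prop)).inter ((isOpen_lt (by fun_prop)
    (by fun_prop)).inter ((finite_powRoots ha _).isOpen_biInter fun ω' _ => ?_))
  by_cases hne : ω' = ω
  · simp [hne]
  · simp only [ne_eq, hne, not_false_eq_true, forall_const]
    exact isOpen_lt (by fun_prop) (by fun_prop)

theorem closure_circuitPetal_subset (M : ℝ) (U ω : ℂ) : closure (circuitPetal a M U ω) ⊆
    {u | ‖U‖ ≤ ‖u‖ ∧ ‖u‖ ≤ M ∧ ∀ ω' ∈ powRoots a (-1), ‖u - ω‖ ≤ ‖u - ω'‖} := by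
  refine closure_minimal (fun u hu => ⟨hu.1.le, hu.2.1.le, fun ω' hω' => ?_⟩) ?_
  · rcases eq_or_ne ω' ω with rfl | hne
    · exact le_rfl
    · exact (hu.2.2 ω' hω' hne).le
  · have h : {u : ℂ | ‖U‖ ≤ ‖u‖ ∧ ‖u‖ ≤ M ∧ ∀ ω' ∈ powRoots a (-1), ‖u - ω‖ ≤ ‖u - ω'‖} =
        {u | ‖U‖ ≤ ‖u‖} ∩ ({u | ‖u‖ ≤ M} ∩
        ⋂ ω' ∈ powRoots a (-1), {u | ‖u - ω‖ ≤ ‖u - ω'‖}) := by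
      ext u
      simp only [Set.mem_inter_iff, Set.mem_ofPred_eq, Set.mem_iInter]
    rw [h]
    exact (isClosed_le (by fun_prop) (by fun_prop)).inter ((isClosed_le (by fun_prop)
      (by fun_prop)).inter (isClosed_biInter fun ω' _ => isClosed_le (by fun_prop) (by fun_prop)))

theorem frontier_circuitPetal (ha : 0 < a) {M : ℝ} {U ω v : ℂ}
    (hv : v ∈ frontier (circuitPetal a M U ω)) :
    (∀ ω' ∈ powRoots a (-1), ‖v - ω‖ ≤ ‖v - ω'‖) ∧ (‖v‖ = M ∨ ‖v‖ ≤ M ∧ (‖v‖ = ‖U‖ ∨ ‖U‖ ≤ ‖v‖ ∧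
      ∃ ω' ∈ powRoots a (-1), ω' ≠ ω ∧ ‖v - ω‖ = ‖v - ω'‖)) := by
  rw [(isOpen_circuitPetal ha M U ω).frontier_eq] at hv
  obtain ⟨h1, h2, h3⟩ := closure_circuitPetal_subset M U ω hv.1
  refine ⟨h3, ?_⟩
  by_contra! hcon
  have h4 := hcon.2 h2
  refine hv.2 ⟨lt_of_le_of_ne h1 h4.1.symm, lt_of_le_of_ne h2 hcon.1, fun ω' hω' hne => ?_⟩
  exact lt_of_le_of_ne (h3 ω' hω') (h4.2 h1 ω' hω' hne)

/-- On these rays the two terms of `1 + v^a` add up, so this factor is at least `1`, against `a / (a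
+ b) < 1` in the critical norm, and `‖v‖^b` is not smaller either. -/
theorem critNorm_lt_of_equidistant (ha : 0 < a) (hb : 0 < b) (hd : a + b < d) {v : ℂ}
    (hv : critRadius a b ≤ ‖v‖) (hva : v ^ a = ((‖v‖ ^ a : ℝ) : ℂ)) :
    critNorm a b < ‖(coeffPoly d (circuitCoeff a b)).eval v‖ := by
  have hρ := critRadius_pos (a := a) hb
  have h1 : ‖(1 : ℂ) + v ^ a‖ = 1 + ‖v‖ ^ a := by
    rw [hva, ← Complex.ofReal_one, ← Complex.ofReal_add, Complex.norm_real, Real.norm_eq_abs,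
      abs_of_nonneg (by positivity)]
  rw [eval_circuit ha hd, norm_mul, norm_pow, h1, critNorm]
  have h2 : (a : ℝ) / (a + b) < 1 := by
    rw [div_lt_one (by positivity)]
    have : (0 : ℝ) < b := by positivity
    linarith
  have h3 : critRadius a b ^ b ≤ ‖v‖ ^ b := by gcongr
  have h4 : 0 < critRadius a b ^ b := by positivity
  have h5 : 0 ≤ ‖v‖ ^ a := by positivity
  nlinarith

/-- On the critical circle `‖1 + v^a‖ ≥ 1 - ‖v‖^a = a / (a + b)`, with equality only where `v^a` is
negative. Those are the critical points, and the one on the ray of `ω` is the only one with `ω` as a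
nearest root. -/
theorem critNorm_lt_of_nearest (ha : 0 < a) (hb : 0 < b) (hd : a + b < d) {ω v : ℂ}
    (hω : ω ∈ powRoots a (-1)) (hv : ‖v‖ = critRadius a b)
    (hmin : ∀ ω' ∈ powRoots a (-1), ‖v - ω‖ ≤ ‖v - ω'‖) (hne : v ≠ critRadius a b * ω) :
    critNorm a b < ‖(coeffPoly d (circuitCoeff a b)).eval v‖ := by
  have hρ := critRadius_pos (a := a) hb
  have hρ0 : (critRadius a b : ℂ) ≠ 0 := by exact_mod_cast hρ.ne'
  have hN : (0 : ℝ) < a + b := by positivity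
  have hpow : ‖v ^ a‖ = (b : ℝ) / (a + b) := by rw [norm_pow, hv, critRadius_pow ha]
  rw [eval_circuit ha hd, norm_mul, norm_pow, hv, critNorm]
  refine mul_lt_mul_of_pos_left ?_ (by positivity)
  have h1 : (a : ℝ) / (a + b) = 1 - ‖v ^ a‖ := by rw [hpow]; field_simp; ring
  rw [h1]
  by_contra! hle
  -- equality in the triangle inequality
  have h2 : v ^ a = -(((b : ℝ) / (a + b) : ℝ) : ℂ) := by
    have h3 := Complex.sq_norm (1 + v ^ a)
    have h4 := Complex.sq_norm (v ^ a)
    rw [Complex.normSq_apply] at h3 h4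
    simp only [Complex.add_re, Complex.one_re, Complex.add_im, Complex.one_im, zero_add] at h3
    have h5 := Complex.abs_re_le_norm (v ^ a)
    rw [abs_le] at h5
    have h7 : 0 ≤ 1 - ‖v ^ a‖ := by rw [← h1]; positivity
    have h6 : (v ^ a).re = -‖v ^ a‖ := by nlinarith [norm_nonneg (1 + v ^ a)]
    refine Complex.ext ?_ ?_
    · rw [h6, hpow, Complex.neg_re, Complex.ofReal_re]
    · have : (v ^ a).im = 0 := by nlinarith
      rw [this, Complex.neg_im, Complex.ofReal_im, neg_zero]
  have h3 : v / critRadius a b ∈ powRoots a (-1) := by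
    change (v / critRadius a b) ^ a = -1
    rw [div_pow, h2, ← Complex.ofReal_pow, critRadius_pow ha, neg_div, div_self]
    have : (0 : ℝ) < b / (a + b) := by positivity
    exact_mod_cast this.ne'
  have h4 : v = critRadius a b * (v / critRadius a b) := by field_simp
  have h5 : ω ≠ v / critRadius a b := fun h => hne (by rw [h]; exact h4)
  have h6 := norm_mul_sub_lt (norm_eq_one_of_mem_powRoots ha h3)
    (norm_eq_one_of_mem_powRoots ha hω) h5 hρ
  rw [← h4] at h6
  exact absurd (hmin _ h3) (not_le.2 h6)

theorem eventually_notEquidistant (ha : 0 < a) {ω v : ℂ}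
    (h : ∀ ω' ∈ powRoots a (-1), ω' ≠ ω → ‖v - ω‖ ≠ ‖v - ω'‖) :
    ∀ᶠ v' in 𝓝 v, ∀ ω' ∈ powRoots a (-1), ω' ≠ ω → ‖v' - ω‖ ≠ ‖v' - ω'‖ := by
  rw [Filter.eventually_all_finite (finite_powRoots ha _)]
  intro ω' hω'
  by_cases hne : ω' = ω
  · simp [hne]
  · have hc : Continuous fun v' : ℂ => ‖v' - ω‖ - ‖v' - ω'‖ := by fun_prop
    filter_upwards [hc.continuousAt.eventually_ne (sub_ne_zero.2 (h ω' hω' hne))] with v' hv' _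
    exact sub_ne_zero.1 hv'

/-- Away from the circle of radius `M` the frontier consists of an arc of the circle through the
critical point and of points outside it that are equidistant from two roots of `-1`. For the circuit
polynomial the inequality there is strict except at the critical point, hence stable by compactness;
near the critical point, `eventually_norm_eval_crit_le` takes over. -/
theorem eventually_frontier_circuitPetal (ha : 0 < a) (hb : 0 < b) (hd : a + b < d) {ω : ℂ}
    (hω : ω ∈ powRoots a (-1)) (M : ℝ) :
    ∀ᶠ p : (ℕ → ℂ) × ℂ in 𝓝 (circuitCoeff a b, (critRadius a b : ℂ) * ω),
      (coeffPoly d p.1).derivative.eval p.2 = 0 → ∀ v ∈ frontier (circuitPetal a M p.2 ω),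
        ‖v‖ = M ∨ ‖(coeffPoly d p.1).eval p.2‖ ≤ ‖(coeffPoly d p.1).eval v‖ := by
  have hnc := norm_crit (b := b) ha hb hω
  have hGc := norm_eval_circuit_crit (d := d) ha hb hd hω
  have hloc := eventually_norm_eval_crit_le (d := d) ha hb hd hω
  have hstrict := fun v => critNorm_lt_of_nearest (d := d) ha hb hd (v := v) hω
  have hnear : ∀ ω' ∈ powRoots a (-1), ω' ≠ ω → ‖(critRadius a b : ℂ) * ω - ω‖ ≠
      ‖(critRadius a b : ℂ) * ω - ω'‖ := fun ω' hω' hne =>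
    (norm_mul_sub_lt (norm_eq_one_of_mem_powRoots ha hω) (norm_eq_one_of_mem_powRoots ha hω')
      hne (critRadius_pos hb)).ne
  set u₀ := (critRadius a b : ℂ) * ω
  set K : Set ℂ := Metric.closedBall 0 M ∩
    {v | ∀ ω' ∈ powRoots a (-1), ‖v - ω‖ ≤ ‖v - ω'‖} with hK
  have hKc : IsCompact K := by
    refine (isCompact_closedBall _ _).inter_right ?_
    have h : {v : ℂ | ∀ ω' ∈ powRoots a (-1), ‖v - ω‖ ≤ ‖v - ω'‖} =
        ⋂ ω' ∈ powRoots a (-1), {v | ‖v - ω‖ ≤ ‖v - ω'‖} := by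
      ext u
      simp only [Set.mem_ofPred_eq, Set.mem_iInter]
    rw [h]
    exact isClosed_biInter fun ω' _ => isClosed_le (by fun_prop) (by fun_prop)
  have hcG1 : Continuous fun z : ((ℕ → ℂ) × ℂ) × ℂ => ‖(coeffPoly d z.1.1).eval z.1.2‖ :=
    (continuous_eval_coeffPoly.comp (by fun_prop :
      Continuous fun z : ((ℕ → ℂ) × ℂ) × ℂ => (z.1.1, z.1.2))).norm
  have hcG2 : Continuous fun z : ((ℕ → ℂ) × ℂ) × ℂ => ‖(coeffPoly d z.1.1).eval z.2‖ :=
    (continuous_eval_coeffPoly.comp (by fun_prop :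
      Continuous fun z : ((ℕ → ℂ) × ℂ) × ℂ => (z.1.1, z.2))).norm
  have key : ∀ᶠ p : (ℕ → ℂ) × ℂ in 𝓝 (circuitCoeff a b, u₀), ∀ v ∈ K,
      (coeffPoly d p.1).derivative.eval p.2 = 0 →
      (‖v‖ = ‖p.2‖ ∨ ‖p.2‖ ≤ ‖v‖ ∧ ∃ ω' ∈ powRoots a (-1), ω' ≠ ω ∧ ‖v - ω‖ = ‖v - ω'‖) →
      ‖(coeffPoly d p.1).eval p.2‖ ≤ ‖(coeffPoly d p.1).eval v‖ := by
    refine hKc.eventually_forall_of_forall_eventually fun v hv => ?_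
    have hlt : critNorm a b < ‖(coeffPoly d (circuitCoeff a b)).eval v‖ →
        ∀ᶠ z : ((ℕ → ℂ) × ℂ) × ℂ in 𝓝 ((circuitCoeff a b, u₀), v),
          ‖(coeffPoly d z.1.1).eval z.1.2‖ ≤ ‖(coeffPoly d z.1.1).eval z.2‖ := by
      intro h
      rw [← hGc] at h
      exact (hcG1.continuousAt.eventually_lt hcG2.continuousAt h).mono fun _ => le_of_lt
    have hneq : (∀ ω' ∈ powRoots a (-1), ω' ≠ ω → ‖v - ω‖ ≠ ‖v - ω'‖) →
        ∀ᶠ z : ((ℕ → ℂ) × ℂ) × ℂ in 𝓝 ((circuitCoeff a b, u₀), v),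
          ∀ ω' ∈ powRoots a (-1), ω' ≠ ω → ‖z.2 - ω‖ ≠ ‖z.2 - ω'‖ := fun h =>
      continuousAt_snd.eventually (eventually_notEquidistant ha h)
    -- On the critical circle the local lemma serves at `u₀`, and strictness elsewhere. Points
    -- strictly inside are not on the frontier, and points strictly outside only if they are
    -- equidistant.
    by_cases h1 : ‖v‖ = critRadius a b
    · by_cases h2 : v = u₀
      · subst h2
        have hcont : ContinuousAt (fun z : ((ℕ → ℂ) × ℂ) × ℂ => (z.1.1, (z.1.2, z.2)))
          ((circuitCoeff a b, u₀), u₀) := by fun_prop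
        filter_upwards [hcont.eventually hloc, hneq hnear] with z hz1 hz2 hd' hor
        rcases hor with h | ⟨-, ω', hω', hne, he⟩
        · exact hz1 hd' h
        · exact absurd he (hz2 ω' hω' hne)
      · exact (hlt (hstrict v h1 hv.2 h2)).mono fun _ h _ _ => h
    · have hne : ∀ᶠ z : ((ℕ → ℂ) × ℂ) × ℂ in 𝓝 ((circuitCoeff a b, u₀), v),
          ‖z.2‖ ≠ ‖z.1.2‖ := by
        have hc : Continuous fun z : ((ℕ → ℂ) × ℂ) × ℂ => ‖z.2‖ - ‖z.1.2‖ := by fun_prop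
        have h0 : ‖v‖ - ‖u₀‖ ≠ 0 := by rw [hnc]; exact sub_ne_zero.2 h1
        filter_upwards [hc.continuousAt.eventually_ne (x := ((circuitCoeff a b, u₀), v)) h0]
          with z hz
        exact sub_ne_zero.1 hz
      rcases lt_or_gt_of_ne h1 with hlt' | hgt
      · have : ∀ᶠ z : ((ℕ → ℂ) × ℂ) × ℂ in 𝓝 ((circuitCoeff a b, u₀), v), ‖z.2‖ < ‖z.1.2‖ := by
          rw [← hnc] at hlt'
          exact ContinuousAt.eventually_lt (by fun_prop) (by fun_prop) hlt'
        filter_upwards [hne, this] with z hz1 hz2 _ hor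
        rcases hor with h | ⟨h, -⟩
        · exact absurd h hz1
        · exact absurd h (not_le.2 hz2)
      · by_cases heq : ∀ ω' ∈ powRoots a (-1), ω' ≠ ω → ‖v - ω‖ ≠ ‖v - ω'‖
        · filter_upwards [hne, hneq heq] with z hz1 hz2 _ hor
          rcases hor with h | ⟨-, ω', hω', hne, he⟩
          · exact absurd h hz1
          · exact absurd he (hz2 ω' hω' hne)
        · push Not at heq
          obtain ⟨ω', hω', hne', he⟩ := heq
          exact (hlt (critNorm_lt_of_equidistant ha hb hd hgt.le
            (pow_eq_norm_pow_of_equidistant ha hω hω' hne' he hv.2))).mono fun _ h _ _ => h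
  filter_upwards [key] with p hp hd' v hv
  obtain ⟨h1, h2⟩ := frontier_circuitPetal ha hv
  rcases h2 with h2 | ⟨h2, h3⟩
  · exact Or.inl h2
  · exact Or.inr (hp v ⟨by simpa using h2, h1⟩ hd' h3)

/-- Of two roots that collide at a critical point `U`, as the value moves radially outwards,
one is outside and one inside the circle of radius `‖U‖`. -/
theorem exists_norm_lt_of_collision (P : ℂ[X]) {U : ℂ} (hU : U ≠ 0) (hPU : P.eval U ≠ 0)
    (hd : P.derivative.eval U = 0) {s : ℝ}
    (hs : ‖U ^ 2 * P.derivative.derivative.eval U / P.eval U + s‖ < s / 4) :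
    ∃ ε > 0, ∀ η : ℝ, 0 < η → ∀ v₁ v₂, dist v₁ U < ε → dist v₂ U < ε → v₁ ≠ v₂ →
      P.eval v₁ = P.eval U * Complex.exp (-η) → P.eval v₂ = P.eval U * Complex.exp (-η) →
      (‖U‖ < ‖v₁‖ ∧ ‖v₂‖ < ‖U‖) ∨ (‖U‖ < ‖v₂‖ ∧ ‖v₁‖ < ‖U‖) := by
  have hs0 : 0 < s := by have := norm_nonneg (U ^ 2 * P.derivative.derivative.eval U / P.eval U + s); linarith
  obtain ⟨H, hH, hH2⟩ := P.exists_eval_sub_eq_sq_mul hd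
  have hd2 : P.derivative.derivative.eval U ≠ 0 := by
    intro h0
    rw [h0, mul_zero, zero_div, zero_add, Complex.norm_real, Real.norm_of_nonneg hs0.le] at hs
    linarith
  obtain ⟨ε₁, hε₁, hsum⟩ := P.exists_norm_add_le_of_double_root hd hd2 (κ := 1 / 2) (by norm_num)
  have hc : Continuous fun v => ‖U ^ 2 * H.eval v / P.eval U + s / 2‖ := by fun_prop
  have h0 : ‖U ^ 2 * H.eval U / P.eval U + s / 2‖ < s / 8 := by
    have : U ^ 2 * H.eval U / P.eval U + s / 2 =
        (U ^ 2 * P.derivative.derivative.eval U / P.eval U + s) / 2 := by rw [← hH2]; ring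
    rw [this, norm_div]
    simp only [Complex.norm_ofNat]
    linarith
  obtain ⟨ε₂, hε₂, hball⟩ := Metric.eventually_nhds_iff.1
    (hc.continuousAt.eventually (gt_mem_nhds h0))
  have hUn : 0 < ‖U‖ := norm_pos_iff.2 hU
  refine ⟨min ε₁ (min ε₂ ‖U‖), by positivity, fun η hη v₁ v₂ h₁ h₂ hne hv₁ hv₂ => ?_⟩
  have hsum' := hsum v₁ v₂ (h₁.trans_le (min_le_left _ _)) (h₂.trans_le (min_le_left _ _)) hne
    (hv₁.trans hv₂.symm)
  have key : ∀ v, dist v U < min ε₁ (min ε₂ ‖U‖) → P.eval v = P.eval U * Complex.exp (-η) →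
      ((v - U) / U).im ^ 2 < ((v - U) / U).re ^ 2 ∧ ‖(v - U) / U‖ < 1 := by
    intro v hv hvP
    have h1 := hball (hv.trans_le ((min_le_right _ _).trans (min_le_left _ _)))
    have h2 : ‖v - U‖ < ‖U‖ := by
      rw [← dist_eq_norm]
      exact hv.trans_le ((min_le_right _ _).trans (min_le_right _ _))
    set x := (v - U) / U with hx
    set W := U ^ 2 * H.eval v / P.eval U with hW
    -- For `v = U (1 + x)`, the factorization at the double root gives `x² W = -(1 - e^(-η))` with
    -- `W` close to `-s / 2`. So `x²` has positive real part and `x` is closer to the real than to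
    -- the imaginary axis, which makes the sign of `Re x` decide on which side of the circle `v`
    -- lies.
    have h3 : x ^ 2 * W = -((1 - Real.exp (-η) : ℝ) : ℂ) := by
      have h4 := hH v
      rw [hvP] at h4
      have h5 : x ^ 2 * W = (v - U) ^ 2 * H.eval v / P.eval U := by
        rw [hx, hW]
        field_simp
      rw [h5, ← h4]
      push_cast
      field_simp
      ring
    have hpos : 0 < 1 - Real.exp (-η) := by
      have := Real.exp_lt_exp.2 (show -η < 0 by linarith)
      rw [Real.exp_zero] at this
      linarith
    have hre : W.re < 0 := by
      have h6 := Complex.abs_re_le_norm (W + s / 2)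
      rw [Complex.add_re, show ((s : ℂ) / 2).re = s / 2 by
        rw [show (s : ℂ) / 2 = ((s / 2 : ℝ) : ℂ) by push_cast; rfl, Complex.ofReal_re]] at h6
      have := (abs_le.1 h6).2
      linarith
    have hW0 : W ≠ 0 := fun h => by rw [h] at hre; simp at hre
    have h7 : x ^ 2 = -((1 - Real.exp (-η) : ℝ) : ℂ) * (starRingEnd ℂ) W *
        ((Complex.normSq W)⁻¹ : ℝ) := by
      rw [← h3, mul_assoc (x ^ 2), Complex.mul_conj]
      have : (Complex.normSq W : ℂ) ≠ 0 := by exact_mod_cast (Complex.normSq_pos.2 hW0).ne'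
      push_cast
      field_simp
    have h8 : 0 < (x ^ 2).re := by
      rw [h7, Complex.re_mul_ofReal, ← Complex.ofReal_neg, Complex.re_ofReal_mul, Complex.conj_re]
      have := Complex.normSq_pos.2 hW0
      have h9 : 0 < -(1 - Real.exp (-η)) * W.re := by nlinarith
      positivity
    rw [sq, Complex.mul_re] at h8
    refine ⟨by nlinarith, ?_⟩
    rw [hx, norm_div, div_lt_one hUn]
    exact h2
  have hout : ∀ v, ((v - U) / U).im ^ 2 < ((v - U) / U).re ^ 2 → ‖(v - U) / U‖ < 1 →
      (0 < ((v - U) / U).re → ‖U‖ < ‖v‖) ∧ (((v - U) / U).re < 0 → ‖v‖ < ‖U‖) := by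
    intro v hv1 hv2
    set x := (v - U) / U with hx
    have h1 : v = U * (1 + x) := by rw [hx]; field_simp; ring
    have h2 : ‖1 + x‖ ^ 2 = 1 + 2 * x.re + (x.re ^ 2 + x.im ^ 2) := by
      rw [Complex.sq_norm, Complex.normSq_apply]
      simp
      ring
    have h3 := (abs_le.1 ((Complex.abs_re_le_norm x).trans hv2.le)).1
    constructor <;> intro h
    · have : 1 < ‖1 + x‖ := by nlinarith [norm_nonneg (1 + x), sq_nonneg x.im]
      rw [h1, norm_mul]
      nlinarith
    · have : ‖1 + x‖ < 1 := by nlinarith [norm_nonneg (1 + x), sq_nonneg x.im]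
      rw [h1, norm_mul]
      nlinarith
  obtain ⟨k1, k1'⟩ := key v₁ h₁ hv₁
  obtain ⟨k2, k2'⟩ := key v₂ h₂ hv₂
  -- The displacements are nearly opposite, so their real parts, which dominate, have opposite
  -- signs.
  have hx12 : ‖(v₁ - U) / U + (v₂ - U) / U‖ ≤ 1 / 2 * ‖(v₂ - U) / U‖ := by
    rw [← add_div, norm_div, norm_div, ← mul_div_assoc]
    gcongr
  have o1 := hout v₁ k1 k1'
  have o2 := hout v₂ k2 k2'
  set x₁ := (v₁ - U) / U
  set x₂ := (v₂ - U) / U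
  have hn2 : ‖x₂‖ ^ 2 < 2 * x₂.re ^ 2 := by
    rw [Complex.sq_norm, Complex.normSq_apply]
    nlinarith
  have hre12 := (Complex.abs_re_le_norm (x₁ + x₂)).trans hx12
  rw [Complex.add_re] at hre12
  have hre1 : x₁.re ≠ 0 := fun h => by rw [h] at k1; nlinarith [sq_nonneg x₁.im]
  have hre2 : x₂.re ≠ 0 := fun h => by rw [h] at k2; nlinarith [sq_nonneg x₂.im]
  have hsq : (x₁.re + x₂.re) ^ 2 ≤ 1 / 4 * ‖x₂‖ ^ 2 := by
    have := sq_abs (x₁.re + x₂.re)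
    nlinarith [abs_nonneg (x₁.re + x₂.re), norm_nonneg x₂]
  rcases lt_or_gt_of_ne hre1 with h1 | h1 <;> rcases lt_or_gt_of_ne hre2 with h2 | h2
  · exfalso
    nlinarith [mul_pos_of_neg_of_neg h1 h2]
  · exact Or.inr ⟨o2.1 h2, o1.2 h1⟩
  · exact Or.inl ⟨o1.1 h1, o2.2 h2⟩
  · exfalso
    nlinarith [mul_pos h1 h2]

end CircuitPetals

/-! ## The roots of a perturbed circuit polynomial for small and large values -/

section ScaledRoots

/-- The polynomial with the given coefficients has exactly one root in each disc of radius `δ` around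
a `d`-th root of unity, and no other roots of norm at most `K`. -/
structure HasUnitRoots (D d : ℕ) (δ K : ℝ) (h : ℕ → ℂ) : Prop where
  exists_root : ∀ ζ ∈ powRoots d 1, ∃ y ∈ Metric.ball ζ δ, (coeffPoly D h).eval y = 0
  injOn : ∀ ζ ∈ powRoots d 1, Set.InjOn (fun y => (coeffPoly D h).eval y) (Metric.ball ζ δ)
  exists_disc : ∀ y ∈ Metric.closedBall (0 : ℂ) K, (coeffPoly D h).eval y = 0 →
    ∃ ζ ∈ powRoots d 1, y ∈ Metric.ball ζ δ

/-- The coefficients of `y ^ d + x y ^ e - 1`. -/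
def modelCoeff (d e : ℕ) (x : ℂ) (j : ℕ) : ℂ :=
  if j = 0 then -1 else if j = d then 1 else if j = e then x else 0

/-- The coefficients of `Φ ^ (-d) G(Φ y) - 1`, if `G` has the coefficients `g`. -/
noncomputable def scaleCoeff (d : ℕ) (g : ℕ → ℂ) (Φ : ℂ) (j : ℕ) : ℂ :=
  if j = 0 then -1 else g j * Φ ^ j / Φ ^ d

variable {a b d e D : ℕ}

theorem eval_modelCoeff_zero (hd : 0 < d) (hD : d < D) (y : ℂ) :
    (coeffPoly D (modelCoeff d e 0)).eval y = y ^ d - 1 := by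
  have h : ∀ j, modelCoeff d e 0 j * y ^ j =
      (if j = 0 then -1 else 0) + (if j = d then y ^ d else 0) := by
    intro j
    unfold modelCoeff
    by_cases h0 : j = 0
    · subst h0
      simp [hd.ne]
    · by_cases h1 : j = d
      · subst h1
        simp [h0]
      · simp [h0, h1]
  rw [eval_coeffPoly]
  simp only [h, Finset.sum_add_distrib, Finset.sum_ite_eq', Finset.mem_range]
  rw [if_pos (by omega), if_pos hD]
  ring

theorem eval_derivative_modelCoeff_zero (hd : 0 < d) (hD : d < D) (y : ℂ) :
    (coeffPoly D (modelCoeff d e 0)).derivative.eval y = d * y ^ (d - 1) := by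
  have h : coeffPoly D (modelCoeff d e 0) = X ^ d - 1 := by
    refine Polynomial.funext fun y => ?_
    rw [eval_modelCoeff_zero hd hD]
    simp
  rw [h]
  simp [derivative_X_pow]

theorem eventually_nhdsGT_of_forall_le {p : ℝ → Prop} (h : ∃ δ₀ > 0, ∀ δ, 0 < δ → δ ≤ δ₀ → p δ) :
    ∀ᶠ δ in 𝓝[>] (0 : ℝ), p δ := by
  obtain ⟨δ₀, hδ₀, h⟩ := h
  filter_upwards [Ioc_mem_nhdsGT hδ₀] with δ hδ using h δ hδ.1 hδ.2

/-- The simple roots of a polynomial persist. -/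
theorem eventually_forall_root {h₀ : ℕ → ℂ} {Z : Set ℂ} (hZ : Z.Finite)
    (hz : ∀ ζ ∈ Z, (coeffPoly D h₀).eval ζ = 0)
    (hd : ∀ ζ ∈ Z, (coeffPoly D h₀).derivative.eval ζ ≠ 0) :
    ∀ᶠ δ in 𝓝[>] (0 : ℝ), ∀ᶠ h in 𝓝 h₀, ∀ ζ ∈ Z,
      (∃ y ∈ Metric.ball ζ δ, (coeffPoly D h).eval y = 0) ∧
      Set.InjOn (fun y => (coeffPoly D h).eval y) (Metric.ball ζ δ) := by
  simp only [Filter.eventually_all_finite hZ]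
  intro ζ hζ
  obtain ⟨δ₀, hδ₀, hinj⟩ := eventually_injOn_coeffPoly (hd ζ hζ)
  refine eventually_nhdsGT_of_forall_le ⟨δ₀, hδ₀, fun δ hδ hle => ?_⟩
  filter_upwards [hinj, eventually_exists_root (hz ζ hζ) (hd ζ hζ) hδ] with h h1 h2
  exact ⟨h2, h1.mono (Metric.ball_subset_ball hle)⟩

theorem continuous_modelCoeff : Continuous (modelCoeff d e) := by
  refine continuous_pi fun j => ?_
  unfold modelCoeff
  split_ifs <;> fun_prop

/-- For `x = 0` the polynomial is `y^d - 1`, whose roots are simple; simple roots persist and by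
compactness no others appear in the ball. -/
theorem eventually_hasUnitRoots_modelCoeff (hd : 0 < d) (hD : d < D) (K : ℝ) :
    ∀ᶠ δ in 𝓝[>] (0 : ℝ), ∀ᶠ x in 𝓝 (0 : ℂ), ∀ᶠ h in 𝓝 (modelCoeff d e x),
      HasUnitRoots D d δ K h := by
  have h1 := eventually_forall_root (D := D) (h₀ := modelCoeff d e 0) (finite_powRoots hd 1)
    (fun ζ hζ => by rw [eval_modelCoeff_zero hd hD, show ζ ^ d = 1 from hζ, sub_self])
    (fun ζ hζ => by
      rw [eval_derivative_modelCoeff_zero hd hD]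
      have hζ' : ζ ^ d = 1 := hζ
      have : ζ ≠ 0 := fun h0 => by simp [h0, hd.ne'] at hζ'
      exact mul_ne_zero (by exact_mod_cast hd.ne') (pow_ne_zero _ this))
  filter_upwards [h1, self_mem_nhdsWithin] with δ h1 hδ
  have h2 := eventually_root_mem (d := D) (h := id) (x₀ := modelCoeff d e 0) continuousAt_id
    (isCompact_closedBall (0 : ℂ) K) (U := ⋃ ζ ∈ powRoots d 1, Metric.ball ζ δ)
    (isOpen_biUnion fun _ _ => Metric.isOpen_ball) (fun y _ hy => by
      rw [id, eval_modelCoeff_zero hd hD, sub_eq_zero] at hy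
      exact Set.mem_biUnion hy (Metric.mem_ball_self hδ))
  have h3 : ∀ᶠ h in 𝓝 (modelCoeff d e 0), HasUnitRoots D d δ K h := by
    filter_upwards [h1, h2] with h h1 h2
    refine ⟨fun ζ hζ => (h1 ζ hζ).1, fun ζ hζ => (h1 ζ hζ).2, fun y hy hy0 => ?_⟩
    obtain ⟨ζ, hζ, hyζ⟩ := Set.mem_iUnion₂.1 (h2 y hy hy0)
    exact ⟨ζ, hζ, hyζ⟩
  exact (continuous_modelCoeff.tendsto 0).eventually (eventually_eventually_nhds.2 h3)

/-- Of the two terms of the circuit polynomial the one of degree `d` is normalized to `y^d`, and the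
other one becomes negligible: for small `Φ` if `d = b`, for large `Φ` if `d = a + b`. -/
theorem scaleCoeff_circuit (ha : 0 < a) (hb : 0 < b)
    (hde : (d = b ∧ e = a + b) ∨ (d = a + b ∧ e = b)) {Φ : ℂ} (hΦ : Φ ≠ 0) :
    scaleCoeff d (circuitCoeff a b) Φ = modelCoeff d e (Φ ^ e / Φ ^ d) := by
  funext j
  unfold scaleCoeff modelCoeff circuitCoeff
  by_cases h0 : j = 0
  · simp [h0]
  rw [if_neg h0, if_neg h0]
  by_cases h1 : j = d
  · subst h1
    rw [if_pos rfl, if_pos (by omega), one_mul, div_self (pow_ne_zero _ hΦ)]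
  · rw [if_neg h1]
    by_cases h2 : j = e
    · subst h2
      rw [if_pos rfl, if_pos (by omega), one_mul]
    · rw [if_neg h2, if_neg (by omega), zero_mul, zero_div]

theorem continuousAt_scaleCoeff {p : (ℕ → ℂ) × ℂ} (hp : p.2 ≠ 0) :
    ContinuousAt (fun p : (ℕ → ℂ) × ℂ => scaleCoeff d p.1 p.2) p := by
  refine continuousAt_pi.2 fun j => ?_
  unfold scaleCoeff
  split_ifs
  · exact continuousAt_const
  · exact ContinuousAt.div (by fun_prop) (by fun_prop) (pow_ne_zero _ hp)

theorem eval_scaleCoeff {g : ℕ → ℂ} (hg : g 0 = 0) (hD : 0 < D) {Φ : ℂ} (y : ℂ) :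
    (coeffPoly D (scaleCoeff d g Φ)).eval y = (coeffPoly D g).eval (Φ * y) / Φ ^ d - 1 := by
  obtain ⟨D, rfl⟩ := Nat.exists_eq_succ_of_ne_zero hD.ne'
  rw [eval_coeffPoly, eval_coeffPoly, Nat.succ_eq_add_one, Finset.sum_range_succ',
    Finset.sum_range_succ' _ D, hg, zero_mul, add_zero, Finset.sum_div]
  simp only [scaleCoeff, Nat.succ_ne_zero, if_false, if_true, pow_zero, mul_one]
  rw [sub_eq_add_neg]
  congr 1
  refine Finset.sum_congr rfl fun j _ => ?_
  rw [mul_pow]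
  ring

/-- The order of the quantifiers matters: `δ` comes first, then the bound on the radius `ρ`, and
only then a neighbourhood of the coefficients, uniform over the circle `‖Φ‖ = ρ` by compactness. -/
theorem eventually_hasUnitRoots_scaleCoeff (ha : 0 < a) (hb : 0 < b)
    (hde : (d = b ∧ e = a + b) ∨ (d = a + b ∧ e = b)) (hD : a + b < D) (K : ℝ) :
    ∀ᶠ δ in 𝓝[>] (0 : ℝ), ∃ κ > 0, ∀ ρ : ℝ, 0 < ρ → ρ ^ e / ρ ^ d < κ →
      ∀ᶠ g in 𝓝 (circuitCoeff a b), ∀ Φ : ℂ, ‖Φ‖ = ρ →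
        HasUnitRoots D d δ K (scaleCoeff d g Φ) := by
  filter_upwards [eventually_hasUnitRoots_modelCoeff (e := e) (show 0 < d by omega)
    (show d < D by omega) K] with δ h
  obtain ⟨κ, hκ, hball⟩ := Metric.eventually_nhds_iff.1 h
  refine ⟨κ, hκ, fun ρ hρ hlt => ?_⟩
  have := (isCompact_sphere (0 : ℂ) ρ).eventually_forall_of_forall_eventually
    (x₀ := circuitCoeff a b) (P := fun g Φ => HasUnitRoots D d δ K (scaleCoeff d g Φ))
    fun Φ hΦ => ?_
  · filter_upwards [this] with g hg Φ hΦ using hg Φ (by simpa using hΦ)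
  · have hΦn : ‖Φ‖ = ρ := by simpa using hΦ
    have hΦ0 : Φ ≠ 0 := by rw [← norm_pos_iff, hΦn]; exact hρ
    refine (continuousAt_scaleCoeff (d := d) (p := (circuitCoeff a b, Φ)) hΦ0).eventually ?_
    dsimp only
    rw [scaleCoeff_circuit ha hb hde hΦ0]
    refine hball ?_
    rw [dist_zero_right, norm_div, norm_pow, norm_pow, hΦn]
    exact hlt

/-- Near an `a`-th root of `-1`, there is exactly one root for small values. -/
theorem eventually_middle (ha : 0 < a) (hb : 0 < b) (hD : a + b < D) :
    ∀ᶠ δ in 𝓝[>] (0 : ℝ), ∃ κ > 0, ∀ r : ℝ, 0 < r → r < κ → ∀ᶠ g in 𝓝 (circuitCoeff a b),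
      ∀ t : ℂ, ‖t‖ = r → ∀ ω ∈ powRoots a (-1),
        (∃ u ∈ Metric.ball ω δ, (coeffPoly D g).eval u = -t) ∧
        Set.InjOn (fun u => (coeffPoly D g).eval u) (Metric.ball ω δ) := by
  have hN : (a : ℂ) + b ≠ 0 := by exact_mod_cast (by omega : a + b ≠ 0)
  have h1 := eventually_forall_root (D := D) (h₀ := circuitCoeff a b) (finite_powRoots ha (-1))
    (fun ζ hζ => by rw [eval_circuit ha hD, show ζ ^ a = -1 from hζ]; simp)
    (fun ζ hζ => by
      rw [eval_derivative_circuit ha hb hD, show ζ ^ a = -1 from hζ]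
      have hζ0 : ζ ≠ 0 := by
        rw [← norm_pos_iff, norm_eq_one_of_mem_powRoots ha hζ]; exact one_pos
      refine mul_ne_zero (pow_ne_zero _ hζ0) ?_
      have : (b : ℂ) + (a + b) * -1 = -a := by ring
      rw [this]
      exact neg_ne_zero.2 (by exact_mod_cast ha.ne'))
  filter_upwards [h1] with δ h1
  have hc : Continuous fun p : (ℕ → ℂ) × ℂ => p.1 + Pi.single 0 p.2 := by
    refine continuous_pi fun j => ?_
    simp only [Pi.add_apply, Pi.single_apply]
    split_ifs <;> fun_prop
  have h2 := (hc.tendsto (circuitCoeff a b, 0)).eventually (by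
    dsimp only
    rw [Pi.single_zero, add_zero]
    exact h1)
  rw [nhds_prod_eq] at h2
  obtain ⟨pa, hpa, pb, hpb, hab⟩ := eventually_prod_iff.1 h2
  obtain ⟨κ, hκ, hball⟩ := Metric.eventually_nhds_iff.1 hpb
  refine ⟨κ, hκ, fun r _ hr => ?_⟩
  filter_upwards [hpa, h1] with g hg hg1 t ht ω hω
  refine ⟨?_, (hg1 ω hω).2⟩
  obtain ⟨u, hu, hu0⟩ := (hab hg (hball (y := t) (by rw [dist_zero_right, ht]; exact hr)) ω hω).1
  refine ⟨u, hu, ?_⟩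
  rw [coeffPoly_add_single (by omega)] at hu0
  exact eq_neg_of_add_eq_zero_left hu0

/-- For small values, all roots of the circuit polynomial are near `0` or near an `a`-th root
of `-1`. -/
theorem exists_radius_middle (ha : 0 < a) {δ : ℝ} (hδ : 0 < δ) :
    ∃ κ > 0, ∀ r : ℝ, 0 < r → r < κ → ∀ u : ℂ, ‖u ^ b * (1 + u ^ a)‖ = r →
      4 * r ≤ ‖u‖ ^ b → ∃ ω ∈ powRoots a (-1), u ∈ Metric.ball ω δ := by
  set K : Set ℂ := Metric.closedBall 0 2 \ ⋃ ω ∈ powRoots a (-1), Metric.ball ω δ with hK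
  have hKc : IsCompact K := (isCompact_closedBall _ _).diff
    (isOpen_biUnion fun _ _ => Metric.isOpen_ball)
  obtain ⟨μ, hμ, hμK⟩ : ∃ μ > 0, ∀ u ∈ K, μ ≤ ‖1 + u ^ a‖ := by
    rcases K.eq_empty_or_nonempty with he | hne
    · exact ⟨1, one_pos, by simp [he]⟩
    · have hc : Continuous fun u : ℂ => ‖1 + u ^ a‖ := by fun_prop
      obtain ⟨u₀, hu₀, hmin⟩ := hKc.exists_isMinOn hne hc.continuousOn
      refine ⟨‖1 + u₀ ^ a‖, ?_, fun u hu => hmin hu⟩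
      rw [gt_iff_lt, norm_pos_iff]
      intro h0
      refine hu₀.2 (Set.mem_biUnion (x := u₀) ?_ (Metric.mem_ball_self hδ))
      exact eq_neg_of_add_eq_zero_right h0
  -- The hypothesis `4 r ≤ ‖u‖^b` forces `‖1 + u^a‖ ≤ 1/4`, hence `‖u‖ ≤ 2` and `‖u‖^b ≥
  -- 4^(-(a+b))`. Then `‖1 + u^a‖ ≤ r 4^(a+b) < μ`, against the choice of `μ` if `u` is outside the
  -- discs.
  refine ⟨min 1 μ / 4 ^ (a + b), by positivity, fun r hr hrκ u hu hur => ?_⟩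
  by_contra hcon
  rw [norm_mul, norm_pow] at hu
  have h4 : (0 : ℝ) < 4 ^ (a + b) := by positivity
  rw [lt_div_iff₀ h4] at hrκ
  have hua : ‖1 + u ^ a‖ ≤ 1 / 4 := by
    have := norm_nonneg (1 + u ^ a)
    nlinarith
  have hone : 1 - ‖u‖ ^ a ≤ ‖1 + u ^ a‖ := by
    have := norm_sub_le_norm_add (1 : ℂ) (u ^ a)
    rwa [norm_one, norm_pow] at this
  have hone' : ‖u‖ ^ a - 1 ≤ ‖1 + u ^ a‖ := by
    have := norm_sub_le_norm_add (u ^ a) (1 : ℂ)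
    rwa [norm_one, norm_pow, add_comm] at this
  have hlow : (1 / 4 : ℝ) ^ (a + b) ≤ ‖u‖ ^ b := by
    by_contra! hlt
    have h5 : ‖u‖ < 1 / 4 ∨ 1 / 4 ≤ ‖u‖ := lt_or_ge _ _
    rcases h5 with h5 | h5
    · have : ‖u‖ ^ a ≤ ‖u‖ := by
        refine pow_le_of_le_one (norm_nonneg _) (by linarith) ha.ne'
      linarith
    · have h6 : (1 / 4 : ℝ) ^ b ≤ ‖u‖ ^ b := by gcongr
      have h7 : (1 / 4 : ℝ) ^ (a + b) ≤ (1 / 4) ^ b :=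
        pow_le_pow_of_le_one (by norm_num) (by norm_num) (by omega)
      linarith
  have hup : ‖u‖ ≤ 2 := by
    by_contra! hlt
    have : ‖u‖ ≤ ‖u‖ ^ a := le_self_pow₀ (by linarith) ha.ne'
    linarith
  have huK : u ∈ K := by
    refine ⟨by simpa using hup, fun hmem => hcon ?_⟩
    obtain ⟨ω, hω, huω⟩ := Set.mem_iUnion₂.1 hmem
    exact ⟨ω, hω, huω⟩
  have h8 := hμK u huK
  have h9 : μ ≤ r * 4 ^ (a + b) := by
    have h10 : (1 / 4 : ℝ) ^ (a + b) * 4 ^ (a + b) = 1 := by rw [← mul_pow]; norm_num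
    have h11 : (1 / 4 : ℝ) ^ (a + b) * μ ≤ r := by
      rw [← hu]
      gcongr
    calc μ = (1 / 4 : ℝ) ^ (a + b) * μ * 4 ^ (a + b) := by rw [mul_right_comm, h10, one_mul]
      _ ≤ _ := by gcongr
  have := min_le_right 1 μ
  linarith

end ScaledRoots

/-! ### Well separated discs around the roots of a number of norm one. -/

section SmallRadius

/-- A radius `δ` of discs around the `d`-th roots of `c` in which these are well separated. -/
structure IsSmallRadius (d : ℕ) (c : ℂ) (δ : ℝ) : Prop where
  pos : 0 < δ
  lt : δ < 1 / 4
  sep : ∀ ζ ∈ powRoots d c, ∀ ζ' ∈ powRoots d c, ζ ≠ ζ' → 2 * δ < ‖ζ - ζ'‖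
  pow : ∀ ζ ∈ powRoots d c, ∀ y, ‖y - ζ‖ < δ → ‖y ^ d - c‖ < 1 / 2
  arg : ∀ ζ ∈ powRoots d c, ∀ y, ‖y - ζ‖ < δ → |(y / ζ).arg| < Real.pi / d

theorem norm_eq_one_of_pow_eq {d : ℕ} (hd : 0 < d) {c : ℂ} (hc : ‖c‖ = 1) {ζ : ℂ}
    (hζ : ζ ∈ powRoots d c) : ‖ζ‖ = 1 := by
  have : ‖ζ‖ ^ d = 1 := by rw [← norm_pow, show ζ ^ d = c from hζ, hc]
  exact (pow_eq_one_iff_of_nonneg (norm_nonneg _) hd.ne').1 this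

theorem eventually_isSmallRadius {d : ℕ} (hd : 0 < d) {c : ℂ} (hc : ‖c‖ = 1) :
    ∀ᶠ δ in 𝓝[>] (0 : ℝ), IsSmallRadius d c δ := by
  have hfin := finite_powRoots hd c
  have hp : ∀ ζ ∈ powRoots d c, ∃ δ > 0, ∀ y, ‖y - ζ‖ < δ →
      ‖y ^ d - c‖ < 1 / 2 ∧ |(y / ζ).arg| < Real.pi / d := by
    intro ζ hζ
    have hζ0 : ζ ≠ 0 := by
      rw [← norm_pos_iff, norm_eq_one_of_pow_eq hd hc hζ]
      exact one_pos
    have h1 : ∀ᶠ y in 𝓝 ζ, ‖y ^ d - c‖ < 1 / 2 := by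
      have hcont : Continuous fun y : ℂ => ‖y ^ d - c‖ := by fun_prop
      refine hcont.continuousAt.eventually (gt_mem_nhds ?_)
      dsimp only
      rw [show ζ ^ d = c from hζ, sub_self, norm_zero]
      norm_num
    have h2 : ∀ᶠ y in 𝓝 ζ, |(y / ζ).arg| < Real.pi / d := by
      have hcont : ContinuousAt (fun y : ℂ => |(y / ζ).arg|) ζ := by
        refine ContinuousAt.abs (ContinuousAt.comp (g := Complex.arg) ?_ (by fun_prop))
        rw [div_self hζ0]
        exact Complex.continuousAt_arg (by simp)
      refine hcont.eventually (gt_mem_nhds ?_)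
      dsimp only
      rw [div_self hζ0, Complex.arg_one, abs_zero]
      have := Real.pi_pos
      positivity
    obtain ⟨δ, hδ, h⟩ := Metric.eventually_nhds_iff.1 (h1.and h2)
    exact ⟨δ, hδ, fun y hy => h (by rwa [dist_eq_norm])⟩
  have hp' : ∀ᶠ δ in 𝓝[>] (0 : ℝ), ∀ ζ ∈ powRoots d c, ∀ y, ‖y - ζ‖ < δ →
      ‖y ^ d - c‖ < 1 / 2 ∧ |(y / ζ).arg| < Real.pi / d := by
    rw [Filter.eventually_all_finite hfin]
    intro ζ hζ
    obtain ⟨δ₀, hδ₀, h⟩ := hp ζ hζ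
    exact eventually_nhdsGT_of_forall_le ⟨δ₀, hδ₀, fun δ _ hle y hy => h y (hy.trans_le hle)⟩
  obtain ⟨ε, hε, hsep⟩ := hfin.exists_pos_forall_le_dist
  have hs : ∀ᶠ δ in 𝓝[>] (0 : ℝ), ∀ ζ ∈ powRoots d c, ∀ ζ' ∈ powRoots d c, ζ ≠ ζ' →
      2 * δ < ‖ζ - ζ'‖ := eventually_nhdsGT_of_forall_le ⟨ε / 3, by positivity,
    fun δ hδ hle ζ hζ ζ' hζ' hne => by
      have := hsep ζ hζ ζ' hζ' hne
      rw [dist_eq_norm] at this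
      linarith⟩
  filter_upwards [hp', hs, self_mem_nhdsWithin, Ioo_mem_nhdsGT (show (0 : ℝ) < 1 / 4 by norm_num)]
    with δ h1 h2 h3 h4
  exact ⟨h3, h4.2, h2, fun ζ hζ y hy => (h1 ζ hζ y hy).1, fun ζ hζ y hy => (h1 ζ hζ y hy).2⟩

namespace IsSmallRadius

variable {d : ℕ} {c : ℂ} {δ : ℝ} (h : IsSmallRadius d c δ)

include h

theorem eq_of_norm_le {ζ ζ' y : ℂ} (hζ : ζ ∈ powRoots d c) (hζ' : ζ' ∈ powRoots d c)
    (h1 : ‖y - ζ‖ ≤ δ) (h2 : ‖y - ζ'‖ ≤ δ) : ζ = ζ' := by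
  by_contra hne
  have := h.sep ζ hζ ζ' hζ' hne
  have h3 : ‖ζ - ζ'‖ ≤ ‖y - ζ‖ + ‖y - ζ'‖ := by
    rw [norm_sub_rev y ζ]
    exact norm_sub_le_norm_sub_add_norm_sub ζ y ζ'
  linarith

theorem norm_lt_of_ne {ζ ζ' y : ℂ} (hζ : ζ ∈ powRoots d c) (hζ' : ζ' ∈ powRoots d c)
    (h1 : ‖y - ζ‖ < δ) (hne : ζ' ≠ ζ) : ‖y - ζ‖ < ‖y - ζ'‖ := by
  by_contra! hle
  exact hne (h.eq_of_norm_le hζ hζ' h1.le (hle.trans h1.le)).symm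

theorem isNearest {ζ y : ℂ} (hζ : ζ ∈ powRoots d c) (h1 : ‖y - ζ‖ < δ) :
    IsNearest (powRoots d c) y ζ :=
  ⟨hζ, fun _ hζ' hne => h.norm_lt_of_ne hζ hζ' h1 hne⟩

theorem norm_bounds (hd : 0 < d) (hc : ‖c‖ = 1) {ζ y : ℂ} (hζ : ζ ∈ powRoots d c)
    (h1 : ‖y - ζ‖ ≤ δ) : 3 / 4 < ‖y‖ ∧ ‖y‖ < 5 / 4 := by
  have h2 := norm_eq_one_of_pow_eq hd hc hζ
  have h3 := abs_norm_sub_norm_le y ζ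
  rw [h2] at h3
  have h4 := abs_le.1 (h3.trans h1)
  have := h.lt
  constructor <;> linarith [h4.1, h4.2]

end IsSmallRadius

end SmallRadius

/-! ### The inner, middle and outer roots along a vertical line. -/

section RootDiscs

/-- On the line `Re w = x₀`, the roots of norm less than `M` of `P + exp w` are one in each of
the discs `‖u / p x w - ζ x‖ < δ`. -/
structure RootDiscs (P : ℂ[X]) (M x₀ δ : ℝ) {ι : Type*} (p : ι → ℂ → ℂ) (ζ : ι → ℂ) : Prop where
  exists_root : ∀ w : ℂ, w.re = x₀ → ∀ x, ∃ u, P.eval u = -Complex.exp w ∧ ‖u‖ < M ∧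
    ‖u / p x w - ζ x‖ < δ
  unique : ∀ w : ℂ, w.re = x₀ → ∀ x u u', P.eval u = -Complex.exp w → P.eval u' = -Complex.exp w →
    ‖u / p x w - ζ x‖ < δ → ‖u' / p x w - ζ x‖ < δ → u = u'
  exists_disc : ∀ w : ℂ, w.re = x₀ → ∀ u, P.eval u = -Complex.exp w → ‖u‖ < M →
    ∃ x, ‖u / p x w - ζ x‖ < δ
  disjoint : ∀ w : ℂ, w.re = x₀ → ∀ x y u, ‖u / p x w - ζ x‖ ≤ δ → ‖u / p y w - ζ y‖ < δ → x = y

theorem phaseRoot_pow {d : ℕ} (hd : 0 < d) (w : ℂ) : phaseRoot d w ^ d = -Complex.exp w := by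
  have hd' : (d : ℂ) ≠ 0 := by exact_mod_cast hd.ne'
  rw [phaseRoot, ← Complex.exp_nat_mul, mul_div_cancel₀ _ hd', Complex.exp_add,
    Complex.exp_pi_mul_I]
  ring

theorem phaseRoot_ne_zero (d : ℕ) (w : ℂ) : phaseRoot d w ≠ 0 := Complex.exp_ne_zero _

theorem norm_phaseRoot (d : ℕ) (w : ℂ) : ‖phaseRoot d w‖ = Real.exp (w.re / d) := by
  rw [phaseRoot, Complex.norm_exp, show (d : ℂ) = ((d : ℝ) : ℂ) by simp, Complex.div_ofReal_re]
  simp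

theorem phaseRoot_add (d : ℕ) (w : ℂ) :
    phaseRoot d (w + 2 * Real.pi * Complex.I) = phaseRoot d w * unitRoot d := by
  rw [phaseRoot, phaseRoot, unitRoot, ← Complex.exp_add]
  congr 1
  ring

theorem continuous_phaseRoot (d : ℕ) : Continuous (phaseRoot d) := by
  unfold phaseRoot
  fun_prop

/-- The scales of the inner and middle roots. -/
noncomputable def innerScale (a b : ℕ) : powRoots b 1 ⊕ powRoots a (-1) → ℂ → ℂ :=
  Sum.elim (fun _ => phaseRoot b) fun _ _ => 1

/-- The approximate positions of the inner and middle roots. -/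
def innerCenter (a b : ℕ) : powRoots b 1 ⊕ powRoots a (-1) → ℂ :=
  Sum.elim Subtype.val Subtype.val

variable {a b D : ℕ} {δ : ℝ}

/-- For `Φ = phaseRoot d w` one has `Φ^d = -e^w`, so that `y = u / Φ` turns the fibre over `e^w`
into the zeros of the scaled polynomial. -/
theorem exists_root_of_hasUnitRoots {d : ℕ} (hd : 0 < d) {g : ℕ → ℂ} (hg : g 0 = 0) (hD : 0 < D)
    {w : ℂ} {K : ℝ} (h : HasUnitRoots D d δ K (scaleCoeff d g (phaseRoot d w))) :
    (∀ ζ ∈ powRoots d 1, ∃ u, (coeffPoly D g).eval u = -Complex.exp w ∧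
      ‖u / phaseRoot d w - ζ‖ < δ) ∧
    (∀ ζ ∈ powRoots d 1, ∀ u u', (coeffPoly D g).eval u = -Complex.exp w →
      (coeffPoly D g).eval u' = -Complex.exp w → ‖u / phaseRoot d w - ζ‖ < δ →
      ‖u' / phaseRoot d w - ζ‖ < δ → u = u') ∧
    (∀ u, (coeffPoly D g).eval u = -Complex.exp w → ‖u / phaseRoot d w‖ ≤ K →
      ∃ ζ ∈ powRoots d 1, ‖u / phaseRoot d w - ζ‖ < δ) := by
  have hΦ := phaseRoot_ne_zero d w
  have hpow := phaseRoot_pow hd w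
  set Φ := phaseRoot d w
  have hΦd : Φ ^ d ≠ 0 := pow_ne_zero _ hΦ
  have hiff : ∀ y, (coeffPoly D (scaleCoeff d g Φ)).eval y = 0 ↔
      (coeffPoly D g).eval (Φ * y) = -Complex.exp w := by
    intro y
    rw [eval_scaleCoeff hg hD, sub_eq_zero, div_eq_one_iff_eq hΦd, hpow]
  have hiff' : ∀ u, (coeffPoly D (scaleCoeff d g Φ)).eval (u / Φ) = 0 ↔
      (coeffPoly D g).eval u = -Complex.exp w := by
    intro u
    rw [hiff, mul_div_cancel₀ _ hΦ]
  refine ⟨fun ζ hζ => ?_, fun ζ hζ u u' hu hu' h1 h2 => ?_, fun u hu h1 => ?_⟩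
  · obtain ⟨y, hy, hy0⟩ := h.exists_root ζ hζ
    refine ⟨Φ * y, (hiff y).1 hy0, ?_⟩
    rw [mul_div_cancel_left₀ _ hΦ, ← dist_eq_norm]
    exact hy
  · have := h.injOn ζ hζ (by rwa [Metric.mem_ball, dist_eq_norm])
      (by rwa [Metric.mem_ball, dist_eq_norm]) (((hiff' u).2 hu).trans ((hiff' u').2 hu').symm)
    exact (div_left_inj' hΦ).1 this
  · obtain ⟨ζ, hζ, hy⟩ := h.exists_disc (u / Φ) (by simpa using h1) ((hiff' u).2 hu)
    exact ⟨ζ, hζ, by rwa [Metric.mem_ball, dist_eq_norm] at hy⟩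

/-- The outer roots. -/
theorem eventually_rootDiscs_outer (ha : 0 < a) (hb : 0 < b) (hD : a + b < D) :
    ∀ᶠ δ in 𝓝[>] (0 : ℝ), ∃ R₀ > 0, ∀ R M : ℝ, R₀ < R →
      2 * Real.exp (Real.log R / (a + b : ℕ)) ≤ M → M ≤ 12 * Real.exp (Real.log R / (a + b : ℕ)) →
      ∀ᶠ g in 𝓝 (circuitCoeff a b), g 0 = 0 →
        RootDiscs (coeffPoly D g) M (Real.log R) δ
          (fun (_ : powRoots (a + b) 1) => phaseRoot (a + b)) Subtype.val := by
  have hN : 0 < a + b := by omega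
  filter_upwards [eventually_hasUnitRoots_scaleCoeff ha hb (Or.inr ⟨rfl, rfl⟩) hD 12,
    eventually_isSmallRadius hN (c := 1) (by simp)] with δ h1 h2
  obtain ⟨κ, hκ, h1⟩ := h1
  -- The scale `ρ = R^(1/(a+b))` of the outer roots then exceeds `1` and `1 / κ`, and the ratio `ρ^b
  -- / ρ^(a+b) = ρ^(-a)` is less than `κ`.
  refine ⟨max 1 (1 / κ) ^ (a + b), by positivity, fun R M hR hM1 hM2 => ?_⟩
  have hR0 : 0 < R := lt_trans (by positivity) hR
  set ρ := Real.exp (Real.log R / (a + b : ℕ)) with hρ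
  have hρ0 : 0 < ρ := Real.exp_pos _
  have hρN : ρ ^ (a + b) = R := by
    rw [hρ, ← Real.exp_nat_mul, mul_div_cancel₀ _ (by positivity), Real.exp_log hR0]
  have hρm : max 1 (1 / κ) < ρ := by
    rw [← hρN] at hR
    exact lt_of_pow_lt_pow_left₀ _ hρ0.le hR
  have hlt : ρ ^ b / ρ ^ (a + b) < κ := by
    rw [pow_add, div_mul_cancel_right₀ (by positivity), inv_lt_comm₀ (by positivity) hκ,
      ← one_div]
    calc 1 / κ < ρ := (le_max_right _ _).trans_lt hρm
      _ ≤ ρ ^ a := le_self_pow₀ ((le_max_left _ _).trans hρm.le) ha.ne'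
  filter_upwards [h1 ρ hρ0 hlt] with g hg hg0
  have hnorm : ∀ w : ℂ, w.re = Real.log R → ‖phaseRoot (a + b) w‖ = ρ := fun w hw => by
    rw [norm_phaseRoot, hw]
  refine ⟨fun w hw ζ => ?_, fun w hw ζ => ?_, fun w hw u hu huM => ?_, fun w hw x y u hx hy => ?_⟩
  · obtain ⟨u, hu, hu'⟩ := (exists_root_of_hasUnitRoots hN hg0 (by omega)
      (hg _ (hnorm w hw))).1 ζ ζ.2
    refine ⟨u, hu, ?_, hu'⟩
    have := (h2.norm_bounds hN (by simp) ζ.2 hu'.le).2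
    rw [norm_div, hnorm w hw, div_lt_iff₀ hρ0] at this
    linarith
  · exact (exists_root_of_hasUnitRoots hN hg0 (by omega) (hg _ (hnorm w hw))).2.1 ζ ζ.2
  · obtain ⟨ζ, hζ, h⟩ := (exists_root_of_hasUnitRoots hN hg0 (by omega)
      (hg _ (hnorm w hw))).2.2 u hu (by
        rw [norm_div, hnorm w hw, div_le_iff₀ hρ0]
        linarith)
    exact ⟨⟨ζ, hζ⟩, h⟩
  · exact Subtype.ext (h2.eq_of_norm_le x.2 y.2 hx hy.le)

/-- The inner and middle roots. -/
theorem eventually_rootDiscs_inner (ha : 0 < a) (hb : 0 < b) (hD : a + b < D) :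
    ∀ᶠ δ in 𝓝[>] (0 : ℝ), ∃ r₀ > 0, ∀ r M : ℝ, 0 < r → r < r₀ → 2 ≤ M →
      ∀ᶠ g in 𝓝 (circuitCoeff a b), g 0 = 0 →
        RootDiscs (coeffPoly D g) M (Real.log r) δ (innerScale a b) (innerCenter a b) := by
  filter_upwards [eventually_hasUnitRoots_scaleCoeff ha hb (Or.inl ⟨rfl, rfl⟩) hD 4,
    eventually_isSmallRadius hb (c := 1) (by simp), eventually_isSmallRadius ha (c := -1) (by simp),
    eventually_middle ha hb hD] with δ h1 h2 h3 h4
  obtain ⟨κ, hκ, h1⟩ := h1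
  obtain ⟨κ', hκ', h4⟩ := h4
  obtain ⟨κ'', hκ'', h5⟩ := exists_radius_middle ha (b := b) h2.pos
  -- The scale `ρ = r^(1/b)` of the inner roots will be less than `m`: less than `κ` for the
  -- persistence of the roots, and less than `1/8` so that the inner discs stay in `‖u‖ < 1/4`,
  -- apart from the middle ones.
  set m := min (min 1 κ) (1 / 8) with hm
  have hm0 : 0 < m := by positivity
  have hm1 : m ≤ 1 := (min_le_left _ _).trans (min_le_left _ _)
  have hm2 : m ≤ κ := (min_le_left _ _).trans (min_le_right _ _)
  have hm3 : m ≤ 1 / 8 := min_le_right _ _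
  refine ⟨min (m ^ b) (min κ' κ''), by positivity, fun r M hr hr0 hM => ?_⟩
  have hr1 : r < m ^ b := hr0.trans_le (min_le_left _ _)
  have hr2 : r < κ' := hr0.trans_le ((min_le_right _ _).trans (min_le_left _ _))
  have hr3 : r < κ'' := hr0.trans_le ((min_le_right _ _).trans (min_le_right _ _))
  set ρ := Real.exp (Real.log r / b) with hρ
  have hρ0 : 0 < ρ := Real.exp_pos _
  have hρb : ρ ^ b = r := by
    rw [hρ, ← Real.exp_nat_mul, mul_div_cancel₀ _ (by positivity), Real.exp_log hr]
  have hρm : ρ < m := by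
    rw [← hρb] at hr1
    exact lt_of_pow_lt_pow_left₀ _ hm0.le hr1
  have hlt : ρ ^ (a + b) / ρ ^ b < κ := by
    rw [pow_add, mul_div_cancel_right₀ _ (by positivity)]
    calc ρ ^ a ≤ ρ := pow_le_of_le_one hρ0.le (hρm.le.trans hm1) ha.ne'
      _ < κ := hρm.trans_le hm2
  -- Bounded roots that are too large to be inner ones are near a root of `-1`: for the circuit
  -- polynomial by `exists_radius_middle`, and nearby by compactness.
  have hring : ∀ᶠ g in 𝓝 (circuitCoeff a b), ∀ u ∈ Metric.closedBall (0 : ℂ) M,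
      ‖(coeffPoly D g).eval u‖ = r → 4 * r ≤ ‖u‖ ^ b →
        u ∈ ⋃ ω ∈ powRoots a (-1), Metric.ball ω δ := by
    set B := ⋃ ω ∈ powRoots a (-1), Metric.ball ω δ with hB
    have hBo : IsOpen B := isOpen_biUnion fun _ _ => Metric.isOpen_ball
    have hKc : IsCompact (Metric.closedBall (0 : ℂ) M ∩ {u | 4 * r ≤ ‖u‖ ^ b}) :=
      (isCompact_closedBall _ _).inter_right (isClosed_le (by fun_prop) (by fun_prop))
    have := hKc.eventually_forall_of_forall_eventually (x₀ := circuitCoeff a b)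
      (P := fun g u => ‖(coeffPoly D g).eval u‖ = r → u ∈ B) fun u hu => ?_
    · filter_upwards [this] with g hg u hu h6 h7 using hg u ⟨hu, h7⟩ h6
    · by_cases huB : u ∈ B
      · filter_upwards [continuousAt_snd.eventually (hBo.mem_nhds huB)] with z hz _ using hz
      · have hne : ‖(coeffPoly D (circuitCoeff a b)).eval u‖ ≠ r := by
          intro h6
          rw [eval_circuit ha hD] at h6
          obtain ⟨ω, hω, h7⟩ := h5 r hr hr3 u h6 hu.2
          exact huB (Set.mem_biUnion hω h7)
        filter_upwards [(continuous_eval_coeffPoly (d := D)).norm.continuousAt.eventually_ne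
          (x := (circuitCoeff a b, u)) hne] with z hz h6
        exact absurd h6 hz
  filter_upwards [h1 ρ hρ0 hlt, h4 r hr hr2, hring] with g hg hgm hgr hg0
  have hnorm : ∀ w : ℂ, w.re = Real.log r → ‖phaseRoot b w‖ = ρ := fun w hw => by
    rw [norm_phaseRoot, hw]
  have hexp : ∀ w : ℂ, w.re = Real.log r → ‖Complex.exp w‖ = r := fun w hw => by
    rw [Complex.norm_exp, hw, Real.exp_log hr]
  have hin : ∀ w : ℂ, w.re = Real.log r → ∀ ζ ∈ powRoots b 1, ∀ u,
      ‖u / phaseRoot b w - ζ‖ ≤ δ → ‖u‖ < 1 / 4 := by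
    intro w hw ζ hζ u hu
    have := (h2.norm_bounds hb (by simp) hζ hu).2
    rw [norm_div, hnorm w hw, div_lt_iff₀ hρ0] at this
    linarith
  have hmid : ∀ ω ∈ powRoots a (-1), ∀ u, ‖u / 1 - ω‖ ≤ δ → 3 / 4 < ‖u‖ ∧ ‖u‖ < 5 / 4 := by
    intro ω hω u hu
    rw [div_one] at hu
    exact h3.norm_bounds ha (by simp) hω hu
  refine ⟨fun w hw x => ?_, fun w hw x => ?_, fun w hw u hu huM => ?_, fun w hw x y u hx hy => ?_⟩
  · rcases x with ζ | ω
    · obtain ⟨u, hu, hu'⟩ := (exists_root_of_hasUnitRoots hb hg0 (by omega)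
        (hg _ (hnorm w hw))).1 ζ ζ.2
      have := hin w hw ζ ζ.2 u hu'.le
      exact ⟨u, hu, by linarith, hu'⟩
    · obtain ⟨u, hu, hu'⟩ := (hgm _ (hexp w hw) ω ω.2).1
      have hu2 : ‖u / 1 - ω‖ < δ := by rwa [div_one, ← dist_eq_norm]
      have := hmid ω ω.2 u hu2.le
      exact ⟨u, hu', by linarith [this.2], hu2⟩
  · rcases x with ζ | ω
    · exact (exists_root_of_hasUnitRoots hb hg0 (by omega) (hg _ (hnorm w hw))).2.1 ζ ζ.2
    · intro u u' hu hu' h6 h7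
      refine (hgm _ (hexp w hw) ω ω.2).2 ?_ ?_ (hu.trans hu'.symm)
      · rw [Metric.mem_ball, dist_eq_norm, ← div_one u]
        exact h6
      · rw [Metric.mem_ball, dist_eq_norm, ← div_one u']
        exact h7
  -- Up to norm `4 ρ` the scaled polynomial accounts for the root; beyond, `‖u‖^b ≥ 4^b r ≥ 4 r`,
  -- and `hgr` applies.
  · rcases le_or_gt ‖u‖ (4 * ρ) with hle | hgt
    · obtain ⟨ζ, hζ, h⟩ := (exists_root_of_hasUnitRoots hb hg0 (by omega)
        (hg _ (hnorm w hw))).2.2 u hu (by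
          rw [norm_div, hnorm w hw, div_le_iff₀ hρ0]
          exact hle)
      exact ⟨Sum.inl ⟨ζ, hζ⟩, h⟩
    · have h6 : 4 * r ≤ ‖u‖ ^ b := by
        calc 4 * r ≤ 4 ^ b * ρ ^ b := by
              rw [hρb]
              gcongr
              exact le_self_pow₀ (by norm_num) hb.ne'
          _ = (4 * ρ) ^ b := (mul_pow _ _ _).symm
          _ ≤ _ := by gcongr
      have h7 := hgr u (by simpa using huM.le) (by rw [hu, norm_neg, hexp w hw]) h6
      obtain ⟨ω, hω, h8⟩ := Set.mem_iUnion₂.1 h7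
      refine ⟨Sum.inr ⟨ω, hω⟩, ?_⟩
      rw [Metric.mem_ball, dist_eq_norm, ← div_one u] at h8
      exact h8
  · rcases x with ζ | ω <;> rcases y with ζ' | ω'
    · exact congrArg Sum.inl (Subtype.ext (h2.eq_of_norm_le ζ.2 ζ'.2 hx hy.le))
    · have e1 := hin w hw ζ ζ.2 u hx
      have e2 := (hmid ω' ω'.2 u hy.le).1
      linarith
    · have e1 := hin w hw ζ' ζ'.2 u hy.le
      have e2 := (hmid ω ω.2 u hx).1
      linarith
    · exact congrArg Sum.inr (Subtype.ext (h3.eq_of_norm_le ω.2 ω'.2 hx hy.le))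

end RootDiscs

/-! ### Polynomials near the circuit polynomial: the conditions used later and their stability. -/

section NearCircuit

/-- The properties of a critical point `U` near that of the circuit polynomial on the ray of `ω`. -/
structure IsCritNear (P : ℂ[X]) (a b : ℕ) (M : ℝ) (ω U : ℂ) : Prop where
  crit : P.derivative.eval U = 0
  half_lt : critRadius a b / 2 < ‖U‖
  lt_half : ‖U‖ < (1 + critRadius a b) / 2
  nearest : ∀ ω' ∈ powRoots a (-1), ω' ≠ ω → ‖U - ω‖ < ‖U - ω'‖
  lt_value : critNorm a b / 2 < ‖P.eval U‖
  value_lt : ‖P.eval U‖ < 2 * critNorm a b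
  second : ‖U ^ 2 * P.derivative.derivative.eval U / P.eval U + ((b * (a + b) : ℝ) : ℂ)‖ <
    (b * (a + b) : ℝ) / 4
  frontier : ∀ v ∈ frontier (circuitPetal a M U ω), ‖v‖ = M ∨ ‖P.eval U‖ ≤ ‖P.eval v‖

variable {a b D : ℕ}

theorem eventually_isCritNear (ha : 0 < a) (hb : 0 < b) (hD : a + b < D) {ω : ℂ}
    (hω : ω ∈ powRoots a (-1)) (M : ℝ) :
    ∀ᶠ p : (ℕ → ℂ) × ℂ in 𝓝 (circuitCoeff a b, (critRadius a b : ℂ) * ω),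
      (coeffPoly D p.1).derivative.eval p.2 = 0 → IsCritNear (coeffPoly D p.1) a b M ω p.2 := by
  have hρ := critRadius_pos (a := a) hb
  have hρ1 := critRadius_lt_one (b := b) ha
  have hn := norm_crit (b := b) ha hb hω
  have hG := eval_circuit_crit_ne_zero (d := D) ha hb hD hω
  have hGn := norm_eval_circuit_crit (d := D) ha hb hD hω
  have hpos := critNorm_pos ha hb
  have h2 := eval_derivative2_circuit_crit (d := D) ha hb hD hω
  have hcn : Continuous fun p : (ℕ → ℂ) × ℂ => ‖p.2‖ := by fun_prop
  have hcv := (continuous_eval_coeffPoly (d := D)).norm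
  have hc2 : ContinuousAt (fun p : (ℕ → ℂ) × ℂ => ‖p.2 ^ 2 *
      (coeffPoly D p.1).derivative.derivative.eval p.2 / (coeffPoly D p.1).eval p.2 +
        ((b * (a + b) : ℝ) : ℂ)‖) (circuitCoeff a b, (critRadius a b : ℂ) * ω) := by
    refine ContinuousAt.norm (ContinuousAt.add (ContinuousAt.div (ContinuousAt.mul (by fun_prop)
      continuous_eval_derivative2_coeffPoly.continuousAt)
      continuous_eval_coeffPoly.continuousAt hG) continuousAt_const)
  have hnear : ∀ᶠ v in 𝓝 ((critRadius a b : ℂ) * ω), ∀ ω' ∈ powRoots a (-1), ω' ≠ ω →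
      ‖v - ω‖ < ‖v - ω'‖ := by
    rw [Filter.eventually_all_finite (finite_powRoots ha _)]
    intro ω' hω'
    by_cases hne : ω' = ω
    · simp [hne]
    · have := norm_mul_sub_lt (norm_eq_one_of_mem_powRoots ha hω)
        (norm_eq_one_of_mem_powRoots ha hω') hne hρ
      have hev : ∀ᶠ v in 𝓝 ((critRadius a b : ℂ) * ω), ‖v - ω‖ < ‖v - ω'‖ :=
        ContinuousAt.eventually_lt (by fun_prop) (by fun_prop) this
      exact hev.mono fun v hv _ => hv
  have e1 : critRadius a b / 2 < ‖(critRadius a b : ℂ) * ω‖ := by rw [hn]; linarith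
  have e2 : ‖(critRadius a b : ℂ) * ω‖ < (1 + critRadius a b) / 2 := by rw [hn]; linarith
  have e3 : critNorm a b / 2 <
      ‖(coeffPoly D (circuitCoeff a b)).eval ((critRadius a b : ℂ) * ω)‖ := by rw [hGn]; linarith
  have e4 : ‖(coeffPoly D (circuitCoeff a b)).eval ((critRadius a b : ℂ) * ω)‖ <
      2 * critNorm a b := by rw [hGn]; linarith
  have e5 : ‖((critRadius a b : ℂ) * ω) ^ 2 *
      (coeffPoly D (circuitCoeff a b)).derivative.derivative.eval ((critRadius a b : ℂ) * ω) /
      (coeffPoly D (circuitCoeff a b)).eval ((critRadius a b : ℂ) * ω) +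
        ((b * (a + b) : ℝ) : ℂ)‖ < (b * (a + b) : ℝ) / 4 := by
    rw [h2, mul_div_assoc, div_self hG]
    push_cast
    rw [mul_one, neg_add_cancel, norm_zero]
    positivity
  filter_upwards [hcn.continuousAt.eventually (lt_mem_nhds e1),
    hcn.continuousAt.eventually (gt_mem_nhds e2), continuousAt_snd.eventually hnear,
    hcv.continuousAt.eventually (lt_mem_nhds e3), hcv.continuousAt.eventually (gt_mem_nhds e4),
    hc2.eventually (gt_mem_nhds e5), eventually_frontier_circuitPetal ha hb hD hω M]
    with p f1 f2 f3 f4 f5 f6 f7 hp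
  exact ⟨hp, f1, f2, f3, f4, f5, f6, f7 hp⟩

theorem exists_forall_isCritNear (ha : 0 < a) (hb : 0 < b) (hD : a + b < D) (M : ℝ) :
    ∃ ε > 0, ∀ᶠ g in 𝓝 (circuitCoeff a b), ∀ ω ∈ powRoots a (-1), ∀ U,
      ‖U - critRadius a b * ω‖ < ε → (coeffPoly D g).derivative.eval U = 0 →
        IsCritNear (coeffPoly D g) a b M ω U := by
  have : ∀ᶠ ε in 𝓝[>] (0 : ℝ), ∀ ω ∈ powRoots a (-1), ∀ᶠ g in 𝓝 (circuitCoeff a b), ∀ U,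
      ‖U - critRadius a b * ω‖ < ε → (coeffPoly D g).derivative.eval U = 0 →
        IsCritNear (coeffPoly D g) a b M ω U := by
    rw [Filter.eventually_all_finite (finite_powRoots ha _)]
    intro ω hω
    have h := eventually_isCritNear ha hb hD hω M
    rw [nhds_prod_eq] at h
    obtain ⟨pa, hpa, pb, hpb, hab⟩ := eventually_prod_iff.1 h
    obtain ⟨ε, hε, hball⟩ := Metric.eventually_nhds_iff.1 hpb
    refine eventually_nhdsGT_of_forall_le ⟨ε, hε, fun ε' _ hle => ?_⟩
    filter_upwards [hpa] with g hg U hU hd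
    exact hab hg (hball (by rw [dist_eq_norm]; exact hU.trans_le hle)) hd
  obtain ⟨ε, h, hε⟩ := (this.and self_mem_nhdsWithin).exists
  exact ⟨ε, hε, (Filter.eventually_all_finite (finite_powRoots ha _)).2 h⟩

/-- The properties of the roots of a polynomial near the circuit polynomial. -/
structure IsNearCircuit (P : ℂ[X]) (a b : ℕ) (δ M r R : ℝ) (U : ℂ → ℂ) : Prop where
  pos : 0 < r
  exp_mul_lt : Real.exp 1 * r < critNorm a b / 2
  lt_R : 2 * critNorm a b < R
  two_le : 2 ≤ M
  lt_pow : r < (1 / 4) ^ b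
  mul_le_pow : 2 * R ≤ M ^ (a + b)
  crit : ∀ ω ∈ powRoots a (-1), IsCritNear P a b M ω (U ω)
  norm_lt : ∀ v, ‖v‖ = M → Real.exp 1 * R < ‖P.eval v‖
  inner : RootDiscs P M (Real.log r) δ (innerScale a b) (innerCenter a b)
  outer : RootDiscs P M (Real.log R) δ (fun (_ : powRoots (a + b) 1) => phaseRoot (a + b))
    Subtype.val
  small_inner : IsSmallRadius b 1 δ
  small_middle : IsSmallRadius a (-1) δ
  small_outer : IsSmallRadius (a + b) 1 δ
  petal_iff : ∀ w : ℂ, w.re = Real.log r → ∀ x u, ‖u / innerScale a b x w - innerCenter a b x‖ < δ →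
    ∀ ω : powRoots a (-1), u ∈ circuitPetal a M (U ω) ω ↔ x = Sum.inr ω

/-- The radii `r₀, R₀` are fixed before the coefficients `g` vary, so they do not depend on the
regeneration. The bound `δ < (1 - critRadius a b) / 2` keeps the middle discs outside the circles
through the critical points. -/
theorem eventually_isNearCircuit (ha : 0 < a) (hb : 0 < b) (hD : a + b < D) :
    ∀ᶠ δ in 𝓝[>] (0 : ℝ), ∃ r₀ > 0, ∃ R₀ > 0, ∀ r R : ℝ, 0 < r → r < r₀ → R₀ < R →
      ∃ M, ∃ ε > 0, ∀ᶠ g in 𝓝 (circuitCoeff a b), g 0 = 0 → ∀ U : ℂ → ℂ,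
        (∀ ω ∈ powRoots a (-1), ‖U ω - critRadius a b * ω‖ < ε ∧
          (coeffPoly D g).derivative.eval (U ω) = 0) →
        IsNearCircuit (coeffPoly D g) a b δ M r R U := by
  have hN : 0 < a + b := by omega
  have hρc := critRadius_pos (a := a) hb
  have hρ1 := critRadius_lt_one (b := b) ha
  have hcrit := critNorm_pos ha hb
  filter_upwards [eventually_rootDiscs_outer ha hb hD, eventually_rootDiscs_inner ha hb hD,
    eventually_isSmallRadius hb (c := 1) (by simp),
    eventually_isSmallRadius ha (c := -1) (by simp),
    eventually_isSmallRadius hN (c := 1) (by simp),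
    Ioo_mem_nhdsGT (show (0 : ℝ) < (1 - critRadius a b) / 2 by linarith)] with δ h1 h2 h3 h4 h5 h6
  obtain ⟨R₁, hR₁, h1⟩ := h1
  obtain ⟨r₁, hr₁, h2⟩ := h2
  have he1 : 1 ≤ Real.exp 1 := Real.one_le_exp (by norm_num)
  have he3 : Real.exp 1 < 3 := by
    have := Real.exp_one_lt_d9
    linarith
  -- The second bound puts the inner roots inside the circles through the critical points, and thus
  -- outside all petals; the third leaves a factor `e` between `r` and the norms of the critical
  -- values.
  refine ⟨min r₁ (min ((critRadius a b / 4) ^ b) (critNorm a b / (2 * Real.exp 1))),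
    by positivity, max R₁ (max 1 (2 * critNorm a b)), by positivity, fun r R hr hrr hRR => ?_⟩
  have hr1 : r < r₁ := hrr.trans_le (min_le_left _ _)
  have hr2 : r < (critRadius a b / 4) ^ b :=
    hrr.trans_le ((min_le_right _ _).trans (min_le_left _ _))
  have hr3 : r < critNorm a b / (2 * Real.exp 1) :=
    hrr.trans_le ((min_le_right _ _).trans (min_le_right _ _))
  have hR1 : R₁ < R := (le_max_left _ _).trans_lt hRR
  have hR2 : 1 < R := ((le_max_left _ _).trans (le_max_right _ _)).trans_lt hRR
  have hR3 : 2 * critNorm a b < R := ((le_max_right _ _).trans (le_max_right _ _)).trans_lt hRR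
  have hR0 : 0 < R := one_pos.trans hR2
  set σ := Real.exp (Real.log R / (a + b : ℕ)) with hσ
  have hσN : σ ^ (a + b) = R := by
    rw [hσ, ← Real.exp_nat_mul, mul_div_cancel₀ _ (by positivity), Real.exp_log hR0]
  have hσ1 : 1 ≤ σ := Real.one_le_exp (div_nonneg (Real.log_nonneg hR2.le) (by positivity))
  -- Since `M^(a+b) ≥ 4 e R`, the polynomial exceeds `e R` on the circle of radius `M`, which no
  -- root over the strip up to `log R + 1` can then meet. As `e < 3`, also `2 σ ≤ M ≤ 12 σ`, as the
  -- outer roots require.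
  set M := 4 * Real.exp 1 * σ with hM
  have hM4 : 4 ≤ M := by rw [hM]; nlinarith
  obtain ⟨ε, hε, h7⟩ := exists_forall_isCritNear ha hb hD M
  refine ⟨M, ε, hε, ?_⟩
  have hbd : ∀ᶠ g in 𝓝 (circuitCoeff a b), ∀ v ∈ Metric.sphere (0 : ℂ) M,
      Real.exp 1 * R < ‖(coeffPoly D g).eval v‖ := by
    refine (isCompact_sphere (0 : ℂ) M).eventually_forall_of_forall_eventually fun v hv => ?_
    have hvM : ‖v‖ = M := by simpa using hv
    refine (continuous_eval_coeffPoly (d := D)).norm.continuousAt.eventually (lt_mem_nhds ?_)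
    change Real.exp 1 * R < ‖(coeffPoly D (circuitCoeff a b)).eval v‖
    rw [eval_circuit ha hD, norm_mul, norm_pow, hvM]
    have e1 : M ^ a - 1 ≤ ‖1 + v ^ a‖ := by
      have := norm_sub_le_norm_add (v ^ a) (1 : ℂ)
      rwa [norm_one, norm_pow, add_comm, hvM] at this
    have e2 : 4 ≤ M ^ a := hM4.trans (le_self_pow₀ (by linarith) ha.ne')
    have e3 : Real.exp 1 * R * 4 ≤ M ^ (a + b) := by
      have e4 : 4 * Real.exp 1 ≤ (4 * Real.exp 1) ^ (a + b) :=
        le_self_pow₀ (by linarith) hN.ne'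
      rw [hM, mul_pow, hσN]
      nlinarith
    have e5 : M ^ b * (M ^ a / 2) ≤ M ^ b * ‖1 + v ^ a‖ := by
      gcongr
      linarith
    have e6 : M ^ (a + b) = M ^ b * M ^ a := by rw [pow_add]; ring
    have : 0 < Real.exp 1 * R := by positivity
    linarith
  filter_upwards [h1 R M hR1 (by rw [hM, ← hσ]; nlinarith) (by rw [hM, ← hσ]; nlinarith),
    h2 r M hr hr1 (by linarith), hbd, h7] with g g1 g2 g3 g4 g0 U hU
  have hcr := fun ω hω => g4 ω hω (U ω) (hU ω hω).1 (hU ω hω).2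
  have hr4 : r < (1 / 4 : ℝ) ^ b := hr2.trans_le (by gcongr)
  have hMN : 2 * R ≤ M ^ (a + b) := by
    have e4 : 4 * Real.exp 1 ≤ (4 * Real.exp 1) ^ (a + b) :=
      le_self_pow₀ (by linarith) hN.ne'
    rw [hM, mul_pow, hσN]
    nlinarith
  refine ⟨hr, ?_, hR3, by linarith, hr4, hMN, hcr, fun v hv => g3 v (by simpa using hv), g2 g0, g1 g0, h3, h4,
    h5, fun w hw x u hu ω => ?_⟩
  · rw [lt_div_iff₀ (by positivity)] at hr3
    linarith
  have hω := hcr ω ω.2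
  rcases x with ζ | ω'
  · refine iff_of_false (fun hmem => ?_) (by simp)
    have e1 := hmem.1
    have hu' : ‖u / phaseRoot b w - ζ‖ < δ := hu
    have e2 := (h3.norm_bounds hb (by simp) ζ.2 hu'.le).2
    have e3 : ‖phaseRoot b w‖ < critRadius a b / 4 := by
      refine lt_of_pow_lt_pow_left₀ b (by positivity) ?_
      rw [← norm_pow, phaseRoot_pow hb, norm_neg, Complex.norm_exp, hw, Real.exp_log hr]
      exact hr2
    rw [norm_div, div_lt_iff₀ (norm_pos_iff.2 (phaseRoot_ne_zero _ _))] at e2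
    linarith [hω.half_lt]
  · have hu' : ‖u - ω'‖ < δ := by
      have : ‖u / 1 - ω'‖ < δ := hu
      rwa [div_one] at this
    constructor
    · intro hmem
      by_contra hne
      have hne' : (ω' : ℂ) ≠ ω := fun h => hne (by rw [Subtype.ext h])
      have e1 := hmem.2.2 ω' ω'.2 hne'
      have e2 := h4.norm_lt_of_ne ω'.2 ω.2 hu' hne'.symm
      linarith
    · intro h
      obtain rfl : ω' = ω := Sum.inr_injective h
      have e1 : 1 - δ < ‖u‖ := by
        have := norm_sub_norm_le (ω' : ℂ) u
        rw [norm_eq_one_of_mem_powRoots ha ω'.2, norm_sub_rev] at this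
        linarith
      refine ⟨?_, ?_, fun ω hω'' hne => h4.norm_lt_of_ne ω'.2 hω'' hu' hne⟩
      · linarith [hω.lt_half, h6.2]
      · linarith [(h4.norm_bounds ha (by simp) ω'.2 hu'.le).2]

end NearCircuit

/-! ### The labelling of the roots by roots of unity, and its monodromy. -/

section CircuitLabelling

variable {P : ℂ[X]} {a b : ℕ} {δ M r R : ℝ} {U : ℂ → ℂ}

theorem norm_eval_of_eval_eq {w v : ℂ} (h : P.eval v = -Complex.exp w) :
    ‖P.eval v‖ = Real.exp w.re := by rw [h, norm_neg, Complex.norm_exp]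

namespace IsNearCircuit

variable (h : IsNearCircuit P a b δ M r R U)

include h

theorem R_pos : 0 < R := by
  have h1 := h.exp_mul_lt
  have h2 := h.lt_R
  have h3 := h.pos
  have : 0 < Real.exp 1 * r := by positivity
  linarith

theorem log_lt_log : Real.log r < Real.log R := by
  refine Real.log_lt_log h.pos ?_
  have h1 := h.exp_mul_lt
  have h2 := h.lt_R
  have h3 := h.pos
  have h4 := Real.add_one_le_exp 1
  nlinarith

theorem re_crit {ω c : ℂ} (hω : ω ∈ powRoots a (-1)) (hc : P.eval (U ω) = -Complex.exp c) :
    Real.log r < c.re ∧ c.re < Real.log R := by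
  have h1 := norm_eval_of_eval_eq hc
  have h2 := (h.crit ω hω).lt_value
  have h3 := (h.crit ω hω).value_lt
  rw [h1] at h2 h3
  have h4 := h.exp_mul_lt
  have h5 := h.lt_R
  have h6 := h.pos
  have h7 := Real.add_one_le_exp 1
  constructor
  · rw [Real.log_lt_iff_lt_exp h.pos]
    nlinarith
  · rw [Real.lt_log_iff_exp_lt h.R_pos]
    linarith

/-- Near its critical point, a petal is just the outside of the circle through this point, so the
collision condition is `exists_norm_lt_of_collision`; the confinement comes from the minimum of the
norm on the frontier. -/
theorem petalData (ha : 0 < a) (hb : 0 < b) {c : ℕ → ℂ} {ξ : ℕ → powRoots a (-1)}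
    (hinj : Set.InjOn ξ (Set.Iio a)) (hsurj : ∀ s, ∃ l < a, ξ l = s)
    (hc : ∀ l < a, P.eval (U (ξ l)) = -Complex.exp (c l))
    (hmono : StrictMonoOn (fun l => (c l).re) (Set.Iio a))
    (hcrit : ∀ w : ℂ, Real.log r - 1 < w.re → w.re < Real.log R + 1 → ∀ v,
      P.eval v = -Complex.exp w → P.derivative.eval v = 0 → ∃ ω ∈ powRoots a (-1), v = U ω) :
    PetalData P M (Real.log r - 1) (Real.log R + 1) a c (fun l => U (ξ l)) ξ
      (fun ω => circuitPetal a M (U ω) ω) := by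
  have hρ := critRadius_pos (a := a) hb
  have hρ1 := critRadius_lt_one (b := b) ha
  have hM : ∀ w : ℂ, w.re < Real.log R + 1 → ∀ v, P.eval v = -Complex.exp w → ‖v‖ ≠ M := by
    intro w hw v hv hvM
    have h1 := h.norm_lt v hvM
    rw [norm_eval_of_eval_eq hv] at h1
    have h2 := Real.exp_lt_exp.2 hw
    rw [Real.exp_add, Real.exp_log h.R_pos] at h2
    linarith
  have hUM : ∀ ω ∈ powRoots a (-1), ‖U ω‖ < M := fun ω hω => by
    linarith [(h.crit ω hω).lt_half, h.two_le]
  have hs0 : (0 : ℝ) < b * (a + b) := by positivity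
  refine ⟨?_, by linarith [h.log_lt_log], hmono, fun l hl => ?_, fun w h1 h2 v hv hv' => ?_,
    fun w hw v hv => hM w hw.2 v hv, hc, fun l _ => (h.crit _ (ξ l).2).crit, fun l _ h0 => ?_,
    fun l _ => hUM _ (ξ l).2, fun ω => isOpen_circuitPetal ha _ _ _, hinj, hsurj,
    fun l hl w h1 h2 v hv hfr => ?_, fun l hl l' hl' hne hmem => ?_, fun l hl => ?_⟩
  · obtain ⟨l, hl, -⟩ : ∃ l < a, True := ⟨0, ha, trivial⟩
    by_contra hdeg
    obtain ⟨x, hx⟩ := natDegree_eq_zero.1 (Nat.eq_zero_of_not_pos hdeg)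
    have e1 := h.norm_lt (M : ℂ) (by
      rw [Complex.norm_real, Real.norm_of_nonneg (by linarith [h.two_le])])
    have e2 := (h.crit _ (ξ l).2).value_lt
    rw [← hx, eval_C] at e1 e2
    have := Real.add_one_le_exp 1
    have := h.lt_R
    have := h.R_pos
    nlinarith
  · have := h.re_crit (ξ l).2 (hc l hl)
    constructor <;> linarith
  · obtain ⟨ω, hω, rfl⟩ := hcrit w h1 h2 v hv hv'
    obtain ⟨l, hl, hlω⟩ := hsurj ⟨ω, hω⟩
    have e1 : (ξ l : ℂ) = ω := by rw [hlω]
    refine ⟨l, hl, by rw [e1], ?_⟩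
    have e2 := hc l hl
    rw [e1, hv] at e2
    exact Complex.exp_eq_exp_iff_exists_int.1 (neg_injective e2)
  · have e1 := (h.crit _ (ξ l).2).second
    rw [h0, mul_zero, zero_div, zero_add, Complex.norm_real, Real.norm_of_nonneg hs0.le] at e1
    linarith
  -- A root on the frontier would have norm `M`, which is excluded over the strip, or else `e^(Re
  -- w)` would be at least the norm of the critical value, against `Re w < Re (c l)`.
  · rcases (h.crit _ (ξ l).2).frontier v hfr with e1 | e1
    · refine hM w ?_ v hv e1
      linarith [(h.re_crit (ξ l).2 (hc l hl)).2]
    · rw [norm_eval_of_eval_eq hv, norm_eval_of_eval_eq (hc l hl), Real.exp_le_exp] at e1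
      linarith
  · have hne' : (ξ l' : ℂ) ≠ ξ l := fun he => hne (hinj hl hl' (Subtype.ext he.symm))
    have e1 := (closure_circuitPetal_subset _ _ _ hmem).2.2 (ξ l) (ξ l).2
    have e2 := (h.crit _ (ξ l).2).nearest _ (ξ l').2 hne'
    linarith
  · have hcr := h.crit _ (ξ l).2
    have hP0 : P.eval (U (ξ l)) ≠ 0 := by
      rw [hc l hl]
      exact neg_ne_zero.2 (Complex.exp_ne_zero _)
    have hU0 : U (ξ l) ≠ 0 := by
      rw [← norm_pos_iff]
      linarith [hcr.half_lt]
    obtain ⟨ε, hε, hcol⟩ := exists_norm_lt_of_collision P hU0 hP0 hcr.crit hcr.second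
    have hnear : ∀ᶠ v in 𝓝 (U (ξ l)), ‖v‖ < M ∧ ∀ ω' ∈ powRoots a (-1), ω' ≠ (ξ l : ℂ) →
        ‖v - (ξ l : ℂ)‖ < ‖v - ω'‖ := by
      refine (continuous_norm.continuousAt.eventually (gt_mem_nhds (hUM _ (ξ l).2))).and ?_
      rw [Filter.eventually_all_finite (finite_powRoots ha _)]
      intro ω' hω'
      by_cases hne : ω' = (ξ l : ℂ)
      · simp [hne]
      · have hev : ∀ᶠ v in 𝓝 (U (ξ l)), ‖v - (ξ l : ℂ)‖ < ‖v - ω'‖ :=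
          ContinuousAt.eventually_lt (by fun_prop) (by fun_prop) (hcr.nearest ω' hω' hne)
        exact hev.mono fun v hv _ => hv
    obtain ⟨ε', hε', hball⟩ := Metric.eventually_nhds_iff.1 hnear
    refine ⟨min ε ε', by positivity, fun η hη _ v₁ v₂ h1 h2 hne hv1 hv2 => ?_⟩
    have hexp : ∀ v, P.eval v = -Complex.exp (c l - η) →
        P.eval v = P.eval (U (ξ l)) * Complex.exp (-η) := by
      intro v hv
      rw [hv, hc l hl, sub_eq_add_neg, Complex.exp_add]
      ring
    have hiff : ∀ v, dist v (U (ξ l)) < min ε ε' →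
        (v ∈ circuitPetal a M (U (ξ l)) (ξ l) ↔ ‖U (ξ l)‖ < ‖v‖) := by
      intro v hv
      have := hball (hv.trans_le (min_le_right _ _))
      exact ⟨fun hm => hm.1, fun hm => ⟨hm, this⟩⟩
    rw [hiff v₁ h1, hiff v₂ h2]
    rcases hcol η hη v₁ v₂ (h1.trans_le (min_le_left _ _)) (h2.trans_le (min_le_left _ _)) hne
      (hexp _ hv1) (hexp _ hv2) with ⟨e1, e2⟩ | ⟨e1, e2⟩
    · exact Or.inl ⟨e1, not_lt.2 e2.le⟩
    · exact Or.inr ⟨e1, not_lt.2 e2.le⟩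

end IsNearCircuit

theorem isPreconnected_reLine (x : ℝ) : IsPreconnected {w : ℂ | w.re = x} := by
  have : Convex ℝ {w : ℂ | w.re = x} := by
    have h := (convex_halfSpace_re_le x).inter (convex_halfSpace_re_ge x)
    convert h using 1
    ext w
    simp only [Set.mem_inter_iff, Set.mem_ofPred_eq]
    exact ⟨fun h => ⟨h.le, h.ge⟩, fun h => le_antisymm h.1 h.2⟩
  exact this.isPreconnected

/-- A label stays in its disc along the line. -/
theorem RootDiscs.mem_of_mem {x₀ : ℝ} {ι κ : Type*} {p : ι → ℂ → ℂ} {ζ : ι → ℂ}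
    (h : RootDiscs P M x₀ δ p ζ) (hpc : ∀ x, Continuous (p x)) (hp0 : ∀ x w, p x w ≠ 0)
    {W : Set ℂ} {ρ : κ → ℂ → ℂ} (hρ : IsLabelling P M W ρ) (hW : ∀ w : ℂ, w.re = x₀ → w ∈ W)
    {x : ι} {z : κ} {w₀ : ℂ} (hw₀ : w₀.re = x₀) (hz : ‖ρ z w₀ / p x w₀ - ζ x‖ < δ) :
    ∀ w : ℂ, w.re = x₀ → ‖ρ z w / p x w - ζ x‖ < δ := by
  have := (isPreconnected_reLine x₀).mem_of_notMem_frontier (f := fun w => ρ z w / p x w)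
    (U := Metric.ball (ζ x) δ) (((hρ.continuousOn z).mono hW).div (hpc x).continuousOn
      fun w _ => hp0 x w) Metric.isOpen_ball (fun w hw hfr => ?_) hw₀
      (by rwa [Metric.mem_ball, dist_eq_norm])
  · intro w hw
    have := this w hw
    rwa [Metric.mem_ball, dist_eq_norm] at this
  · have h1 := Metric.frontier_ball_subset_sphere hfr
    rw [Metric.mem_sphere, dist_eq_norm] at h1
    obtain ⟨y, hy⟩ := h.exists_disc w hw _ (hρ.eval_eq z w (hW w hw)) (hρ.norm_lt z w (hW w hw))
    have h2 := h.disjoint w hw x y _ h1.le hy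
    subst h2
    linarith

/-- A labelling of the roots of a polynomial near a circuit polynomial, with the labels given by
the roots of unity, and its monodromy. -/
structure IsCircuitLabelling (P : ℂ[X]) {a b : ℕ} (hb : 0 < b) (hN : 0 < a + b) (δ M r R : ℝ)
    (U : ℂ → ℂ) (c : ℕ → ℂ) (ξ : ℕ → powRoots a (-1)) (ρ : powRoots b 1 ⊕ powRoots a (-1) → ℂ → ℂ)
    (π : ℕ → Equiv.Perm (powRoots b 1 ⊕ powRoots a (-1)))
    (y : ℕ → powRoots b 1 ⊕ powRoots a (-1))
    (σ : powRoots b 1 ⊕ powRoots a (-1) ≃ powRoots (a + b) 1) : Prop where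
  petal : PetalData P M (Real.log r - 1) (Real.log R + 1) a c (fun l => U (ξ l)) ξ
    (fun ω => circuitPetal a M (U ω) ω)
  left : ∀ w : ℂ, w.re = Real.log r → Real.log r - 1 < w.re ∧
    w.re < stripRight (Real.log R + 1) a c 0
  right : ∀ w : ℂ, w.re = Real.log R → stripLeft (Real.log r - 1) c a < w.re ∧
    w.re < stripRight (Real.log R + 1) a c a
  labelling : IsLabelling P M (cutStrip (Real.log r - 1) (Real.log R + 1) a c) ρ
  inner : ∀ w : ℂ, w.re = Real.log r → ∀ x, ‖ρ x w / innerScale a b x w - innerCenter a b x‖ < δ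
  outer : ∀ w : ℂ, w.re = Real.log R → ∀ x, ‖ρ x w / phaseRoot (a + b) w - σ x‖ < δ
  perm : ∀ l ≤ a, ∀ x, ∀ w : ℂ, stripLeft (Real.log r - 1) c l < w.re →
    w.re < stripRight (Real.log R + 1) a c l → ρ x (w + 2 * Real.pi * Complex.I) = ρ (π l x) w
  chain : IsInsertionChain a (rotatePerm b hb) ξ y π
  limit : ∀ l < a, ∀ z, Tendsto (ρ z) (𝓝[slitUp (c l)] (c l)) (𝓝 (U (ξ l))) ↔
    z = Sum.inr (ξ l) ∨ z = y l
  rotate : ∀ x, σ (π a x) = rotatePerm (a + b) hN (σ x)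

theorem norm_unitRoot (d : ℕ) : ‖unitRoot d‖ = 1 := by
  rw [unitRoot, Complex.norm_exp, show (d : ℂ) = ((d : ℝ) : ℂ) by simp, Complex.div_ofReal_re]
  simp

theorem norm_div_phaseRoot_rotate {d : ℕ} (hd : 0 < d) (w u : ℂ) (ζ : powRoots d 1) :
    ‖u / phaseRoot d (w + 2 * Real.pi * Complex.I) - ζ‖ =
      ‖u / phaseRoot d w - rotatePerm d hd ζ‖ := by
  have h1 : unitRoot d ≠ 0 := Complex.exp_ne_zero _
  have h2 := phaseRoot_ne_zero d w
  rw [phaseRoot_add, coe_rotatePerm]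
  have h3 : u / phaseRoot d w - unitRoot d * ζ =
      unitRoot d * (u / (phaseRoot d w * unitRoot d) - ζ) := by field_simp
  rw [h3, norm_mul, norm_unitRoot, one_mul]

theorem stripRight_zero_gt {c : ℕ → ℂ} (ha : 0 < a) (hc : Real.log r < (c 0).re) :
    Real.log r < stripRight (Real.log R + 1) a c 0 := by
  rw [stripRight, if_pos ha]
  exact hc

/-- The discs at `Re w = log r` name the labels, and `σ` records their discs at `Re w = log R`.
Along each of these lines a root stays in its moving disc, and a translation by `2πi` rotates the
centres of the inner and outer discs by one step. This yields `π 0` on the inner labels, and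
identifies `π a` with the rotation of the outer ones. -/
theorem IsNearCircuit.exists_isCircuitLabelling (h : IsNearCircuit P a b δ M r R U)
    (ha : 0 < a) (hb : 0 < b) (hN : 0 < a + b) {c : ℕ → ℂ} {ξ : ℕ → powRoots a (-1)}
    (hc : ∀ l < a, P.eval (U (ξ l)) = -Complex.exp (c l))
    (hpd : PetalData P M (Real.log r - 1) (Real.log R + 1) a c (fun l => U (ξ l)) ξ
      (fun ω => circuitPetal a M (U ω) ω)) :
    ∃ ρ π y σ, IsCircuitLabelling P hb hN δ M r R U c ξ ρ π y σ := by
  have := (finite_powRoots hb 1).to_subtype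
  have := (finite_powRoots ha (-1)).to_subtype
  have hcre := fun l hl => h.re_crit (ξ l).2 (hc l hl)
  have hline : ∀ w : ℂ, w.re = Real.log r → Real.log r - 1 < w.re ∧
      w.re < stripRight (Real.log R + 1) a c 0 := fun w hw => by
    rw [hw]
    exact ⟨by linarith, stripRight_zero_gt ha (hcre 0 ha).1⟩
  have hlineW : ∀ w : ℂ, w.re = Real.log r → w ∈ cutStrip (Real.log r - 1) (Real.log R + 1) a c :=
    fun w hw => hpd.mem_of_strip (Nat.zero_le a) (hline w hw).1 (hline w hw).2
  have hlineR : ∀ w : ℂ, w.re = Real.log R → stripLeft (Real.log r - 1) c a < w.re ∧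
      w.re < stripRight (Real.log R + 1) a c a := fun w hw => by
    rw [hw, stripRight, if_neg (lt_irrefl a)]
    obtain ⟨a', rfl⟩ := Nat.exists_eq_succ_of_ne_zero ha.ne'
    exact ⟨(hcre a' (Nat.lt_succ_self _)).2, by linarith⟩
  have hlineRW : ∀ w : ℂ, w.re = Real.log R →
      w ∈ cutStrip (Real.log r - 1) (Real.log R + 1) a c :=
    fun w hw => hpd.mem_of_strip le_rfl (hlineR w hw).1 (hlineR w hw).2
  have hpc : ∀ x, Continuous (innerScale a b x) := by
    rintro (x | x)
    · exact continuous_phaseRoot b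
    · exact continuous_const
  have hp0 : ∀ x w, innerScale a b x w ≠ 0 := by
    rintro (x | x) w
    · exact phaseRoot_ne_zero b w
    · exact one_ne_zero
  set z₀ : ℂ := (Real.log r : ℂ) with hz₀
  have hz₀re : z₀.re = Real.log r := Complex.ofReal_re _
  choose u hu huM hud using h.inner.exists_root z₀ hz₀re
  have huinj : Function.Injective u := fun x y hxy =>
    h.inner.disjoint z₀ hz₀re x y (u x) (hud x).le (hxy ▸ hud y)
  obtain ⟨ρ, hρ, hρ0⟩ := exists_isLabelling hpd.isSimplyConnected isOpen_cutStrip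
    hpd.regularOn hpd.noRootOn (hlineW z₀ hz₀re) u huinj hu huM (fun v hv hvM => by
      obtain ⟨x, hx⟩ := h.inner.exists_disc z₀ hz₀re v hv hvM
      exact ⟨x, h.inner.unique z₀ hz₀re x _ _ (hu x) hv (hud x) hx⟩)
  have hin : ∀ w : ℂ, w.re = Real.log r → ∀ x,
      ‖ρ x w / innerScale a b x w - innerCenter a b x‖ < δ := fun w hw x =>
    h.inner.mem_of_mem hpc hp0 hρ hlineW hz₀re (by rw [hρ0]; exact hud x) w hw
  obtain ⟨π, hπ⟩ := hpd.exists_perm hρ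
  obtain ⟨y, hchain, hlim⟩ := hpd.exists_isInsertionChain hρ (hline z₀ hz₀re)
    (fun x s => h.petal_iff z₀ hz₀re x _ (hin z₀ hz₀re x) s) (f := rotatePerm b hb)
    (fun x => by
      have hz' : (z₀ + 2 * Real.pi * Complex.I).re = Real.log r := by
        rw [← hz₀re]; simp
      have e1 : ‖ρ (Sum.inl x) (z₀ + 2 * Real.pi * Complex.I) /
          phaseRoot b (z₀ + 2 * Real.pi * Complex.I) - x‖ < δ := hin _ hz' (Sum.inl x)
      rw [norm_div_phaseRoot_rotate hb] at e1
      have hr := hρ.eval_eq (Sum.inl x) _ (hlineW _ hz')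
      rw [Complex.exp_periodic] at hr
      exact h.inner.unique z₀ hz₀re (Sum.inl (rotatePerm b hb x)) _ _ hr
        (hρ.eval_eq _ _ (hlineW _ hz₀re)) e1 (hin z₀ hz₀re _)) hπ
  set e₀ : ℂ := (Real.log R : ℂ) with he₀
  have he₀re : e₀.re = Real.log R := Complex.ofReal_re _
  choose σ hσ using fun x => h.outer.exists_disc e₀ he₀re _ (hρ.eval_eq x _ (hlineRW _ he₀re))
    (hρ.norm_lt x _ (hlineRW _ he₀re))
  have hσinj : Function.Injective σ := fun x x' hxx => hρ.injective _ (hlineRW _ he₀re)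
    (h.outer.unique e₀ he₀re (σ x) _ _ (hρ.eval_eq x _ (hlineRW _ he₀re))
      (hρ.eval_eq x' _ (hlineRW _ he₀re)) (hσ x) (hxx ▸ hσ x'))
  have hσsurj : Function.Surjective σ := fun ζ => by
    obtain ⟨v, hv, hvM, hvd⟩ := h.outer.exists_root e₀ he₀re ζ
    obtain ⟨x, rfl⟩ := hρ.exists_eq e₀ (hlineRW _ he₀re) v hv hvM
    exact ⟨x, h.outer.disjoint e₀ he₀re _ _ _ (hσ x).le hvd⟩
  have hout : ∀ w : ℂ, w.re = Real.log R → ∀ x, ‖ρ x w / phaseRoot (a + b) w - σ x‖ < δ :=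
    fun w hw x => h.outer.mem_of_mem (fun _ => continuous_phaseRoot (a + b))
      (fun _ w => phaseRoot_ne_zero _ w) hρ hlineRW he₀re (hσ x) w hw
  refine ⟨ρ, π, y, Equiv.ofBijective σ ⟨hσinj, hσsurj⟩, hpd, hline, hlineR, hρ, hin, hout, hπ, hchain, hlim,
    fun x => ?_⟩
  change σ (π a x) = rotatePerm (a + b) hN (σ x)
  have he' : (e₀ + 2 * Real.pi * Complex.I).re = Real.log R := by
    rw [← he₀re]; simp
  have e1 := hout _ he' x
  rw [norm_div_phaseRoot_rotate hN, hπ a le_rfl x e₀ (hlineR e₀ he₀re).1 (hlineR e₀ he₀re).2] at e1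
  exact h.outer.disjoint e₀ he₀re _ _ _ (hσ (π a x)).le e1

end CircuitLabelling

/-! ### Identification of the fibres in the theorem with the labels. -/

section Fibres

variable {P : ℂ[X]} {a b : ℕ} {δ M r R : ℝ} {U : ℂ → ℂ} {c : ℕ → ℂ} {ξ : ℕ → powRoots a (-1)}
  {ρ : powRoots b 1 ⊕ powRoots a (-1) → ℂ → ℂ}
  {π : ℕ → Equiv.Perm (powRoots b 1 ⊕ powRoots a (-1))} {y : ℕ → powRoots b 1 ⊕ powRoots a (-1)}
  {σ : powRoots b 1 ⊕ powRoots a (-1) ≃ powRoots (a + b) 1}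

theorem div_phaseRoot_pow {d : ℕ} (hd : 0 < d) (u w : ℂ) :
    (u / phaseRoot d w) ^ d = -(u ^ d / Complex.exp w) := by
  rw [div_pow, phaseRoot_pow hd, div_neg]

theorem norm_lt_of_norm_div_add_one_lt {d : ℕ} {u w : ℂ} (h : ‖u ^ d / Complex.exp w + 1‖ < 1 / 2) :
    ‖u‖ ^ d < 3 / 2 * Real.exp w.re := by
  have h1 := norm_sub_le_norm_add (u ^ d / Complex.exp w) 1
  rw [norm_one, norm_div, norm_pow, Complex.norm_exp] at h1
  rw [← div_lt_iff₀ (Real.exp_pos _)]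
  linarith

namespace IsCircuitLabelling

variable {hb : 0 < b} {hN : 0 < a + b} (hl : IsCircuitLabelling P hb hN δ M r R U c ξ ρ π y σ)

include hl

theorem left_mem {w : ℂ} (hw : w.re = Real.log r) :
    w ∈ cutStrip (Real.log r - 1) (Real.log R + 1) a c :=
  hl.petal.mem_of_strip (Nat.zero_le a) (hl.left w hw).1 (hl.left w hw).2

theorem right_mem {w : ℂ} (hw : w.re = Real.log R) :
    w ∈ cutStrip (Real.log r - 1) (Real.log R + 1) a c :=
  hl.petal.mem_of_strip le_rfl (hl.right w hw).1 (hl.right w hw).2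

theorem norm_inl_lt (h : IsNearCircuit P a b δ M r R U) {z : ℂ} (hz : z.re = Real.log r)
    (ζ : powRoots b 1) : ‖ρ (Sum.inl ζ) z‖ < 1 / 2 := by
  have h1 : ‖ρ (Sum.inl ζ) z / phaseRoot b z - ζ‖ < δ := hl.inner z hz (Sum.inl ζ)
  have h2 := (h.small_inner.norm_bounds hb (by simp) ζ.2 h1.le).2
  have h3 : ‖phaseRoot b z‖ < 1 / 4 := by
    refine lt_of_pow_lt_pow_left₀ b (by positivity) ?_
    rw [← norm_pow, phaseRoot_pow hb, norm_neg, Complex.norm_exp, hz, Real.exp_log h.pos]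
    exact h.lt_pow
  rw [norm_div, div_lt_iff₀ (norm_pos_iff.2 (phaseRoot_ne_zero _ _))] at h2
  linarith

theorem norm_inr_gt (h : IsNearCircuit P a b δ M r R U) (ha : 0 < a) {z : ℂ}
    (hz : z.re = Real.log r) (ω : powRoots a (-1)) :
    ‖ρ (Sum.inr ω) z - ω‖ < δ ∧ 3 / 4 < ‖ρ (Sum.inr ω) z‖ := by
  have h1 : ‖ρ (Sum.inr ω) z / 1 - ω‖ < δ := hl.inner z hz (Sum.inr ω)
  rw [div_one] at h1
  exact ⟨h1, (h.small_middle.norm_bounds ha (by simp) ω.2 h1.le).1⟩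

/-- The condition with `1/2` selects the same roots as the discs of radius `δ`: it implies `‖u‖ <
3/4`, whereas the middle roots are larger than that. -/
theorem mem_inner_iff (h : IsNearCircuit P a b δ M r R U) (ha : 0 < a) {z : ℂ}
    (hz : z.re = Real.log r) (u : ℂ) :
    (P.eval u = -Complex.exp z ∧ ‖u ^ b / Complex.exp z + 1‖ < 1 / 2) ↔
      ∃ ζ, ρ (Sum.inl ζ) z = u := by
  constructor
  · rintro ⟨hu, hn⟩
    have h1 := norm_lt_of_norm_div_add_one_lt hn
    rw [hz, Real.exp_log h.pos] at h1
    have h2 : ‖u‖ < 3 / 4 := by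
      refine lt_of_pow_lt_pow_left₀ b (by positivity) (h1.trans_le ?_)
      have h3 : (3 / 4 : ℝ) ^ b = 3 ^ b * (1 / 4) ^ b := by rw [← mul_pow]; norm_num
      have h4 : (3 : ℝ) ≤ 3 ^ b := le_self_pow₀ (by norm_num) hb.ne'
      rw [h3]
      have := h.lt_pow
      have := h.pos
      nlinarith
    obtain ⟨x, rfl⟩ := hl.labelling.exists_eq z (hl.left_mem hz) u hu (by linarith [h.two_le])
    rcases x with ζ | ω
    · exact ⟨ζ, rfl⟩
    · have := (hl.norm_inr_gt h ha hz ω).2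
      linarith
  · rintro ⟨ζ, rfl⟩
    refine ⟨hl.labelling.eval_eq _ _ (hl.left_mem hz), ?_⟩
    have h1 := h.small_inner.pow ζ ζ.2 _ (hl.inner z hz (Sum.inl ζ))
    have h2 : ‖(ρ (Sum.inl ζ) z / phaseRoot b z) ^ b - 1‖ < 1 / 2 := h1
    rw [div_phaseRoot_pow hb, ← neg_add', norm_neg] at h2
    exact h2

theorem mem_middle_iff (h : IsNearCircuit P a b δ M r R U) (ha : 0 < a) {z : ℂ}
    (hz : z.re = Real.log r) (u : ℂ) :
    (P.eval u = -Complex.exp z ∧ ‖u ^ a + 1‖ < 1 / 2) ↔ ∃ ω, ρ (Sum.inr ω) z = u := by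
  constructor
  · rintro ⟨hu, hn⟩
    have h1 := norm_sub_le_norm_add (u ^ a) 1
    have h1' := norm_sub_le_norm_add 1 (u ^ a)
    rw [add_comm (1 : ℂ)] at h1'
    rw [norm_one, norm_pow] at h1 h1'
    have h2 : ‖u‖ < 2 := by
      by_contra! hle
      have : ‖u‖ ≤ ‖u‖ ^ a := le_self_pow₀ (by linarith) ha.ne'
      linarith
    obtain ⟨x, rfl⟩ := hl.labelling.exists_eq z (hl.left_mem hz) u hu (by linarith [h.two_le])
    rcases x with ζ | ω
    · have h3 := hl.norm_inl_lt h hz ζ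
      have : ‖ρ (Sum.inl ζ) z‖ ^ a ≤ ‖ρ (Sum.inl ζ) z‖ :=
        pow_le_of_le_one (norm_nonneg _) (by linarith) ha.ne'
      linarith
    · exact ⟨ω, rfl⟩
  · rintro ⟨ω, rfl⟩
    refine ⟨hl.labelling.eval_eq _ _ (hl.left_mem hz), ?_⟩
    have h1 := h.small_middle.pow ω ω.2 _ (hl.norm_inr_gt h ha hz ω).1
    rwa [sub_neg_eq_add] at h1

theorem mem_outer_iff (h : IsNearCircuit P a b δ M r R U) {e : ℂ}
    (he : e.re = Real.log R) (u : ℂ) :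
    (P.eval u = -Complex.exp e ∧ ‖u ^ (a + b) / Complex.exp e + 1‖ < 1 / 2) ↔ ∃ x, ρ x e = u := by
  constructor
  · rintro ⟨hu, hn⟩
    have h1 := norm_lt_of_norm_div_add_one_lt hn
    have hM := h.mul_le_pow
    have hR := h.R_pos
    rw [he, Real.exp_log hR] at h1
    have h2 : ‖u‖ < M := lt_of_pow_lt_pow_left₀ (a + b) (by linarith [h.two_le]) (by linarith)
    exact hl.labelling.exists_eq e (hl.right_mem he) u hu h2
  · rintro ⟨x, rfl⟩
    refine ⟨hl.labelling.eval_eq _ _ (hl.right_mem he), ?_⟩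
    have h2 := h.small_outer.pow (σ x) (σ x).2 _ (hl.outer e he x)
    rw [div_phaseRoot_pow hN, ← neg_add', norm_neg] at h2
    exact h2

/-- The identification of the fibres with roots of unity. -/
theorem exists_equivs (h : IsNearCircuit P a b δ M r R U) (ha : 0 < a) {F : ℂ → ℂ → Prop}
    (hF : ∀ t u, F t u ↔ P.eval u = -t) {z e : ℂ} (hz : z.re = Real.log r)
    (he : e.re = Real.log R) :
    ∃ (e₁ : powRoots b 1 ≃ {u | F (Complex.exp z) u ∧ ‖u ^ b / Complex.exp z + 1‖ < 1 / 2})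
      (e₂ : powRoots a (-1) ≃ {u | F (Complex.exp z) u ∧ ‖u ^ a + 1‖ < 1 / 2})
      (e₃ : powRoots (a + b) 1 ≃
        {u | F (Complex.exp e) u ∧ ‖u ^ (a + b) / Complex.exp e + 1‖ < 1 / 2}),
      (∀ ζ, (e₁ ζ : ℂ) = ρ (Sum.inl ζ) z) ∧ (∀ ω, (e₂ ω : ℂ) = ρ (Sum.inr ω) z) ∧
        ∀ x, (e₃ (σ x) : ℂ) = ρ x e := by
  have i1 : Function.Injective fun ζ => ρ (Sum.inl ζ) z := fun ζ ζ' hζ =>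
    Sum.inl_injective (hl.labelling.injective z (hl.left_mem hz) hζ)
  have i2 : Function.Injective fun ω => ρ (Sum.inr ω) z := fun ζ ζ' hζ =>
    Sum.inr_injective (hl.labelling.injective z (hl.left_mem hz) hζ)
  have i3 : Function.Injective fun ζ => ρ (σ.symm ζ) e := fun ζ ζ' hζ =>
    σ.symm.injective (hl.labelling.injective e (hl.right_mem he) hζ)
  have s1 : {u | F (Complex.exp z) u ∧ ‖u ^ b / Complex.exp z + 1‖ < 1 / 2} =
      Set.range fun ζ => ρ (Sum.inl ζ) z := by
    ext u
    rw [Set.mem_ofPred_eq, hF, hl.mem_inner_iff h ha hz, Set.mem_range]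
  have s2 : {u | F (Complex.exp z) u ∧ ‖u ^ a + 1‖ < 1 / 2} =
      Set.range fun ω => ρ (Sum.inr ω) z := by
    ext u
    rw [Set.mem_ofPred_eq, hF, hl.mem_middle_iff h ha hz, Set.mem_range]
  have s3 : {u | F (Complex.exp e) u ∧ ‖u ^ (a + b) / Complex.exp e + 1‖ < 1 / 2} =
      Set.range fun ζ => ρ (σ.symm ζ) e := by
    ext u
    rw [Set.mem_ofPred_eq, hF, hl.mem_outer_iff h he, Set.mem_range]
    exact ⟨fun ⟨x, hx⟩ => ⟨σ x, by simpa using hx⟩, fun ⟨ζ, hζ⟩ => ⟨_, hζ⟩⟩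
  refine ⟨(Equiv.ofInjective _ i1).trans (Equiv.setCongr s1.symm),
    (Equiv.ofInjective _ i2).trans (Equiv.setCongr s2.symm),
    (Equiv.ofInjective _ i3).trans (Equiv.setCongr s3.symm), fun ζ => rfl, fun ω => rfl,
    fun x => ?_⟩
  change ρ (σ.symm (σ x)) e = ρ x e
  rw [Equiv.symm_apply_apply]

theorem ne_of_chain {l : ℕ} (hla : l < a) : y l ≠ Sum.inr (ξ l) :=
  hl.chain.mem l hla l le_rfl hla

/-- It suffices that `ε` is less than `2π`, to pass through the gaps, and less than the widths of
the strips, for the turns to take place inside them. -/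
theorem eventually_transport {F : ℂ → ℂ → Prop}
    (hF : ∀ t u, F t u ↔ P.eval u = -t) (ha : 0 < a) {w : ℕ → ℂ} {b' : ℕ}
    (hw : ∀ l < a, w (b' + l) = c l)
    {z e : ℂ} (hz : z.re = Real.log r) (he : e.re = Real.log R) :
    ∀ᶠ ε in 𝓝[>] (0 : ℝ), (∀ x u', Transport F (radarPath w ε z e (List.range' b' a)) (ρ x z) u' ↔
        u' = ρ x e) ∧
      ∀ l < a, ∀ u', Transport F (radarPath w ε (c l) e (List.range' (b' + l + 1) (a - 1 - l)))
        (U (ξ l)) u' ↔ u' = ρ (Sum.inr (ξ l)) e ∨ u' = ρ (y l) e := by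
  have := (finite_powRoots hb 1).to_subtype
  have := (finite_powRoots ha (-1)).to_subtype
  have hgap : ∀ᶠ ε in 𝓝[>] (0 : ℝ), ∀ l < a, stripLeft (Real.log r - 1) c l < (c l).re - ε := by
    have : ∀ᶠ ε in 𝓝[>] (0 : ℝ), ∀ l ∈ Set.Iio a,
        stripLeft (Real.log r - 1) c l < (c l).re - ε := by
      rw [Filter.eventually_all_finite (Set.finite_Iio a)]
      intro l hla
      have hlt := hl.petal.stripLeft_lt (l := l) (le_of_lt hla)
      rw [PetalData.stripRight_eq (show l < a from hla)] at hlt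
      filter_upwards [Ioo_mem_nhdsGT (sub_pos.2 hlt)] with ε hε
      linarith [hε.2]
    exact this
  have he' : stripLeft (Real.log r - 1) c a < e.re ∧ e.re < Real.log R + 1 := by
    refine ⟨(hl.right e he).1, ?_⟩
    rw [he]
    linarith
  filter_upwards [hgap, Ioo_mem_nhdsGT (show (0 : ℝ) < 2 * Real.pi by positivity)] with ε h1 h2
  refine ⟨fun x u' => hl.petal.transport_radarPath hF hl.labelling hw he' h2.1 h2.2 h1
    (hl.left z hz) x u', fun l hla u' => ?_⟩
  rw [hl.petal.transport_blockPath hF hl.labelling hl.perm hw he' h2.1 h2.2 h1 hla u']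
  constructor
  · rintro ⟨x, hx, rfl⟩
    rcases (hl.limit l hla x).1 hx with rfl | rfl
    · exact Or.inl rfl
    · exact Or.inr rfl
  · rintro (rfl | rfl)
    · exact ⟨_, (hl.limit l hla _).2 (Or.inl rfl), rfl⟩
    · exact ⟨_, (hl.limit l hla _).2 (Or.inr rfl), rfl⟩

end IsCircuitLabelling

end Fibres

/-! ### Incidence graphs and cyclic orders under change of labels. -/

section Congruence

variable {S₁ S₂ S₃ T₁ T₂ : Type*}

theorem incidenceEdge_congr {C₃ : S₃ → S₃ → S₃ → Prop} (e₁ : S₁ ≃ T₁) (e₂ : S₂ ≃ T₂)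
    (σ : S₁ ⊕ S₂ ≃ S₃) (lt : T₂ → T₂ → Prop) (l : ℕ) (x y : S₃) :
    IncidenceEdge C₃ ((Equiv.sumCongr e₁ e₂).symm.trans σ) lt l x y ↔
      IncidenceEdge C₃ σ (fun s s' => lt (e₂ s) (e₂ s')) l x y := by
  have hcard : ∀ s, Nat.card {s' : T₂ // lt s' (e₂ s)} = Nat.card {s' : S₂ // lt (e₂ s') (e₂ s)} :=
    fun s => (Nat.card_congr (e₂.subtypeEquiv fun _ => Iff.rfl)).symm
  have hbelow : ∀ (p : S₁ ⊕ S₂) s, LiesBelow lt (Equiv.sumCongr e₁ e₂ p) (e₂ s) ↔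
      LiesBelow (fun s s' => lt (e₂ s) (e₂ s')) p s := by
    rintro (p | p) s <;> simp [LiesBelow]
  have habove : ∀ (p : S₁ ⊕ S₂) s, LiesAbove lt (Equiv.sumCongr e₁ e₂ p) (e₂ s) ↔
      LiesAbove (fun s s' => lt (e₂ s) (e₂ s')) p s := by
    rintro (p | p) s <;> simp [LiesAbove]
  have hval : ∀ p, ((Equiv.sumCongr e₁ e₂).symm.trans σ) (Equiv.sumCongr e₁ e₂ p) = σ p :=
    fun p => by rw [Equiv.trans_apply, Equiv.symm_apply_apply]
  have hinr : ∀ s, (Sum.inr (e₂ s) : T₁ ⊕ T₂) = Equiv.sumCongr e₁ e₂ (Sum.inr s) := fun _ => rfl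
  have hsymm : ∀ x, ((Equiv.sumCongr e₁ e₂).symm.trans σ).symm x =
      Equiv.sumCongr e₁ e₂ (σ.symm x) := fun _ => rfl
  have hatt : ∀ (p : S₁ ⊕ S₂) s, IsAttachingPoint C₃ ((Equiv.sumCongr e₁ e₂).symm.trans σ) lt
      (e₂ s) (Equiv.sumCongr e₁ e₂ p) ↔
      IsAttachingPoint C₃ σ (fun s s' => lt (e₂ s) (e₂ s')) s p := by
    intro p s
    simp only [IsAttachingPoint, hbelow, hval, hinr, hsymm, habove]
  simp only [IncidenceEdge, e₂.surjective.exists, (Equiv.sumCongr e₁ e₂).surjective.exists, hcard,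
    hatt, hinr, hval]

theorem IsCyclicSucc.of_comap {C : T₁ → T₁ → T₁ → Prop} {f : Equiv.Perm S₁} {d : ℕ} (e : S₁ ≃ T₁)
    (h : IsCyclicSucc C ((e.symm.trans f).trans e) d) :
    IsCyclicSucc (fun x y z => C (e x) (e y) (e z)) f d := by
  have hp : ∀ j x, (((e.symm.trans f).trans e) ^ j : Equiv.Perm T₁) (e x) = e ((f ^ j) x) := by
    intro j x
    induction j with
    | zero => simp
    | succ j ih =>
      rw [pow_succ', Equiv.Perm.mul_apply, ih, pow_succ', Equiv.Perm.mul_apply]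
      simp
  refine ⟨fun x y => ?_, fun x j h1 h2 he => ?_, fun x => ?_, fun x y z => ?_⟩
  · obtain ⟨j, hj, he⟩ := h.exists_pow (e x) (e y)
    rw [hp] at he
    exact ⟨j, hj, e.injective he⟩
  · exact h.pow_ne (e x) j h1 h2 (by rw [hp, he])
  · have := h.pow_eq (e x)
    rw [hp] at this
    exact e.injective this
  · rw [h.iff_pow]
    simp only [hp, e.injective.eq_iff]

end Congruence

/-! ### Monodromy map and vanishing graph in terms of the labels. -/

section Conclusion

variable {P : ℂ[X]} {a b : ℕ} {δ M r R : ℝ} {U : ℂ → ℂ} {c : ℕ → ℂ} {ξ : ℕ → powRoots a (-1)}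
  {ρ : powRoots b 1 ⊕ powRoots a (-1) → ℂ → ℂ}
  {π : ℕ → Equiv.Perm (powRoots b 1 ⊕ powRoots a (-1))} {y : ℕ → powRoots b 1 ⊕ powRoots a (-1)}
  {σ : powRoots b 1 ⊕ powRoots a (-1) ≃ powRoots (a + b) 1} {n m : ℕ} {k : ℕ → ℕ}
  {D : Regeneration n m k} {i : ℕ} {s : ℂ} {w : ℕ → ℂ}

theorem card_powRoots {d : ℕ} (hd : 0 < d) {x : ℂ} (hx : x ≠ 0) : Nat.card (powRoots d x) = d := by
  have h1 : Complex.exp (Complex.log x / d) ^ d = x := by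
    rw [← Complex.exp_nat_mul, mul_div_cancel₀ _ (by exact_mod_cast hd.ne'), Complex.exp_log hx]
  have h2 : powRoots d x = (nthRootsFinset d x : Set ℂ) := by
    ext ζ
    rw [Finset.mem_coe, mem_nthRootsFinset hd]
    exact Iff.rfl
  rw [h2, Nat.card_coe_set_eq, Set.ncard_coe_finset]
  have := isPrimitiveRoot_unitRoot hd
  rw [nthRootsFinset_def, Multiset.toFinset_card_of_nodup (this.nthRoots_nodup hx),
    this.card_nthRoots, if_pos ⟨_, h1⟩]

namespace IsCircuitLabelling

variable {hb : 0 < b} {hN : 0 < a + b} (hl : IsCircuitLabelling P hb hN δ M r R U c ξ ρ π y σ)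

include hl

/-- The identifications of the fibres depend only on the start and the end of the paths, so they are
chosen before `ε`. The vanishing edge of `w (b + l)` joins the labels that tend to the critical
point, namely `ξ l` and `y l`. -/
theorem exists_conclusion (h : IsNearCircuit P a b δ M r R U) (ha : 0 < a) (hkb : k i = b)
    (hkN : k (i + 1) = a + b) (hF : ∀ t u, D.FiberPoint i s t u ↔ P.eval u = -t)
    (hS : ∀ t u, D.SingularPoint i s t u ↔ P.eval u = -t ∧ P.derivative.eval u = 0)
    (hw : ∀ l < a, w (b + l) = c l) :
    ∃ (e₁ : powRoots b 1 ≃ D.innerFiber i s (startPoint k i w r))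
      (e₂ : powRoots a (-1) ≃ D.middleFiber i s (startPoint k i w r))
      (e₃ : powRoots (a + b) 1 ≃ D.outerFiber i s (endPoint k i w R)),
      (∀ ζ, ‖(e₁ ζ : ℂ) / phaseRoot b (startPoint k i w r) - ζ‖ < δ) ∧
      (∀ ω, ‖(e₂ ω : ℂ) - ω‖ < δ) ∧
      (∀ ζ, ‖(e₃ ζ : ℂ) / phaseRoot (a + b) (endPoint k i w R) - ζ‖ < δ) ∧
      ∀ᶠ ε in 𝓝[>] (0 : ℝ),
        D.IsMonodromyMap i s w ε r R ((Equiv.sumCongr e₁ e₂).symm.trans (σ.trans e₃)) ∧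
        ∀ l < a, ∀ X Y, D.VanishingEdge i s w ε R (b + l) X Y ↔
          (X = e₃ (σ (Sum.inr (ξ l))) ∧ Y = e₃ (σ (y l))) ∨
          (X = e₃ (σ (y l)) ∧ Y = e₃ (σ (Sum.inr (ξ l)))) := by
  have hz : (startPoint k i w r).re = Real.log r := rfl
  have he : (endPoint k i w R).re = Real.log R := rfl
  obtain ⟨e₁, e₂, e₃, h1, h2, h3⟩ := hl.exists_equivs h ha hF hz he
  have s1 : {u | D.FiberPoint i s (Complex.exp (startPoint k i w r)) u ∧
      ‖u ^ b / Complex.exp (startPoint k i w r) + 1‖ < 1 / 2} =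
      D.innerFiber i s (startPoint k i w r) := by
    rw [Regeneration.innerFiber, hkb]
  have s2 : {u | D.FiberPoint i s (Complex.exp (startPoint k i w r)) u ∧ ‖u ^ a + 1‖ < 1 / 2} =
      D.middleFiber i s (startPoint k i w r) := by
    rw [Regeneration.middleFiber, hkb, hkN, Nat.add_sub_cancel]
  have s3 : {u | D.FiberPoint i s (Complex.exp (endPoint k i w R)) u ∧
      ‖u ^ (a + b) / Complex.exp (endPoint k i w R) + 1‖ < 1 / 2} =
      D.outerFiber i s (endPoint k i w R) := by
    rw [Regeneration.outerFiber, hkN]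
  have h3' : ∀ x, ((e₃.trans (Equiv.setCongr s3)) (σ x) : ℂ) = ρ x (endPoint k i w R) := h3
  refine ⟨e₁.trans (Equiv.setCongr s1), e₂.trans (Equiv.setCongr s2),
    e₃.trans (Equiv.setCongr s3), fun ζ => ?_, fun ω => ?_, fun ζ => ?_, ?_⟩
  · change ‖(e₁ ζ : ℂ) / phaseRoot b (startPoint k i w r) - ζ‖ < δ
    rw [h1]
    exact hl.inner _ hz (Sum.inl ζ)
  · change ‖(e₂ ω : ℂ) - ω‖ < δ
    rw [h2]
    exact (hl.norm_inr_gt h ha hz ω).1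
  · have := hl.outer _ he (σ.symm ζ)
    rw [← h3', Equiv.apply_symm_apply] at this
    exact this
  · filter_upwards [hl.eventually_transport hF ha hw hz he] with ε hε
    refine ⟨fun p u' => ?_, fun l hla X Y => ?_⟩
    · obtain ⟨x, rfl⟩ := (Equiv.sumCongr (e₁.trans (Equiv.setCongr s1))
        (e₂.trans (Equiv.setCongr s2))).surjective p
      rw [Equiv.trans_apply, Equiv.symm_apply_apply, Equiv.trans_apply, h3', ← hε.1 x u', gammaPath,
        hkb, hkN, Nat.add_sub_cancel]
      have : Sum.elim Subtype.val Subtype.val ((Equiv.sumCongr (e₁.trans (Equiv.setCongr s1))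
          (e₂.trans (Equiv.setCongr s2))) x) = ρ x (startPoint k i w r) := by
        rcases x with x | x
        · exact h1 x
        · exact h2 x
      rw [this]
    · have hne : (e₃.trans (Equiv.setCongr s3)) (σ (Sum.inr (ξ l))) ≠
          (e₃.trans (Equiv.setCongr s3)) (σ (y l)) := fun hh =>
        hl.ne_of_chain hla (σ.injective ((e₃.trans (Equiv.setCongr s3)).injective hh)).symm
      have hT : ∀ X : D.outerFiber i s (endPoint k i w R),
          Transport (D.FiberPoint i s) (blockPath k i w ε R (b + l)) (U (ξ l)) X ↔
          X = (e₃.trans (Equiv.setCongr s3)) (σ (Sum.inr (ξ l))) ∨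
            X = (e₃.trans (Equiv.setCongr s3)) (σ (y l)) := by
        intro X
        rw [blockPath, hw l hla, hkN, show a + b - 1 - (b + l) = a - 1 - l by omega,
          hε.2 l hla, ← h3', ← h3', Subtype.coe_inj, Subtype.coe_inj]
      -- The real parts of the `c l` are distinct, so there is a single critical point over each
      -- `e^(c l)`.
      have hsing : ∀ u, D.SingularPoint i s (Complex.exp (w (b + l))) u ↔ u = U (ξ l) := by
        intro u
        rw [hS, hw l hla]
        constructor
        · rintro ⟨hu1, hu2⟩
          obtain ⟨l', hl', hu', j, hj⟩ := hl.petal.crit (c l) (hl.petal.mem l hla).1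
            (hl.petal.mem l hla).2 u hu1 hu2
          have : l = l' := hl.petal.injOn_re hla hl' (by simp [hj])
          rw [hu', this]
        · rintro rfl
          exact ⟨hl.petal.eval_crit l hla, hl.petal.deriv_crit l hla⟩
      simp only [Regeneration.VanishingEdge, hsing, exists_eq_left, hT]
      constructor
      · rintro ⟨hXY, h5 | h5, h6 | h6⟩
        · exact absurd (h5.trans h6.symm) hXY
        · exact Or.inl ⟨h5, h6⟩
        · exact Or.inr ⟨h5, h6⟩
        · exact absurd (h5.trans h6.symm) hXY
      · rintro (⟨rfl, rfl⟩ | ⟨rfl, rfl⟩)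
        · exact ⟨hne, Or.inl rfl, Or.inr rfl⟩
        · exact ⟨hne.symm, Or.inr rfl, Or.inl rfl⟩

omit hl in
theorem _root_.isCyclicSucc_outer (hN : 0 < a + b) (h : IsNearCircuit P a b δ M r R U) {e : ℂ} {S : Set ℂ}
    (e₃ : powRoots (a + b) 1 ≃ S) (h3 : ∀ ζ, ‖(e₃ ζ : ℂ) / phaseRoot (a + b) e - ζ‖ < δ) :
    IsCyclicSucc (CCWOn S) ((e₃.symm.trans (rotatePerm (a + b) hN)).trans e₃) (a + b) :=
  isCyclicSucc_of_arg_lt hN e₃ (phaseRoot_ne_zero (a + b) e) (fun ζ h0 => by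
    have := (h.small_outer.norm_bounds hN (by simp) ζ.2 (h3 ζ).le).1
    rw [h0, zero_div, norm_zero] at this
    linarith) fun ζ => h.small_outer.arg ζ ζ.2 _ (h3 ζ)

omit hl in
theorem _root_.isCyclicSucc_inner (hb : 0 < b) (h : IsNearCircuit P a b δ M r R U) {z : ℂ} {S : Set ℂ}
    (e₁ : powRoots b 1 ≃ S) (h1 : ∀ ζ, ‖(e₁ ζ : ℂ) / phaseRoot b z - ζ‖ < δ) :
    IsCyclicSucc (CCWOn S) ((e₁.symm.trans (rotatePerm b hb)).trans e₁) b :=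
  isCyclicSucc_of_arg_lt hb e₁ (phaseRoot_ne_zero b z) (fun ζ h0 => by
    have := (h.small_inner.norm_bounds hb (by simp) ζ.2 (h1 ζ).le).1
    rw [h0, zero_div, norm_zero] at this
    linarith) fun ζ => h.small_inner.arg ζ ζ.2 _ (h1 ζ)

theorem rotate_trans {S : Set ℂ} (e₃ : powRoots (a + b) 1 ≃ S) (x : powRoots b 1 ⊕ powRoots a (-1)) :
    (σ.trans e₃) (π a x) = ((e₃.symm.trans (rotatePerm (a + b) hN)).trans e₃) ((σ.trans e₃) x) := by
  simp [hl.rotate]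

/-- The vanishing graph is the incidence graph for the order of insertion, so the condition on `lt'`
becomes the equality of two incidence graphs; from here `order_unique` applies. -/
theorem vanishingGraphEq_iff (h : IsNearCircuit P a b δ M r R U) (hkb : k i = b)
    (hkN : k (i + 1) = a + b) {e₁ : powRoots b 1 ≃ D.innerFiber i s (startPoint k i w r)}
    {e₂ : powRoots a (-1) ≃ D.middleFiber i s (startPoint k i w r)}
    {e₃ : powRoots (a + b) 1 ≃ D.outerFiber i s (endPoint k i w R)}
    (h3 : ∀ ζ, ‖(e₃ ζ : ℂ) / phaseRoot (a + b) (endPoint k i w R) - ζ‖ < δ) {ε : ℝ}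
    (hV : ∀ l < a, ∀ X Y, D.VanishingEdge i s w ε R (b + l) X Y ↔
          (X = e₃ (σ (Sum.inr (ξ l))) ∧ Y = e₃ (σ (y l))) ∨
          (X = e₃ (σ (y l)) ∧ Y = e₃ (σ (Sum.inr (ξ l)))))
    {lt : powRoots a (-1) → powRoots a (-1) → Prop}
    (hlt : ∀ i < a, ∀ j < a, lt (ξ i) (ξ j) ↔ i < j)
    (lt' : D.middleFiber i s (startPoint k i w r) → D.middleFiber i s (startPoint k i w r) → Prop) :
    D.VanishingGraphEq i s w ε r R ((Equiv.sumCongr e₁ e₂).symm.trans (σ.trans e₃)) lt' ↔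
      ∀ l < a, ∀ X Y, IncidenceEdge (CCWOn _) (σ.trans e₃) lt l X Y ↔
        IncidenceEdge (CCWOn _) (σ.trans e₃) (fun x y => lt' (e₂ x) (e₂ y)) l X Y := by
  have hR := isCyclicSucc_outer hN h e₃ h3
  rw [Regeneration.VanishingGraphEq, hkb, hkN, Nat.add_sub_cancel]
  refine forall₂_congr fun l hla => forall₂_congr fun X Y => ?_
  rw [hV l hla, incidenceEdge_congr,
    hl.chain.incidenceEdge_iff hR (fun z => hl.rotate_trans e₃ z) hlt hla]
  exact Iff.rfl

/-- The conclusions of the theorem on all radar screens. -/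
theorem eventually_exists_monodromy (h : IsNearCircuit P a b δ M r R U) (ha : 0 < a) (hkb : k i = b)
    (hkN : k (i + 1) = a + b) (hF : ∀ t u, D.FiberPoint i s t u ↔ P.eval u = -t)
    (hS : ∀ t u, D.SingularPoint i s t u ↔ P.eval u = -t ∧ P.derivative.eval u = 0)
    (hw : ∀ l < a, w (b + l) = c l) :
    ∀ᶠ ε in 𝓝[>] (0 : ℝ),
      ∃ τ : D.innerFiber i s (startPoint k i w r) ⊕ D.middleFiber i s (startPoint k i w r) ≃
          D.outerFiber i s (endPoint k i w R),
        D.IsMonodromyMap i s w ε r R τ ∧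
        Nat.card (D.innerFiber i s (startPoint k i w r)) = k i ∧
        IsCyclicInsertion (CCWOn _) (CCWOn _) (k (i + 1) - k i) τ ∧
        ∃! lt : D.middleFiber i s (startPoint k i w r) →
            D.middleFiber i s (startPoint k i w r) → Prop,
          IsStrictTotalOrder _ lt ∧ D.VanishingGraphEq i s w ε r R τ lt := by
  have f1 := (finite_powRoots hb 1).to_subtype
  have f2 := (finite_powRoots ha (-1)).to_subtype
  have c2 : Nat.card (powRoots a (-1)) = a := card_powRoots ha (by simp)
  obtain ⟨e₁, e₂, e₃, h1, h2, h3, hev⟩ := hl.exists_conclusion h ha hkb hkN hF hS hw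
  have hR := isCyclicSucc_outer hN h e₃ h3
  have hf := isCyclicSucc_inner hb h e₁ h1
  obtain ⟨lt, hlt⟩ : ∃ lt : powRoots a (-1) → powRoots a (-1) → Prop,
      ∀ i < a, ∀ j < a, lt (ξ i) (ξ j) ↔ i < j := by
    refine ⟨fun s s' => ∃ i < a, ∃ j < a, ξ i = s ∧ ξ j = s' ∧ i < j, fun i hi j hj => ?_⟩
    constructor
    · rintro ⟨i', hi', j', hj', h1, h2, h3⟩
      rwa [← hl.chain.injOn hi' hi h1, ← hl.chain.injOn hj' hj h2]
    · exact fun hij => ⟨i, hi, j, hj, rfl, rfl, hij⟩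
  have hsto := hl.chain.isStrictTotalOrder hlt
  filter_upwards [hev] with ε hε
  refine ⟨_, hε.1, ?_, ⟨Finite.of_equiv _ e₁, Finite.of_equiv _ e₂, ?_, fun x y z hxyz => ?_⟩,
    fun x y => lt (e₂.symm x) (e₂.symm y), ⟨?_, ?_⟩, ?_⟩
  · rw [← Nat.card_congr e₁, card_powRoots hb one_ne_zero, hkb]
  · rw [← Nat.card_congr e₂, c2, hkb, hkN, Nat.add_sub_cancel]
  · obtain ⟨x, rfl⟩ := e₁.surjective x
    obtain ⟨y, rfl⟩ := e₁.surjective y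
    obtain ⟨z, rfl⟩ := e₁.surjective z
    have := hl.chain.cyclic_preserved hf.of_comap hR (fun z => hl.rotate_trans e₃ z) hxyz
    have hval : ∀ x, ((Equiv.sumCongr e₁ e₂).symm.trans (σ.trans e₃)) (Sum.inl (e₁ x)) =
        (σ.trans e₃) (Sum.inl x) := fun x => by simp
    rw [hval, hval, hval]
    exact this
  · exact
      { trichotomous := fun x y h1 h2 => e₂.symm.injective (hsto.trichotomous _ _ h1 h2)
        irrefl := fun x => hsto.irrefl _
        trans := fun x y z => hsto.trans _ _ _ }
  · rw [hl.vanishingGraphEq_iff h hkb hkN h3 hε.2 hlt]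
    intro l _ X Y
    simp only [Equiv.symm_apply_apply]
  · rintro lt' ⟨hlt', hV⟩
    rw [hl.vanishingGraphEq_iff h hkb hkN h3 hε.2 hlt] at hV
    have := hl.chain.order_unique c2 hR (fun z => hl.rotate_trans e₃ z) hlt
      (fun x y => lt' (e₂ x) (e₂ y))
      { trichotomous := fun x y h1 h2 => e₂.injective (hlt'.trichotomous _ _ h1 h2)
        irrefl := fun x => hlt'.irrefl _
        trans := fun x y z => hlt'.trans _ _ _ } fun l hla X Y h5 => (hV l hla X Y).1 h5
    funext x y
    rw [← this]
    simp

end IsCircuitLabelling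

end Conclusion

/-! ## The coefficients of the regenerated circuits -/

namespace IsMonotonePath

variable {n m : ℕ} {k : ℕ → ℕ} (hk : IsMonotonePath n m k)

include hk

theorem le {i j : ℕ} (hij : i ≤ j) (hj : j ≤ m) : k i ≤ k j := by
  induction j, hij using Nat.le_induction with
  | base => exact le_rfl
  | succ j _ ih => exact (ih (by omega)).trans (hk.2.2 j (by omega)).le

theorem one_le {i : ℕ} (hi : i ≤ m) : 1 ≤ k i := by
  rw [← hk.1]
  exact hk.le (Nat.zero_le i) hi

theorem le_succ {i : ℕ} (hi : i ≤ m) : k i ≤ n + 1 := by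
  rw [← hk.2.1]
  exact hk.le hi le_rfl

theorem exists_between (hm : 0 < m) {j : ℕ} (h1 : 1 ≤ j) (hj : j ≤ n + 1) :
    ∃ l < m, k l ≤ j ∧ j ≤ k (l + 1) := by
  have : ∃ l, j ≤ k (l + 1) := ⟨m - 1, by rwa [Nat.sub_add_cancel hm, hk.2.1]⟩
  classical
  have hle : Nat.find this ≤ m - 1 :=
    Nat.find_min' this (by rwa [Nat.sub_add_cancel hm, hk.2.1])
  refine ⟨Nat.find this, by omega, ?_, Nat.find_spec this⟩
  by_cases h0 : Nat.find this = 0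
  · rw [h0, hk.1]
    exact h1
  · have := Nat.find_min this (m := Nat.find this - 1) (by omega)
    rw [Nat.sub_add_cancel (by omega)] at this
    omega

theorem sum_gaps {l : ℕ} (hl : l ≤ m) :
    ∑ j ∈ Finset.range l, (k (j + 1) - k j) + 1 = k l := by
  induction l with
  | zero => simp [hk.1]
  | succ l ih =>
    rw [Finset.sum_range_succ, add_right_comm, ih (by omega)]
    have := hk.2.2 l (by omega)
    omega

end IsMonotonePath

namespace Regeneration

variable {n m : ℕ} {k : ℕ → ℕ} (D : Regeneration n m k)

/-- The height of `η` above the affine function that it agrees with on the `i`-th circuit. -/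
def expo (i j : ℕ) : ℤ := D.η j - D.η (k i) - D.slope i * ((j : ℤ) - k i)

/-- The exponent of the rescaling of `t` for the `i`-th circuit. -/
def energy (i : ℕ) : ℤ := D.η (k (i + 1)) - D.η 0 - (k (i + 1) : ℤ) * D.slope i

/-- The coefficients of `ψ̃_i(s, t)` in the coordinate of the `i`-th circuit, without the constant
one. -/
noncomputable def coef (i : ℕ) (s : ℂ) (j : ℕ) : ℂ :=
  if 1 ≤ j ∧ j ≤ n + 1 then D.c j * s ^ D.expo i j else 0

/-- The polynomial `ψ̃_i(s, 0)` in the coordinate of the `i`-th circuit. -/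
noncomputable def circuitPoly (i : ℕ) (s : ℂ) : ℂ[X] := coeffPoly (n + 2) (D.coef i s)

/-- The gap `g` of the slopes is kept as a parameter: `1` is available for every regeneration, while
the model with prescribed order of the critical values has gap `2`. -/
theorem slope_gap {g : ℤ} (hg0 : 0 ≤ g) (hg : ∀ l, l + 1 < m → D.slope l + g ≤ D.slope (l + 1))
    {l l' : ℕ} (h : l < l') (hl' : l' < m) : D.slope l + g ≤ D.slope l' := by
  induction l', h using Nat.le_induction with
  | base => exact hg l hl'
  | succ j _ ih => linarith [ih (by omega), hg j hl']

theorem expo_self (i : ℕ) : D.expo i (k i) = 0 := by simp [expo]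

theorem expo_next {i : ℕ} (hi : i < m) : D.expo i (k (i + 1)) = 0 := by
  rw [expo, D.slope_eq i hi, sub_self]

theorem expo_cocycle (i l j : ℕ) :
    D.expo i j = D.expo i (k l) + D.expo l j + (D.slope l - D.slope i) * ((j : ℤ) - k l) := by
  simp only [expo]
  ring

theorem expo_nonneg_of_between {l j : ℕ} (hl : l < m) (h1 : k l ≤ j) (h2 : j ≤ k (l + 1)) :
    0 ≤ D.expo l j := by
  rcases h1.eq_or_lt with rfl | h1
  · rw [D.expo_self]
  · rcases h2.eq_or_lt with rfl | h2
    · rw [D.expo_next hl]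
    · have := D.above l hl j h1 h2
      rw [expo]
      linarith

theorem energy_eq {i : ℕ} (hi : i < m) :
    D.energy i = D.η (k i) - D.η 0 - (k i : ℤ) * D.slope i := by
  have := D.slope_eq i hi
  rw [energy]
  linarith [mul_sub (D.slope i) (k (i + 1)) (k i), mul_comm (D.slope i) (k i),
    mul_comm (D.slope i) (k (i + 1))]

variable {D}

theorem expo_right (hk : IsMonotonePath n m k) {g : ℤ} (hg0 : 0 ≤ g)
    (hg : ∀ l, l + 1 < m → D.slope l + g ≤ D.slope (l + 1)) {i l : ℕ} (hil : i + 1 ≤ l)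
    (hl : l ≤ m) : 0 ≤ D.expo i (k l) ∧ (i + 1 < l → g ≤ D.expo i (k l)) := by
  induction l, hil using Nat.le_induction with
  | base => exact ⟨(D.expo_next (by omega)).ge, fun h => absurd h (lt_irrefl _)⟩
  | succ l hl' ih =>
    have h1 := (ih (by omega)).1
    have h2 := D.expo_cocycle i l (k (l + 1))
    rw [D.expo_next (by omega), add_zero] at h2
    have h3 := D.slope_gap hg0 hg (show i < l by omega) (by omega)
    have h4 : (k l : ℤ) < k (l + 1) := by exact_mod_cast hk.2.2 l (by omega)
    have : g ≤ D.expo i (k (l + 1)) := by nlinarith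
    exact ⟨hg0.trans this, fun _ => this⟩

theorem expo_left (hk : IsMonotonePath n m k) {g : ℤ} (hg0 : 0 ≤ g)
    (hg : ∀ l, l + 1 < m → D.slope l + g ≤ D.slope (l + 1)) {i l : ℕ} (hli : l ≤ i)
    (hi : i < m) : 0 ≤ D.expo i (k l) ∧ (l < i → g ≤ D.expo i (k l)) := by
  induction hli using Nat.decreasingInduction with
  | self => exact ⟨(D.expo_self i).ge, fun h => absurd h (lt_irrefl _)⟩
  | of_succ l hl' ih =>
    have h1 := ih.1
    have h2 := D.expo_cocycle i l (k (l + 1))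
    rw [D.expo_next (by omega), add_zero] at h2
    have h3 := D.slope_gap hg0 hg (show l < i by omega) (by omega)
    have h4 : (k l : ℤ) < k (l + 1) := by exact_mod_cast hk.2.2 l (by omega)
    have : g ≤ D.expo i (k l) := by nlinarith
    exact ⟨hg0.trans this, fun _ => this⟩

/-- Outside the `i`-th circuit the exponents are bounded below by the gaps of the slopes. -/
theorem le_expo (hk : IsMonotonePath n m k) {g : ℤ} (hg0 : 0 ≤ g)
    (hg : ∀ l, l + 1 < m → D.slope l + g ≤ D.slope (l + 1)) {i j : ℕ} (hi : i < m) (h1 : 1 ≤ j)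
    (hj : j ≤ n + 1) (hji : j < k i ∨ k (i + 1) < j) : g ≤ D.expo i j := by
  obtain ⟨l, hl, h2, h3⟩ := hk.exists_between (by omega) h1 hj
  have h4 := D.expo_nonneg_of_between hl h2 h3
  have h5 := D.expo_cocycle i l j
  rcases lt_trichotomy l i with hli | rfl | hli
  · have h6 := D.expo_cocycle i l (k (l + 1))
    rw [D.expo_next hl] at h6
    have h7 := D.slope_gap hg0 hg hli hi
    have h8 := D.expo_left hk hg0 hg (show l + 1 ≤ i by omega) hi
    have h10 := hk.2.2 i hi
    have h11 := hk.le (show l + 1 ≤ i by omega) hi.le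
    rcases h3.eq_or_lt with rfl | h3
    · refine h8.2 (lt_of_le_of_ne hli ?_)
      rintro rfl
      omega
    · have h9 : (j : ℤ) < k (l + 1) := by exact_mod_cast h3
      nlinarith
  · omega
  · have h7 := D.slope_gap hg0 hg hli hl
    have h8 := D.expo_right hk hg0 hg (show i + 1 ≤ l by omega) hl.le
    have h11 := hk.le (show i + 1 ≤ l by omega) hl.le
    have h10 := hk.2.2 i hi
    rcases h2.eq_or_lt with rfl | h2
    · refine h8.2 (lt_of_le_of_ne hli ?_)
      rintro rfl
      omega
    · have h9 : (k l : ℤ) < j := by exact_mod_cast h2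
      nlinarith

theorem expo_pos (hk : IsMonotonePath n m k) {i j : ℕ} (hi : i < m) (h1 : 1 ≤ j) (hj : j ≤ n + 1)
    (hji : j ≠ k i) (hji' : j ≠ k (i + 1)) : 0 < D.expo i j := by
  by_cases hout : j < k i ∨ k (i + 1) < j
  · exact D.le_expo hk zero_le_one (fun l hl => D.slope_lt l hl) hi h1 hj hout
  · push Not at hout
    have := D.above i hi j (lt_of_le_of_ne hout.1 hji.symm) (lt_of_le_of_ne hout.2 hji')
    rw [expo]
    linarith

/-- The critical values of the `l`-th circuit have the order of magnitude `‖s‖^(energy l)`, up to a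
common factor. Strict decrease of the energy thus means that for small `s` later circuits have much
larger critical values. -/
theorem energy_strict (hk : IsMonotonePath n m k) {l l' : ℕ} (h : l < l') (hl' : l' < m) :
    D.energy l' < D.energy l := by
  induction l', h using Nat.le_induction with
  | base =>
    have h1 := D.energy_eq hl'
    have h2 := D.slope_lt l hl'
    have h3 : (1 : ℤ) ≤ k (l + 1) := by exact_mod_cast hk.one_le hl'.le
    rw [h1, energy]
    nlinarith
  | succ j _ ih =>
    refine lt_trans ?_ (ih (by omega))
    have h1 := D.energy_eq hl'
    have h2 := D.slope_lt j hl'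
    have h3 : (1 : ℤ) ≤ k (j + 1) := by exact_mod_cast hk.one_le hl'.le
    rw [h1, energy]
    nlinarith

theorem coef_zero (i : ℕ) (s : ℂ) : D.coef i s 0 = 0 := by simp [coef]

/-- In the coordinate of the circuit all exponents of `s` are positive, except those at its two
vertices, which vanish. -/
theorem tendsto_coef (hk : IsMonotonePath n m k) {i : ℕ} (hi : i < m) :
    Tendsto (D.coef i) (𝓝[≠] 0) (𝓝 (circuitCoeff (k (i + 1) - k i) (k i))) := by
  have hlt := hk.2.2 i hi
  rw [tendsto_pi_nhds]
  intro j
  by_cases hj : 1 ≤ j ∧ j ≤ n + 1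
  · simp only [coef, if_pos hj]
    by_cases h1 : j = k i ∨ j = k (i + 1)
    · have h2 : D.c j = 1 := by
        rcases h1 with rfl | rfl
        exacts [D.c_vertex i hi.le, D.c_vertex (i + 1) hi]
      have h3 : D.expo i j = 0 := by
        rcases h1 with rfl | rfl
        exacts [D.expo_self i, D.expo_next hi]
      have h4 : circuitCoeff (k (i + 1) - k i) (k i) j = 1 := by
        rw [circuitCoeff, if_pos (by omega)]
      simp only [h2, h3, h4, zpow_zero, one_mul]
      exact tendsto_const_nhds
    · push Not at h1
      obtain ⟨e, he⟩ := Int.eq_ofNat_of_zero_le (D.expo_pos hk hi hj.1 hj.2 h1.1 h1.2).le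
      have he' : e ≠ 0 := by
        have := D.expo_pos hk hi hj.1 hj.2 h1.1 h1.2
        omega
      have h4 : circuitCoeff (k (i + 1) - k i) (k i) j = 0 := by
        rw [circuitCoeff, if_neg (by omega)]
      have h5 : Continuous fun s : ℂ => D.c j * s ^ e := by fun_prop
      have h6 := (h5.tendsto 0).mono_left (nhdsWithin_le_nhds (s := {0}ᶜ))
      rw [zero_pow he', mul_zero] at h6
      simpa only [he, h4, Int.ofNat_eq_natCast, zpow_natCast] using h6
  · have h1 := hk.one_le hi.le
    have h2 := hk.le_succ (show i + 1 ≤ m from hi)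
    have h4 : circuitCoeff (k (i + 1) - k i) (k i) j = 0 := by
      rw [circuitCoeff, if_neg (by omega)]
    simp only [coef, if_neg hj, h4]
    exact tendsto_const_nhds

theorem psiTilde_comp {i : ℕ} (hi : i < m) {s : ℂ} (hs : s ≠ 0) (t : ℂ) :
    (D.psiTilde i s t).comp (C (s ^ (-D.slope i)) * X) =
      C (s ^ (D.η (k i) - k i * D.slope i)) * (D.circuitPoly i s + C t) := by
  have h1 : D.circuitPoly i s = ∑ j ∈ Finset.Icc 1 (n + 1), C (D.c j * s ^ D.expo i j) * X ^ j := by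
    rw [circuitPoly, coeffPoly]
    symm
    refine Finset.sum_subset_zero_on_sdiff (fun j hj => ?_) (fun j hj => ?_) fun j hj => ?_
    · rw [Finset.mem_Icc] at hj
      exact Finset.mem_range.2 (by omega)
    · have : ¬ (1 ≤ j ∧ j ≤ n + 1) := by
        rw [Finset.mem_sdiff, Finset.mem_Icc] at hj
        exact hj.2
      simp [coef, this]
    · rw [Finset.mem_Icc] at hj
      simp [coef, hj]
  have h2 : D.η 0 + D.energy i = D.η (k i) - k i * D.slope i := by
    rw [D.energy_eq hi]
    ring
  have h3 : ∀ j, C (D.c j * s ^ D.η j) * (C (s ^ (-D.slope i)) * X) ^ j =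
      C (s ^ (D.η (k i) - k i * D.slope i)) * (C (D.c j * s ^ D.expo i j) * X ^ j) := by
    intro j
    rw [mul_pow, ← C_pow, ← mul_assoc, ← mul_assoc, ← C_mul, ← C_mul]
    congr 2
    rw [← zpow_natCast, ← zpow_mul, mul_left_comm, ← zpow_add₀ hs, mul_assoc, ← zpow_add₀ hs]
    congr 2
    rw [expo]
    ring
  rw [psiTilde, psi, ← mul_assoc, ← zpow_add₀ hs,
    show D.η 0 + (D.η (k (i + 1)) - D.η 0 - (k (i + 1) : ℤ) * D.slope i) = D.η 0 + D.energy i from rfl,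
    h2, h1]
  simp only [add_comp, C_comp, Polynomial.sum_comp, mul_comp, X_pow_comp, h3]
  rw [← Finset.mul_sum, C_mul, mul_add]

theorem fiberPoint_iff {i : ℕ} (hi : i < m) {s : ℂ} (hs : s ≠ 0) (t u : ℂ) :
    D.FiberPoint i s t u ↔ (D.circuitPoly i s).eval u = -t := by
  have h := congrArg (eval u) (D.psiTilde_comp hi hs t)
  rw [eval_comp, eval_mul, eval_C, eval_X, eval_mul, eval_C, eval_add, eval_C] at h
  rw [FiberPoint, h, mul_eq_zero, or_iff_right (zpow_ne_zero _ hs), add_eq_zero_iff_eq_neg]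

theorem singularPoint_iff {i : ℕ} (hi : i < m) {s : ℂ} (hs : s ≠ 0) (t u : ℂ) :
    D.SingularPoint i s t u ↔
      (D.circuitPoly i s).eval u = -t ∧ (D.circuitPoly i s).derivative.eval u = 0 := by
  have h := congrArg (fun p => eval u (derivative p)) (D.psiTilde_comp hi hs t)
  simp only [derivative_comp, derivative_C_mul, derivative_X, derivative_add, derivative_C,
    eval_mul, eval_comp, eval_C, eval_X, mul_one, add_zero] at h
  rw [SingularPoint, fiberPoint_iff hi hs]
  refine and_congr_right fun _ => ?_
  rw [← mul_eq_zero_iff_left (zpow_ne_zero (-D.slope i) hs) (b := eval _ _), h,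
    mul_eq_zero, or_iff_right (zpow_ne_zero _ hs)]

/-- The families `ψ̃_l` and `ψ̃_i` differ only by a rescaling of `t` by a power of `s`, so the
critical points of every circuit can be viewed in the coordinate of the `i`-th one. -/
theorem singularPoint_shift (i l : ℕ) {s : ℂ} (hs : s ≠ 0) (t u : ℂ) :
    D.SingularPoint l s t u ↔ D.SingularPoint i s (s ^ (D.energy l - D.energy i) * t)
      (s ^ (D.slope i - D.slope l) * u) := by
  have h1 : D.psiTilde i s (s ^ (D.energy l - D.energy i) * t) = D.psiTilde l s t := by
    change D.psi s (s ^ D.energy i * _) = D.psi s (s ^ D.energy l * t)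
    rw [← mul_assoc, ← zpow_add₀ hs, add_sub_cancel]
  have h2 : s ^ (-D.slope i) * (s ^ (D.slope i - D.slope l) * u) = s ^ (-D.slope l) * u := by
    rw [← mul_assoc, ← zpow_add₀ hs]
    congr 2
    ring
  simp only [SingularPoint, FiberPoint, h1, h2]

end Regeneration

/-! ## The critical points of all circuits -/

theorem card_nthRootsFinset_of_ne_zero {d : ℕ} (hd : 0 < d) {x : ℂ} (hx : x ≠ 0) :
    (nthRootsFinset d x).card = d := by
  have h : powRoots d x = (nthRootsFinset d x : Set ℂ) := by
    ext ζ
    rw [Finset.mem_coe, mem_nthRootsFinset hd]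
    exact Iff.rfl
  have h1 := card_powRoots hd hx
  rwa [h, Nat.card_coe_set_eq, Set.ncard_coe_finset] at h1

/-- The critical points of all circuits are indexed by the circuit and a root of `-1`. -/
noncomputable def critIndex (m : ℕ) (k : ℕ → ℕ) : Finset (Σ _ : ℕ, ℂ) :=
  (Finset.range m).sigma fun l => nthRootsFinset (k (l + 1) - k l) (-1 : ℂ)

section Index

variable {n m : ℕ} {k : ℕ → ℕ}

theorem mem_critIndex (hk : IsMonotonePath n m k) {p : Σ _ : ℕ, ℂ} :
    p ∈ critIndex m k ↔ p.1 < m ∧ p.2 ∈ powRoots (k (p.1 + 1) - k p.1) (-1) := by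
  rw [critIndex, Finset.mem_sigma, Finset.mem_range]
  refine and_congr_right fun h => ?_
  rw [mem_nthRootsFinset (Nat.sub_pos_of_lt (hk.2.2 _ h))]
  exact Iff.rfl

theorem card_critIndex_filter (hk : IsMonotonePath n m k) {l : ℕ} (hl : l ≤ m) :
    ((critIndex m k).filter fun p => p.1 < l).card + 1 = k l := by
  have h : (critIndex m k).filter (fun p => p.1 < l) =
      (Finset.range l).sigma fun l => nthRootsFinset (k (l + 1) - k l) (-1 : ℂ) := by
    ext p
    simp only [critIndex, Finset.mem_filter, Finset.mem_sigma, Finset.mem_range]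
    constructor
    · rintro ⟨⟨_, h⟩, h'⟩
      exact ⟨h', h⟩
    · rintro ⟨h, h'⟩
      exact ⟨⟨by omega, h'⟩, h⟩
  rw [h, Finset.card_sigma, ← hk.sum_gaps hl]
  congr 1
  refine Finset.sum_congr rfl fun j hj => card_nthRootsFinset_of_ne_zero ?_ (by simp)
  exact Nat.sub_pos_of_lt (hk.2.2 _ ((Finset.mem_range.1 hj).trans_le hl))

theorem card_critIndex (hk : IsMonotonePath n m k) : (critIndex m k).card = n := by
  have h := card_critIndex_filter hk le_rfl
  rw [Finset.filter_true_of_mem fun p hp => ((mem_critIndex hk).1 hp).1, hk.2.1] at h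
  omega

theorem lt_iff_le_of_monotoneOn {f : ℕ → ℕ} (hf : MonotoneOn f (Set.Icc 1 n)) {l K : ℕ}
    (hK : ((Finset.Icc 1 n).filter fun j => f j < l).card = K) {j : ℕ} (hj : j ∈ Set.Icc 1 n) :
    f j < l ↔ j ≤ K := by
  constructor
  · intro h
    have : Finset.Icc 1 j ⊆ (Finset.Icc 1 n).filter fun j => f j < l := by
      intro x hx
      rw [Finset.mem_Icc] at hx
      have hxn : x ∈ Set.Icc 1 n := ⟨hx.1, hx.2.trans hj.2⟩
      exact Finset.mem_filter.2 ⟨Finset.mem_Icc.2 hxn, (hf hxn hj hx.2).trans_lt h⟩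
    have := Finset.card_le_card this
    rwa [hK, Nat.card_Icc, Nat.add_sub_cancel] at this
  · intro h
    by_contra hlt
    have : ((Finset.Icc 1 n).filter fun j => f j < l) ⊆ Finset.Icc 1 (j - 1) := by
      intro x hx
      rw [Finset.mem_filter, Finset.mem_Icc] at hx
      rw [Finset.mem_Icc]
      refine ⟨hx.1.1, ?_⟩
      by_contra hxj
      have := hf hj hx.1 (by omega)
      omega
    have := Finset.card_le_card this
    rw [hK, Nat.card_Icc, Nat.add_sub_cancel] at this
    have := hj.1
    omega

end Index

/-! ### Separation of the critical values of different circuits. -/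

namespace Regeneration

variable {n m : ℕ} {k : ℕ → ℕ} (D : Regeneration n m k)

/-- Critical points `U l ω` of the circuits, with well separated critical values. -/
structure IsCritSystem (s : ℂ) (U : ℕ → ℂ → ℂ) : Prop where
  ne_zero : s ≠ 0
  crit : ∀ l < m, ∀ ω ∈ powRoots (k (l + 1) - k l) (-1),
    (D.circuitPoly l s).derivative.eval (U l ω) = 0
  lt_value : ∀ l < m, ∀ ω ∈ powRoots (k (l + 1) - k l) (-1),
    critNorm (k (l + 1) - k l) (k l) / 2 < ‖(D.circuitPoly l s).eval (U l ω)‖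
  value_lt : ∀ l < m, ∀ ω ∈ powRoots (k (l + 1) - k l) (-1),
    ‖(D.circuitPoly l s).eval (U l ω)‖ < 2 * critNorm (k (l + 1) - k l) (k l)
  injOn : ∀ l < m, Set.InjOn (U l) (powRoots (k (l + 1) - k l) (-1))
  separated : ∀ l l', l < l' → l' < m → ‖s‖ ^ (D.energy l - D.energy l') *
    (2 * critNorm (k (l + 1) - k l) (k l)) < critNorm (k (l' + 1) - k l') (k l') / 2

/-- The critical point with index `p`, in the coordinate of the `i`-th circuit. -/
noncomputable def critPoint (i : ℕ) (s : ℂ) (U : ℕ → ℂ → ℂ) (p : Σ _ : ℕ, ℂ) : ℂ :=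
  s ^ (D.slope i - D.slope p.1) * U p.1 p.2

/-- The critical value with index `p`, in the coordinate of the `i`-th circuit. -/
noncomputable def critValue (i : ℕ) (s : ℂ) (U : ℕ → ℂ → ℂ) (p : Σ _ : ℕ, ℂ) : ℂ :=
  s ^ (D.energy p.1 - D.energy i) * -(D.circuitPoly p.1 s).eval (U p.1 p.2)

variable {D}

theorem derivative_circuitPoly_ne_zero (hk : IsMonotonePath n m k) {s : ℂ} (hs : s ≠ 0) (i : ℕ) :
    (D.circuitPoly i s).derivative ≠ 0 := by
  intro h
  have h1 : (D.circuitPoly i s).coeff (n + 1) = D.coef i s (n + 1) := by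
    simp [circuitPoly, coeffPoly, coeff_C_mul, coeff_X_pow]
  have h2 := congrArg (fun p => coeff p n) h
  simp only [coeff_derivative, h1, coeff_zero] at h2
  have hc : D.c (n + 1) = 1 := by rw [← hk.2.1, D.c_vertex m le_rfl]
  rw [coef, if_pos ⟨by omega, le_rfl⟩, hc, one_mul] at h2
  rcases mul_eq_zero.1 h2 with h3 | h3
  · exact zpow_ne_zero _ hs h3
  · exact Nat.cast_add_one_ne_zero n h3

theorem natDegree_derivative_circuitPoly (s : ℂ) (i : ℕ) :
    (D.circuitPoly i s).derivative.natDegree ≤ n := by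
  refine (natDegree_derivative_le _).trans (Nat.sub_le_of_le_add ?_)
  rw [circuitPoly, coeffPoly]
  refine natDegree_sum_le_of_forall_le _ _ fun j hj => ?_
  have := Finset.mem_range.1 hj
  exact (natDegree_C_mul_X_pow_le _ _).trans (by omega)

namespace IsCritSystem

variable {s : ℂ} {U : ℕ → ℂ → ℂ} (h : D.IsCritSystem s U) (hk : IsMonotonePath n m k)

include h hk

theorem singularPoint (i : ℕ) {p : Σ _ : ℕ, ℂ} (hp : p ∈ critIndex m k) :
    D.SingularPoint i s (D.critValue i s U p) (D.critPoint i s U p) := by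
  rw [mem_critIndex hk] at hp
  rw [critValue, critPoint, ← singularPoint_shift i p.1 h.ne_zero, singularPoint_iff hp.1 h.ne_zero,
    neg_neg]
  exact ⟨rfl, h.crit _ hp.1 _ hp.2⟩

theorem norm_critValue (i : ℕ) {p : Σ _ : ℕ, ℂ} (hp : p ∈ critIndex m k) :
    ‖s‖ ^ (D.energy p.1 - D.energy i) * (critNorm (k (p.1 + 1) - k p.1) (k p.1) / 2) <
      ‖D.critValue i s U p‖ ∧ ‖D.critValue i s U p‖ <
    ‖s‖ ^ (D.energy p.1 - D.energy i) * (2 * critNorm (k (p.1 + 1) - k p.1) (k p.1)) := by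
  rw [mem_critIndex hk] at hp
  have hs : 0 < ‖s‖ := norm_pos_iff.2 h.ne_zero
  rw [critValue, norm_mul, norm_zpow, norm_neg]
  exact ⟨mul_lt_mul_of_pos_left (h.lt_value _ hp.1 _ hp.2) (by positivity),
    mul_lt_mul_of_pos_left (h.value_lt _ hp.1 _ hp.2) (by positivity)⟩

theorem critValue_ne_zero (i : ℕ) {p : Σ _ : ℕ, ℂ} (hp : p ∈ critIndex m k) :
    D.critValue i s U p ≠ 0 := by
  have hp' := (mem_critIndex hk).1 hp
  have hs : 0 < ‖s‖ := norm_pos_iff.2 h.ne_zero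
  have h1 := critNorm_pos (Nat.sub_pos_of_lt (hk.2.2 _ hp'.1)) (hk.one_le hp'.1.le)
  rw [← norm_pos_iff]
  exact lt_trans (by positivity) (h.norm_critValue hk i hp).1

theorem norm_critValue_lt (i : ℕ) {p p' : Σ _ : ℕ, ℂ} (hp : p ∈ critIndex m k)
    (hp' : p' ∈ critIndex m k) (hlt : p.1 < p'.1) :
    ‖D.critValue i s U p‖ < ‖D.critValue i s U p'‖ := by
  have hs : 0 < ‖s‖ := norm_pos_iff.2 h.ne_zero
  refine (h.norm_critValue hk i hp).2.trans (lt_trans ?_ (h.norm_critValue hk i hp').1)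
  have h1 := h.separated _ _ hlt ((mem_critIndex hk).1 hp').1
  have h2 : D.energy p.1 - D.energy i =
    (D.energy p'.1 - D.energy i) + (D.energy p.1 - D.energy p'.1) := by ring
  rw [h2, zpow_add₀ hs.ne', mul_assoc]
  exact mul_lt_mul_of_pos_left h1 (by positivity)

/-- Critical points of different circuits have values of different norms; within a circuit the
points `U l ω` are distinct. -/
theorem injOn_critPoint {i : ℕ} (hi : i < m) : Set.InjOn (D.critPoint i s U) (critIndex m k) := by
  intro p hp p' hp' he
  have h1 := ((singularPoint_iff hi h.ne_zero _ _).1 (h.singularPoint hk i hp)).1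
  have h2 := ((singularPoint_iff hi h.ne_zero _ _).1 (h.singularPoint hk i hp')).1
  rw [← he, h1, neg_inj] at h2
  have h3 : p.1 = p'.1 := by
    rcases lt_trichotomy p.1 p'.1 with h3 | h3 | h3
    · exact absurd (h.norm_critValue_lt hk i hp hp' h3) (by rw [h2]; exact lt_irrefl _)
    · exact h3
    · exact absurd (h.norm_critValue_lt hk i hp' hp h3) (by rw [h2]; exact lt_irrefl _)
  obtain ⟨l, ω⟩ := p
  obtain ⟨l', ω'⟩ := p'
  dsimp only at h3
  subst h3
  rw [Finset.mem_coe, mem_critIndex hk] at hp hp'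
  have h4 := mul_left_cancel₀ (zpow_ne_zero _ h.ne_zero) he
  exact congrArg (Sigma.mk l) (h.injOn l hp.1 hp.2 hp'.2 h4)

/-- By counting: the derivative has degree at most `n`, and the circuits already provide `n`
distinct critical points. -/
theorem exists_critPoint {i : ℕ} (hi : i < m) {u : ℂ}
    (hu : (D.circuitPoly i s).derivative.eval u = 0) :
    ∃ p ∈ critIndex m k, u = D.critPoint i s U p := by
  have hne := derivative_circuitPoly_ne_zero (D := D) hk h.ne_zero i
  have hsub : (critIndex m k).image (D.critPoint i s U) ⊆
      (D.circuitPoly i s).derivative.roots.toFinset := by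
    intro v hv
    obtain ⟨p, hp, rfl⟩ := Finset.mem_image.1 hv
    rw [Multiset.mem_toFinset, mem_roots hne, IsRoot]
    exact ((singularPoint_iff hi h.ne_zero _ _).1 (h.singularPoint hk i hp)).2
  have hcard : (D.circuitPoly i s).derivative.roots.toFinset.card ≤
      ((critIndex m k).image (D.critPoint i s U)).card := by
    rw [Finset.card_image_of_injOn (h.injOn_critPoint hk hi), card_critIndex hk]
    exact (Multiset.toFinset_card_le _).trans ((card_roots' _).trans
      (natDegree_derivative_circuitPoly s i))
  have heq := Finset.eq_of_subset_of_card_le hsub hcard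
  have : u ∈ (D.circuitPoly i s).derivative.roots.toFinset := by
    rw [Multiset.mem_toFinset, mem_roots hne]
    exact hu
  rw [← heq] at this
  obtain ⟨p, hp, rfl⟩ := Finset.mem_image.1 this
  exact ⟨p, hp, rfl⟩

theorem criticalValues_eq {i : ℕ} (hi : i < m) :
    D.criticalValues i s = D.critValue i s U '' critIndex m k := by
  ext t
  constructor
  · rintro ⟨-, u, hu⟩
    have hu' := (singularPoint_iff hi h.ne_zero _ _).1 hu
    obtain ⟨p, hp, rfl⟩ := h.exists_critPoint hk hi hu'.2
    refine ⟨p, hp, ?_⟩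
    have := ((singularPoint_iff hi h.ne_zero _ _).1 (h.singularPoint hk i hp)).1
    rw [hu'.1, neg_inj] at this
    exact this.symm
  · rintro ⟨p, hp, rfl⟩
    exact ⟨h.critValue_ne_zero hk i hp, _, h.singularPoint hk i hp⟩

/-- The enumeration by norm goes through the circuits one after the other. -/
theorem lt_iff_of_enumeration {i : ℕ} {p : ℕ → Σ _ : ℕ, ℂ}
    (hp : Set.BijOn p (Set.Icc 1 n) (critIndex m k))
    (hmono : StrictMonoOn (fun j => ‖D.critValue i s U (p j)‖) (Set.Icc 1 n)) {l : ℕ} (hl : l ≤ m)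
    {j : ℕ} (hj : j ∈ Set.Icc 1 n) : (p j).1 < l ↔ j < k l := by
  have hf : MonotoneOn (fun j => (p j).1) (Set.Icc 1 n) := by
    intro x hx y hy hxy
    by_contra hlt
    rcases hxy.eq_or_lt with rfl | hxy
    · exact hlt le_rfl
    · exact lt_asymm (hmono hx hy hxy)
        (h.norm_critValue_lt hk i (hp.mapsTo hy) (hp.mapsTo hx) (not_le.1 hlt))
  have hcard : ((Finset.Icc 1 n).filter fun j => (p j).1 < l).card =
      ((critIndex m k).filter fun p => p.1 < l).card := by
    refine Finset.card_bij (fun j _ => p j) (fun j hj => ?_) (fun j hj j' hj' he => ?_)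
      fun q hq => ?_
    · rw [Finset.mem_filter, Finset.mem_Icc] at hj
      exact Finset.mem_filter.2 ⟨hp.mapsTo hj.1, hj.2⟩
    · rw [Finset.mem_filter, Finset.mem_Icc] at hj hj'
      exact hp.injOn hj.1 hj'.1 he
    · rw [Finset.mem_filter] at hq
      obtain ⟨j, hj, rfl⟩ := hp.surjOn hq.1
      exact ⟨j, Finset.mem_filter.2 ⟨Finset.mem_Icc.2 hj, hq.2⟩, rfl⟩
  have := card_critIndex_filter hk hl
  rw [lt_iff_le_of_monotoneOn hf hcard hj]
  omega

theorem exists_enumeration_of_radarScreen {i : ℕ} (hi : i < m) {w : ℕ → ℂ}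
    (hw : D.IsRadarScreen i s w) : ∃ p : ℕ → Σ _ : ℕ, ℂ,
      Set.BijOn p (Set.Icc 1 n) (critIndex m k) ∧
      (∀ j ∈ Set.Icc 1 n, Complex.exp (w j) = D.critValue i s U (p j)) ∧
      StrictMonoOn (fun j => ‖D.critValue i s U (p j)‖) (Set.Icc 1 n) := by
  obtain ⟨h1, h2⟩ := hw
  rw [h.criticalValues_eq hk hi] at h2
  have h3 : ∀ j, ∃ p, j ∈ Set.Icc 1 n → p ∈ critIndex m k ∧
      D.critValue i s U p = Complex.exp (w j) := by
    intro j
    by_cases hj : j ∈ Set.Icc 1 n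
    · obtain ⟨p, hp, hpj⟩ := h2.subset (Set.mem_image_of_mem _ hj)
      exact ⟨p, fun _ => ⟨hp, hpj⟩⟩
    · exact ⟨⟨0, 0⟩, fun h => absurd h hj⟩
  choose p hp using h3
  have hmono : StrictMonoOn (fun j => ‖D.critValue i s U (p j)‖) (Set.Icc 1 n) := by
    intro x hx y hy hxy
    dsimp only
    rw [(hp x hx).2, (hp y hy).2, Complex.norm_exp, Complex.norm_exp]
    exact Real.exp_lt_exp.2 (h1 hx hy hxy)
  have hinj : Set.InjOn p (Set.Icc 1 n) := by
    intro x hx y hy he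
    exact hmono.injOn hx hy (by simp only [he])
  have hmaps : Set.MapsTo p (Set.Icc 1 n) (critIndex m k) := fun j hj => (hp j hj).1
  refine ⟨p, ⟨hmaps, hinj, ?_⟩, fun j hj => (hp j hj).2.symm, hmono⟩
  have h4 : (Finset.Icc 1 n).image p = critIndex m k := by
    refine Finset.eq_of_subset_of_card_le (fun q hq => ?_) ?_
    · obtain ⟨j, hj, rfl⟩ := Finset.mem_image.1 hq
      exact hmaps (Finset.mem_Icc.1 hj)
    · rw [card_critIndex hk, Finset.card_image_of_injOn, Nat.card_Icc, Nat.add_sub_cancel]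
      rwa [Finset.coe_Icc]
  intro q hq
  rw [← h4] at hq
  obtain ⟨j, hj, rfl⟩ := Finset.mem_image.1 hq
  exact ⟨j, Finset.mem_Icc.1 hj, rfl⟩

end IsCritSystem

theorem eventually_norm_zpow_mul_lt {e : ℤ} (he : 0 < e) (A : ℝ) {B : ℝ} (hB : 0 < B) :
    ∀ᶠ s : ℂ in 𝓝[≠] 0, ‖s‖ ^ e * A < B := by
  obtain ⟨d, rfl⟩ := Int.eq_ofNat_of_zero_le he.le
  have hd : d ≠ 0 := by
    rintro rfl
    exact lt_irrefl _ he
  have h : Continuous fun s : ℂ => ‖s‖ ^ d * A := by fun_prop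
  have h0 : ‖(0 : ℂ)‖ ^ d * A < B := by rwa [norm_zero, zero_pow hd, zero_mul]
  filter_upwards [nhdsWithin_le_nhds (h.continuousAt.eventually (gt_mem_nhds h0))] with s hs
  exact_mod_cast hs

theorem exists_critPoints (hk : IsMonotonePath n m k) : ∃ ε₀ > 0,
    ∀ᶠ s in 𝓝[≠] 0, ∀ U : ℕ → ℂ → ℂ,
      (∀ l < m, ∀ ω ∈ powRoots (k (l + 1) - k l) (-1),
        ‖U l ω - critRadius (k (l + 1) - k l) (k l) * ω‖ < ε₀ ∧
          (D.circuitPoly l s).derivative.eval (U l ω) = 0) → D.IsCritSystem s U := by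
  have hgap : ∀ l < m, 0 < k (l + 1) - k l := fun l hl => Nat.sub_pos_of_lt (hk.2.2 l hl)
  have hsum : ∀ l < m, k (l + 1) - k l + k l < n + 2 := fun l hl => by
    have := hk.le_succ (show l + 1 ≤ m from hl)
    have := hk.2.2 l hl
    omega
  have h1 : ∀ᶠ ε in 𝓝[>] (0 : ℝ), ∀ l ∈ Finset.range m,
      ∀ᶠ s in 𝓝[≠] 0, ∀ ω ∈ powRoots (k (l + 1) - k l) (-1), ∀ u : ℂ,
        ‖u - critRadius (k (l + 1) - k l) (k l) * ω‖ < ε →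
          (D.circuitPoly l s).derivative.eval u = 0 →
          IsCritNear (D.circuitPoly l s) (k (l + 1) - k l) (k l) 2 ω u := by
    rw [Filter.eventually_all_finset]
    intro l hl
    rw [Finset.mem_range] at hl
    -- The bound `2` on the petals is arbitrary here: only the estimates for the values and the
    -- nearest roots are used, which do not involve it.
    obtain ⟨ε, hε, hev⟩ := exists_forall_isCritNear (hgap l hl) (hk.one_le hl.le) (hsum l hl) 2
    refine eventually_nhdsGT_of_forall_le ⟨ε, hε, fun ε' _ hle => ?_⟩
    filter_upwards [(D.tendsto_coef hk hl).eventually hev] with s hs ω hω u hu hd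
    exact hs ω hω u (hu.trans_le hle) hd
  obtain ⟨ε, hε, hε0⟩ := (h1.and self_mem_nhdsWithin).exists
  refine ⟨ε, hε0, ?_⟩
  have hsep : ∀ᶠ s : ℂ in 𝓝[≠] 0, ∀ l ∈ Finset.range m, ∀ l' ∈ Finset.range m, l < l' →
      ‖s‖ ^ (D.energy l - D.energy l') *
    (2 * critNorm (k (l + 1) - k l) (k l)) < critNorm (k (l' + 1) - k l') (k l') / 2 := by
    simp only [Filter.eventually_all_finset]
    intro l _ l' hl'
    rw [Finset.mem_range] at hl'
    by_cases hlt : l < l'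
    · have h2 := critNorm_pos (hgap l' hl') (hk.one_le hl'.le)
      filter_upwards [eventually_norm_zpow_mul_lt (sub_pos.2 (energy_strict hk hlt hl'))
        (2 * critNorm (k (l + 1) - k l) (k l)) (half_pos h2)] with s hs _ using hs
    · simp [hlt]
  filter_upwards [(Filter.eventually_all_finset _).2 hε, hsep, self_mem_nhdsWithin] with s h2 h3 h4 U hU
  have h5 := fun l hl ω hω => h2 l (Finset.mem_range.2 hl) ω hω _ (hU l hl ω hω).1 (hU l hl ω hω).2
  refine ⟨h4, fun l hl ω hω => (hU l hl ω hω).2, fun l hl ω hω => (h5 l hl ω hω).lt_value,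
    fun l hl ω hω => (h5 l hl ω hω).value_lt, fun l hl ω hω ω' hω' he => ?_,
    fun l l' hlt hl' => h3 l (Finset.mem_range.2 (hlt.trans hl')) l' (Finset.mem_range.2 hl') hlt⟩
  -- A common critical point would be strictly nearer to each of two roots of `-1` than to the other
  -- one.
  by_contra hne
  have e1 := (h5 l hl ω hω).nearest ω' hω' (Ne.symm hne)
  have e2 := (h5 l hl ω' hω').nearest ω hω hne
  rw [← he] at e2
  exact lt_asymm e1 e2

theorem eventually_exists_critPoints (hk : IsMonotonePath n m k) {ε : ℝ} (hε : 0 < ε) :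
    ∀ᶠ s in 𝓝[≠] 0, ∃ U : ℕ → ℂ → ℂ, ∀ l < m, ∀ ω ∈ powRoots (k (l + 1) - k l) (-1),
        ‖U l ω - critRadius (k (l + 1) - k l) (k l) * ω‖ < ε ∧
          (D.circuitPoly l s).derivative.eval (U l ω) = 0 := by
  have h1 : ∀ᶠ s in 𝓝[≠] 0, ∀ l ∈ Finset.range m, ∀ ω ∈ powRoots (k (l + 1) - k l) (-1), ∃ u,
      ‖u - critRadius (k (l + 1) - k l) (k l) * ω‖ < ε ∧
        (D.circuitPoly l s).derivative.eval u = 0 := by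
    rw [Filter.eventually_all_finset]
    intro l hl
    rw [Finset.mem_range] at hl
    have ha : 0 < k (l + 1) - k l := Nat.sub_pos_of_lt (hk.2.2 l hl)
    rw [Filter.eventually_all_finite (finite_powRoots ha _)]
    intro ω hω
    have := hk.le_succ (show l + 1 ≤ m from hl)
    have := hk.2.2 l hl
    filter_upwards [(D.tendsto_coef hk hl).eventually (eventually_exists_crit ha (hk.one_le hl.le)
      (show k (l + 1) - k l + k l < n + 2 by omega) hω hε)] with s ⟨u, hu, hd⟩
    exact ⟨u, mem_ball_iff_norm.1 hu, hd⟩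
  filter_upwards [h1] with s hs
  choose! U hU using hs
  exact ⟨U, fun l hl ω hω => hU l (Finset.mem_range.2 hl) ω hω⟩

end Regeneration

/-! ### Isolation of one circuit between the radii `r` and `R`. -/

namespace Regeneration

variable {n m : ℕ} {k : ℕ → ℕ} (D : Regeneration n m k)

/-- The critical values of the other circuits are small or large compared to `r` and `R`. -/
structure IsIsolated (i : ℕ) (s : ℂ) (r R : ℝ) : Prop where
  below : ∀ l < i, ‖s‖ ^ (D.energy l - D.energy i) * (2 * critNorm (k (l + 1) - k l) (k l)) <
    r / Real.exp 1
  above : ∀ l, i < l → l < m → ‖s‖ ^ (D.energy i - D.energy l) * (R * Real.exp 1) <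
    critNorm (k (l + 1) - k l) (k l) / 2

variable {D}

theorem eventually_isIsolated (hk : IsMonotonePath n m k) {i : ℕ} (hi : i < m) {r : ℝ} (hr : 0 < r)
    (R : ℝ) : ∀ᶠ s in 𝓝[≠] 0, D.IsIsolated i s r R := by
  have h1 : ∀ᶠ s : ℂ in 𝓝[≠] 0, ∀ l ∈ Finset.range i,
      ‖s‖ ^ (D.energy l - D.energy i) * (2 * critNorm (k (l + 1) - k l) (k l)) <
        r / Real.exp 1 := by
    rw [Filter.eventually_all_finset]
    intro l hl
    exact eventually_norm_zpow_mul_lt (sub_pos.2 (energy_strict hk (Finset.mem_range.1 hl) hi)) _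
      (by positivity)
  have h2 : ∀ᶠ s : ℂ in 𝓝[≠] 0, ∀ l ∈ Finset.Ioo i m,
      ‖s‖ ^ (D.energy i - D.energy l) * (R * Real.exp 1) <
        critNorm (k (l + 1) - k l) (k l) / 2 := by
    rw [Filter.eventually_all_finset]
    intro l hl
    rw [Finset.mem_Ioo] at hl
    exact eventually_norm_zpow_mul_lt (sub_pos.2 (energy_strict hk hl.1 hl.2)) _
      (half_pos (critNorm_pos (Nat.sub_pos_of_lt (hk.2.2 _ hl.2)) (hk.one_le hl.2.le)))
  filter_upwards [h1, h2] with s h1 h2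
  exact ⟨fun l hl => h1 l (Finset.mem_range.2 hl), fun l hl hl' => h2 l (Finset.mem_Ioo.2 ⟨hl, hl'⟩)⟩

theorem critPoint_self (i : ℕ) (s : ℂ) (U : ℕ → ℂ → ℂ) (ω : ℂ) :
    D.critPoint i s U ⟨i, ω⟩ = U i ω := by
  simp [critPoint]

theorem critValue_self (i : ℕ) (s : ℂ) (U : ℕ → ℂ → ℂ) (ω : ℂ) :
    D.critValue i s U ⟨i, ω⟩ = -(D.circuitPoly i s).eval (U i ω) := by
  simp [critValue]

namespace IsCritSystem

variable {s : ℂ} {U : ℕ → ℂ → ℂ} (h : D.IsCritSystem s U) (hk : IsMonotonePath n m k) {i : ℕ}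
  (hi : i < m) {p : ℕ → Σ _ : ℕ, ℂ} (hp : Set.BijOn p (Set.Icc 1 n) (critIndex m k))
  (hmono : StrictMonoOn (fun j => ‖D.critValue i s U (p j)‖) (Set.Icc 1 n))

include hk hi in
theorem block_mem {l : ℕ} (hl : l < k (i + 1) - k i) : k i + l ∈ Set.Icc 1 n := by
  have h1 := hk.one_le hi.le
  have h2 := hk.le_succ (show i + 1 ≤ m from hi)
  exact ⟨by omega, by omega⟩

include h hk hi hp hmono

theorem block_iff {j : ℕ} (hj : j ∈ Set.Icc 1 n) : (p j).1 = i ↔ k i ≤ j ∧ j < k (i + 1) := by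
  have h1 := h.lt_iff_of_enumeration hk hp hmono hi.le hj
  have h2 := h.lt_iff_of_enumeration hk hp hmono (show i + 1 ≤ m from hi) hj
  omega

theorem exists_block : ∃ ξ : ℕ → powRoots (k (i + 1) - k i) (-1),
    ∀ l < k (i + 1) - k i, p (k i + l) = ⟨i, ξ l⟩ := by
  have h1 : ∀ l, ∃ ω : powRoots (k (i + 1) - k i) (-1), l < k (i + 1) - k i →
      p (k i + l) = ⟨i, ω⟩ := by
    intro l
    by_cases hl : l < k (i + 1) - k i
    · have hj := block_mem hk hi hl
      have h1 := (h.block_iff hk hi hp hmono hj).2 ⟨by omega, by omega⟩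
      have h2 := ((mem_critIndex hk).1 (hp.mapsTo hj)).2
      generalize p (k i + l) = q at h1 h2
      obtain ⟨l', ω⟩ := q
      dsimp only at h1 h2
      subst h1
      exact ⟨⟨ω, h2⟩, fun _ => rfl⟩
    · have : Nonempty (powRoots (k (i + 1) - k i) (-1)) := by
        refine (Nat.card_pos_iff.1 ?_).1
        have ha := Nat.sub_pos_of_lt (hk.2.2 i hi)
        rw [card_powRoots ha (by simp)]
        exact ha
      exact ⟨Classical.arbitrary _, fun h => absurd h hl⟩
  choose ξ hξ using h1
  exact ⟨ξ, hξ⟩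

/-- The conditions on `P` alone are already in `IsNearCircuit`. What has to be added is that the
block of the enumeration consists of the critical values of the `i`-th circuit, and that no others
are over the strip. -/
theorem exists_isCircuitLabelling {δ M r R : ℝ}
    (hnear : IsNearCircuit (D.circuitPoly i s) (k (i + 1) - k i) (k i) δ M r R (U i))
    (hiso : D.IsIsolated i s r R) (hb : 0 < k i) (hN : 0 < k (i + 1) - k i + k i)
    {ξ : ℕ → powRoots (k (i + 1) - k i) (-1)}
    (hξ : ∀ l < k (i + 1) - k i, p (k i + l) = ⟨i, ξ l⟩) {c : ℕ → ℂ}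
    (hc : ∀ l < k (i + 1) - k i, Complex.exp (c l) = D.critValue i s U ⟨i, ξ l⟩) :
    ∃ ρ π y σ, IsCircuitLabelling (D.circuitPoly i s) hb hN δ M r R (U i) c ξ ρ π y σ := by
  have ha : 0 < k (i + 1) - k i := Nat.sub_pos_of_lt (hk.2.2 i hi)
  have hs : 0 < ‖s‖ := norm_pos_iff.2 h.ne_zero
  have hR := hnear.R_pos
  have hc' : ∀ l < k (i + 1) - k i, (D.circuitPoly i s).eval (U i (ξ l)) = -Complex.exp (c l) := by
    intro l hl
    rw [hc l hl, critValue_self, neg_neg]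
  refine hnear.exists_isCircuitLabelling ha hb hN hc' (hnear.petalData ha hb ?_ ?_ hc' ?_ ?_)
  · intro x hx y hy he
    have h1 := hp.injOn (block_mem hk hi hx) (block_mem hk hi hy) (by rw [hξ x hx, hξ y hy, he])
    omega
  · intro ω
    obtain ⟨j, hj, hpj⟩ := hp.surjOn ((mem_critIndex hk (p := ⟨i, ω⟩)).2 ⟨hi, ω.2⟩)
    have h1 := (h.block_iff hk hi hp hmono hj).1 (by rw [hpj])
    refine ⟨j - k i, by omega, Subtype.ext ?_⟩
    have h2 := hξ (j - k i) (by omega)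
    rw [Nat.add_sub_cancel' h1.1, hpj] at h2
    simpa using h2.symm
  · intro x hx y hy hxy
    have h1 := hmono (block_mem hk hi hx) (block_mem hk hi hy) (by omega)
    dsimp only at h1
    rw [hξ x hx, hξ y hy, ← hc x hx, ← hc y hy, Complex.norm_exp, Complex.norm_exp] at h1
    exact Real.exp_lt_exp.1 h1
  -- Over the strip the norms of the values are between `r / e` and `R e`; by `IsIsolated`, the
  -- critical values of the earlier circuits are below and those of the later ones above this range.
  · intro w hw1 hw2 v hv hv'
    obtain ⟨q, hq, rfl⟩ := h.exists_critPoint hk hi hv'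
    have h1 := ((singularPoint_iff hi h.ne_zero _ _).1 (h.singularPoint hk i hq)).1
    rw [hv, neg_inj] at h1
    have hn : ‖D.critValue i s U q‖ = Real.exp w.re := by rw [← h1, Complex.norm_exp]
    have hlow : r / Real.exp 1 < Real.exp w.re := by
      have := Real.exp_lt_exp.2 hw1
      rwa [Real.exp_sub, Real.exp_log hnear.pos] at this
    have hup : Real.exp w.re < R * Real.exp 1 := by
      have := Real.exp_lt_exp.2 hw2
      rwa [Real.exp_add, Real.exp_log hR] at this
    have h2 := h.norm_critValue hk i hq
    rw [hn] at h2
    have hq' := (mem_critIndex hk).1 hq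
    obtain ⟨l, ω⟩ := q
    dsimp only at h2 hq'
    rcases lt_trichotomy l i with hl | rfl | hl
    · have := hiso.below l hl
      linarith
    · exact ⟨ω, hq'.2, critPoint_self _ s U ω⟩
    · exfalso
      have h3 := mul_lt_mul_of_pos_left (hiso.above l hl hq'.1)
        (zpow_pos hs (D.energy l - D.energy i))
      rw [← mul_assoc, ← zpow_add₀ hs.ne', sub_add_sub_cancel, sub_self, zpow_zero, one_mul] at h3
      linarith

end IsCritSystem

/-- For small `s`, all the properties of the critical points and roots hold that determine
the monodromy. -/
theorem eventually_exists_isCritSystem (hk : IsMonotonePath n m k) {i : ℕ} (hi : i < m)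
    {δ M r R ε : ℝ} (hr : 0 < r) (hε : 0 < ε)
    (hnear : ∀ᶠ g in 𝓝 (circuitCoeff (k (i + 1) - k i) (k i)), g 0 = 0 → ∀ U : ℂ → ℂ,
        (∀ ω ∈ powRoots (k (i + 1) - k i) (-1),
          ‖U ω - critRadius (k (i + 1) - k i) (k i) * ω‖ < ε ∧
          (coeffPoly (n + 2) g).derivative.eval (U ω) = 0) →
        IsNearCircuit (coeffPoly (n + 2) g) (k (i + 1) - k i) (k i) δ M r R U) {ε₁ : ℝ}
    (hε₁ : 0 < ε₁) :
    ∀ᶠ s in 𝓝[≠] 0, ∃ U : ℕ → ℂ → ℂ, D.IsCritSystem s U ∧ D.IsIsolated i s r R ∧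
      IsNearCircuit (D.circuitPoly i s) (k (i + 1) - k i) (k i) δ M r R (U i) ∧
      ∀ l < m, ∀ ω ∈ powRoots (k (l + 1) - k l) (-1),
        ‖U l ω - critRadius (k (l + 1) - k l) (k l) * ω‖ < ε₁ := by
  obtain ⟨ε₀, hε₀, hev⟩ := D.exists_critPoints hk
  filter_upwards [hev, eventually_exists_critPoints (D := D) hk
    (show 0 < min ε (min ε₀ ε₁) by positivity), eventually_isIsolated hk hi hr R,
    (D.tendsto_coef hk hi).eventually hnear] with s h1 ⟨U, hU⟩ h3 h4
  refine ⟨U, h1 U fun l hl ω hω => ⟨(hU l hl ω hω).1.trans_le ?_, (hU l hl ω hω).2⟩, h3,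
    h4 (coef_zero i s) (U i) fun ω hω => ⟨(hU i hi ω hω).1.trans_le ?_, (hU i hi ω hω).2⟩,
    fun l hl ω hω => (hU l hl ω hω).1.trans_le ?_⟩
  · exact (min_le_right _ _).trans (min_le_left _ _)
  · exact min_le_left _ _
  · exact (min_le_right _ _).trans (min_le_right _ _)

theorem eventually_monodromy (hk : IsMonotonePath n m k) {i : ℕ} (hi : i < m)
    {δ M r R ε : ℝ} (hr : 0 < r) (hε : 0 < ε)
    (hnear : ∀ᶠ g in 𝓝 (circuitCoeff (k (i + 1) - k i) (k i)), g 0 = 0 → ∀ U : ℂ → ℂ,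
        (∀ ω ∈ powRoots (k (i + 1) - k i) (-1),
          ‖U ω - critRadius (k (i + 1) - k i) (k i) * ω‖ < ε ∧
          (coeffPoly (n + 2) g).derivative.eval (U ω) = 0) →
        IsNearCircuit (coeffPoly (n + 2) g) (k (i + 1) - k i) (k i) δ M r R U) :
    ∃ s₀ > (0 : ℝ), ∀ s : ℂ, s ≠ 0 → ‖s‖ < s₀ →
      ∀ w : ℕ → ℂ, D.IsRadarScreen i s w → ∀ᶠ ε in 𝓝[>] (0 : ℝ),
        ∃ τ : D.innerFiber i s (startPoint k i w r) ⊕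
            D.middleFiber i s (startPoint k i w r) ≃ D.outerFiber i s (endPoint k i w R),
          D.IsMonodromyMap i s w ε r R τ ∧
          Nat.card (D.innerFiber i s (startPoint k i w r)) = k i ∧
          IsCyclicInsertion (CCWOn _) (CCWOn _) (k (i + 1) - k i) τ ∧
          ∃! lt : D.middleFiber i s (startPoint k i w r) →
              D.middleFiber i s (startPoint k i w r) → Prop,
            IsStrictTotalOrder _ lt ∧ D.VanishingGraphEq i s w ε r R τ lt := by
  have hlt := hk.2.2 i hi
  have hev := D.eventually_exists_isCritSystem hk hi hr hε hnear one_pos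
  rw [eventually_nhdsWithin_iff, Metric.eventually_nhds_iff] at hev
  obtain ⟨s₀, hs₀, hev⟩ := hev
  refine ⟨s₀, hs₀, fun s hs hss w hw => ?_⟩
  obtain ⟨U, h1, h2, h3, -⟩ := hev (by simpa using hss) hs
  obtain ⟨p, hp, hpw, hmono⟩ := h1.exists_enumeration_of_radarScreen hk hi hw
  obtain ⟨ξ, hξ⟩ := h1.exists_block hk hi hp hmono
  obtain ⟨ρ, π, y, σ, hl⟩ := h1.exists_isCircuitLabelling hk hi hp hmono h3 h2 (hk.one_le hi.le)
    (by omega) hξ (c := fun l => w (k i + l)) fun l hl => by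
      rw [hpw _ (IsCritSystem.block_mem hk hi hl), hξ l hl]
  exact hl.eventually_exists_monodromy h3 (by omega) rfl (by omega) (fiberPoint_iff hi hs)
    (singularPoint_iff hi hs) fun l _ => rfl

end Regeneration

/-! ## Change of the logarithms of the critical values -/

section Chain

variable {S₁ S₂ : Type*} [DecidableEq (S₁ ⊕ S₂)] {a : ℕ} {f : Equiv.Perm S₁} {ξ : ℕ → S₂}
  {y : ℕ → S₁ ⊕ S₂} {π : ℕ → Equiv.Perm (S₁ ⊕ S₂)}

namespace IsInsertionChain

theorem perm_congr {y' : ℕ → S₁ ⊕ S₂} {π' : ℕ → Equiv.Perm (S₁ ⊕ S₂)}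
    (h : IsInsertionChain a f ξ y π) (h' : IsInsertionChain a f ξ y' π') {L : ℕ} (hL : L ≤ a)
    (hy : ∀ l < L, y' l = y l) : π' L = π L := by
  induction L with
  | zero =>
    ext z
    rcases z with x | s
    · rw [h.zero_inl, h'.zero_inl]
    · rw [h.zero_inr, h'.zero_inr]
  | succ L ih =>
    rw [h.succ L (by omega), h'.succ L (by omega), ih (by omega) fun l hl => hy l (by omega),
      hy L (by omega)]

variable (h : IsInsertionChain a f ξ y π)

include h

/-- If the last permutation is transitive, then the earlier ones are transitive on the elements
already inserted. -/
theorem exists_pow (ht : ∀ x z, ∃ j, (π a ^ j) x = z) {l : ℕ} (hl : l ≤ a) {x z : S₁ ⊕ S₂}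
    (hx : x ∈ insertedBefore S₁ a ξ l) (hz : z ∈ insertedBefore S₁ a ξ l) :
    ∃ j, (π l ^ j) x = z := by
  obtain ⟨t, ht1, -, ht2, ht3⟩ := (h.isFirstReturn hl).exists_times
    (fun z hz => h.perm_mem hl hz) hx
  obtain ⟨t', rfl⟩ := ht x z
  obtain ⟨j, -, rfl⟩ := ht3 t' t' (ht1.id_le t') hz
  exact ⟨j, (ht2 j).symm⟩

/-- Before the last insertion, the permutation fixes the element still missing and is a single cycle
on all the others. -/
theorem pow_card_eq_one [Finite S₁] [Finite S₂] (ha : 0 < a) (ht : ∀ x z, ∃ j, (π a ^ j) x = z) :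
    π (a - 1) ^ (Nat.card (S₁ ⊕ S₂) - 1) = 1 := by
  have := Fintype.ofFinite (S₁ ⊕ S₂)
  have hmem : ∀ z, z ∈ insertedBefore S₁ a ξ (a - 1) ↔ z ≠ Sum.inr (ξ (a - 1)) := by
    intro z
    constructor
    · intro hz
      exact hz (a - 1) le_rfl (by omega)
    · intro hz l' h1 h2
      rwa [show l' = a - 1 by omega]
  have hfix := h.perm_inr (show a - 1 ≤ a by omega) le_rfl (show a - 1 < a by omega)
  have hcyc : (π (a - 1)).IsCycleOn
      ((Finset.univ.erase (Sum.inr (ξ (a - 1))) : Finset (S₁ ⊕ S₂)) : Set (S₁ ⊕ S₂)) := by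
    refine ⟨Set.BijOn.mk ?_ (π (a - 1)).injective.injOn ?_, ?_⟩
    · intro z hz
      simp only [Finset.coe_erase, Finset.coe_univ, Set.mem_sdiff, Set.mem_univ, true_and,
        Set.mem_singleton_iff] at hz ⊢
      exact fun he => hz ((π (a - 1)).injective (he.trans hfix.symm))
    · intro z hz
      refine ⟨(π (a - 1)).symm z, ?_, Equiv.apply_symm_apply _ _⟩
      simp only [Finset.coe_erase, Finset.coe_univ, Set.mem_sdiff, Set.mem_univ, true_and,
        Set.mem_singleton_iff] at hz ⊢
      intro he
      rw [Equiv.symm_apply_eq, hfix] at he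
      exact hz he
    · intro x hx z hz
      simp only [Finset.coe_erase, Finset.coe_univ, Set.mem_sdiff, Set.mem_univ, true_and,
        Set.mem_singleton_iff] at hx hz
      obtain ⟨j, hj⟩ := h.exists_pow ht (show a - 1 ≤ a by omega) ((hmem x).2 hx) ((hmem z).2 hz)
      exact ⟨j, by simpa using hj⟩
  have hcard : (Finset.univ.erase (Sum.inr (ξ (a - 1))) : Finset (S₁ ⊕ S₂)).card =
      Nat.card (S₁ ⊕ S₂) - 1 := by
    rw [Finset.card_erase_of_mem (Finset.mem_univ _), Finset.card_univ, Nat.card_eq_fintype_card]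
  ext z
  by_cases hz : z = Sum.inr (ξ (a - 1))
  · rw [hz, Equiv.Perm.coe_one, id]
    exact Function.IsFixedPt.perm_pow hfix _
  · rw [← hcard, hcyc.pow_card_apply (Finset.mem_erase.2 ⟨hz, Finset.mem_univ _⟩)]
    rfl

end IsInsertionChain

end Chain

/-! ### Comparison of the labellings for two choices of logarithms. -/

section Relabelling

variable {P : ℂ[X]} {a b : ℕ} {δ M r R : ℝ} {U : ℂ → ℂ} {c c' : ℕ → ℂ} {ξ : ℕ → powRoots a (-1)}
  {ρ ρ' : powRoots b 1 ⊕ powRoots a (-1) → ℂ → ℂ}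
  {π π' : ℕ → Equiv.Perm (powRoots b 1 ⊕ powRoots a (-1))}
  {y y' : ℕ → powRoots b 1 ⊕ powRoots a (-1)}
  {σ σ' : powRoots b 1 ⊕ powRoots a (-1) ≃ powRoots (a + b) 1}

theorem cutStrip_congr {A B : ℝ} {L : ℕ} (h : ∀ l < L, c' l = c l) :
    cutStrip A B L c' = cutStrip A B L c := by
  ext w
  simp only [cutStrip, Set.mem_ofPred_eq]
  refine and_congr_right fun _ => and_congr_right fun _ => forall₂_congr fun l hl => ?_
  rw [h l hl]

theorem PetalData.cutStrip_subset {A B : ℝ} {u : ℕ → ℂ} {S₂ : Type*} {ξ : ℕ → S₂}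
    {petal : S₂ → Set ℂ} (h : PetalData P M A B a c u ξ petal) {L : ℕ} (hL : L < a) :
    cutStrip A (c L).re L c ⊆ cutStrip A B a c := by
  intro w hw
  refine ⟨hw.1, hw.2.1.trans (h.mem L hL).2, fun l' hl' hre => ?_⟩
  rcases lt_or_ge l' L with hlt | hge
  · exact hw.2.2 l' hlt hre
  · have := h.re_le_re hl' hge
    have := hw.2.1
    linarith

theorem PetalData.isPreconnected_cutStrip {A B : ℝ} {u : ℕ → ℂ} {S₂ : Type*} {ξ : ℕ → S₂}
    {petal : S₂ → Set ℂ} (h : PetalData P M A B a c u ξ petal) {L : ℕ} (hL : L < a) :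
    IsPreconnected (cutStrip A (c L).re L c) :=
  (isSimplyConnected_cutStrip (h.mem L hL).1 (h.injOn_re.mono fun _ hl => lt_trans hl hL)
    ).isPathConnected.isConnected.isPreconnected

theorem PetalData.mem_cutStrip_of_strip {A B : ℝ} {u : ℕ → ℂ} {S₂ : Type*} {ξ : ℕ → S₂}
    {petal : S₂ → Set ℂ} (h : PetalData P M A B a c u ξ petal) {L : ℕ} (hL : L < a) {w : ℂ}
    (h1 : stripLeft A c L < w.re) (h2 : w.re < (c L).re) : w ∈ cutStrip A (c L).re L c := by
  refine ⟨(h.le_stripLeft hL.le).trans_lt h1, h2, fun l hl hre => ?_⟩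
  exact absurd hre (ne_of_gt ((h.stripLeft_le hl hL.le).trans_lt h1))

theorem norm_div_phaseRoot_rotate_pow {d : ℕ} (hd : 0 < d) (w u : ℂ) (ζ : powRoots d 1) (κ : ℕ) :
    ‖u / phaseRoot d (w + κ * (2 * Real.pi * Complex.I)) - ζ‖ =
      ‖u / phaseRoot d w - (rotatePerm d hd ^ κ) ζ‖ := by
  induction κ generalizing ζ with
  | zero => simp
  | succ κ ih =>
    rw [Nat.cast_succ, add_mul, one_mul, ← add_assoc, norm_div_phaseRoot_rotate hd, ih, pow_succ,
      Equiv.Perm.mul_apply]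

namespace IsCircuitLabelling

variable {hb : 0 < b} {hN : 0 < a + b}

theorem perm_pow (hl : IsCircuitLabelling P hb hN δ M r R U c ξ ρ π y σ) {l : ℕ} (hla : l ≤ a)
    (x : powRoots b 1 ⊕ powRoots a (-1)) {w : ℂ} (h1 : stripLeft (Real.log r - 1) c l < w.re)
    (h2 : w.re < stripRight (Real.log R + 1) a c l) (κ : ℕ) :
    ρ x (w + κ * (2 * Real.pi * Complex.I)) = ρ ((π l ^ κ) x) w := by
  induction κ generalizing x with
  | zero => simp
  | succ κ ih =>
    rw [Nat.cast_succ, add_mul, one_mul, ← add_assoc, hl.perm l hla x _ (by simpa using h1)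
      (by simpa using h2), ih, pow_succ, Equiv.Perm.mul_apply]

variable (hl : IsCircuitLabelling P hb hN δ M r R U c ξ ρ π y σ)
  (hl' : IsCircuitLabelling P hb hN δ M r R U c' ξ ρ' π' y' σ')
  (h : IsNearCircuit P a b δ M r R U)

include hl

theorem transitive (x z : powRoots b 1 ⊕ powRoots a (-1)) : ∃ j, (π a ^ j) x = z := by
  obtain ⟨j, -, hj⟩ := exists_rotatePerm_pow hN (σ x) (σ z)
  have hp : ∀ j, σ ((π a ^ j) x) = (rotatePerm (a + b) hN ^ j) (σ x) := by
    intro j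
    induction j with
    | zero => simp
    | succ j ih => rw [pow_succ', Equiv.Perm.mul_apply, hl.rotate, ih, pow_succ', Equiv.Perm.mul_apply]
  exact ⟨j, σ.injective (by rw [hp, hj])⟩

include hl' h

/-- Labellings agree to the left of the first critical value at which the logarithms differ. -/
theorem eqOn {L : ℕ} (hL : L < a) (hc : ∀ l < L, c' l = c l) (hre : (c' L).re = (c L).re)
    (x : powRoots b 1 ⊕ powRoots a (-1)) {w : ℂ}
    (hw : w ∈ cutStrip (Real.log r - 1) (c L).re L c) : ρ' x w = ρ x w := by
  have hsub := hl.petal.cutStrip_subset hL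
  have hsub' := hl'.petal.cutStrip_subset hL
  rw [cutStrip_congr hc, hre] at hsub'
  have hz : ((Real.log r : ℂ)).re = Real.log r := Complex.ofReal_re _
  have hz₀ : (Real.log r : ℂ) ∈ cutStrip (Real.log r - 1) (c L).re L c := by
    have h1 := (hl.left _ hz).2
    have h2 : ∀ l < a, ((Real.log r : ℂ)).re < (c l).re := fun l hla =>
      h1.trans_le (hl.petal.le_stripRight (Nat.zero_le l) hla)
    refine ⟨by rw [hz]; linarith, h2 L hL, fun l hlL he => ?_⟩
    exact absurd he (h2 l (by omega)).ne
  exact hl.labelling.eqOn_lift hl.petal.regularOn (hl.petal.isPreconnected_cutStrip hL)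
    continuousOn_id hsub ((hl'.labelling.continuousOn x).mono hsub')
    (fun w hw => hl'.labelling.eval_eq x w (hsub' hw)) hz₀
    (h.inner.unique _ hz x _ _ (hl'.labelling.eval_eq x _ (hsub' hz₀))
      (hl.labelling.eval_eq x _ (hsub hz₀)) (hl'.inner _ hz x) (hl.inner _ hz x)) w hw

/-- The effect on `y L` of a change of the logarithm of the critical value `L`. -/
theorem pow_apply {L : ℕ} (hL : L < a) (hc : ∀ l < L, c' l = c l) {κ : ℕ}
    (hcL : c' L = c L + κ * (2 * Real.pi * Complex.I)) : (π L ^ κ) (y' L) = y L := by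
  have := (finite_powRoots hb 1).to_subtype
  have := (finite_powRoots (Nat.zero_lt_of_lt hL) (-1)).to_subtype
  have hre : (c' L).re = (c L).re := by rw [hcL]; simp
  have hfix : (π L ^ κ) (Sum.inr (ξ L)) = Sum.inr (ξ L) :=
    Function.IsFixedPt.perm_pow (hl.chain.perm_inr hL.le le_rfl hL) κ
  have hne' : y' L ≠ Sum.inr (ξ L) := hl'.chain.mem L hL L le_rfl hL
  have key : Tendsto (ρ ((π L ^ κ) (y' L))) (𝓝[slitUp (c L)] (c L)) (𝓝 (U (ξ L))) := by
    obtain ⟨s, -, hs⟩ := (hl.petal.crossingData hl.labelling hl.perm hL).exists_limit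
      hl.petal.natDegree_pos ((π L ^ κ) (y' L))
    have h1 := hs.comp (tendsto_sub_ofReal_nhdsGT (c L) fun _ => mem_slitUp_of_ne)
    have h2 := ((hl'.limit L hL (y' L)).2 (Or.inr rfl)).comp
      (tendsto_sub_ofReal_nhdsGT (c' L) fun _ => mem_slitUp_of_ne)
    -- Just before the line through `c L` the two labellings agree, but `c' L` lies `κ` turns above
    -- `c L`: the root `ρ' x (c' L - η)` is `ρ x` continued through `κ` translations by `2πi`, that
    -- is, `ρ ((π L ^ κ) x) (c L - η)`.
    have h3 : ∀ᶠ η : ℝ in 𝓝[>] 0, ρ' (y' L) (c' L - η) = ρ ((π L ^ κ) (y' L)) (c L - η) := by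
      have hlt : stripLeft (Real.log r - 1) c L < (c L).re := by
        rw [← PetalData.stripRight_eq hL]
        exact hl.petal.stripLeft_lt hL.le
      filter_upwards [Ioo_mem_nhdsGT (sub_pos.2 hlt)] with η hη
      have e1 : c' L - η = (c L - η) + κ * (2 * Real.pi * Complex.I) := by rw [hcL]; ring
      have e2 : stripLeft (Real.log r - 1) c L < (c L - η : ℂ).re := by
        rw [Complex.sub_re, Complex.ofReal_re]
        linarith [hη.2]
      have e3 : (c L - η : ℂ).re < (c L).re := by
        rw [Complex.sub_re, Complex.ofReal_re]
        linarith [hη.1]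
      rw [e1, hl.eqOn hl' h hL hc hre _ (hl.petal.mem_cutStrip_of_strip hL (by simpa using e2)
        (by simpa using e3)), hl.perm_pow hL.le _ e2 (by rwa [PetalData.stripRight_eq hL])]
    rwa [tendsto_nhds_unique (h2.congr' h3) h1]
  rcases (hl.limit L hL _).1 key with h1 | h1
  · exact absurd ((π L ^ κ).injective (h1.trans hfix.symm)) hne'
  · exact h1

/-- The case `κ = 0` of `pow_apply`. -/
theorem y_eq {L : ℕ} (hL : L ≤ a) (hc : ∀ l < L, c' l = c l) {l : ℕ} (hlL : l < L) :
    y' l = y l := by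
  have := hl.pow_apply hl' h (show l < a by omega) (fun l' hl' => hc l' (by omega)) (κ := 0)
    (by simp [hc l hlL])
  simpa using this

/-- The effect of a change of the logarithm of the last critical value that does not change the
insertion chain. -/
theorem rotate_pow (ha : 0 < a) (hc : ∀ l < a - 1, c' l = c l) {κ : ℕ}
    (hcL : c' (a - 1) = c (a - 1) + κ * (2 * Real.pi * Complex.I)) (hπ : π (a - 1) ^ κ = 1)
    (x : powRoots b 1 ⊕ powRoots a (-1)) : (rotatePerm (a + b) hN ^ κ) (σ' x) = σ x := by
  have hL : a - 1 < a := by omega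
  have hLa : a - 1 + 1 = a := by omega
  have hre : (c' (a - 1)).re = (c (a - 1)).re := by rw [hcL]; simp
  set A := stripLeft (Real.log r - 1) c (a - 1) with hA
  set B := Real.log R + 1 with hB
  have hAA : stripLeft (Real.log r - 1) c' (a - 1) = A := by
    rw [hA]
    rcases h0 : a - 1 with _ | L
    · rfl
    · simp only [stripLeft]
      rw [hc L (by omega)]
  have hlt : A < (c (a - 1)).re := by
    rw [← PetalData.stripRight_eq hL]
    exact hl.petal.stripLeft_lt hL.le
  have hltB : (c (a - 1)).re < B := (hl.petal.mem _ hL).2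
  -- `S` is a strip around the last cut only. It lies in the cut strip for `c` and, after
  -- translation by `κ` turns, in the one for `c'`, so both labellings can be compared across this
  -- cut.
  set S := cutStrip A B 1 (fun _ => c (a - 1)) with hS
  have hSB : ∀ c'' : ℕ → ℂ, stripRight B a c'' a = B := fun c'' => if_neg (lt_irrefl a)
  have hmem : ∀ w ∈ S, w ∈ cutStrip (Real.log r - 1) B a c := fun w hw =>
    hl.petal.mem_of_gap hL hw.1 (by rw [hLa, hSB]; exact hw.2.1) (hw.2.2 0 one_pos)
  have hmem' : ∀ w ∈ S, w + κ * (2 * Real.pi * Complex.I) ∈ cutStrip (Real.log r - 1) B a c' := by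
    intro w hw
    refine hl'.petal.mem_of_gap hL ?_ ?_ fun he => ?_
    · rw [hAA]
      simpa using hw.1
    · rw [hLa, hSB]
      simpa using hw.2.1
    · rw [hre] at he
      have := hw.2.2 0 one_pos (by simpa using he)
      rw [hcL]
      simp only [Complex.add_im, Complex.mul_im, Complex.natCast_re, Complex.natCast_im]
      constructor <;> linarith
  have hpre : IsPreconnected S := (isSimplyConnected_cutStrip (hlt.trans hltB)
    (fun i hi j hj _ => by
      have hi' : i < 1 := hi
      have hj' : j < 1 := hj
      omega)).isPathConnected.isConnected.isPreconnected
  set s₀ : ℂ := (((A + (c (a - 1)).re) / 2 : ℝ) : ℂ) with hs₀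
  have hs₀re : s₀.re = (A + (c (a - 1)).re) / 2 := Complex.ofReal_re _
  have h1 : A < s₀.re := by rw [hs₀re]; linarith
  have h2 : s₀.re < (c (a - 1)).re := by rw [hs₀re]; linarith
  have hs₀S : s₀ ∈ S := ⟨h1, h2.trans hltB, fun _ _ he => absurd he h2.ne⟩
  have key := hl.labelling.eqOn_lift hl.petal.regularOn hpre continuousOn_id hmem
    (f := fun w => ρ' x (w + κ * (2 * Real.pi * Complex.I))) (x := x)
    ((hl'.labelling.continuousOn x).comp (by fun_prop) hmem')
    (fun w hw => by
      rw [hl'.labelling.eval_eq x _ (hmem' w hw), id, Complex.exp_periodic.nat_mul κ]) hs₀S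
    (by
      change ρ' x (s₀ + κ * (2 * Real.pi * Complex.I)) = ρ x s₀
      rw [hl.eqOn hl' h hL hc hre _ (hl.petal.mem_cutStrip_of_strip hL (by simpa using h1)
        (by simpa using h2)), hl.perm_pow hL.le _ h1 (by rwa [PetalData.stripRight_eq hL]), hπ,
        Equiv.Perm.coe_one, id])
  have he : ((Real.log R : ℂ)).re = Real.log R := Complex.ofReal_re _
  have hR := hl.right _ he
  have hcR : (c (a - 1)).re < ((Real.log R : ℂ)).re :=
    (hl.petal.stripLeft_le hL le_rfl).trans_lt hR.1
  have heS : (Real.log R : ℂ) ∈ S := ⟨hlt.trans hcR, by rw [he, hB]; linarith,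
    fun _ _ hh => absurd hh hcR.ne'⟩
  -- At the right end `ρ'`, taken `κ` turns higher, equals `ρ`; the outer disc with centre `σ' x`
  -- there is the disc with centre rotated by `κ` steps here.
  have h3 := hl'.outer ((Real.log R : ℂ) + κ * (2 * Real.pi * Complex.I)) (by simp) x
  have h4 : ρ' x ((Real.log R : ℂ) + κ * (2 * Real.pi * Complex.I)) = ρ x (Real.log R : ℂ) :=
    key _ heS
  rw [norm_div_phaseRoot_rotate_pow hN, h4] at h3
  exact h.outer.disjoint _ he _ _ _ h3.le (hl.outer _ he x)

end IsCircuitLabelling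

end Relabelling

/-! ## First order variation of critical values -/

section Variation

variable {d : ℕ}

theorem coeffPoly_eq_add_smul {g₀ g : ℕ → ℂ} {s : ℂ} (hs : s ≠ 0) :
    coeffPoly d g = coeffPoly d g₀ + C s * coeffPoly d fun j => (g j - g₀ j) / s := by
  simp only [coeffPoly, Finset.mul_sum, ← Finset.sum_add_distrib]
  refine Finset.sum_congr rfl fun j _ => ?_
  rw [← mul_assoc, ← C_mul, ← add_mul, ← C_add, mul_div_cancel₀ _ hs, add_sub_cancel]

/-- The first order variation of the critical value at a nondegenerate critical point is the value
of the variation of the polynomial. -/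
theorem exists_tendsto_critical_value {g₀ h : ℕ → ℂ} {u₀ : ℂ}
    (h1 : (coeffPoly d g₀).derivative.eval u₀ = 0)
    (h2 : (coeffPoly d g₀).derivative.derivative.eval u₀ ≠ 0) :
    ∃ ε > 0, ∀ {ι : Type} (f : Filter ι) (s : ι → ℂ) (g : ι → ℕ → ℂ) (V : ι → ℂ),
      Tendsto s f (𝓝 0) → (∀ᶠ x in f, s x ≠ 0) →
      (∀ j, Tendsto (fun x => (g x j - g₀ j) / s x) f (𝓝 (h j))) →
      (∀ᶠ x in f, ‖V x - u₀‖ < ε ∧ (coeffPoly d (g x)).derivative.eval (V x) = 0) →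
      Tendsto (fun x => ((coeffPoly d (g x)).eval (V x) - (coeffPoly d g₀).eval u₀) / s x) f
        (𝓝 ((coeffPoly d h).eval u₀)) := by
  set G := coeffPoly d g₀ with hG
  -- Nondegeneracy bounds `‖u - u₀‖` by the derivative of `G`. At a critical point of the perturbed
  -- polynomial this derivative is `O(s)`, so the critical point moves by `O(s)` only.
  obtain ⟨K, hK, hsl⟩ : ∃ K > 0, ∀ᶠ u in 𝓝 u₀, ‖u - u₀‖ ≤ K * ‖G.derivative.eval u‖ := by
    have h3 := (hasDerivAt_iff_tendsto_slope.1 (G.derivative.hasDerivAt u₀)).norm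
    have h4 := h3.eventually (lt_mem_nhds (half_lt_self (norm_pos_iff.2 h2)))
    rw [eventually_nhdsWithin_iff] at h4
    refine ⟨2 / ‖G.derivative.derivative.eval u₀‖, by positivity, ?_⟩
    filter_upwards [h4] with u hu
    by_cases he : u = u₀
    · simp [he, h1]
    · have h5 := hu he
      have h6 : 0 < ‖u - u₀‖ := norm_pos_iff.2 (sub_ne_zero.2 he)
      rw [slope_def_field, h1, sub_zero, norm_div, lt_div_iff₀ h6] at h5
      rw [div_mul_eq_mul_div, le_div_iff₀ (norm_pos_iff.2 h2)]
      linarith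
  obtain ⟨ε, hε, hball⟩ := Metric.eventually_nhds_iff.1 hsl
  refine ⟨ε, hε, fun {ι} f s g V hs hs0 hg hV => ?_⟩
  set q : ι → ℕ → ℂ := fun x j => (g x j - g₀ j) / s x with hq
  have hqt : Tendsto q f (𝓝 h) := tendsto_pi_nhds.2 hg
  have hVb : V =O[f] (fun _ => (1 : ℂ)) := by
    refine Asymptotics.IsBigO.of_bound (‖u₀‖ + ε) ?_
    filter_upwards [hV] with x hx
    have := norm_sub_norm_le (V x) u₀
    rw [norm_one, mul_one]
    linarith [hx.1]
  have hQb : (fun x => (coeffPoly d (q x)).derivative.eval (V x)) =O[f] (fun _ => (1 : ℂ)) := by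
    simp only [eval_derivative_coeffPoly]
    refine Asymptotics.IsBigO.fun_sum fun j _ => ?_
    have e1 : (fun x => q x j) =O[f] (fun _ => (1 : ℂ)) := (hg j).isBigO_one ℂ
    have e2 : (fun x => V x ^ (j - 1)) =O[f] (fun _ => (1 : ℂ)) := by
      simpa using hVb.pow (j - 1)
    simpa using e1.mul (e2.const_mul_left (j : ℂ))
  have hVs : (fun x => V x - u₀) =O[f] s := by
    have e1 : (fun x => V x - u₀) =O[f] fun x => s x * (coeffPoly d (q x)).derivative.eval (V x) := by
      refine Asymptotics.IsBigO.of_bound K ?_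
      filter_upwards [hV, hs0] with x hx hx0
      have e2 := hball (y := V x) (by rw [dist_eq_norm]; exact hx.1)
      have e3 := hx.2
      rw [coeffPoly_eq_add_smul (g₀ := g₀) hx0, derivative_add, derivative_C_mul, eval_add, eval_mul,
        eval_C, ← hG] at e3
      rwa [eq_neg_of_add_eq_zero_left e3, norm_neg] at e2
    refine e1.trans ?_
    simpa using (Asymptotics.isBigO_refl s f).mul hQb
  have hVt : Tendsto V f (𝓝 u₀) := by
    have := hVs.trans_tendsto hs
    simpa using this.add_const u₀
  -- As `G' (u₀) = 0`, moving the critical point changes the value of `G` by `o(s)`; to first order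
  -- only the perturbation itself contributes.
  have hlit : Tendsto (fun x => (G.eval (V x) - G.eval u₀) / s x) f (𝓝 0) := by
    have e1 := hasDerivAt_iff_isLittleO.1 (G.hasDerivAt u₀)
    rw [h1] at e1
    simp only [smul_zero, sub_zero] at e1
    exact ((e1.comp_tendsto hVt).trans_isBigO hVs).tendsto_div_nhds_zero
  have hQt : Tendsto (fun x => (coeffPoly d (q x)).eval (V x)) f (𝓝 ((coeffPoly d h).eval u₀)) :=
    (continuous_eval_coeffPoly.tendsto (h, u₀)).comp (hqt.prodMk_nhds hVt)
  have := hlit.add hQt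
  rw [zero_add] at this
  refine this.congr' ?_
  filter_upwards [hs0] with x hx
  rw [coeffPoly_eq_add_smul (g := g x) (g₀ := g₀) hx, eval_add, eval_mul, eval_C, ← hG]
  field_simp
  ring

/-- For real `s`, `‖1 + s q‖² = 1 + 2 s Re q + s² ‖q‖²`. -/
theorem tendsto_norm_sq_variation {ι : Type} {f : Filter ι} {s : ι → ℝ} (hs : Tendsto s f (𝓝 0))
    (hs0 : ∀ᶠ x in f, s x ≠ 0) {v : ι → ℂ} {v₀ H : ℂ} (hv₀ : v₀ ≠ 0)
    (hv : Tendsto (fun x => (v x - v₀) / s x) f (𝓝 H)) :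
    Tendsto (fun x => (‖v x‖ ^ 2 / ‖v₀‖ ^ 2 - 1) / s x) f (𝓝 (2 * (H / v₀).re)) := by
  set q : ι → ℂ := fun x => (v x - v₀) / s x / v₀ with hq
  have hqt : Tendsto q f (𝓝 (H / v₀)) := hv.div_const v₀
  have h1 : Tendsto (fun x => 2 * (q x).re + s x * ‖q x‖ ^ 2) f
      (𝓝 (2 * (H / v₀).re + 0 * ‖H / v₀‖ ^ 2)) :=
    (((Complex.continuous_re.tendsto _).comp hqt).const_mul 2).add (hs.mul (hqt.norm.pow 2))
  rw [zero_mul, add_zero] at h1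
  refine h1.congr' ?_
  filter_upwards [hs0] with x hx
  have hx' : (s x : ℂ) ≠ 0 := by exact_mod_cast hx
  have h2 : v x / v₀ = 1 + s x * q x := by
    rw [hq]
    field_simp
    ring
  rw [← div_pow, ← norm_div, h2, ← Complex.normSq_eq_norm_sq, ← Complex.normSq_eq_norm_sq,
    Complex.normSq_add]
  simp only [map_one, map_mul, Complex.normSq_ofReal, one_mul, Complex.conj_ofReal, Complex.re_ofReal_mul,
    Complex.conj_re]
  field_simp
  ring

/-- Critical values of equal norm are separated at first order in `s` by the real parts of their
relative variations. -/
theorem exists_eventually_norm_lt {g₀ h : ℕ → ℂ} {G : ℝ → ℕ → ℂ}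
    (hG : ∀ j, Tendsto (fun s => (G s j - g₀ j) / (s : ℂ)) (𝓝[>] 0) (𝓝 (h j))) {u₀ u₁ : ℂ}
    (h1 : (coeffPoly d g₀).derivative.eval u₀ = 0)
    (h2 : (coeffPoly d g₀).derivative.derivative.eval u₀ ≠ 0)
    (h1' : (coeffPoly d g₀).derivative.eval u₁ = 0)
    (h2' : (coeffPoly d g₀).derivative.derivative.eval u₁ ≠ 0)
    (h0 : (coeffPoly d g₀).eval u₀ ≠ 0)
    (hn : ‖(coeffPoly d g₀).eval u₁‖ = ‖(coeffPoly d g₀).eval u₀‖)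
    (hlt : ((coeffPoly d h).eval u₀ / (coeffPoly d g₀).eval u₀).re <
      ((coeffPoly d h).eval u₁ / (coeffPoly d g₀).eval u₁).re) :
    ∃ ε > 0, ∀ᶠ s in 𝓝[>] (0 : ℝ), ∀ V V', ‖V - u₀‖ < ε →
      (coeffPoly d (G s)).derivative.eval V = 0 → ‖V' - u₁‖ < ε →
      (coeffPoly d (G s)).derivative.eval V' = 0 →
      ‖(coeffPoly d (G s)).eval V‖ < ‖(coeffPoly d (G s)).eval V'‖ := by
  obtain ⟨ε₁, hε₁, key₁⟩ := exists_tendsto_critical_value (h := h) h1 h2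
  obtain ⟨ε₂, hε₂, key₂⟩ := exists_tendsto_critical_value (h := h) h1' h2'
  have h0' : (coeffPoly d g₀).eval u₁ ≠ 0 := by
    rw [← norm_pos_iff, hn]
    exact norm_pos_iff.2 h0
  refine ⟨min ε₁ ε₂, lt_min hε₁ hε₂, ?_⟩
  -- The limits are taken along triples of a parameter and two admissible critical points. This
  -- makes the comparison uniform in the critical points, without a choice of branches.
  set T : Set (ℝ × ℂ × ℂ) := {p | ‖p.2.1 - u₀‖ < min ε₁ ε₂ ∧
      (coeffPoly d (G p.1)).derivative.eval p.2.1 = 0 ∧ ‖p.2.2 - u₁‖ < min ε₁ ε₂ ∧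
      (coeffPoly d (G p.1)).derivative.eval p.2.2 = 0} with hT
  set F : Filter (ℝ × ℂ × ℂ) := comap Prod.fst (𝓝[>] 0) ⊓ 𝓟 T with hF
  have hfst : Tendsto Prod.fst F (𝓝[>] (0 : ℝ)) := tendsto_comap.mono_left inf_le_left
  have hs : Tendsto (fun p : ℝ × ℂ × ℂ => p.1) F (𝓝 0) := hfst.mono_right nhdsWithin_le_nhds
  have hpos : ∀ᶠ p : ℝ × ℂ × ℂ in F, 0 < p.1 := hfst.eventually self_mem_nhdsWithin
  have hs0 : ∀ᶠ p : ℝ × ℂ × ℂ in F, p.1 ≠ 0 := hpos.mono fun _ hp => hp.ne'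
  have hsc : Tendsto (fun p : ℝ × ℂ × ℂ => (p.1 : ℂ)) F (𝓝 0) := by
    have := (Complex.continuous_ofReal.tendsto 0).comp hs
    rwa [Complex.ofReal_zero] at this
  have hs0c : ∀ᶠ p : ℝ × ℂ × ℂ in F, (p.1 : ℂ) ≠ 0 := hs0.mono fun _ hp => by exact_mod_cast hp
  have hmem : ∀ᶠ p in F, p ∈ T := mem_inf_of_right (mem_principal_self T)
  have e1 := tendsto_norm_sq_variation hs hs0 h0 (key₁ F _ (fun p => G p.1) (fun p => p.2.1) hsc hs0c
    (fun j => (hG j).comp hfst)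
    (hmem.mono fun p hp => ⟨hp.1.trans_le (min_le_left _ _), hp.2.1⟩))
  have e2 := tendsto_norm_sq_variation hs hs0 h0' (key₂ F _ (fun p => G p.1) (fun p => p.2.2) hsc hs0c
    (fun j => (hG j).comp hfst)
    (hmem.mono fun p hp => ⟨hp.2.2.1.trans_le (min_le_right _ _), hp.2.2.2⟩))
  have e3 := (e1.eventually_lt e2 (by linarith)).and hpos
  rw [hF, eventually_inf_principal, eventually_comap] at e3
  filter_upwards [e3] with s hs V V' hV hV0 hV' hV0'
  obtain ⟨e4, e5⟩ := hs (s, V, V') rfl ⟨hV, hV0, hV', hV0'⟩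
  dsimp only at e4 e5
  have e6 : 0 < ‖(coeffPoly d g₀).eval u₀‖ ^ 2 := by positivity
  rw [hn, div_lt_div_iff_of_pos_right e5, sub_lt_sub_iff_right, div_lt_div_iff_of_pos_right e6] at e4
  exact lt_of_pow_lt_pow_left₀ 2 (norm_nonneg _) e4

/-- Prescribed order of the real parts of a polynomial on a finite set. -/
theorem exists_coeff_re_lt (Z : Finset ℂ) (θ : ℂ → ℝ) : ∃ c : ℕ → ℂ, (∀ j, c j ≠ 0) ∧
    ∀ ω ∈ Z, ∀ ω' ∈ Z, θ ω < θ ω' → (∑ j ∈ Finset.range Z.card, c j * ω ^ j).re <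
      (∑ j ∈ Finset.range Z.card, c j * ω' ^ j).re := by
  set p := Lagrange.interpolate Z id fun ω => (θ ω : ℂ) with hp
  have hinj : Set.InjOn (id : ℂ → ℂ) Z := Set.injOn_id _
  have hev : ∀ ω ∈ Z, ∑ j ∈ Finset.range Z.card, p.coeff j * ω ^ j = θ ω := by
    intro ω hω
    have h1 := Lagrange.eval_interpolate_at_node (fun ω => (θ ω : ℂ)) hinj hω
    rw [id, ← hp] at h1
    rw [← h1]
    by_cases h0 : p = 0
    · simp [h0]
    · rw [eval_eq_sum_range' ((natDegree_lt_iff_degree_lt h0).2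
        (Lagrange.degree_interpolate_lt _ hinj))]
  -- The interpolating polynomial may have vanishing coefficients. A small common shift `τ` makes
  -- them nonzero and keeps the finitely many strict inequalities.
  have hne : ∀ᶠ τ : ℝ in 𝓝[>] 0, ∀ j ∈ Finset.range Z.card, p.coeff j + τ ≠ 0 := by
    rw [Filter.eventually_all_finset]
    intro j _
    by_cases h0 : p.coeff j = 0
    · filter_upwards [self_mem_nhdsWithin] with τ hτ
      rw [h0, zero_add]
      exact_mod_cast (show (0 : ℝ) < τ from hτ).ne'
    · have hc : Continuous fun τ : ℝ => p.coeff j + τ := by fun_prop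
      exact nhdsWithin_le_nhds (hc.continuousAt.eventually_ne (by simpa using h0))
  have hlt : ∀ᶠ τ : ℝ in 𝓝[>] 0, ∀ ω ∈ Z, ∀ ω' ∈ Z, θ ω < θ ω' →
      (∑ j ∈ Finset.range Z.card, (p.coeff j + τ) * ω ^ j).re <
      (∑ j ∈ Finset.range Z.card, (p.coeff j + τ) * ω' ^ j).re := by
    simp only [Filter.eventually_all_finset]
    intro ω hω ω' hω'
    by_cases h0 : θ ω < θ ω'
    · have hc : ∀ ω : ℂ, Continuous fun τ : ℝ =>
          (∑ j ∈ Finset.range Z.card, (p.coeff j + τ) * ω ^ j).re := fun ω => by fun_prop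
      have := (hc ω).continuousAt.eventually_lt (x₀ := (0 : ℝ)) (hc ω').continuousAt (by
        simpa [hev ω hω, hev ω' hω'] using h0)
      filter_upwards [nhdsWithin_le_nhds this] with τ hτ _ using hτ
    · simp [h0]
  obtain ⟨τ, h1, h2⟩ := (hne.and hlt).exists
  refine ⟨fun j => if j < Z.card then p.coeff j + τ else 1, fun j => ?_, fun ω hω ω' hω' h => ?_⟩
  · dsimp only
    split_ifs with hj
    · exact h1 j (Finset.mem_range.2 hj)
    · exact one_ne_zero
  · have h3 : ∀ ω : ℂ, ∑ j ∈ Finset.range Z.card,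
        (if j < Z.card then p.coeff j + (τ : ℂ) else 1) * ω ^ j =
        ∑ j ∈ Finset.range Z.card, (p.coeff j + τ) * ω ^ j := fun ω =>
      Finset.sum_congr rfl fun j hj => by rw [if_pos (Finset.mem_range.1 hj)]
    rw [h3, h3]
    exact h2 ω hω ω' hω' h

/-- The coefficients `C j`, `b < j < a + b`, as coefficients of a polynomial. -/
def interiorCoeff (a b : ℕ) (c : ℕ → ℂ) (j : ℕ) : ℂ := if b < j ∧ j < a + b then c j else 0

/-- All nonzero critical values of the circuit polynomial have the same norm. The variation by
interior terms, relative to the critical value on the ray of `ω`, is a polynomial in `ω` of degree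
less than `a` with arbitrary coefficients except the constant one, which does not affect
comparisons; so the order of its real parts can be prescribed. -/
theorem exists_coeff_norm_lt {a b : ℕ} (ha : 0 < a) (hb : 0 < b) (hd : a + b < d) (θ : ℂ → ℝ) :
    ∃ c : ℕ → ℂ, (∀ j, c j ≠ 0) ∧ ∀ G : ℝ → ℕ → ℂ,
      (∀ j, Tendsto (fun s => (G s j - circuitCoeff a b j) / (s : ℂ)) (𝓝[>] 0)
        (𝓝 (interiorCoeff a b c j))) →
      ∃ ε > 0, ∀ᶠ s in 𝓝[>] (0 : ℝ), ∀ U : ℂ → ℂ,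
        (∀ ω ∈ powRoots a (-1), ‖U ω - critRadius a b * ω‖ < ε ∧
          (coeffPoly d (G s)).derivative.eval (U ω) = 0) →
        ∀ ω ∈ powRoots a (-1), ∀ ω' ∈ powRoots a (-1), θ ω < θ ω' →
          ‖(coeffPoly d (G s)).eval (U ω)‖ < ‖(coeffPoly d (G s)).eval (U ω')‖ := by
  have hfin := finite_powRoots ha (-1)
  have hcard : (nthRootsFinset a (-1 : ℂ)).card = a := card_nthRootsFinset_of_ne_zero ha (by simp)
  have hmem : ∀ ω, ω ∈ nthRootsFinset a (-1 : ℂ) ↔ ω ∈ powRoots a (-1) := fun ω =>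
    mem_nthRootsFinset ha _
  obtain ⟨C₀, hC0, hC⟩ := exists_coeff_re_lt (nthRootsFinset a (-1 : ℂ)) θ
  rw [hcard] at hC
  have hρ : (critRadius a b : ℂ) ≠ 0 := by exact_mod_cast (critRadius_pos (a := a) hb).ne'
  have hn : (critNorm a b : ℂ) ≠ 0 := by exact_mod_cast (critNorm_pos ha hb).ne'
  -- The factors compensate for the radius of the critical points and the norm of the critical
  -- values; the index is shifted by `b` because the critical value contains `ω^b`.
  set c : ℕ → ℂ := fun j => C₀ (j - b) * critNorm a b / critRadius a b ^ j with hc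
  have hval : ∀ ω ∈ powRoots a (-1), (coeffPoly d (interiorCoeff a b c)).eval (critRadius a b * ω) /
      (coeffPoly d (circuitCoeff a b)).eval (critRadius a b * ω) =
      (∑ j ∈ Finset.range a, C₀ j * ω ^ j) - C₀ 0 := by
    intro ω hω
    have hω0 : ω ≠ 0 := ne_zero_of_mem_powRoots ha (by simp) hω
    rw [eval_circuit_crit ha hd hω, eval_coeffPoly, div_eq_iff (mul_ne_zero (pow_ne_zero _ hω0) hn),
      sub_mul, Finset.sum_mul]
    obtain ⟨a, rfl⟩ := Nat.exists_eq_succ_of_ne_zero ha.ne'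
    rw [Finset.sum_range_succ', pow_zero, mul_one, add_sub_cancel_right]
    have hsub : Finset.Ioo b (a.succ + b) ⊆ Finset.range d := fun j hj => by
      rw [Finset.mem_Ioo] at hj
      exact Finset.mem_range.2 (by omega)
    rw [← Finset.sum_subset hsub fun j _ hj => by
      rw [Finset.mem_Ioo] at hj
      rw [interiorCoeff, if_neg hj, zero_mul]]
    symm
    refine Finset.sum_bij (fun j _ => j + 1 + b) (fun j hj => ?_) (fun i _ j _ h => by omega)
      (fun j hj => ?_) fun j hj => ?_
    · rw [Finset.mem_range] at hj
      rw [Finset.mem_Ioo]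
      omega
    · rw [Finset.mem_Ioo] at hj
      exact ⟨j - b - 1, Finset.mem_range.2 (by omega), by omega⟩
    · rw [Finset.mem_range] at hj
      rw [interiorCoeff, if_pos (by omega), hc]
      dsimp only
      rw [Nat.add_sub_cancel, mul_pow, div_mul_eq_mul_div, mul_div_assoc, mul_div_cancel_left₀ _
        (pow_ne_zero _ hρ)]
      ring
  have h2 : ∀ ω ∈ powRoots a (-1),
      (coeffPoly d (circuitCoeff a b)).derivative.derivative.eval (critRadius a b * ω) ≠ 0 := by
    intro ω hω h0
    have h3 := eval_derivative2_circuit_crit ha hb hd hω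
    rw [h0, mul_zero] at h3
    have h4 := eval_circuit_crit_ne_zero ha hb hd hω
    have h5 : ((b : ℂ) * (a + b)) ≠ 0 := by
      exact_mod_cast (Nat.mul_pos hb (by omega)).ne'
    exact mul_ne_zero (neg_ne_zero.2 h5) h4 h3.symm
  refine ⟨c, fun j => div_ne_zero (mul_ne_zero (hC0 _) hn) (pow_ne_zero _ hρ), fun G hG => ?_⟩
  have key : ∀ᶠ ε in 𝓝[>] (0 : ℝ), ∀ ω ∈ powRoots a (-1), ∀ ω' ∈ powRoots a (-1), θ ω < θ ω' →
      ∀ᶠ s in 𝓝[>] (0 : ℝ), ∀ V V', ‖V - critRadius a b * ω‖ < ε →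
        (coeffPoly d (G s)).derivative.eval V = 0 → ‖V' - critRadius a b * ω'‖ < ε →
        (coeffPoly d (G s)).derivative.eval V' = 0 →
        ‖(coeffPoly d (G s)).eval V‖ < ‖(coeffPoly d (G s)).eval V'‖ := by
    simp only [Filter.eventually_all_finite hfin, Filter.eventually_imp_distrib_left]
    intro ω hω ω' hω' hlt
    obtain ⟨ε, hε, hev⟩ := exists_eventually_norm_lt hG
      (eval_derivative_circuit_crit ha hb hd hω) (h2 ω hω)
      (eval_derivative_circuit_crit ha hb hd hω') (h2 ω' hω')
      (eval_circuit_crit_ne_zero ha hb hd hω)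
      (by rw [norm_eval_circuit_crit ha hb hd hω, norm_eval_circuit_crit ha hb hd hω']) (by
        rw [hval ω hω, hval ω' hω', Complex.sub_re, Complex.sub_re, sub_lt_sub_iff_right]
        exact hC ω ((hmem ω).2 hω) ω' ((hmem ω').2 hω') hlt)
    refine eventually_nhdsGT_of_forall_le ⟨ε, hε, fun ε' _ hle => ?_⟩
    filter_upwards [hev] with s hs V V' h1 h2 h3 h4
    exact hs V V' (h1.trans_le hle) h2 (h3.trans_le hle) h4
  obtain ⟨ε, hε, hε0⟩ := (key.and self_mem_nhdsWithin).exists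
  refine ⟨ε, hε0, ?_⟩
  have : ∀ᶠ s in 𝓝[>] (0 : ℝ), ∀ ω ∈ powRoots a (-1), ∀ ω' ∈ powRoots a (-1), θ ω < θ ω' →
      ∀ V V', ‖V - critRadius a b * ω‖ < ε →
        (coeffPoly d (G s)).derivative.eval V = 0 → ‖V' - critRadius a b * ω'‖ < ε →
        (coeffPoly d (G s)).derivative.eval V' = 0 →
        ‖(coeffPoly d (G s)).eval V‖ < ‖(coeffPoly d (G s)).eval V'‖ := by
    simp only [Filter.eventually_all_finite hfin, Filter.eventually_imp_distrib_left]
    exact hε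
  filter_upwards [this] with s hs U hU ω hω ω' hω' hlt
  exact hs ω hω ω' hω' hlt _ _ (hU ω hω).1 (hU ω hω).2 (hU ω' hω').1 (hU ω' hω').2

end Variation

/-! ## A regeneration with prescribed order of the critical values -/

section ModelHeight

variable {n m : ℕ} {k : ℕ → ℕ}

/-- A convex function with slope `2 l` on the interval from `k l` to `k (l + 1)`. -/
def modelHeight (m : ℕ) (k : ℕ → ℕ) (j : ℕ) : ℤ := ∑ l ∈ Finset.Ico 1 m, 2 * ((j - k l : ℕ) : ℤ)

theorem modelHeight_eq (hk : IsMonotonePath n m k) {l j : ℕ} (hl : l < m) (h1 : k l ≤ j)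
    (h2 : j ≤ k (l + 1)) :
    modelHeight m k j = modelHeight m k (k l) + 2 * l * ((j : ℤ) - k l) := by
  have hsub : Finset.Ico 1 (l + 1) ⊆ Finset.Ico 1 m := Finset.Ico_subset_Ico_right hl
  rw [modelHeight, modelHeight, ← sub_eq_iff_eq_add', ← Finset.sum_sub_distrib,
    ← Finset.sum_subset hsub, Finset.sum_congr rfl (g := fun _ => 2 * ((j : ℤ) - k l))]
  · simp only [Finset.sum_const, Nat.card_Ico, Nat.add_sub_cancel, nsmul_eq_mul]
    ring
  · intro x hx
    rw [Finset.mem_Ico] at hx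
    have := hk.le (show x ≤ l by omega) hl.le
    omega
  · intro x hx hx'
    rw [Finset.mem_Ico] at hx hx'
    have := hk.le (show l + 1 ≤ x by omega) hx.2.le
    have := hk.2.2 l hl
    omega

theorem eq_of_interior (hk : IsMonotonePath n m k) {l l' j : ℕ} (hl : l < m) (hl' : l' < m)
    (h1 : k l < j) (h2 : j < k (l + 1)) (h1' : k l' < j) (h2' : j < k (l' + 1)) : l = l' := by
  rcases lt_trichotomy l l' with h | h | h
  · have := hk.le (show l + 1 ≤ l' by omega) hl'.le
    omega
  · exact h
  · have := hk.le (show l' + 1 ≤ l by omega) hl.le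
    omega

theorem not_interior (hk : IsMonotonePath n m k) {l : ℕ} (hl : l ≤ m) :
    ¬ ∃ l' < m, k l' < k l ∧ k l < k (l' + 1) := by
  rintro ⟨l', hl', h1, h2⟩
  rcases le_or_gt l l' with h | h
  · have := hk.le h hl'.le
    omega
  · have := hk.le (show l' + 1 ≤ l by omega) hl
    omega

open Classical in
/-- The height function that is `1` above the convex function at the interior points. -/
noncomputable def modelEta (m : ℕ) (k : ℕ → ℕ) (j : ℕ) : ℤ :=
  -- The value `1` at `0` makes `η 1 - η 0 = -1` less than the first slope, which is `0`.
  if j = 0 then 1 else modelHeight m k j + if ∃ l < m, k l < j ∧ j < k (l + 1) then 1 else 0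

theorem modelEta_vertex (hk : IsMonotonePath n m k) {l : ℕ} (hl : l ≤ m) :
    modelEta m k (k l) = modelHeight m k (k l) := by
  have h := hk.one_le hl
  have h0 : k l ≠ 0 := by omega
  rw [modelEta, if_neg h0, if_neg (not_interior hk hl), add_zero]

theorem modelEta_interior (hk : IsMonotonePath n m k) {l j : ℕ} (hl : l < m) (h1 : k l < j)
    (h2 : j < k (l + 1)) :
    modelEta m k j = modelHeight m k (k l) + 2 * l * ((j : ℤ) - k l) + 1 := by
  have h0 : j ≠ 0 := by omega
  rw [modelEta, if_neg h0, if_pos ⟨l, hl, h1, h2⟩, modelHeight_eq hk hl h1.le h2.le]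

end ModelHeight

namespace Regeneration

variable {n m : ℕ} {k : ℕ → ℕ}

open Classical in
/-- The regeneration with slopes `2 l`, height `1` above the convex function at the interior points,
and the given coefficients at the interior points of each circuit. -/
noncomputable def model (hk : IsMonotonePath n m k) (C : ℕ → ℕ → ℂ) : Regeneration n m k where
  η := modelEta m k
  slope l := 2 * l
  c j := if h : ∃ l < m, k l < j ∧ j < k (l + 1) then C h.choose j else 1
  slope_eq l hl := by
    rw [modelEta_vertex hk hl.le, modelEta_vertex hk (show l + 1 ≤ m from hl),
      modelHeight_eq hk hl (hk.2.2 l hl).le le_rfl]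
    ring
  slope_zero_lt l hl := by
    have h1 : modelHeight m k 1 = 0 := by
      refine Finset.sum_eq_zero fun x hx => ?_
      rw [Finset.mem_Ico] at hx
      have := hk.one_le hx.2.le
      omega
    have h2 := modelEta_vertex hk (Nat.zero_le m)
    rw [hk.1, h1] at h2
    rw [h2, modelEta, if_pos rfl]
    omega
  slope_lt l _ := by
    push_cast
    linarith
  above l hl j h1 h2 := by
    rw [modelEta_interior hk hl h1 h2, modelEta_vertex hk hl.le]
    linarith
  c_zero := by
    rw [dif_neg]
    rintro ⟨l, -, h, -⟩
    exact Nat.not_lt_zero _ h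
  c_vertex l hl := dif_neg (not_interior hk hl)

variable (hk : IsMonotonePath n m k) (C : ℕ → ℕ → ℂ)

theorem model_c_ne_zero (hC : ∀ l j, C l j ≠ 0) (j : ℕ) : (model hk C).c j ≠ 0 := by
  simp only [model]
  split_ifs with h
  · exact hC _ _
  · exact one_ne_zero

theorem model_c_interior {l j : ℕ} (hl : l < m) (h1 : k l < j) (h2 : j < k (l + 1)) :
    (model hk C).c j = C l j := by
  have h : ∃ l < m, k l < j ∧ j < k (l + 1) := ⟨l, hl, h1, h2⟩
  simp only [model, dif_pos h]
  rw [eq_of_interior hk h.choose_spec.1 hl h.choose_spec.2.1 h.choose_spec.2.2 h1 h2]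

theorem model_expo_interior {l j : ℕ} (hl : l < m) (h1 : k l < j) (h2 : j < k (l + 1)) :
    (model hk C).expo l j = 1 := by
  simp only [expo, model]
  rw [modelEta_interior hk hl h1 h2, modelEta_vertex hk hl.le]
  ring

/-- Interior points of the circuit have exponent `1`. All other points off the vertices have
exponent at least `2`, because consecutive slopes differ by `2`, and so do not contribute to first
order. -/
theorem tendsto_model_coef {l : ℕ} (hl : l < m) (j : ℕ) :
    Tendsto (fun s : ℝ => ((model hk C).coef l s j - circuitCoeff (k (l + 1) - k l) (k l) j) / s)
      (𝓝[>] 0) (𝓝 (interiorCoeff (k (l + 1) - k l) (k l) (C l) j)) := by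
  have hlt := hk.2.2 l hl
  have hb := hk.one_le hl.le
  have hN := hk.le_succ (show l + 1 ≤ m from hl)
  have hzero : ∀ {f : ℝ → ℂ}, ¬ (k l < j ∧ j < k (l + 1)) → (∀ᶠ s in 𝓝[>] (0 : ℝ), f s = 0) →
      Tendsto f (𝓝[>] 0) (𝓝 (interiorCoeff (k (l + 1) - k l) (k l) (C l) j)) := by
    intro f hj hf
    rw [interiorCoeff, if_neg (by omega)]
    exact tendsto_const_nhds.congr' (hf.mono fun _ h => h.symm)
  by_cases hj : 1 ≤ j ∧ j ≤ n + 1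
  · by_cases hv : j = k l ∨ j = k (l + 1)
    · refine hzero (by omega) (Eventually.of_forall fun s => ?_)
      have h1 : (model hk C).c j = 1 := by
        rcases hv with rfl | rfl
        exacts [(model hk C).c_vertex l hl.le, (model hk C).c_vertex (l + 1) hl]
      have h2 : (model hk C).expo l j = 0 := by
        rcases hv with rfl | rfl
        exacts [(model hk C).expo_self l, (model hk C).expo_next hl]
      rw [coef, if_pos hj, h1, h2, circuitCoeff, if_pos (by omega)]
      simp
    · have hcc : circuitCoeff (k (l + 1) - k l) (k l) j = 0 := by
        rw [circuitCoeff, if_neg (by omega)]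
      by_cases hint : k l < j ∧ j < k (l + 1)
      · rw [interiorCoeff, if_pos (by omega)]
        refine tendsto_const_nhds.congr' ?_
        filter_upwards [self_mem_nhdsWithin] with s hs
        have hs' : (s : ℂ) ≠ 0 := by exact_mod_cast (show (0 : ℝ) < s from hs).ne'
        rw [coef, if_pos hj, model_c_interior hk C hl hint.1 hint.2,
          model_expo_interior hk C hl hint.1 hint.2, hcc, zpow_one, sub_zero, mul_div_cancel_right₀ _ hs']
      · have h1 : 2 ≤ (model hk C).expo l j := le_expo hk zero_le_two
          (fun x _ => by simp only [model]; push_cast; linarith) hl hj.1 hj.2 (by omega)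
        obtain ⟨e, he⟩ := Int.eq_ofNat_of_zero_le (show 0 ≤ (model hk C).expo l j - 2 by omega)
        have he' : (model hk C).expo l j = ((e + 1 : ℕ) : ℤ) + 1 := by push_cast; omega
        have h2 : Continuous fun s : ℝ => (model hk C).c j * (s : ℂ) ^ (e + 1) := by fun_prop
        have h3 := (h2.tendsto 0).mono_left (nhdsWithin_le_nhds (s := Set.Ioi 0))
        rw [Complex.ofReal_zero, zero_pow (Nat.succ_ne_zero e), mul_zero] at h3
        rw [interiorCoeff, if_neg (by omega)]
        refine h3.congr' ?_
        filter_upwards [self_mem_nhdsWithin] with s hs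
        have hs' : (s : ℂ) ≠ 0 := by exact_mod_cast (show (0 : ℝ) < s from hs).ne'
        rw [coef, if_pos hj, hcc, he', zpow_add₀ hs', zpow_one, zpow_natCast, sub_zero, ← mul_assoc,
          mul_div_cancel_right₀ _ hs']
  · refine hzero (by omega) (Eventually.of_forall fun s => ?_)
    rw [coef, if_neg hj, circuitCoeff, if_neg (by omega)]
    simp

/-- There is a regeneration for which the norms of the critical values of each circuit are ordered
in a prescribed way. -/
theorem exists_regeneration_norm_lt (hk : IsMonotonePath n m k) (θ : ℕ → ℂ → ℝ) : ∃ D : Regeneration n m k, (∀ j, D.c j ≠ 0) ∧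
    ∃ ε > 0, ∀ᶠ s : ℝ in 𝓝[>] 0, ∀ U : ℕ → ℂ → ℂ,
      (∀ l < m, ∀ ω ∈ powRoots (k (l + 1) - k l) (-1),
        ‖U l ω - critRadius (k (l + 1) - k l) (k l) * ω‖ < ε ∧
          (D.circuitPoly l s).derivative.eval (U l ω) = 0) →
      ∀ l < m, ∀ ω ∈ powRoots (k (l + 1) - k l) (-1), ∀ ω' ∈ powRoots (k (l + 1) - k l) (-1),
        θ l ω < θ l ω' → ‖(D.circuitPoly l s).eval (U l ω)‖ < ‖(D.circuitPoly l s).eval (U l ω')‖ := by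
  have hgap : ∀ l < m, 0 < k (l + 1) - k l := fun l hl => Nat.sub_pos_of_lt (hk.2.2 l hl)
  have hsum : ∀ l < m, k (l + 1) - k l + k l < n + 2 := fun l hl => by
    have := hk.le_succ (show l + 1 ≤ m from hl)
    have := hk.2.2 l hl
    omega
  have hex : ∀ l, ∃ c : ℕ → ℂ, (∀ j, c j ≠ 0) ∧ (l < m → ∀ G : ℝ → ℕ → ℂ,
      (∀ j, Tendsto (fun s => (G s j - circuitCoeff (k (l + 1) - k l) (k l) j) / (s : ℂ)) (𝓝[>] 0)
        (𝓝 (interiorCoeff (k (l + 1) - k l) (k l) c j))) →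
      ∃ ε > 0, ∀ᶠ s in 𝓝[>] (0 : ℝ), ∀ U : ℂ → ℂ,
        (∀ ω ∈ powRoots (k (l + 1) - k l) (-1),
          ‖U ω - critRadius (k (l + 1) - k l) (k l) * ω‖ < ε ∧
          (coeffPoly (n + 2) (G s)).derivative.eval (U ω) = 0) →
        ∀ ω ∈ powRoots (k (l + 1) - k l) (-1), ∀ ω' ∈ powRoots (k (l + 1) - k l) (-1),
          θ l ω < θ l ω' →
          ‖(coeffPoly (n + 2) (G s)).eval (U ω)‖ < ‖(coeffPoly (n + 2) (G s)).eval (U ω')‖) := by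
    intro l
    by_cases hl : l < m
    · obtain ⟨c, hc, h⟩ := exists_coeff_norm_lt (hgap l hl) (hk.one_le hl.le) (hsum l hl) (θ l)
      exact ⟨c, hc, fun _ => h⟩
    · exact ⟨fun _ => 1, fun _ => one_ne_zero, fun h => absurd h hl⟩
  choose C hC0 hC using hex
  refine ⟨model hk C, model_c_ne_zero hk C hC0, ?_⟩
  have key : ∀ᶠ ε in 𝓝[>] (0 : ℝ), ∀ l ∈ Finset.range m, ∀ᶠ s : ℝ in 𝓝[>] 0, ∀ U : ℂ → ℂ,
      (∀ ω ∈ powRoots (k (l + 1) - k l) (-1),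
        ‖U ω - critRadius (k (l + 1) - k l) (k l) * ω‖ < ε ∧
          ((model hk C).circuitPoly l s).derivative.eval (U ω) = 0) →
      ∀ ω ∈ powRoots (k (l + 1) - k l) (-1), ∀ ω' ∈ powRoots (k (l + 1) - k l) (-1),
        θ l ω < θ l ω' → ‖((model hk C).circuitPoly l s).eval (U ω)‖ <
          ‖((model hk C).circuitPoly l s).eval (U ω')‖ := by
    rw [Filter.eventually_all_finset]
    intro l hl
    rw [Finset.mem_range] at hl
    obtain ⟨ε, hε, hev⟩ := hC l hl (fun s => (model hk C).coef l s) (tendsto_model_coef hk C hl)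
    refine eventually_nhdsGT_of_forall_le ⟨ε, hε, fun ε' _ hle => ?_⟩
    filter_upwards [hev] with s hs U hU
    exact hs U fun ω hω => ⟨(hU ω hω).1.trans_le hle, (hU ω hω).2⟩
  obtain ⟨ε, hε, hε0⟩ := (key.and self_mem_nhdsWithin).exists
  refine ⟨ε, hε0, ?_⟩
  filter_upwards [(Filter.eventually_all_finset _).2 hε] with s hs U hU l hl
  exact hs l (Finset.mem_range.2 hl) (U l) (hU l hl)

end Regeneration

/-! ## Realization of insertions -/

theorem isCyclicSucc_rotatePerm {d : ℕ} (hd : 0 < d) :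
    IsCyclicSucc (CCWOn (powRoots d 1)) (rotatePerm d hd) d := by
  have h0 : ∀ ζ : powRoots d 1, (ζ : ℂ) ≠ 0 := fun ζ =>
    ne_zero_of_mem_powRoots hd one_ne_zero ζ.2
  refine isCyclicSucc_of_arg_lt hd (Equiv.refl (powRoots d 1)) one_ne_zero h0 fun ζ => ?_
  rw [Equiv.refl_apply, div_one, div_self (h0 ζ), Complex.arg_one, abs_zero]
  positivity

/-- The logarithms of the critical values can be chosen so that the monodromy is a given insertion. -/
theorem exists_isCircuitLabelling_eq {P : ℂ[X]} {a b : ℕ} (ha : 0 < a) (hb : 0 < b)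
    (hN : 0 < a + b) {δ M r R : ℝ} {U : ℂ → ℂ} {ξ : ℕ → powRoots a (-1)}
    (h : IsNearCircuit P a b δ M r R U) {v : ℕ → ℂ} (hv : ∀ l < a, v l ≠ 0)
    (hex : ∀ c : ℕ → ℂ, (∀ l < a, Complex.exp (c l) = v l) →
      ∃ ρ π y σ, IsCircuitLabelling P hb hN δ M r R U c ξ ρ π y σ)
    {y₀ : ℕ → powRoots b 1 ⊕ powRoots a (-1)}
    {π₀ : ℕ → Equiv.Perm (powRoots b 1 ⊕ powRoots a (-1))}
    (h₀ : IsInsertionChain a (rotatePerm b hb) ξ y₀ π₀)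
    {σ₀ : powRoots b 1 ⊕ powRoots a (-1) ≃ powRoots (a + b) 1}
    (hσ₀ : ∀ z, σ₀ (π₀ a z) = rotatePerm (a + b) hN (σ₀ z)) :
    ∃ c : ℕ → ℂ, (∀ l < a, Complex.exp (c l) = v l) ∧
      ∃ ρ π y, IsCircuitLabelling P hb hN δ M r R U c ξ ρ π y σ₀ := by
  have f1 := (finite_powRoots hb 1).to_subtype
  have f2 := (finite_powRoots ha (-1)).to_subtype
  have hupd : ∀ (c : ℕ → ℂ) (L κ : ℕ), (∀ l < a, Complex.exp (c l) = v l) → ∀ l < a,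
      Complex.exp (Function.update c L (c L + κ * (2 * Real.pi * Complex.I)) l) = v l := by
    intro c L κ hc l hl
    by_cases hlL : l = L
    · subst hlL
      rw [Function.update_self, Complex.exp_periodic.nat_mul κ, hc l hl]
    · rw [Function.update_of_ne hlL, hc l hl]
  -- The attaching points are corrected one after the other: additional turns of `c L` move `y L`
  -- within its orbit under `π L`, which contains all elements inserted before, and leave the
  -- earlier attaching points unchanged.
  have key : ∀ L ≤ a, ∃ c : ℕ → ℂ, (∀ l < a, Complex.exp (c l) = v l) ∧
      ∃ ρ π y σ, IsCircuitLabelling P hb hN δ M r R U c ξ ρ π y σ ∧ ∀ l < L, y l = y₀ l := by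
    intro L
    induction L with
    | zero =>
      intro _
      have hc : ∀ l < a, Complex.exp (Complex.log (v l)) = v l := fun l hl => Complex.exp_log (hv l hl)
      obtain ⟨ρ, π, y, σ, hl⟩ := hex _ hc
      exact ⟨_, hc, ρ, π, y, σ, hl, fun l hl => absurd hl (Nat.not_lt_zero l)⟩
    | succ L ih =>
      intro hLa
      have hL : L < a := hLa
      obtain ⟨c, hc, ρ, π, y, σ, hl, hy⟩ := ih hL.le
      have hπ := h₀.perm_congr hl.chain hL.le hy
      obtain ⟨j, hj⟩ := hl.chain.exists_pow hl.transitive hL.le (h₀.mem L hL) (hl.chain.mem L hL)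
      obtain ⟨ρ', π', y', σ', hl'⟩ := hex _ (hupd c L j hc)
      have hcl : ∀ l < L, Function.update c L (c L + j * (2 * Real.pi * Complex.I)) l = c l :=
        fun l hl => Function.update_of_ne hl.ne _ _
      refine ⟨_, hupd c L j hc, ρ', π', y', σ', hl', fun l hlL => ?_⟩
      rcases (Nat.lt_succ_iff.1 hlL).eq_or_lt with rfl | hlL
      · have := hl.pow_apply hl' h hL hcl (Function.update_self _ _ _)
        rw [← hj] at this
        exact (π l ^ j).injective this
      · rw [hl.y_eq hl' h hL.le hcl hlL, hy l hlL]
  obtain ⟨c, hc, ρ, π, y, σ, hl, hy⟩ := key a le_rfl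
  have hπ := h₀.perm_congr hl.chain le_rfl hy
  obtain ⟨z₀⟩ : Nonempty (powRoots b 1 ⊕ powRoots a (-1)) := ⟨Sum.inr (ξ 0)⟩
  -- The chains now agree, so `σ₀` is `σ` followed by `K` rotations. With `N = a + b`, adding `(N -
  -- 1) K` turns to the last logarithm does not change the chain, as `π (a-1) ^ (N-1) = 1`, and
  -- rotates the outer labels by `-(N - 1) K`, which is `K` modulo `N`.
  obtain ⟨K, -, hK⟩ := exists_pow_of_conj (isCyclicSucc_rotatePerm hN) σ σ₀ (π a) hl.rotate
    (fun z => by rw [hπ, hσ₀]) z₀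
  have hcard : Nat.card (powRoots b 1 ⊕ powRoots a (-1)) = a + b := by
    rw [Nat.card_congr σ, card_powRoots hN one_ne_zero]
  have hone : π (a - 1) ^ ((a + b - 1) * K) = 1 := by
    have := hl.chain.pow_card_eq_one ha hl.transitive
    rw [hcard] at this
    rw [pow_mul, this, one_pow]
  obtain ⟨ρ', π', y', σ', hl'⟩ := hex _ (hupd c (a - 1) ((a + b - 1) * K) hc)
  have hrot := hl.rotate_pow hl' h ha (fun l hl => Function.update_of_ne hl.ne _ _)
    (Function.update_self _ _ _) hone
  have hσ : σ' = σ₀ := by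
    ext1 z
    rw [hK, ← hrot, ← Equiv.Perm.mul_apply, ← pow_add,
      show K + (a + b - 1) * K = (a + b) * K by
        obtain ⟨N, hN'⟩ := Nat.exists_eq_succ_of_ne_zero hN.ne'
        rw [hN', Nat.succ_sub_one, Nat.succ_mul, add_comm], pow_mul]
    have h1 : rotatePerm (a + b) hN ^ (a + b) = 1 := Equiv.ext (rotatePerm_pow_eq hN)
    rw [h1, one_pow, Equiv.Perm.coe_one, id]
  subst hσ
  exact ⟨_, hupd c (a - 1) _ hc, ρ', π', y', hl'⟩

/-- A strict total order on a finite set of complex numbers is the order of the values of a function. -/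
theorem exists_real_of_isStrictTotalOrder {Z : Set ℂ} (hZ : Z.Finite) (lt : Z → Z → Prop)
    (hlt : IsStrictTotalOrder Z lt) : ∃ θ : ℂ → ℝ, ∀ x y : Z, lt x y ↔ θ x < θ y := by
  classical
  have := hZ.to_subtype
  rcases isEmpty_or_nonempty Z with he | hne
  · exact ⟨0, fun x => he.elim x⟩
  · obtain ⟨ξ, -, hsurj, hξ⟩ := exists_enumeration (Nat.card Z) rfl Nat.card_pos lt hlt
    choose f hf hfξ using hsurj
    refine ⟨fun x => if hx : x ∈ Z then f ⟨x, hx⟩ else 0, fun x y => ?_⟩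
    dsimp only
    rw [dif_pos x.2, dif_pos y.2, Nat.cast_lt]
    conv_lhs => rw [← hfξ x, ← hfξ y]
    exact hξ _ (hf x) _ (hf y)

theorem injOn_arg_powRoots {a : ℕ} (ha : 0 < a) : Set.InjOn Complex.arg (powRoots a (-1)) :=
  fun _ hx _ hy h => Complex.ext_norm_arg
    ((norm_eq_one_of_mem_powRoots ha hx).trans (norm_eq_one_of_mem_powRoots ha hy).symm) h

namespace Regeneration

variable {n m : ℕ} {k : ℕ → ℕ} {D : Regeneration n m k}

namespace IsCritSystem

variable {s : ℂ} {U : ℕ → ℂ → ℂ}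

theorem exists_enumeration (hk : IsMonotonePath n m k) (hn : 0 < n) (i : ℕ)
    (hinj : Set.InjOn (fun p => ‖D.critValue i s U p‖) (critIndex m k)) :
    ∃ p : ℕ → Σ _ : ℕ, ℂ, Set.BijOn p (Set.Icc 1 n) (critIndex m k) ∧
      StrictMonoOn (fun j => ‖D.critValue i s U (p j)‖) (Set.Icc 1 n) := by
  obtain ⟨ξ, h1, h2, h3⟩ := _root_.exists_enumeration (S₂ := critIndex m k) n
    (by rw [Nat.card_eq_fintype_card, Fintype.card_coe, card_critIndex hk]) hn
    (fun p q => ‖D.critValue i s U p‖ < ‖D.critValue i s U q‖)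
    { trichotomous := fun p q h1 h2 => Subtype.ext (hinj p.2 q.2 (le_antisymm (not_lt.1 h2) (not_lt.1 h1)))
      irrefl := fun _ => lt_irrefl _
      trans := fun _ _ _ => lt_trans }
  refine ⟨fun j => ξ (j - 1), ⟨fun j _ => (ξ (j - 1)).2, fun x hx y hy he => ?_, fun q hq => ?_⟩,
    fun x hx y hy hxy => ?_⟩
  · have hx1 := hx.1
    have hx2 := hx.2
    have hy1 := hy.1
    have hy2 := hy.2
    have := h1 (show x - 1 < n by omega) (show y - 1 < n by omega) (Subtype.ext he)
    omega
  · obtain ⟨l, hl, he⟩ := h2 ⟨q, hq⟩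
    exact ⟨l + 1, ⟨by omega, by omega⟩, congrArg Subtype.val he⟩
  · have hx1 := hx.1
    have hy1 := hy.1
    have hy2 := hy.2
    exact (h3 (x - 1) (by omega) (y - 1) (by omega)).2 (by omega)

variable (h : D.IsCritSystem s U) (hk : IsMonotonePath n m k)

include h hk

/-- Norms from different circuits are separated by the energies; within a circuit they are ordered
strictly like the injective function `θ l`. -/
theorem injOn_norm_critValue {θ : ℕ → ℂ → ℝ}
    (hθ : ∀ l < m, Set.InjOn (θ l) (powRoots (k (l + 1) - k l) (-1)))
    (hlt : ∀ l < m, ∀ ω ∈ powRoots (k (l + 1) - k l) (-1),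
      ∀ ω' ∈ powRoots (k (l + 1) - k l) (-1), θ l ω < θ l ω' →
        ‖(D.circuitPoly l s).eval (U l ω)‖ < ‖(D.circuitPoly l s).eval (U l ω')‖) (i : ℕ) :
    Set.InjOn (fun p => ‖D.critValue i s U p‖) (critIndex m k) := by
  intro p hp q hq he
  dsimp only at he
  have h1 : p.1 = q.1 := by
    rcases lt_trichotomy p.1 q.1 with h3 | h3 | h3
    · exact absurd he (h.norm_critValue_lt hk i hp hq h3).ne
    · exact h3
    · exact absurd he (h.norm_critValue_lt hk i hq hp h3).ne'
  obtain ⟨l, ω⟩ := p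
  obtain ⟨l', ω'⟩ := q
  dsimp only at h1
  subst h1
  rw [Finset.mem_coe, mem_critIndex hk] at hp hq
  rw [critValue, critValue, norm_mul, norm_mul, norm_neg, norm_neg] at he
  have h2 := mul_left_cancel₀ (norm_ne_zero_iff.2 (zpow_ne_zero _ h.ne_zero)) he
  refine congrArg (Sigma.mk l) (hθ l hp.1 hp.2 hq.2 ?_)
  rcases lt_trichotomy (θ l ω) (θ l ω') with h3 | h3 | h3
  · exact absurd h2 (hlt l hp.1 ω hp.2 ω' hq.2 h3).ne
  · exact h3
  · exact absurd h2 (hlt l hp.1 ω' hq.2 ω hp.2 h3).ne'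

theorem isRadarScreen {i : ℕ} (hi : i < m) {p : ℕ → Σ _ : ℕ, ℂ}
    (hp : Set.BijOn p (Set.Icc 1 n) (critIndex m k))
    (hmono : StrictMonoOn (fun j => ‖D.critValue i s U (p j)‖) (Set.Icc 1 n)) {w : ℕ → ℂ}
    (hw : ∀ j ∈ Set.Icc 1 n, Complex.exp (w j) = D.critValue i s U (p j)) :
    D.IsRadarScreen i s w := by
  constructor
  · intro x hx y hy hxy
    have h1 := hmono hx hy hxy
    dsimp only at h1
    rw [← hw x hx, ← hw y hy, Complex.norm_exp, Complex.norm_exp] at h1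
    exact Real.exp_lt_exp.1 h1
  · rw [h.criticalValues_eq hk hi, ← hp.image_eq, Set.image_image]
    exact Set.image_congr hw

end IsCritSystem

/-- The regeneration takes care of the order `lt`, as the order of the norms of the critical values;
the logarithms in the radar screen take care of `σ`. The degree `N` is a variable so that it can be
replaced by the sum `a + b` in the type of `σ`. -/
theorem exists_regeneration_of_insertion (hk : IsMonotonePath n m k) {i : ℕ} (hi : i < m)
    {δ r₀ R₀ : ℝ}
    (hnear : ∀ r R : ℝ, 0 < r → r < r₀ → R₀ < R → ∃ M, ∃ ε > 0,
      ∀ᶠ g in 𝓝 (circuitCoeff (k (i + 1) - k i) (k i)), g 0 = 0 → ∀ U : ℂ → ℂ,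
        (∀ ω ∈ powRoots (k (i + 1) - k i) (-1),
          ‖U ω - critRadius (k (i + 1) - k i) (k i) * ω‖ < ε ∧
          (coeffPoly (n + 2) g).derivative.eval (U ω) = 0) →
        IsNearCircuit (coeffPoly (n + 2) g) (k (i + 1) - k i) (k i) δ M r R U)
    {N : ℕ} (hN : N = k (i + 1) - k i + k i)
    (σ : powRoots (k i) 1 ⊕ powRoots (k (i + 1) - k i) (-1) ≃ powRoots N 1)
    (lt : powRoots (k (i + 1) - k i) (-1) → powRoots (k (i + 1) - k i) (-1) → Prop)
    (hσ : IsCyclicInsertion (CCWOn _) (CCWOn _) (k (i + 1) - k i) σ)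
    (hlt : IsStrictTotalOrder _ lt) :
    ∃ D : Regeneration n m k, (∀ j ∈ Set.Icc 1 (n + 1), D.c j ≠ 0) ∧
      ∀ r R : ℝ, 0 < r → r < r₀ → R₀ < R → ∃ s₀ > (0 : ℝ), ∀ s : ℝ, 0 < s → s < s₀ →
        ∃ w : ℕ → ℂ, D.IsRadarScreen i s w ∧ ∀ᶠ ε in 𝓝[>] (0 : ℝ),
          ∃ (τ : D.innerFiber i s (startPoint k i w r) ⊕
              D.middleFiber i s (startPoint k i w r) ≃ D.outerFiber i s (endPoint k i w R))
            (e₁ : powRoots (k i) 1 ≃ D.innerFiber i s (startPoint k i w r))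
            (e₂ : powRoots (k (i + 1) - k i) (-1) ≃ D.middleFiber i s (startPoint k i w r))
            (e₃ : powRoots N 1 ≃ D.outerFiber i s (endPoint k i w R)),
            (∀ ζ, IsNearest (powRoots (k i) 1)
              (e₁ ζ / phaseRoot (k i) (startPoint k i w r)) ζ) ∧
            (∀ ζ, IsNearest (powRoots (k (i + 1) - k i) (-1)) (e₂ ζ) ζ) ∧
            (∀ ζ, IsNearest (powRoots N 1) (e₃ ζ / phaseRoot N (endPoint k i w R)) ζ) ∧
            D.IsMonodromyMap i s w ε r R τ ∧
            (∀ p, τ (Sum.map e₁ e₂ p) = e₃ (σ p)) ∧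
            D.VanishingGraphEq i s w ε r R τ (fun x y => lt (e₂.symm x) (e₂.symm y)) := by
  subst hN
  have hgap : ∀ l < m, 0 < k (l + 1) - k l := fun l hl => Nat.sub_pos_of_lt (hk.2.2 l hl)
  have ha := hgap i hi
  have hb : 0 < k i := hk.one_le hi.le
  have hN : 0 < k (i + 1) - k i + k i := by omega
  have hkN : k (i + 1) = k (i + 1) - k i + k i := by omega
  have hn : 0 < n := by
    have := hk.le_succ (show i + 1 ≤ m from hi)
    omega
  obtain ⟨θi, hθi⟩ := exists_real_of_isStrictTotalOrder (finite_powRoots ha (-1)) lt hlt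
  -- On the other circuits any injective function will do, for instance the argument: a radar screen
  -- requires all `n` critical values to have distinct norms.
  obtain ⟨θ, hθ, hθ'⟩ : ∃ θ : ℕ → ℂ → ℝ, θ i = θi ∧
      ∀ l < m, Set.InjOn (θ l) (powRoots (k (l + 1) - k l) (-1)) := by
    refine ⟨Function.update (fun _ => Complex.arg) i θi, Function.update_self _ _ _, fun l hl => ?_⟩
    by_cases hli : l = i
    · subst hli
      rw [Function.update_self]
      intro x hx y hy he
      have := hlt.trichotomous ⟨x, hx⟩ ⟨y, hy⟩ (fun h => ((hθi _ _).1 h).ne he)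
        (fun h => ((hθi _ _).1 h).ne' he)
      exact congrArg Subtype.val this
    · rw [Function.update_of_ne hli]
      exact injOn_arg_powRoots (hgap l hl)
  obtain ⟨D, hD, ε₁, hε₁, hord⟩ := exists_regeneration_norm_lt hk θ
  refine ⟨D, fun j _ => hD j, fun r R hr hr₀ hR₀ => ?_⟩
  obtain ⟨M, ε, hε, hev⟩ := hnear r R hr hr₀ hR₀
  have htends : Tendsto (fun s : ℝ => (s : ℂ)) (𝓝[>] 0) (𝓝[≠] 0) := by
    refine tendsto_nhdsWithin_iff.2 ⟨?_, ?_⟩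
    · have := (Complex.continuous_ofReal.tendsto 0).mono_left (nhdsWithin_le_nhds (s := Set.Ioi 0))
      rwa [Complex.ofReal_zero] at this
    · filter_upwards [self_mem_nhdsWithin] with s hs
      exact Complex.ofReal_ne_zero.2 (show (0 : ℝ) < s from hs).ne'
  have hall := (htends.eventually
    (D.eventually_exists_isCritSystem hk hi hr hε hev hε₁)).and hord
  obtain ⟨s₀, hs₀, hsub⟩ := mem_nhdsGT_iff_exists_Ioo_subset.1 hall
  refine ⟨s₀, hs₀, fun s hs hss => ?_⟩
  obtain ⟨⟨U, h1, h2, h3, h4⟩, h5⟩ := hsub ⟨hs, hss⟩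
  have h6 := h5 U fun l hl ω hω => ⟨h4 l hl ω hω, h1.crit l hl ω hω⟩
  obtain ⟨p, hp, hmono⟩ := IsCritSystem.exists_enumeration hk hn i (h1.injOn_norm_critValue hk hθ' h6 i)
  obtain ⟨ξ, hξ⟩ := h1.exists_block hk hi hp hmono
  have hex := fun c => h1.exists_isCircuitLabelling hk hi hp hmono h3 h2 hb hN hξ (c := c)
  have hv : ∀ l < k (i + 1) - k i, D.critValue i s U ⟨i, ξ l⟩ ≠ 0 := fun l hl =>
    h1.critValue_ne_zero hk i ((mem_critIndex hk).2 ⟨hi, (ξ l).2⟩)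
  obtain ⟨ρ₀, π₁, y₁, σ₁, hl₀⟩ := hex (fun l => Complex.log (D.critValue i s U ⟨i, ξ l⟩))
    fun l hl => Complex.exp_log (hv l hl)
  -- Enumeration by increasing norm of the critical values is enumeration by `lt`, since the
  -- regeneration was chosen to order the norms by `θ`.
  have hξlt : ∀ l < k (i + 1) - k i, ∀ l' < k (i + 1) - k i, l < l' → lt (ξ l) (ξ l') := by
    intro l hl l' hl' hll
    rw [hθi]
    by_contra hle
    have hne : θi (ξ l') ≠ θi (ξ l) := by
      rw [← hθ]
      intro he
      have := hl₀.chain.injOn hl' hl (Subtype.ext (hθ' i hi (ξ l').2 (ξ l).2 he))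
      omega
    have h7 := h6 i hi _ (ξ l').2 _ (ξ l).2 (by rw [hθ]; exact lt_of_le_of_ne (not_lt.1 hle) hne)
    have h8 := hmono (IsCritSystem.block_mem hk hi hl) (IsCritSystem.block_mem hk hi hl') (by omega)
    dsimp only at h8
    rw [hξ l hl, hξ l' hl', critValue_self, critValue_self, norm_neg, norm_neg] at h8
    exact lt_asymm h7 h8
  have hξiff : ∀ l < k (i + 1) - k i, ∀ l' < k (i + 1) - k i, lt (ξ l) (ξ l') ↔ l < l' := by
    intro l hl l' hl'
    refine ⟨fun h => ?_, hξlt l hl l' hl'⟩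
    rcases lt_trichotomy l l' with h7 | h7 | h7
    · exact h7
    · rw [h7] at h
      exact absurd h (hlt.irrefl _)
    · exact absurd (hlt.trans _ _ _ h (hξlt l' hl' l hl h7)) (hlt.irrefl _)
  obtain ⟨y₀, π₀, hch, hch'⟩ := exists_isInsertionChain σ ⟨1, one_pow _⟩ (isCyclicSucc_rotatePerm hb)
    (isCyclicSucc_rotatePerm hN) hσ.2.2.2 hl₀.chain.injOn hl₀.chain.surj
  obtain ⟨c, hc, ρ, π, y, hl⟩ := exists_isCircuitLabelling_eq ha hb hN h3 hv hex hch hch'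
  -- Only the logarithms in the block are adjusted; outside it principal ones are taken.
  set w : ℕ → ℂ := fun j => if k i ≤ j ∧ j < k (i + 1) then c (j - k i) else
    Complex.log (D.critValue i s U (p j)) with hw
  have hwc : ∀ l < k (i + 1) - k i, w (k i + l) = c l := by
    intro l hl
    rw [hw]
    dsimp only
    rw [if_pos (by omega), Nat.add_sub_cancel_left]
  have hwp : ∀ j ∈ Set.Icc 1 n, Complex.exp (w j) = D.critValue i s U (p j) := by
    intro j hj
    by_cases hjb : k i ≤ j ∧ j < k (i + 1)
    · obtain ⟨l, rfl⟩ := Nat.exists_eq_add_of_le hjb.1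
      rw [hwc l (by omega), hc l (by omega), hξ l (by omega)]
    · rw [hw]
      dsimp only
      rw [if_neg hjb, Complex.exp_log (h1.critValue_ne_zero hk i (hp.mapsTo hj))]
  refine ⟨w, h1.isRadarScreen hk hi hp hmono hwp, ?_⟩
  obtain ⟨e₁, e₂, e₃, g1, g2, g3, hev⟩ := hl.exists_conclusion h3 ha rfl hkN
    (fiberPoint_iff hi h1.ne_zero) (singularPoint_iff hi h1.ne_zero) hwc
  filter_upwards [hev] with ε hε
  refine ⟨_, e₁, e₂, e₃, fun ζ => h3.small_inner.isNearest ζ.2 (g1 ζ),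
    fun ζ => h3.small_middle.isNearest ζ.2 (g2 ζ), fun ζ => h3.small_outer.isNearest ζ.2 (g3 ζ),
    hε.1, fun x => ?_, ?_⟩
  · rcases x with x | x <;> simp
  · rw [hl.vanishingGraphEq_iff h3 rfl hkN g3 hε.2 hξiff]
    intro l _ X Y
    simp only [Equiv.symm_apply_apply]

end Regeneration

theorem mainTheorem2 (n m : ℕ) (k : ℕ → ℕ) (hk : IsMonotonePath n m k) (i : ℕ) (hi : i < m) :
    ∃ r₀ > (0 : ℝ), ∃ R₀ > (0 : ℝ),
      (∀ D : Regeneration n m k, ∀ r R : ℝ, 0 < r → r < r₀ → R₀ < R →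
        ∃ s₀ > (0 : ℝ), ∀ s : ℂ, s ≠ 0 → ‖s‖ < s₀ →
          ∀ w : ℕ → ℂ, D.IsRadarScreen i s w → ∀ᶠ ε in 𝓝[>] (0 : ℝ),
            ∃ τ : D.innerFiber i s (startPoint k i w r) ⊕
                D.middleFiber i s (startPoint k i w r) ≃ D.outerFiber i s (endPoint k i w R),
              D.IsMonodromyMap i s w ε r R τ ∧
              Nat.card (D.innerFiber i s (startPoint k i w r)) = k i ∧
              IsCyclicInsertion (CCWOn _) (CCWOn _) (k (i + 1) - k i) τ ∧
              ∃! lt : D.middleFiber i s (startPoint k i w r) →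
                  D.middleFiber i s (startPoint k i w r) → Prop,
                IsStrictTotalOrder _ lt ∧ D.VanishingGraphEq i s w ε r R τ lt) ∧
      (∀ (σ : powRoots (k i) 1 ⊕ powRoots (k (i + 1) - k i) (-1) ≃ powRoots (k (i + 1)) 1)
          (lt : powRoots (k (i + 1) - k i) (-1) → powRoots (k (i + 1) - k i) (-1) → Prop),
        IsCyclicInsertion (CCWOn _) (CCWOn _) (k (i + 1) - k i) σ → IsStrictTotalOrder _ lt →
        ∃ D : Regeneration n m k, (∀ j ∈ Set.Icc 1 (n + 1), D.c j ≠ 0) ∧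
          ∀ r R : ℝ, 0 < r → r < r₀ → R₀ < R → ∃ s₀ > (0 : ℝ), ∀ s : ℝ, 0 < s → s < s₀ →
            ∃ w : ℕ → ℂ, D.IsRadarScreen i s w ∧ ∀ᶠ ε in 𝓝[>] (0 : ℝ),
              ∃ (τ : D.innerFiber i s (startPoint k i w r) ⊕
                  D.middleFiber i s (startPoint k i w r) ≃ D.outerFiber i s (endPoint k i w R))
                (e₁ : powRoots (k i) 1 ≃ D.innerFiber i s (startPoint k i w r))
                (e₂ : powRoots (k (i + 1) - k i) (-1) ≃ D.middleFiber i s (startPoint k i w r))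
                (e₃ : powRoots (k (i + 1)) 1 ≃ D.outerFiber i s (endPoint k i w R)),
                (∀ ζ, IsNearest (powRoots (k i) 1)
                  (e₁ ζ / phaseRoot (k i) (startPoint k i w r)) ζ) ∧
                (∀ ζ, IsNearest (powRoots (k (i + 1) - k i) (-1)) (e₂ ζ) ζ) ∧
                (∀ ζ, IsNearest (powRoots (k (i + 1)) 1)
                  (e₃ ζ / phaseRoot (k (i + 1)) (endPoint k i w R)) ζ) ∧
                D.IsMonodromyMap i s w ε r R τ ∧
                (∀ p, τ (Sum.map e₁ e₂ p) = e₃ (σ p)) ∧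
                D.VanishingGraphEq i s w ε r R τ
                  (fun x y => lt (e₂.symm x) (e₂.symm y))) := by
  have ha : 0 < k (i + 1) - k i := Nat.sub_pos_of_lt (hk.2.2 i hi)
  have hb : 0 < k i := hk.one_le hi.le
  have hD : k (i + 1) - k i + k i < n + 2 := by
    have := hk.le_succ (show i + 1 ≤ m from hi)
    omega
  -- One radius `δ` is fixed for both parts; the bounds `r₀, R₀` come from the circuit polynomial
  -- and the degree alone, before any regeneration is chosen.
  obtain ⟨δ, r₀, hr₀, R₀, hR₀, hnear⟩ := (eventually_isNearCircuit ha hb hD).exists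
  refine ⟨r₀, hr₀, R₀, hR₀, fun D r R hr hr' hR => ?_, fun σ lt hσ hlt => ?_⟩
  · obtain ⟨M, ε, hε, hev⟩ := hnear r R hr hr' hR
    exact Regeneration.eventually_monodromy (D := D) hk hi hr hε hev
  · exact Regeneration.exists_regeneration_of_insertion hk hi hnear (by omega) σ lt hσ hlt
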